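/- Let $\sigma,\rho\subseteq\mathbb N$ be finite or co-finite. A set $X$ of vertices of a graph $G$ is a $(\sigma,\rho)$-set if every vertex $v\in X$ has $|N(v)\cap X|\in\sigma$ and every vertex $v\notin X$ has $|N(v)\cap X|\in\rho$. The vertex subset problem for $\sigma,\rho$ and $\mathrm{opt}\in\{\min,\max\}$ is to find the size of a minimum, respectively maximum, $(\sigma,\rho)$-set of $G$, or to report that there is none. Put $d(\mu)=1+\min(\max\mu,\max(\mathbb N\setminus\mu))$, where the maximum of an infinite set is $\infty$ and that of the empty set is $-1$ (so $d(\mathbb N)=d(\emptyset)=0$), and $d=d(\sigma,\rho)=\max(d(\sigma),d(\rho))$. A decomposition tree of $G$ is a tree all of whose internal nodes have degree three, with a bijection between $V(G)$ and its leaves. Each edge of the tree induces a bipartition $\{A,V(G)\setminus A\}$ of $V(G)$. For a cut function $f$, the $f$-width of the decomposition tree is the maximum of $f(A)$ over the edges of the tree; the $f$-width of $G$ is the minimum $f$-width of a decomposition tree of $G$, and a decomposition tree that attains it is optimal. The rank-width $rw(G)$ is obtained for $f(A)=\log_2$ of the number of vectors spanned over $GF(2)$ by the rows of the $A\times(V(G)\setminus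 A)$ submatrix of the adjacency matrix, and the boolean-width $\beta w(G)$ for $f(A)=\log_2|\{N(Y)\cap A: Y\subseteq V(G)\setminus A\}|$, with $N(Y)=\bigcup_{y\in Y}N(y)$. Then for all $\sigma,\rho$ and $\mathrm{opt}$ the vertex subset problem can be solved, for every graph $G$ with $n$ vertices and $m\ge 1$ edges given along with an optimal rank decomposition, respectively an optimal boolean decomposition, in time $$O\bigl(n\,(m+d\,k\,2^{3dk^2+k})\bigr),$$ where $k=rw(G)$, respectively $k=\beta w(G)$. The constant in the $O$ is absolute. The graph and the tree are given by edge lists, and time is the number of steps of a random access machine with unit-cost operations on words of $w$ bits, for every $w$ that is at least an absolute constant times the binary logarithm of $n(m+d\,k\,2^{3dk^2+k})$. -/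

import Mathlib

/-! ### Vertex subset problems -/

/-- `μ` is a finite or co-finite set of natural numbers. -/
def FiniteOrCofinite (μ : Set ℕ) : Prop := μ.Finite ∨ μᶜ.Finite

/-- `X` is a `(σ, ρ)`-set of `G`: a vertex `v` has a number of neighbours in `X` that belongs to `σ`
if `v ∈ X`, and to `ρ` if `v ∉ X`. -/
def IsSigmaRhoSet {V : Type*} (G : SimpleGraph V) (σ ρ : Set ℕ) (X : Finset V) : Prop :=
  ∀ v : V, (v ∈ X → (G.neighborSet v ∩ ↑X).ncard ∈ σ) ∧ (v ∉ X → (G.neighborSet v ∩ ↑X).ncard ∈ ρ)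

/-- The set of all sizes of `(σ, ρ)`-sets of `G`. -/
def sigmaRhoSizes {V : Type*} (G : SimpleGraph V) (σ ρ : Set ℕ) : Set ℕ :=
  {s | ∃ X : Finset V, IsSigmaRhoSet G σ ρ X ∧ X.card = s}

/-- Minimization or maximization. -/
inductive Objective where
  | minimize
  | maximize

/-- `s` is the minimum, respectively the maximum, of `S`. -/
def Objective.IsOptimum : Objective → Set ℕ → ℕ → Prop
  | .minimize, S, s => IsLeast S s
  | .maximize, S, s => IsGreatest S s

/-- `d(μ) = 1 + min (max μ) (max (ℕ \ μ))`, the maximum of an infinite set being `∞`, and that of the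
empty set being `-1`, so that `d(ℕ) = d(∅) = 0`. -/
noncomputable def dValue (μ : Set ℕ) : ℕ :=
  (min (⨆ x ∈ μ, ((x + 1 : ℕ) : ℕ∞)) (⨆ x ∈ μᶜ, ((x + 1 : ℕ) : ℕ∞))).toNat

/-- `d(σ, ρ) = max (d(σ)) (d(ρ))`. -/
noncomputable def dPair (σ ρ : Set ℕ) : ℕ := max (dValue σ) (dValue ρ)

/-! ### Cut functions -/

/-- The union of the neighbourhoods of the vertices of `Y`. -/
def unionNeighbors {V : Type*} (G : SimpleGraph V) (Y : Set V) : Set V :=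
  ⋃ y ∈ Y, G.neighborSet y

/-- The boolean-cut function
`β_G(A) = log₂ |{X ⊆ A : ∃ Y ⊆ B, N(Y) \ B = X}|`, where `B` is the complement of `A`. -/
noncomputable def boolCut {V : Type*} (G : SimpleGraph V) (A : Set V) : ℝ :=
  Real.logb 2 ({X : Set V | X ⊆ A ∧ ∃ Y ⊆ Aᶜ, unionNeighbors G Y \ Aᶜ = X}.ncard : ℝ)

open Classical in
/-- The row, over `GF(2)`, of the vertex `a` in the `A × (V \ A)` submatrix of the adjacency
matrix. -/
noncomputable def cutRow {V : Type*} (G : SimpleGraph V) (A : Set V) (a : A) :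
    (↥(Aᶜ) → ZMod 2) :=
  fun b => if G.Adj a b then 1 else 0

/-- The cut-rank function: `ρ_G(A)` is the logarithm in base 2 of the number of vectors that are
spanned over `GF(2)` by the rows of the `A × (V \ A)` submatrix of the adjacency matrix. -/
noncomputable def cutRank {V : Type*} (G : SimpleGraph V) (A : Set V) : ℝ :=
  Real.logb 2 (Nat.card (Submodule.span (ZMod 2) (Set.range (cutRow G A))) : ℝ)

/-! ### Decomposition trees and width -/

/-- A node of a tree is a leaf if it has at most one neighbour (a one-node tree has one leaf). -/
def IsTreeLeaf {α : Type*} (T : SimpleGraph α) (u : α) : Prop := (T.neighborSet u).ncard ≤ 1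

/-- A decomposition tree of a graph with vertex set `V`: a tree all of whose internal nodes have
degree three, with a bijection between `V` and its leaves. -/
structure DecompTree (V : Type*) where
  /-- the number of nodes -/
  size : ℕ
  /-- the tree -/
  tree : SimpleGraph (Fin size)
  isTree : tree.IsTree
  subcubic : ∀ u, ¬ IsTreeLeaf tree u → (tree.neighborSet u).ncard = 3
  /-- the bijection -/
  leaf : V ≃ {u : Fin size // IsTreeLeaf tree u}

namespace DecompTree

variable {V : Type*}

/-- `X_u`: the vertices mapped to the leaves of the component of `u` when the edge `uv` is removed
from the tree. -/
def side (D : DecompTree V) (u v : Fin D.size) : Set V :=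
  {x | (D.tree.deleteEdges {s(u, v)}).Reachable u (D.leaf x)}

/-- The `f`-width of a decomposition tree: the maximum of `f X_u` over all edges `uv` (and `0` for
the one-node tree, which has no edge). -/
noncomputable def width (D : DecompTree V) (f : Set V → ℝ) : ℝ :=
  sSup {r | ∃ u v, D.tree.Adj u v ∧ r = f (D.side u v)}

/-- An optimal `f`-decomposition: a decomposition tree of minimum `f`-width. -/
def IsOptimal (D : DecompTree V) (f : Set V → ℝ) : Prop :=
  ∀ D' : DecompTree V, D.width f ≤ D'.width f

end DecompTree

/-- The `f`-width: the minimum `f`-width of a decomposition tree. -/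
noncomputable def cutWidth {V : Type*} (f : Set V → ℝ) : ℝ :=
  sInf (Set.range fun D : DecompTree V => D.width f)

/-- The rank-width of a graph. -/
noncomputable def rankWidth {V : Type*} (G : SimpleGraph V) : ℝ := cutWidth (cutRank G)

/-- The boolean-width of a graph. -/
noncomputable def boolWidth {V : Type*} (G : SimpleGraph V) : ℝ := cutWidth (boolCut G)

/-! ### A random access machine with unit-cost operations on bounded words -/

namespace RAM

/-- A machine state: finitely many of the registers `var i` are mentioned in a program; `mem` is
the randomly accessible memory. -/
structure State where
  var : ℕ → ℕ
  mem : ℕ → ℕ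

/-- Expressions: literals, registers, memory reads, and arithmetic (subtraction is truncated at
`0`, and division is rounded down, with `x / 0 = 0`). -/
inductive Expr where
  | lit (c : ℕ)
  | reg (i : ℕ)
  | load (a : Expr)
  | add (a b : Expr)
  | sub (a b : Expr)
  | mul (a b : Expr)
  | div (a b : Expr)

/-- The value of an expression. -/
def Expr.eval (s : State) : Expr → ℕ
  | .lit c => c
  | .reg i => s.var i
  | .load a => s.mem (a.eval s)
  | .add a b => a.eval s + b.eval s
  | .sub a b => a.eval s - b.eval s
  | .mul a b => a.eval s * b.eval s
  | .div a b => a.eval s / b.eval s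

/-- The number of operations needed to evaluate an expression. -/
def Expr.cost : Expr → ℕ
  | .lit _ => 1
  | .reg _ => 1
  | .load a => a.cost + 1
  | .add a b => a.cost + b.cost + 1
  | .sub a b => a.cost + b.cost + 1
  | .mul a b => a.cost + b.cost + 1
  | .div a b => a.cost + b.cost + 1

/-- Every value that occurs in the evaluation of the expression is a word, that is, less
than `W`. -/
def Expr.Fits (W : ℕ) (s : State) : Expr → Prop
  | .lit c => c < W
  | .reg i => s.var i < W
  | .load a => a.Fits W s ∧ s.mem (a.eval s) < W
  | .add a b => a.Fits W s ∧ b.Fits W s ∧ a.eval s + b.eval s < W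
  | .sub a b => a.Fits W s ∧ b.Fits W s
  | .mul a b => a.Fits W s ∧ b.Fits W s ∧ a.eval s * b.eval s < W
  | .div a b => a.Fits W s ∧ b.Fits W s

/-- Programs. -/
inductive Program where
  | skip
  | assign (i : ℕ) (e : Expr)
  | store (a e : Expr)
  | seq (p q : Program)
  | branch (c : Expr) (p q : Program)
  | loop (c : Expr) (p : Program)

/-- `Runs W p s s' t`: on a machine whose words are the numbers less than `W`, the program `p`,
started in the state `s`, halts in the state `s'` after `t` steps. A program that produces a number
which is not a word does not run any further. A condition holds if its value is not `0`. -/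
inductive Runs (W : ℕ) : Program → State → State → ℕ → Prop where
  | skip (s : State) : Runs W .skip s s 1
  | assign (s : State) (i : ℕ) (e : Expr) (he : e.Fits W s) :
      Runs W (.assign i e) s ⟨Function.update s.var i (e.eval s), s.mem⟩ (e.cost + 1)
  | store (s : State) (a e : Expr) (ha : a.Fits W s) (he : e.Fits W s) :
      Runs W (.store a e) s ⟨s.var, Function.update s.mem (a.eval s) (e.eval s)⟩
        (a.cost + e.cost + 1)
  | seq (p q : Program) (s s' s'' : State) (t t' : ℕ)
      (hp : Runs W p s s' t) (hq : Runs W q s' s'' t') : Runs W (.seq p q) s s'' (t + t')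
  | branchTrue (c : Expr) (p q : Program) (s s' : State) (t : ℕ) (hc : c.Fits W s)
      (h : c.eval s ≠ 0) (hp : Runs W p s s' t) : Runs W (.branch c p q) s s' (c.cost + 1 + t)
  | branchFalse (c : Expr) (p q : Program) (s s' : State) (t : ℕ) (hc : c.Fits W s)
      (h : c.eval s = 0) (hq : Runs W q s s' t) : Runs W (.branch c p q) s s' (c.cost + 1 + t)
  | loopTrue (c : Expr) (p : Program) (s s' s'' : State) (t t' : ℕ) (hc : c.Fits W s)
      (h : c.eval s ≠ 0) (hp : Runs W p s s' t) (hl : Runs W (.loop c p) s' s'' t') :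
      Runs W (.loop c p) s s'' (c.cost + 1 + t + t')
  | loopFalse (c : Expr) (p : Program) (s : State) (hc : c.Fits W s) (h : c.eval s = 0) :
      Runs W (.loop c p) s s (c.cost + 1)

/-- The initial state: the input is in the memory from address `0` on, everything else is `0`. -/
def start (input : List ℕ) : State := ⟨fun _ => 0, fun a => input.getD a 0⟩

end RAM

/-! ### The input, the output and the time bound -/

/-- `L` lists every edge of `G` exactly once (in any order and orientation). -/
def IsEdgeList {n : ℕ} (G : SimpleGraph (Fin n)) (L : List (Fin n × Fin n)) : Prop :=
  (L.map fun e => s(e.1, e.2)).Nodup ∧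
    ∀ e : Sym2 (Fin n), e ∈ (L.map fun e => s(e.1, e.2)) ↔ e ∈ G.edgeSet

/-- The sequence of the endpoints of the listed edges. -/
def flattenEdges {n : ℕ} (L : List (Fin n × Fin n)) : List ℕ :=
  L.flatMap fun e => [(e.1 : ℕ), (e.2 : ℕ)]

/-- `I` represents a graph on the vertices `0, …, n - 1` along with a decomposition tree: the
numbers `n` and `m`, an edge list of the graph, the number of nodes of the tree, an edge list of the
tree, and the leaves to which the vertices `0, …, n - 1` are mapped. -/
def IsInput {n : ℕ} (G : SimpleGraph (Fin n)) (D : DecompTree (Fin n)) (I : List ℕ) : Prop :=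
  ∃ (L : List (Fin n × Fin n)) (K : List (Fin D.size × Fin D.size)),
    IsEdgeList G L ∧ IsEdgeList D.tree K ∧
      I = [n, L.length] ++ flattenEdges L ++ [D.size] ++ flattenEdges K ++
        (List.finRange n).map fun v => ((D.leaf v : Fin D.size) : ℕ)

/-- The final state `s` answers the vertex subset problem: register `0` contains `1` and register
`1` the optimum size of a `(σ, ρ)`-set, or there is none and register `0` contains `0`. -/
def IsAnswer {V : Type*} (opt : Objective) (σ ρ : Set ℕ) (G : SimpleGraph V) (s : RAM.State) :
    Prop :=
  (s.var 0 = 1 ∧ opt.IsOptimum (sigmaRhoSizes G σ ρ) (s.var 1)) ∨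
    (s.var 0 = 0 ∧ sigmaRhoSizes G σ ρ = ∅)

/-- `n (m + d k 2 ^ (3 d k² + k))`. -/
noncomputable def timeBound (n m d : ℕ) (k : ℝ) : ℝ :=
  n * (m + d * k * (2 : ℝ) ^ (3 * d * k ^ 2 + k))

/-- On every representation of `G` along with `D`, and on every machine of word length at least
`ℓ`, the program `P` halts within `T` steps with an answer to the vertex subset problem on `G`. -/
def SolvesWithin (P : RAM.Program) (opt : Objective) (σ ρ : Set ℕ) {n : ℕ}
    (G : SimpleGraph (Fin n)) (D : DecompTree (Fin n)) (ℓ T : ℝ) : Prop :=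
  ∀ I : List ℕ, IsInput G D I → ∀ w : ℕ, ℓ ≤ w →
    ∃ (s : RAM.State) (t : ℕ), RAM.Runs (2 ^ w) P (RAM.start I) s t ∧ (t : ℝ) ≤ T ∧
      IsAnswer opt σ ρ G s

/-! The algorithm is dynamic programming over the decomposition tree. A partial solution on one side
of a cut is remembered only through the number of neighbours, capped at `d`, that it gives to each
vertex across the cut. Capping is harmless because membership in `σ` and in `ρ` is constant from `d`
on (`constant_from`).

Number of classes. Let `k` be the width and `w = ⌊2 ^ k⌋`. Both cut functions count values of a map
on the subsets `Y` of one side: the sum over GF(2) of the rows of `Y`, or the union of the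
neighbourhoods. In both cases the value tells whether a vertex across the cut that has at most one
neighbour in `Y` has one at all, and `CutBound.of_separating` needs nothing else. Applied to the
empty set and to singletons, it leaves at most `w - 1` twin classes with neighbours across the cut.
Applied to the subsets of a set `S` in which every vertex has a private neighbour across the cut, it
gives `2 ^ |S| ≤ w`. Every multiset of vertices can be thinned out, without a change of the capped
counts, to a union of `d` such irredundant sets (`exists_small_multiset`). So a class is given by at
most `d log w` twin classes, and there are at most `N = w ^ (d log w) ≤ 2 ^ (d k²)` classes
(`SumList.le_pow`).

The algorithm. The tree is rooted at the leaf of the vertex 0. At each cut, a prefix tree of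
neighbour lists yields the twin classes, and the classes are generated as the closure of the zero
function under adding the row of a representative and capping (`closure_ends`, `Twins.classes`).
This yields the classes of multisets; those that no set realises just have no partial solutions. The
table entry for `(q, q')` is the optimal size of a set of class `q` below the node that makes all
vertices below admissible when the outside counts as class `q'`. At an inner node, a set splits into
the parts below the two children. Their classes `q1`, `q2` and the class `q3` of the outside
determine the class of the union, and also what each child sees from outside, namely its sibling and
`q3` together (`mem_sol_union`). The edge at the root finally joins the two sides of one cut
(`mem_allSizes`).

The time. For each inner node there are `N³` triples and three `N × N` tables of sums of classes. An
entry of the latter is found by a linear search through `N` rows of fewer than `w` numbers. This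
dominates and gives `N³ w ≤ 2 ^ (3 d k² + k)` (`coreTime_le`, `steps_le_timeBound`).

The machine. The program is written for a machine with arrays, specified by `Ends`, and compiled
(`Exec.simulate`). No statement raises the largest stored value by more than one, and the addresses
of array entries are polynomials in the indices. So all numbers are polynomial in the input values
and the running time, and words of logarithmic length suffice.

If `d = 0`, then `σ` and `ρ` are empty or contain everything, and the answer is immediate. Otherwise
an edge of the graph forces `k ≥ 1` (`one_le_width`), so the factor `d k` of the bound is at least
1. -/

set_option linter.constructorNameAsVariable false

/-! ### A machine with multi-dimensional arrays -/


namespace Mach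

/-- The registers of the array machine. -/
inductive Var where
  | d | opt | n | m | s | r | e | tail | h | u | i | t | x | y | a | b | c | fr | o | q | l
  | tu | to | iu | io | ju | jo | jn | q1 | q2 | q3 | res | cc | ne | tt | cur
  | val | k0 | v | out0 | out1 | ch1 | ch2
  deriving DecidableEq

/-- The arrays of the array machine. -/
inductive Arr where
  | sig | adj | ea | eb | nb | deg | leaf | vert | ord | vis | par | ch | nch | ins | st | dict
  | idx | K | rep | vec | cnt | J | tab | fin
  deriving DecidableEq

theorem Var.ctorIdx_injective : Function.Injective Var.ctorIdx :=
  Function.LeftInverse.injective (g := Var.ofNat) fun a => by cases a <;> rfl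

theorem Arr.ctorIdx_injective : Function.Injective Arr.ctorIdx :=
  Function.LeftInverse.injective (g := Arr.ofNat) fun a => by cases a <;> rfl

theorem Arr.ctorIdx_le (A : Arr) : A.ctorIdx ≤ 30 := by cases A <;> decide

/-- A state: the registers, the arrays (with four indices) and the input tape. -/
structure St where
  v : Var → ℕ
  a : Arr → ℕ → ℕ → ℕ → ℕ → ℕ
  inp : ℕ → ℕ

def St.setV (s : St) (x : Var) (e : ℕ) : St := ⟨fun y => if y = x then e else s.v y, s.a, s.inp⟩

def St.setA (s : St) (A : Arr) (i j k l e : ℕ) : St :=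
  ⟨s.v, fun A' i' j' k' l' =>
    if A' = A ∧ i' = i ∧ j' = j ∧ k' = k ∧ l' = l then e else s.a A' i' j' k' l', s.inp⟩

@[simp] theorem St.setV_v (s : St) (x y : Var) (e : ℕ) :
    (s.setV x e).v y = if y = x then e else s.v y := rfl
@[simp] theorem St.setV_a (s : St) (x : Var) (e : ℕ) : (s.setV x e).a = s.a := rfl
@[simp] theorem St.setV_inp (s : St) (x : Var) (e : ℕ) : (s.setV x e).inp = s.inp := rfl
@[simp] theorem St.setA_v (s : St) (A : Arr) (i j k l e : ℕ) : (s.setA A i j k l e).v = s.v := rfl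
@[simp] theorem St.setA_inp (s : St) (A : Arr) (i j k l e : ℕ) :
    (s.setA A i j k l e).inp = s.inp := rfl
@[simp] theorem St.setA_a (s : St) (A A' : Arr) (i j k l i' j' k' l' e : ℕ) :
    (s.setA A i j k l e).a A' i' j' k' l' =
      if A' = A ∧ i' = i ∧ j' = j ∧ k' = k ∧ l' = l then e else s.a A' i' j' k' l' := rfl

theorem St.setA_a_ne (s : St) {A A' : Arr} (h : A' ≠ A) (i j k l e : ℕ) :
    (s.setA A i j k l e).a A' = s.a A' := by
  funext i' j' k' l'; simp [h]

/-- Expressions of the array machine. `cap a b` is the minimum of `a` and `b`. -/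
inductive Ex where
  | lit (c : ℕ)
  | var (x : Var)
  | inp (e : Ex)
  | get (A : Arr) (i j k l : Ex)
  | add (a b : Ex)
  | sub (a b : Ex)
  | mul (a b : Ex)
  | div (a b : Ex)
  | cap (a b : Ex)

def Ex.eval (s : St) : Ex → ℕ
  | .lit c => c
  | .var x => s.v x
  | .inp e => s.inp (e.eval s)
  | .get A i j k l => s.a A (i.eval s) (j.eval s) (k.eval s) (l.eval s)
  | .add a b => a.eval s + b.eval s
  | .sub a b => a.eval s - b.eval s
  | .mul a b => a.eval s * b.eval s
  | .div a b => a.eval s / b.eval s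
  | .cap a b => min (a.eval s) (b.eval s)

/-- Programs of the array machine. -/
inductive Prog where
  | skip
  | assign (x : Var) (e : Ex)
  | store (A : Arr) (i j k l e : Ex)
  | seq (p q : Prog)
  | ite (c : Ex) (p q : Prog)
  | while (c : Ex) (p : Prog)

/-- `Exec p s s' t`: the program `p`, started in `s`, halts in `s'` after `t` statements. -/
inductive Exec : Prog → St → St → ℕ → Prop where
  | skip (s : St) : Exec .skip s s 1
  | assign (s : St) (x : Var) (e : Ex) : Exec (.assign x e) s (s.setV x (e.eval s)) 1
  | store (s : St) (A : Arr) (i j k l e : Ex) : Exec (.store A i j k l e) s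
      (s.setA A (i.eval s) (j.eval s) (k.eval s) (l.eval s) (e.eval s)) 1
  | seq (p q : Prog) (s s' s'' : St) (t t' : ℕ) (hp : Exec p s s' t) (hq : Exec q s' s'' t') :
      Exec (.seq p q) s s'' (t + t')
  | iteTrue (c : Ex) (p q : Prog) (s s' : St) (t : ℕ) (h : c.eval s ≠ 0) (hp : Exec p s s' t) :
      Exec (.ite c p q) s s' (1 + t)
  | iteFalse (c : Ex) (p q : Prog) (s s' : St) (t : ℕ) (h : c.eval s = 0) (hq : Exec q s s' t) :
      Exec (.ite c p q) s s' (1 + t)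
  | whileTrue (c : Ex) (p : Prog) (s s' s'' : St) (t t' : ℕ) (h : c.eval s ≠ 0)
      (hp : Exec p s s' t) (hl : Exec (.while c p) s' s'' t') : Exec (.while c p) s s'' (1 + t + t')
  | whileFalse (c : Ex) (p : Prog) (s : St) (h : c.eval s = 0) : Exec (.while c p) s s 1

/-! ### Compilation -/

/-- An injective polynomial pairing. -/
def pr (x y : ℕ) : ℕ := (x + y) * (x + y) + x

/-- With `s = x + y`, the value `s * s + x` is at least `s * s` and less than `(s + 1) * (s + 1)`,
so it determines `s` and then `x`. This pairing needs only additions and multiplications, so one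
expression computes an address. -/
theorem pr_inj {x y x' y' : ℕ} (h : pr x y = pr x' y') : x = x' ∧ y = y' := by
  unfold pr at h
  have key : ∀ {a b c d : ℕ}, a + b < c + d → (a + b) * (a + b) + a < (c + d) * (c + d) + c := by
    intro a b c d hlt
    have : (a + b + 1) * (a + b + 1) ≤ (c + d) * (c + d) := Nat.mul_le_mul hlt hlt
    nlinarith
  rcases lt_trichotomy (x + y) (x' + y') with hlt | heq | hgt
  · exact absurd h (key hlt).ne
  · rw [heq] at h; omega
  · exact absurd h (key hgt).ne'

/-- The offset of an array entry. -/
def offset (A : Arr) (i j k l : ℕ) : ℕ := pr (pr (pr (pr A.ctorIdx i) j) k) l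

theorem offset_inj {A A' : Arr} {i j k l i' j' k' l' : ℕ}
    (h : offset A i j k l = offset A' i' j' k' l') :
    A = A' ∧ i = i' ∧ j = j' ∧ k = k' ∧ l = l' := by
  obtain ⟨h, h4⟩ := pr_inj h
  obtain ⟨h, h3⟩ := pr_inj h
  obtain ⟨h, h2⟩ := pr_inj h
  obtain ⟨h, h1⟩ := pr_inj h
  exact ⟨Arr.ctorIdx_injective h, h1, h2, h3, h4⟩

open RAM (Expr Program State Runs)

def pairE (a b : Expr) : Expr := .add (.mul (.add a b) (.add a b)) a

/-- Register 0 holds a bound on the length of the input, and the arrays lie behind it. Since unused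
memory is zero, all array entries are zero at first, and the gaps between addresses cost nothing. -/
def addrE (A : Arr) (i j k l : Expr) : Expr :=
  .add (.add (.reg 0) (.lit 1)) (pairE (pairE (pairE (pairE (.lit A.ctorIdx) i) j) k) l)

/-- Register 0 is reserved for the base, hence the shift of the registers. Truncated subtraction
expresses minima: `x - (x - b) = min x b`. An input index is clipped at the base in this way, so
that reading past the input never hits an array. -/
def Ex.compile : Ex → Expr
  | .lit c => .lit c
  | .var x => .reg (x.ctorIdx + 1)
  | .inp e => .load (.sub e.compile (.sub e.compile (.reg 0)))
  | .get A i j k l => .load (addrE A i.compile j.compile k.compile l.compile)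
  | .add a b => .add a.compile b.compile
  | .sub a b => .sub a.compile b.compile
  | .mul a b => .mul a.compile b.compile
  | .div a b => .div a.compile b.compile
  | .cap a b => .sub a.compile (.sub a.compile b.compile)

def Prog.compile : Prog → Program
  | .skip => .skip
  | .assign x e => .assign (x.ctorIdx + 1) e.compile
  | .store A i j k l e => .store (addrE A i.compile j.compile k.compile l.compile) e.compile
  | .seq p q => .seq p.compile q.compile
  | .ite c p q => .branch c.compile p.compile q.compile
  | .while c p => .loop c.compile p.compile

/-- The factors arise because `pairE` contains its first argument three times and its second one
twice. -/
def addrCost (i j k l : ℕ) : ℕ := 3 * (3 * (3 * (3 + 2 * i + 4) + 2 * j + 4) + 2 * k + 4) + 2 * l + 8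

def Ex.cost : Ex → ℕ
  | .lit _ => 1
  | .var _ => 1
  | .inp e => 2 * e.cost + 4
  | .get _ i j k l => addrCost i.cost j.cost k.cost l.cost + 1
  | .add a b => a.cost + b.cost + 1
  | .sub a b => a.cost + b.cost + 1
  | .mul a b => a.cost + b.cost + 1
  | .div a b => a.cost + b.cost + 1
  | .cap a b => 2 * a.cost + b.cost + 2

theorem addrE_cost (A : Arr) (i j k l : Expr) :
    (addrE A i j k l).cost = addrCost i.cost j.cost k.cost l.cost := by
  simp only [addrE, pairE, Expr.cost, addrCost]; ring

theorem Ex.cost_compile (e : Ex) : e.compile.cost = e.cost := by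
  induction e with
  | get A i j k l hi hj hk hl =>
    simp only [Ex.compile, Expr.cost, Ex.cost, addrE_cost, hi, hj, hk, hl]
  | _ => simp_all only [Ex.compile, Expr.cost, Ex.cost] <;> try ring

/-- For `M ≥ 2` and arguments up to `M ^ a` and `M ^ b`, a pair is at most `M ^ (3 * (a + b))`. The
final 2 pays for adding the base. -/
def addrNeed (i j k l : ℕ) : ℕ := 3 * (3 * (3 * (3 * (1 + i) + j) + k) + l) + 2

/-- An exponent that bounds all values that occur in the evaluation of an expression. -/
def Ex.need : Ex → ℕ
  | .lit _ => 1
  | .var _ => 1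
  | .inp e => e.need + 1
  | .get _ i j k l => addrNeed i.need j.need k.need l.need
  | .add a b => a.need + b.need
  | .sub a b => a.need + b.need
  | .mul a b => a.need + b.need
  | .div a b => a.need + b.need
  | .cap a b => a.need + b.need

def Ex.maxLit : Ex → ℕ
  | .lit c => c
  | .var _ => 0
  | .inp e => e.maxLit
  | .get _ i j k l => max (max i.maxLit j.maxLit) (max k.maxLit l.maxLit)
  | .add a b => max a.maxLit b.maxLit
  | .sub a b => max a.maxLit b.maxLit
  | .mul a b => max a.maxLit b.maxLit
  | .div a b => max a.maxLit b.maxLit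
  | .cap a b => max a.maxLit b.maxLit

/-- The value of the expression does not exceed the largest value in the state. -/
def Ex.small : Ex → Bool
  | .lit _ => true
  | .var _ => true
  | .inp _ => true
  | .get _ _ _ _ _ => true
  | .add _ _ => false
  | .sub a _ => a.small
  | .mul _ _ => false
  | .div a _ => a.small
  | .cap a b => a.small || b.small

/-- The value of the expression exceeds the largest value in the state by at most `1`. -/
def Ex.tame : Ex → Bool
  | .add a (.lit 1) => a.small
  | e => e.small

/-- Only assigned and stored values count. Indices and conditions may be larger, but they leave no
trace in the state. -/
def Prog.tame : Prog → Bool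
  | .skip => true
  | .assign _ e => e.tame
  | .store _ _ _ _ _ e => e.tame
  | .seq p q => p.tame && q.tame
  | .ite _ p q => p.tame && q.tame
  | .while _ p => p.tame

def Prog.maxCost : Prog → ℕ
  | .skip => 1
  | .assign _ e => e.cost + 1
  | .store _ i j k l e => addrCost i.cost j.cost k.cost l.cost + e.cost + 1
  | .seq p q => max p.maxCost q.maxCost
  | .ite c p q => max (c.cost + 1) (max p.maxCost q.maxCost)
  | .while c p => max (c.cost + 1) p.maxCost

def Prog.maxNeed : Prog → ℕ
  | .skip => 1
  | .assign _ e => e.need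
  | .store _ i j k l e => max (addrNeed i.need j.need k.need l.need) e.need
  | .seq p q => max p.maxNeed q.maxNeed
  | .ite c p q => max c.need (max p.maxNeed q.maxNeed)
  | .while c p => max c.need p.maxNeed

def Prog.maxLit : Prog → ℕ
  | .skip => 0
  | .assign _ e => e.maxLit
  | .store _ i j k l e =>
    max (max (max i.maxLit j.maxLit) (max k.maxLit l.maxLit)) e.maxLit
  | .seq p q => max p.maxLit q.maxLit
  | .ite c p q => max c.maxLit (max p.maxLit q.maxLit)
  | .while c p => max c.maxLit p.maxLit

/-- The state `S` of the random access machine represents `s`; the input ends before `B`. -/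
structure Sim (B : ℕ) (s : St) (S : State) : Prop where
  base : S.var 0 = B
  var : ∀ x : Var, S.var (x.ctorIdx + 1) = s.v x
  arr : ∀ A i j k l, S.mem (B + 1 + offset A i j k l) = s.a A i j k l
  inp : ∀ i, S.mem (min i B) = s.inp i

/-- All values in the state are at most `M`. -/
structure Bounded (M : ℕ) (s : St) : Prop where
  var : ∀ x, s.v x ≤ M
  arr : ∀ A i j k l, s.a A i j k l ≤ M
  inp : ∀ i, s.inp i ≤ M

theorem Bounded.mono {M M' : ℕ} {s : St} (h : Bounded M s) (hM : M ≤ M') : Bounded M' s :=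
  ⟨fun x => (h.var x).trans hM, fun A i j k l => (h.arr A i j k l).trans hM,
    fun i => (h.inp i).trans hM⟩

theorem Ex.need_pos (e : Ex) : 1 ≤ e.need := by
  induction e <;> simp only [Ex.need, addrNeed] <;> omega

section
variable {B M W : ℕ} {s : St} {S : State}

/-- Two numbers that are at least 2 have a sum that is at most their product. -/
theorem add_le_pow_add {x y a b : ℕ} (hM : 2 ≤ M) (ha : 1 ≤ a) (hb : 1 ≤ b) (hx : x ≤ M ^ a)
    (hy : y ≤ M ^ b) : x + y ≤ M ^ (a + b) := by
  rw [pow_add]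
  have h1 : 2 ≤ M ^ a := hM.trans (Nat.le_self_pow (by omega) M)
  have h2 : 2 ≤ M ^ b := hM.trans (Nat.le_self_pow (by omega) M)
  nlinarith

theorem pairE_spec {a b : Expr} {m n : ℕ} (hM : 2 ≤ M) (hm : 1 ≤ m) (hn : 1 ≤ n)
    (ha : a.eval S ≤ M ^ m ∧ (M ^ m < W → a.Fits W S))
    (hb : b.eval S ≤ M ^ n ∧ (M ^ n < W → b.Fits W S)) :
    (pairE a b).eval S = pr (a.eval S) (b.eval S) ∧
    (pairE a b).eval S ≤ M ^ (3 * (m + n)) ∧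
      (M ^ (3 * (m + n)) < W → (pairE a b).Fits W S) := by
  have h1 := add_le_pow_add hM hm hn ha.1 hb.1
  have h2 : (a.eval S + b.eval S) * (a.eval S + b.eval S) ≤ M ^ (2 * (m + n)) := by
    rw [two_mul, pow_add]; exact Nat.mul_le_mul h1 h1
  have h3 : (pairE a b).eval S ≤ M ^ (3 * (m + n)) := by
    have h4 := add_le_pow_add hM (by omega) hm h2 ha.1
    exact h4.trans (Nat.pow_le_pow_right (by omega) (by omega))
  refine ⟨rfl, h3, fun hW => ?_⟩
  have hlt : ∀ k, k ≤ 3 * (m + n) → M ^ k < W := fun k hk =>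
    (Nat.pow_le_pow_right (by omega) hk).trans_lt hW
  have fa := ha.2 (hlt m (by omega))
  have fb := hb.2 (hlt n (by omega))
  have f1 := h1.trans_lt (hlt _ (by omega))
  exact ⟨⟨⟨fa, fb, f1⟩, ⟨fa, fb, f1⟩, h2.trans_lt (hlt _ (by omega))⟩, fa, h3.trans_lt hW⟩

theorem addrE_spec {i j k l : Expr} {ni nj nk nl : ℕ} (A : Arr) (hM : 30 ≤ M) (hB : S.var 0 = B)
    (hBM : B ≤ M) (h1 : 1 ≤ ni) (h2 : 1 ≤ nj) (h3 : 1 ≤ nk) (h4 : 1 ≤ nl)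
    (hi : i.eval S ≤ M ^ ni ∧ (M ^ ni < W → i.Fits W S))
    (hj : j.eval S ≤ M ^ nj ∧ (M ^ nj < W → j.Fits W S))
    (hk : k.eval S ≤ M ^ nk ∧ (M ^ nk < W → k.Fits W S))
    (hl : l.eval S ≤ M ^ nl ∧ (M ^ nl < W → l.Fits W S)) :
    (addrE A i j k l).eval S = B + 1 + offset A (i.eval S) (j.eval S) (k.eval S) (l.eval S) ∧
    (M ^ addrNeed ni nj nk nl < W → (addrE A i j k l).Fits W S) := by
  have hM2 : 2 ≤ M := by omega
  have h0 : (Expr.lit A.ctorIdx).eval S ≤ M ^ 1 ∧ (M ^ 1 < W → (Expr.lit A.ctorIdx).Fits W S) := by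
    have := A.ctorIdx_le
    simp only [Expr.eval, Expr.Fits, pow_one]
    exact ⟨by omega, fun h => by omega⟩
  have p1 := pairE_spec (W := W) hM2 (le_refl 1) h1 h0 hi
  have p2 := pairE_spec (W := W) hM2 (by omega) h2 p1.2 hj
  have p3 := pairE_spec (W := W) hM2 (by omega) h3 p2.2 hk
  have p4 := pairE_spec (W := W) hM2 (by omega) h4 p3.2 hl
  have hb : B + 1 ≤ M ^ (1 + 1) :=
    add_le_pow_add hM2 le_rfl le_rfl (by simpa using hBM) (by simpa using by omega)
  refine ⟨?_, fun hW => ?_⟩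
  · simp only [addrE, Expr.eval, hB, p4.1, p3.1, p2.1, p1.1, offset]
  · have hlt : ∀ k, k ≤ addrNeed ni nj nk nl → M ^ k < W := fun k hk =>
      (Nat.pow_le_pow_right (by omega) hk).trans_lt hW
    have h1' := hlt 1 (by unfold addrNeed; omega)
    rw [pow_one] at h1'
    have h2' := hlt 2 (by unfold addrNeed; omega)
    refine ⟨⟨?_, ?_, ?_⟩, p4.2.2 (hlt _ (by unfold addrNeed; omega)), ?_⟩
    · simp only [Expr.Fits]; omega
    · simp only [Expr.Fits]; omega
    · simp only [Expr.eval, hB]; exact hb.trans_lt h2'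
    · have := add_le_pow_add hM2 (by omega) (by omega) hb p4.2.1
      simp only [Expr.eval, hB] at this ⊢
      exact this.trans_lt (hlt _ (by unfold addrNeed; omega))

/-- The exponent of a subexpression is at most that of the expression. So if the bound `M ^ e.need`
is a word, then so is every intermediate value. -/
theorem Ex.compile_spec (hM : 30 ≤ M) (hBM : B ≤ M) (hs : Sim B s S) (hb : Bounded M s) (e : Ex)
    (hl : e.maxLit ≤ M) :
    e.compile.eval S = e.eval s ∧ e.eval s ≤ M ^ e.need ∧
      (M ^ e.need < W → e.compile.Fits W S) := by
  have hM2 : 2 ≤ M := by omega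
  have mono : ∀ {a b : ℕ}, a ≤ b → M ^ a ≤ M ^ b := fun h => Nat.pow_le_pow_right (by omega) h
  induction e with
  | lit c =>
    simp only [Ex.maxLit] at hl
    simp only [Ex.compile, Expr.eval, Ex.eval, Ex.need, Expr.Fits, pow_one]
    exact ⟨trivial, hl, fun h => by omega⟩
  | var x =>
    have := hb.var x
    simp only [Ex.compile, Expr.eval, Ex.eval, Ex.need, Expr.Fits, pow_one, hs.var]
    exact ⟨trivial, this, fun h => by omega⟩
  | inp e ih =>
    obtain ⟨h1, h2, h3⟩ := ih hl
    have hmin : ∀ x : ℕ, x - (x - B) = min x B := fun x => by omega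
    have hv := hb.inp (e.eval s)
    have hp := e.need_pos
    have hM1 : M ≤ M ^ (e.need + 1) := Nat.le_self_pow (by omega) M
    simp only [Ex.compile, Expr.eval, Ex.eval, Ex.need, Expr.Fits, h1, hs.base, hmin, hs.inp]
    refine ⟨trivial, hv.trans hM1, fun h => ?_⟩
    have := h3 ((mono (by omega)).trans_lt h)
    exact ⟨⟨this, this, by omega⟩, by omega⟩
  | get A i j k l hi hj hk hl' =>
    simp only [Ex.maxLit, max_le_iff] at hl
    obtain ⟨i1, i2, i3⟩ := hi hl.1.1
    obtain ⟨j1, j2, j3⟩ := hj hl.1.2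
    obtain ⟨k1, k2, k3⟩ := hk hl.2.1
    obtain ⟨l1, l2, l3⟩ := hl' hl.2.2
    have := addrE_spec (W := W) A hM hs.base hBM i.need_pos j.need_pos k.need_pos l.need_pos
      ⟨i1 ▸ i2, i3⟩ ⟨j1 ▸ j2, j3⟩ ⟨k1 ▸ k2, k3⟩ ⟨l1 ▸ l2, l3⟩
    have hv := hb.arr A (i.eval s) (j.eval s) (k.eval s) (l.eval s)
    have hM1 : M ≤ M ^ (addrNeed i.need j.need k.need l.need) :=
      Nat.le_self_pow (by unfold addrNeed; omega) M
    simp only [Ex.compile, Expr.eval, Ex.eval, Ex.need, Expr.Fits, this.1, i1, j1, k1, l1, hs.arr]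
    exact ⟨trivial, hv.trans hM1, fun h => ⟨this.2 h, by omega⟩⟩
  | add a b iha ihb =>
    simp only [Ex.maxLit, max_le_iff] at hl
    obtain ⟨a1, a2, a3⟩ := iha hl.1
    obtain ⟨b1, b2, b3⟩ := ihb hl.2
    have hle := add_le_pow_add hM2 a.need_pos b.need_pos a2 b2
    simp only [Ex.compile, Expr.eval, Ex.eval, Ex.need, Expr.Fits, a1, b1]
    exact ⟨trivial, hle, fun h => ⟨a3 ((mono (by omega)).trans_lt h),
      b3 ((mono (by omega)).trans_lt h), hle.trans_lt h⟩⟩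
  | sub a b iha ihb =>
    simp only [Ex.maxLit, max_le_iff] at hl
    obtain ⟨a1, a2, a3⟩ := iha hl.1
    obtain ⟨b1, b2, b3⟩ := ihb hl.2
    simp only [Ex.compile, Expr.eval, Ex.eval, Ex.need, Expr.Fits, a1, b1]
    exact ⟨trivial, (Nat.sub_le _ _).trans (a2.trans (mono (by omega))),
      fun h => ⟨a3 ((mono (by omega)).trans_lt h), b3 ((mono (by omega)).trans_lt h)⟩⟩
  | mul a b iha ihb =>
    simp only [Ex.maxLit, max_le_iff] at hl
    obtain ⟨a1, a2, a3⟩ := iha hl.1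
    obtain ⟨b1, b2, b3⟩ := ihb hl.2
    have hle : a.eval s * b.eval s ≤ M ^ (a.need + b.need) := by
      rw [pow_add]; exact Nat.mul_le_mul a2 b2
    simp only [Ex.compile, Expr.eval, Ex.eval, Ex.need, Expr.Fits, a1, b1]
    exact ⟨trivial, hle, fun h => ⟨a3 ((mono (by omega)).trans_lt h),
      b3 ((mono (by omega)).trans_lt h), hle.trans_lt h⟩⟩
  | div a b iha ihb =>
    simp only [Ex.maxLit, max_le_iff] at hl
    obtain ⟨a1, a2, a3⟩ := iha hl.1
    obtain ⟨b1, b2, b3⟩ := ihb hl.2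
    simp only [Ex.compile, Expr.eval, Ex.eval, Ex.need, Expr.Fits, a1, b1]
    exact ⟨trivial, (Nat.div_le_self _ _).trans (a2.trans (mono (by omega))),
      fun h => ⟨a3 ((mono (by omega)).trans_lt h), b3 ((mono (by omega)).trans_lt h)⟩⟩
  | cap a b iha ihb =>
    simp only [Ex.maxLit, max_le_iff] at hl
    obtain ⟨a1, a2, a3⟩ := iha hl.1
    obtain ⟨b1, b2, b3⟩ := ihb hl.2
    simp only [Ex.compile, Expr.eval, Ex.eval, Ex.need, Expr.Fits, a1, b1]
    refine ⟨by omega, (min_le_left _ _).trans (a2.trans (mono (by omega))), fun h => ?_⟩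
    have := a3 ((mono (by omega)).trans_lt h)
    exact ⟨this, this, b3 ((mono (by omega)).trans_lt h)⟩

theorem Ex.eval_le_of_small (hb : Bounded M s) (e : Ex) (hl : e.maxLit ≤ M) (hs : e.small = true) :
    e.eval s ≤ M := by
  induction e with
  | lit c => exact hl
  | var x => exact hb.var x
  | inp e => exact hb.inp _
  | get A i j k l => exact hb.arr _ _ _ _ _
  | add => simp [Ex.small] at hs
  | mul => simp [Ex.small] at hs
  | sub a b iha => 
    simp only [Ex.maxLit, max_le_iff] at hl
    exact (Nat.sub_le _ _).trans (iha hl.1 hs)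
  | div a b iha =>
    simp only [Ex.maxLit, max_le_iff] at hl
    exact (Nat.div_le_self _ _).trans (iha hl.1 hs)
  | cap a b iha ihb =>
    simp only [Ex.maxLit, max_le_iff] at hl
    simp only [Ex.small, Bool.or_eq_true] at hs
    rcases hs with hs | hs
    · exact (min_le_left _ _).trans (iha hl.1 hs)
    · exact (min_le_right _ _).trans (ihb hl.2 hs)

theorem Ex.eval_le_of_tame (hb : Bounded M s) (e : Ex) (hl : e.maxLit ≤ M) (hs : e.tame = true) :
    e.eval s ≤ M + 1 := by
  unfold Ex.tame at hs
  split at hs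
  · simp only [Ex.maxLit, max_le_iff] at hl
    exact Nat.add_le_add_right (Ex.eval_le_of_small hb _ hl.1 hs) 1
  · exact (Ex.eval_le_of_small hb _ hl hs).trans (Nat.le_succ _)

theorem Sim.setV (h : Sim B s S) (x : Var) (e : ℕ) :
    Sim B (s.setV x e) ⟨Function.update S.var (x.ctorIdx + 1) e, S.mem⟩ where
  base := by simp [h.base]
  var y := by
    by_cases hy : y = x
    · subst hy; simp
    · have : y.ctorIdx ≠ x.ctorIdx := fun h => hy (Var.ctorIdx_injective h)
      simp [hy, h.var, this]
  arr := h.arr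
  inp := h.inp

theorem Sim.setA (h : Sim B s S) (A : Arr) (i j k l e : ℕ) :
    Sim B (s.setA A i j k l e)
      ⟨S.var, Function.update S.mem (B + 1 + offset A i j k l) e⟩ where
  base := h.base
  var := h.var
  arr A' i' j' k' l' := by
    simp only [St.setA_a]
    split_ifs with hc
    · obtain ⟨rfl, rfl, rfl, rfl, rfl⟩ := hc; simp
    · rw [Function.update_of_ne, h.arr]
      intro heq
      exact hc (offset_inj (Nat.add_left_cancel heq))
  inp i' := by
    simp only [St.setA_inp]
    rw [Function.update_of_ne (by omega), h.inp]

theorem Bounded.setV (h : Bounded M s) (x : Var) {e : ℕ} (he : e ≤ M) : Bounded M (s.setV x e) :=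
  ⟨fun y => by simp only [St.setV_v]; split_ifs; exacts [he, h.var y], h.arr, h.inp⟩

theorem Bounded.setA (h : Bounded M s) (A : Arr) (i j k l : ℕ) {e : ℕ} (he : e ≤ M) :
    Bounded M (s.setA A i j k l e) :=
  ⟨h.var, fun _ _ _ _ _ => by simp only [St.setA_a]; split_ifs; exacts [he, h.arr _ _ _ _ _], h.inp⟩

end

/-- The random access machine simulates the array machine. -/
theorem Exec.simulate {B W κ ν : ℕ} {p : Prog} {s s' : St} {t : ℕ} (h : Exec p s s' t) :
    ∀ (M : ℕ) (S : State), Sim B s S → Bounded M s → 30 ≤ M → B ≤ M → p.maxLit ≤ M →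
      p.tame = true → p.maxNeed ≤ ν → p.maxCost ≤ κ → (M + t) ^ ν < W →
      ∃ S' t', Runs W p.compile S S' t' ∧ t' ≤ κ * t ∧ Sim B s' S' ∧ Bounded (M + t) s' := by
  have mono : ∀ {M t k : ℕ}, 30 ≤ M → k ≤ ν → (M + t) ^ ν < W → M ^ k < W := by
    intro M t k hM hk hW
    exact ((Nat.pow_le_pow_right (by omega) hk).trans
      (Nat.pow_le_pow_left (Nat.le_add_right M t) ν)).trans_lt hW
  -- The bound `M` is generalised: after `t` statements the largest value may have grown to `M + t`,
  -- and the rest of the run starts from that bound. Only the total number of statements enters the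
  -- condition on `W`.
  induction h with
  | skip s =>
    intro M S hs hb hM hB hl ht hn hc hW
    simp only [Prog.maxCost] at hc
    exact ⟨S, 1, Runs.skip _, by omega, hs, hb.mono (by omega)⟩
  | assign s x e =>
    intro M S hs hb hM hB hl ht hn hc hW
    simp only [Prog.maxCost, Prog.maxNeed, Prog.maxLit, Prog.tame] at hc hn hl ht
    obtain ⟨h1, h2, h3⟩ := Ex.compile_spec (W := W) hM hB hs hb e hl
    refine ⟨_, _, Runs.assign _ _ _ (h3 (mono hM hn hW)), ?_, ?_, ?_⟩
    · rw [Ex.cost_compile]; omega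
    · rw [h1]; exact hs.setV x _
    · exact (hb.mono (Nat.le_succ M)).setV x (Ex.eval_le_of_tame hb e hl ht)
  | store s A i j k l e =>
    intro M S hs hb hM hB hl ht hn hc hW
    simp only [Prog.maxCost, Prog.maxNeed, Prog.maxLit, Prog.tame, max_le_iff] at hc hn hl ht
    obtain ⟨h1, h2, h3⟩ := Ex.compile_spec (W := W) hM hB hs hb e hl.2
    obtain ⟨i1, i2, i3⟩ := Ex.compile_spec (W := W) hM hB hs hb i hl.1.1.1
    obtain ⟨j1, j2, j3⟩ := Ex.compile_spec (W := W) hM hB hs hb j hl.1.1.2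
    obtain ⟨k1, k2, k3⟩ := Ex.compile_spec (W := W) hM hB hs hb k hl.1.2.1
    obtain ⟨l1, l2, l3⟩ := Ex.compile_spec (W := W) hM hB hs hb l hl.1.2.2
    have ha := addrE_spec (W := W) A hM hs.base hB i.need_pos j.need_pos k.need_pos l.need_pos
      ⟨i1 ▸ i2, i3⟩ ⟨j1 ▸ j2, j3⟩ ⟨k1 ▸ k2, k3⟩ ⟨l1 ▸ l2, l3⟩
    refine ⟨_, _, Runs.store _ _ _ (ha.2 (mono hM hn.1 hW)) (h3 (mono hM hn.2 hW)), ?_, ?_, ?_⟩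
    · rw [Ex.cost_compile, addrE_cost]; simp only [Ex.cost_compile]; omega
    · rw [h1, ha.1, i1, j1, k1, l1]; exact hs.setA _ _ _ _ _ _
    · exact (hb.mono (Nat.le_succ M)).setA _ _ _ _ _ (Ex.eval_le_of_tame hb e hl.2 ht)
  | seq p q s s' s'' t t' _ _ ihp ihq =>
    intro M S hs hb hM hB hl ht hn hc hW
    simp only [Prog.maxCost, Prog.maxNeed, Prog.maxLit, Prog.tame, max_le_iff,
      Bool.and_eq_true] at hc hn hl ht
    obtain ⟨S1, t1, r1, l1, s1, b1⟩ := ihp M S hs hb hM hB hl.1 ht.1 hn.1 hc.1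
      ((Nat.pow_le_pow_left (by omega) ν).trans_lt hW)
    obtain ⟨S2, t2, r2, l2, s2, b2⟩ := ihq (M + t) S1 s1 b1 (by omega) (by omega)
      (by omega) ht.2 hn.2 hc.2 (by rwa [add_assoc])
    exact ⟨S2, _, Runs.seq _ _ _ _ _ _ _ r1 r2, by rw [mul_add]; omega, s2, by rwa [← add_assoc]⟩
  | iteTrue c p q s s' t h _ ih =>
    intro M S hs hb hM hB hl ht hn hc hW
    simp only [Prog.maxCost, Prog.maxNeed, Prog.maxLit, Prog.tame, max_le_iff,
      Bool.and_eq_true] at hc hn hl ht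
    obtain ⟨h1, h2, h3⟩ := Ex.compile_spec (W := W) hM hB hs hb c hl.1
    obtain ⟨S1, t1, r1, l1, s1, b1⟩ := ih M S hs hb hM hB hl.2.1 ht.1 hn.2.1 hc.2.1
      ((Nat.pow_le_pow_left (by omega) ν).trans_lt hW)
    exact ⟨S1, _, Runs.branchTrue _ _ _ _ _ _ (h3 (mono hM hn.1 hW)) (h1 ▸ h) r1,
      by rw [mul_add, Ex.cost_compile]; omega, s1, b1.mono (by omega)⟩
  | iteFalse c p q s s' t h _ ih =>
    intro M S hs hb hM hB hl ht hn hc hW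
    simp only [Prog.maxCost, Prog.maxNeed, Prog.maxLit, Prog.tame, max_le_iff,
      Bool.and_eq_true] at hc hn hl ht
    obtain ⟨h1, h2, h3⟩ := Ex.compile_spec (W := W) hM hB hs hb c hl.1
    obtain ⟨S1, t1, r1, l1, s1, b1⟩ := ih M S hs hb hM hB hl.2.2 ht.2 hn.2.2 hc.2.2
      ((Nat.pow_le_pow_left (by omega) ν).trans_lt hW)
    exact ⟨S1, _, Runs.branchFalse _ _ _ _ _ _ (h3 (mono hM hn.1 hW)) (h1 ▸ h) r1,
      by rw [mul_add, Ex.cost_compile]; omega, s1, b1.mono (by omega)⟩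
  | whileTrue c p s s' s'' t t' h _ _ ihp ihl =>
    intro M S hs hb hM hB hl ht hn hc hW
    have hl' := hl; have ht' := ht; have hn' := hn; have hc' := hc
    simp only [Prog.maxCost, Prog.maxNeed, Prog.maxLit, Prog.tame, max_le_iff] at hc hn hl ht
    obtain ⟨h1, h2, h3⟩ := Ex.compile_spec (W := W) hM hB hs hb c hl.1
    obtain ⟨S1, t1, r1, l1, s1, b1⟩ := ihp M S hs hb hM hB hl.2 ht hn.2 hc.2
      ((Nat.pow_le_pow_left (by omega) ν).trans_lt hW)
    obtain ⟨S2, t2, r2, l2, s2, b2⟩ := ihl (M + t) S1 s1 b1 (by omega) (by omega)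
      (by omega) ht' hn' hc' ((Nat.pow_le_pow_left (by omega) ν).trans_lt hW)
    exact ⟨S2, _, Runs.loopTrue _ _ _ _ _ _ _ (h3 (mono hM hn.1 hW)) (h1 ▸ h) r1 r2,
      by rw [mul_add, mul_add, Ex.cost_compile]; omega, s2, b2.mono (by omega)⟩
  | whileFalse c p s h =>
    intro M S hs hb hM hB hl ht hn hc hW
    simp only [Prog.maxCost, Prog.maxNeed, Prog.maxLit, Prog.tame, max_le_iff] at hc hn hl ht
    obtain ⟨h1, h2, h3⟩ := Ex.compile_spec (W := W) hM hB hs hb c hl.1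
    exact ⟨S, _, Runs.loopFalse _ _ _ (h3 (mono hM hn.1 hW)) (h1 ▸ h),
      by rw [Ex.cost_compile]; omega, hs, hb.mono (by omega)⟩

end Mach

namespace Mach

/-! ### Frames -/

/-- A computable over-approximation of what a program changes, so that frame conditions of concrete
programs hold by `rfl`. -/
def Prog.writesV (y : Var) : Prog → Bool
  | .skip => false
  | .assign x _ => y = x
  | .store _ _ _ _ _ _ => false
  | .seq p q => p.writesV y || q.writesV y
  | .ite _ p q => p.writesV y || q.writesV y
  | .while _ p => p.writesV y

def Prog.writesA (A : Arr) : Prog → Bool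
  | .skip => false
  | .assign _ _ => false
  | .store A' _ _ _ _ _ => A = A'
  | .seq p q => p.writesA A || q.writesA A
  | .ite _ p q => p.writesA A || q.writesA A
  | .while _ p => p.writesA A

/-- The states agree outside the registers and arrays that `p` writes. -/
structure Agree (p : Prog) (s s' : St) : Prop where
  v : ∀ x, p.writesV x = false → s'.v x = s.v x
  a : ∀ A, p.writesA A = false → s'.a A = s.a A
  inp : s'.inp = s.inp

theorem Agree.refl (p : Prog) (s : St) : Agree p s s := ⟨fun _ _ => rfl, fun _ _ => rfl, rfl⟩

theorem Agree.trans {p : Prog} {s s' s'' : St} (h : Agree p s s') (h' : Agree p s' s'') :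
    Agree p s s'' :=
  ⟨fun x hx => (h'.v x hx).trans (h.v x hx), fun A hA => (h'.a A hA).trans (h.a A hA),
    h'.inp.trans h.inp⟩

theorem Agree.weaken {p q : Prog} {s s' : St} (h : Agree p s s')
    (hv : ∀ x, q.writesV x = false → p.writesV x = false)
    (ha : ∀ A, q.writesA A = false → p.writesA A = false) : Agree q s s' :=
  ⟨fun x hx => h.v x (hv x hx), fun A hA => h.a A (ha A hA), h.inp⟩

theorem Exec.agree {p : Prog} {s s' : St} {t : ℕ} (h : Exec p s s' t) : Agree p s s' := by
  induction h with
  | skip s => exact Agree.refl _ _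
  | assign s x e =>
    refine ⟨fun y hy => ?_, fun _ _ => rfl, rfl⟩
    simp only [Prog.writesV, decide_eq_false_iff_not] at hy
    simp [hy]
  | store s A i j k l e =>
    refine ⟨fun _ _ => rfl, fun A' hA => ?_, rfl⟩
    simp only [Prog.writesA, decide_eq_false_iff_not] at hA
    exact St.setA_a_ne _ hA _ _ _ _ _
  | seq p q s s' s'' t t' _ _ ihp ihq =>
    exact (ihp.weaken (by simp +contextual [Prog.writesV])
      (by simp +contextual [Prog.writesA])).trans
      (ihq.weaken (by simp +contextual [Prog.writesV])
      (by simp +contextual [Prog.writesA]))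
  | iteTrue c p q s s' t _ _ ih =>
    exact ih.weaken (by simp +contextual [Prog.writesV]) (by simp +contextual [Prog.writesA])
  | iteFalse c p q s s' t _ _ ih =>
    exact ih.weaken (by simp +contextual [Prog.writesV]) (by simp +contextual [Prog.writesA])
  | whileTrue c p s s' s'' t t' _ _ _ ihp ihl =>
    exact Agree.trans (p := .while c p) (ihp.weaken (fun _ => id) (fun _ => id)) ihl
  | whileFalse c p s _ => exact Agree.refl _ _

/-! ### Total correctness with step counts -/

/-- The program `p`, started in `s`, halts, and the final state and the number of steps
satisfy `Q`. -/
def Ends (p : Prog) (s : St) (Q : St → ℕ → Prop) : Prop := ∃ s' t, Exec p s s' t ∧ Q s' t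

/-- The frame condition comes for free with every postcondition. Specifications therefore mention
only what a program changes. -/
theorem Ends.mono {p : Prog} {s : St} {Q Q' : St → ℕ → Prop} (h : Ends p s Q)
    (hQ : ∀ s' t, Agree p s s' → Q s' t → Q' s' t) : Ends p s Q' := by
  obtain ⟨s', t, he, hq⟩ := h
  exact ⟨s', t, he, hQ s' t he.agree hq⟩

theorem ends_skip {s : St} {Q : St → ℕ → Prop} : Ends .skip s Q ↔ Q s 1 :=
  ⟨fun ⟨_, _, he, hq⟩ => by cases he; exact hq, fun h => ⟨_, _, .skip _, h⟩⟩

theorem ends_assign {s : St} {x : Var} {e : Ex} {Q : St → ℕ → Prop} :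
    Ends (.assign x e) s Q ↔ Q (s.setV x (e.eval s)) 1 :=
  ⟨fun ⟨_, _, he, hq⟩ => by cases he; exact hq, fun h => ⟨_, _, .assign _ _ _, h⟩⟩

theorem ends_store {s : St} {A : Arr} {i j k l e : Ex} {Q : St → ℕ → Prop} :
    Ends (.store A i j k l e) s Q ↔
      Q (s.setA A (i.eval s) (j.eval s) (k.eval s) (l.eval s) (e.eval s)) 1 :=
  ⟨fun ⟨_, _, he, hq⟩ => by cases he; exact hq, fun h => ⟨_, _, .store _ _ _ _ _ _ _, h⟩⟩

theorem ends_seq {s : St} {p q : Prog} {Q : St → ℕ → Prop} :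
    Ends (.seq p q) s Q ↔ Ends p s fun s' t => Ends q s' fun s'' t' => Q s'' (t + t') :=
  ⟨fun ⟨_, _, he, hq⟩ => by
      cases he with | seq _ _ _ s' _ t t' hp hq' => exact ⟨s', t, hp, _, t', hq', hq⟩,
    fun ⟨_, _, hp, _, _, hq', hq⟩ => ⟨_, _, .seq _ _ _ _ _ _ _ hp hq', hq⟩⟩

theorem ends_ite {s : St} {c : Ex} {p q : Prog} {Q : St → ℕ → Prop} :
    Ends (.ite c p q) s Q ↔
      if c.eval s = 0 then Ends q s fun s' t => Q s' (1 + t)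
      else Ends p s fun s' t => Q s' (1 + t) := by
  constructor
  · rintro ⟨_, _, he, hq⟩
    cases he with
    | iteTrue _ _ _ _ _ t h hp => rw [if_neg h]; exact ⟨_, _, hp, hq⟩
    | iteFalse _ _ _ _ _ t h hp => rw [if_pos h]; exact ⟨_, _, hp, hq⟩
  · split_ifs with h
    · rintro ⟨_, _, he, hq⟩; exact ⟨_, _, .iteFalse _ _ _ _ _ _ h he, hq⟩
    · rintro ⟨_, _, he, hq⟩; exact ⟨_, _, .iteTrue _ _ _ _ _ _ h he, hq⟩

/-- Loops whose invariant is indexed by a counter with an a priori bound. The step budget is the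
sum of the budgets of the rounds. -/
theorem ends_while {c : Ex} {p : Prog} (I : ℕ → St → Prop) (N Tb : ℕ) {s : St} (h0 : I 0 s)
    (hlt : ∀ j s', Agree (.while c p) s s' → I j s' → c.eval s' ≠ 0 → j < N)
    (hb : ∀ j s', j < N → Agree (.while c p) s s' → I j s' → c.eval s' ≠ 0 →
      Ends p s' fun s'' t => I (j + 1) s'' ∧ t ≤ Tb) :
    Ends (.while c p) s fun s' t =>
      (∃ j, I j s') ∧ c.eval s' = 0 ∧ t ≤ N * (Tb + 1) + 1 := by
  suffices H : ∀ k j s', j + k = N → Agree (.while c p) s s' → I j s' →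
      Ends (.while c p) s' fun s' t =>
        (∃ j, I j s') ∧ c.eval s' = 0 ∧ t ≤ k * (Tb + 1) + 1 by
    exact H N 0 s (by omega) (Agree.refl _ _) h0
  intro k
  induction k with
  | zero =>
    intro j s' hj ha hI
    have : c.eval s' = 0 := by
      by_contra hc
      have := hlt j s' ha hI hc
      omega
    exact ⟨s', 1, .whileFalse _ _ _ this, ⟨j, hI⟩, this, by omega⟩
  | succ k ih =>
    intro j s' hj ha hI
    by_cases hc : c.eval s' = 0
    · exact ⟨s', 1, .whileFalse _ _ _ hc, ⟨j, hI⟩, hc, by omega⟩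
    · obtain ⟨s1, t1, e1, hI1, ht1⟩ := hb j s' (by omega) ha hI hc
      have ha1 : Agree (.while c p) s' s1 := e1.agree.weaken (fun _ => id) (fun _ => id)
      obtain ⟨s2, t2, e2, hI2, hc2, ht2⟩ := ih (j + 1) s1 (by omega) (ha.trans ha1) hI1
      refine ⟨s2, _, .whileTrue _ _ _ _ _ _ _ hc e1 e2, hI2, hc2, ?_⟩
      rw [Nat.succ_mul]; omega

/-- `for i < b do p`. -/
def Prog.for (i : Var) (b : Ex) (p : Prog) : Prog :=
  .seq (.assign i (.lit 0)) (.while (.sub b (.var i)) (.seq p (.assign i (.add (.var i) (.lit 1)))))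

/-- A round costs two statements besides the body, the test and the increment. The first assignment
and the last test cost two more. -/
theorem ends_for {i : Var} {b : Ex} {p : Prog} (I : ℕ → St → Prop) (N Tb : ℕ) {s : St}
    (hi : p.writesV i = false)
    (hN : ∀ s', Agree (.for i b p) s s' → b.eval s' = N)
    (h0 : I 0 (s.setV i 0))
    (hb : ∀ j s', j < N → Agree (.for i b p) s s' → s'.v i = j → I j s' →
      Ends p s' fun s'' t => I (j + 1) (s''.setV i (j + 1)) ∧ t ≤ Tb) :
    Ends (.for i b p) s fun s' t => I N s' ∧ t ≤ N * (Tb + 2) + 2 := by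
  have w : ∀ {s' s''}, Agree (.while (.sub b (.var i))
      (.seq p (.assign i (.add (.var i) (.lit 1))))) s' s'' → Agree (.for i b p) s' s'' :=
    fun h => h.weaken (by simp +contextual [Prog.writesV, Prog.for])
      (by simp +contextual [Prog.writesA, Prog.for])
  have w0 : Agree (.for i b p) s (s.setV i 0) :=
    ⟨fun x hx => by
      simp only [Prog.for, Prog.writesV, Bool.or_eq_false_iff, decide_eq_false_iff_not] at hx
      simp [hx.1], fun _ _ => rfl, rfl⟩
  rw [Prog.for, ends_seq, ends_assign]
  refine (ends_while (fun j s' => s'.v i = j ∧ j ≤ N ∧ I j s') N (Tb + 1) ?_ ?_ ?_).mono ?_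
  · exact ⟨by simp [Ex.eval], Nat.zero_le _, h0⟩
  · intro j s' ha hI hc
    have := hN s' (w0.trans (w ha))
    simp only [Ex.eval, this, hI.1] at hc
    omega
  · intro j s' hj ha hI hc
    rw [ends_seq]
    refine (hb j s' hj (w0.trans (w ha)) hI.1 hI.2.2).mono ?_
    intro s'' t ha' hI'
    have hv : s''.v i = j := (ha'.v i hi).trans hI.1
    rw [ends_assign]
    simp only [Ex.eval, hv]
    exact ⟨⟨by simp, hj, hI'.1⟩, by omega⟩
  · rintro s' t ha ⟨⟨j, hj, hjN, hI⟩, hc, ht⟩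
    have := hN s' (w0.trans (w ha))
    simp only [Ex.eval, this, hj] at hc
    have : j = N := by omega
    subst this
    exact ⟨hI, by rw [show Tb + 1 + 1 = Tb + 2 from rfl] at ht; omega⟩

/-! ### Abbreviations for programs -/

infixr:60 " ;; " => Prog.seq

/-- Expressions with value `0` if and only if the values are equal. -/
def Ex.neq (a b : Ex) : Ex := .add (.sub a b) (.sub b a)

theorem Ex.neq_eval (s : St) (a b : Ex) : (Ex.neq a b).eval s = 0 ↔ a.eval s = b.eval s := by
  simp only [Ex.neq, Ex.eval]; omega

abbrev Ex.get1 (A : Arr) (i : Ex) : Ex := .get A i (.lit 0) (.lit 0) (.lit 0)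
abbrev Ex.get2 (A : Arr) (i j : Ex) : Ex := .get A i j (.lit 0) (.lit 0)
abbrev Ex.get3 (A : Arr) (i j k : Ex) : Ex := .get A i j k (.lit 0)
abbrev Prog.store1 (A : Arr) (i e : Ex) : Prog := .store A i (.lit 0) (.lit 0) (.lit 0) e
abbrev Prog.store2 (A : Arr) (i j e : Ex) : Prog := .store A i j (.lit 0) (.lit 0) e
abbrev Prog.store3 (A : Arr) (i j k e : Ex) : Prog := .store A i j k (.lit 0) e

instance (k : ℕ) : OfNat Ex k := ⟨.lit k⟩
instance : Add Ex := ⟨.add⟩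
instance : Sub Ex := ⟨.sub⟩
instance : Mul Ex := ⟨.mul⟩

@[simp] theorem Ex.eval_lit (s : St) (k : ℕ) : (Ex.lit k).eval s = k := rfl
@[simp] theorem Ex.eval_ofNat (s : St) (k : ℕ) : (no_index (OfNat.ofNat k : Ex)).eval s = k := rfl
@[simp] theorem Ex.eval_var (s : St) (x : Var) : (Ex.var x).eval s = s.v x := rfl
@[simp] theorem Ex.eval_add (s : St) (a b : Ex) : (a + b).eval s = a.eval s + b.eval s := rfl
@[simp] theorem Ex.eval_sub (s : St) (a b : Ex) : (a - b).eval s = a.eval s - b.eval s := rfl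
@[simp] theorem Ex.eval_mul (s : St) (a b : Ex) : (a * b).eval s = a.eval s * b.eval s := rfl
@[simp] theorem Ex.eval_cap (s : St) (a b : Ex) :
    (Ex.cap a b).eval s = min (a.eval s) (b.eval s) := rfl
@[simp] theorem Ex.eval_inp (s : St) (a : Ex) : (Ex.inp a).eval s = s.inp (a.eval s) := rfl
@[simp] theorem Ex.eval_get (s : St) (A : Arr) (i j k l : Ex) :
    (Ex.get A i j k l).eval s = s.a A (i.eval s) (j.eval s) (k.eval s) (l.eval s) := rfl

end Mach

namespace Mach

/-! ### The program -/

def readHead : Prog :=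
  .assign .n (.inp 0) ;; .assign .m (.inp 1) ;; .assign .s (.inp (2 + 2 * .var .m))

def readEdges : Prog :=
  .for .t (.var .m) (
    .store2 .adj (.inp (2 + 2 * .var .t)) (.inp (3 + 2 * .var .t)) 1 ;;
    .store2 .adj (.inp (3 + 2 * .var .t)) (.inp (2 + 2 * .var .t)) 1)

def pushEdge (a : Ex) : Prog :=
  .store1 .ea (.var .e) a ;; .store1 .eb (.var .e) (.var .b) ;; .assign .e (.var .e + 1)

/-- No sorting is needed: one scan of the edges per vertex `b` fits into `O(n m)` steps and lists
the neighbours of each vertex in increasing order. -/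
def sortEdges : Prog :=
  .assign .e 0 ;;
  .for .b (.var .n) (.for .t (.var .m) (
    .ite (.neq (.inp (2 + 2 * .var .t)) (.var .b)) .skip (pushEdge (.inp (3 + 2 * .var .t))) ;;
    .ite (.neq (.inp (3 + 2 * .var .t)) (.var .b)) .skip (pushEdge (.inp (2 + 2 * .var .t)))))

/-- Append `y` to the list of the neighbours of `x`. -/
def pushNb (x y : Var) : Prog :=
  .store2 .nb (.var x) (.get1 .deg (.var x)) (.var y) ;;
  .store1 .deg (.var x) (.get1 .deg (.var x) + 1)

def readTree : Prog :=
  .for .t (.var .s - 1) (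
    .assign .x (.inp (3 + 2 * .var .m + 2 * .var .t)) ;;
    .assign .y (.inp (4 + 2 * .var .m + 2 * .var .t)) ;;
    pushNb .x .y ;; pushNb .y .x)

def readLeaves : Prog :=
  .for .v (.var .n) (
    .store1 .leaf (.var .v) (.inp (3 + 2 * .var .m + 2 * (.var .s - 1) + .var .v)) ;;
    .store1 .vert (.get1 .leaf (.var .v)) (.var .v)) ;;
  .assign .r (.get1 .leaf 0)

/-- The array `ord` is the queue of a breadth-first search and, afterwards, an order in which
parents precede their children. -/
def searchTree : Prog :=
  .store1 .ord 0 (.var .r) ;; .store1 .vis (.var .r) 1 ;; .assign .tail 1 ;;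
  .for .h (.var .s) (
    .assign .u (.get1 .ord (.var .h)) ;;
    .for .i (.get1 .deg (.var .u)) (
      .assign .y (.get2 .nb (.var .u) (.var .i)) ;;
      .ite (.get1 .vis (.var .y)) .skip (
        .store1 .vis (.var .y) 1 ;;
        .store1 .par (.var .y) (.var .u) ;;
        .store2 .ch (.var .u) (.get1 .nch (.var .u)) (.var .y) ;;
        .store1 .nch (.var .u) (.get1 .nch (.var .u) + 1) ;;
        .store1 .ord (.var .tail) (.var .y) ;;
        .assign .tail (.var .tail + 1))))

/-- Walking from the leaf of `a` up to the root meets exactly the nodes that have `a` below them.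
Only vertices with an edge are marked; the others are irrelevant for the crossing edges. -/
def markSides : Prog :=
  .for .t (.var .e) (
    .assign .a (.get1 .ea (.var .t)) ;;
    .assign .cur (.get1 .leaf (.var .a)) ;;
    .while (.neq (.var .cur) (.var .r)) (
      .store2 .ins (.var .cur) (.var .a) 1 ;;
      .assign .cur (.get1 .par (.var .cur))))

/-- Whether the edge with number `t` crosses the cut of the node `u`. -/
def crossing : Ex :=
  .neq (.get2 .ins (.var .u) (.get1 .ea (.var .t))) (.get2 .ins (.var .u) (.get1 .eb (.var .t)))

/-- Two vertices on the same side get the same number in `st` if and only if they have the same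
neighbours on the other side. -/
def refineTwins : Prog :=
  .assign .fr 1 ;;
  .for .t (.var .e) (.ite crossing (
    .assign .a (.get1 .ea (.var .t)) ;;
    .assign .b (.get1 .eb (.var .t)) ;;
    .assign .c (.get2 .st (.var .u) (.var .a)) ;;
    .ite (.get3 .dict (.var .u) (.var .c) (.var .b)) .skip (
      .store3 .dict (.var .u) (.var .c) (.var .b) (.var .fr) ;; .assign .fr (.var .fr + 1)) ;;
    .store2 .st (.var .u) (.var .a) (.get3 .dict (.var .u) (.var .c) (.var .b))) .skip)

/-- Columns are numbered from 1, so that the initial value 0 of `idx` means that there is no column.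
-/
def collectReps : Prog :=
  .for .t (.var .e) (.ite crossing (
    .assign .a (.get1 .ea (.var .t)) ;;
    .assign .c (.get2 .st (.var .u) (.var .a)) ;;
    .ite (.get2 .idx (.var .u) (.var .c)) .skip (
      .assign .o (.get2 .ins (.var .u) (.var .a)) ;;
      .store2 .K (.var .u) (.var .o) (.get2 .K (.var .u) (.var .o) + 1) ;;
      .store3 .rep (.var .u) (.var .o) (.get2 .K (.var .u) (.var .o)) (.var .a) ;;
      .store2 .idx (.var .u) (.var .c) (.get2 .K (.var .u) (.var .o)))) .skip)

/-- The number of classes found so far. -/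
def numClasses : Ex := .get2 .cnt (.var .tu) (.var .to)

/-- The number of columns. -/
def numColumns : Ex := .get2 .K (.var .tu) (1 - .var .to)

def column (t : Ex) : Ex := .get3 .rep (.var .tu) (1 - .var .to) (t + 1)

/-- Write the values of `e` for all columns `x` into the slot after the last class. -/
def fillCandidate (e : Ex) : Prog :=
  .for .t numColumns (
    .assign .x (.get3 .rep (.var .tu) (1 - .var .to) (.var .t + 1)) ;;
    .store .vec (.var .tu) (.var .to) numClasses (.var .t + 1) e)

/-- Search for a class that equals the candidate. -/
def lookup : Prog :=
  .assign .res numClasses ;;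
  .for .cc numClasses (
    .assign .ne 0 ;;
    .for .tt numColumns (
      .ite (.neq (.get .vec (.var .tu) (.var .to) (.var .cc) (.var .tt + 1))
        (.get .vec (.var .tu) (.var .to) numClasses (.var .tt + 1))) (.assign .ne 1) .skip) ;;
    .ite (.var .ne) .skip (.assign .res (.var .cc)))

def findClass (e : Ex) : Prog := fillCandidate e ;; lookup

/-- The list of classes is also the work list: the classes before `q` have been extended by every
row. Class 0 is the zero function, which the initial memory already contains. -/
def closure : Prog :=
  .store2 .cnt (.var .tu) (.var .to) 1 ;;
  .assign .q 0 ;;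
  .while (numClasses - .var .q) (
    .for .l (.get2 .K (.var .tu) (.var .to)) (
      findClass (.cap (.get .vec (.var .tu) (.var .to) (.var .q) (.var .t + 1) +
        .get2 .adj (.get3 .rep (.var .tu) (.var .to) (.var .l + 1)) (.var .x)) (.var .d)) ;;
      .ite (.neq (.var .res) numClasses)
        .skip (.store2 .cnt (.var .tu) (.var .to) (numClasses + 1))) ;;
    .assign .q (.var .q + 1))

def analyseCut : Prog :=
  (refineTwins ;; collectReps) ;;
  .assign .tu (.var .u) ;; .assign .to 0 ;; closure ;; .assign .to 1 ;; closure

def analyseCuts : Prog :=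
  .for .h (.var .s - 1) (.assign .u (.get1 .ord (.var .h + 1)) ;; analyseCut)

/-- The column of the vertex `v` at the cut of the node `u`. -/
def columnOf (u v : Ex) : Ex := .get2 .idx u (.get2 .st u v)

def join : Prog :=
  .for .q1 (.get2 .cnt (.var .iu) (.var .io)) (.for .q2 (.get2 .cnt (.var .ju) (.var .jo)) (
    findClass (.cap
      (.get .vec (.var .iu) (.var .io) (.var .q1) (columnOf (.var .iu) (.var .x)) +
        .get .vec (.var .ju) (.var .jo) (.var .q2) (columnOf (.var .ju) (.var .x))) (.var .d)) ;;
    .store3 .J (.var .jn) (.var .q1) (.var .q2) (.var .res)))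

/-- Replace a table entry by `val` if that is better. -/
def relax (A : Arr) (i j k l : Ex) : Prog :=
  .assign .cur (.get A i j k l) ;;
  .ite (.var .val) (
    .ite (.var .opt)
      (.ite (.var .val - .var .cur) (.store A i j k l (.var .val)) .skip)
      -- The condition is nonzero if `val < cur` or if nothing has been stored yet.
      (.ite ((.var .cur - .var .val) + (1 - .var .cur)) (.store A i j k l (.var .val)) .skip))
    .skip

def leafTable : Prog :=
  findClass (.get2 .adj (.var .v) (.var .x)) ;;
  .for .q (.get2 .cnt (.var .tu) (1 - .var .to)) (
    .assign .k0 (.get .vec (.var .tu) (1 - .var .to) (.var .q)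
      (columnOf (.var .tu) (.var .v))) ;;
    -- Sizes are stored as successors. The indicator of `ρ` is thus itself the code of the empty
    -- set, and 2 is the code of a singleton.
    .assign .val (.get2 .sig 0 (.var .k0)) ;;
    relax .tab (.var .tu) (.var .to) 0 (.var .q) ;;
    .ite (.get2 .sig 1 (.var .k0)) (.assign .val 2) (.assign .val 0) ;;
    relax .tab (.var .tu) (.var .to) (.var .res) (.var .q))

/-- A code 0 on either side means that there is no solution. The cap at `n` never takes effect, but
it keeps the assigned value within one of a stored value. -/
def addSizes : Prog :=
  .ite (.var .x * .var .y)
    (.assign .val (.cap ((.var .x - 1) + (.var .y - 1)) (.var .n) + 1)) (.assign .val 0)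

/-- The outside of the first child consists of the second child, of class `q2`, and the outside of
the node, of class `q3`. `J 1` gives its class, and `J 2` does the same for the second child. -/
def combine : Prog :=
  .for .q1 (.get2 .cnt (.var .ch1) 1) (.for .q2 (.get2 .cnt (.var .ch2) 1) (
    .for .q3 (.get2 .cnt (.var .u) 0) (
      .assign .x (.get .tab (.var .ch1) 1 (.var .q1) (.get3 .J 1 (.var .q2) (.var .q3))) ;;
      .assign .y (.get .tab (.var .ch2) 1 (.var .q2) (.get3 .J 2 (.var .q1) (.var .q3))) ;;
      addSizes ;;
      relax .tab (.var .u) 1 (.get3 .J 0 (.var .q1) (.var .q2)) (.var .q3))))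

def setJoin (iu io ju jo tu ti jn : Ex) : Prog :=
  .assign .iu iu ;; .assign .io io ;; .assign .ju ju ;; .assign .jo jo ;; .assign .tu tu ;;
  .assign .to ti ;; .assign .jn jn

def innerTable : Prog :=
  .assign .ch1 (.get2 .ch (.var .u) 0) ;; .assign .ch2 (.get2 .ch (.var .u) 1) ;;
  setJoin (.var .ch1) 1 (.var .ch2) 1 (.var .u) 1 0 ;; join ;;
  setJoin (.var .ch2) 1 (.var .u) 0 (.var .ch1) 0 1 ;; join ;;
  setJoin (.var .ch1) 1 (.var .u) 0 (.var .ch2) 0 2 ;; join ;;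
  combine

/-- The reverse search order treats children before their parents. The root, at position 0, is left
out because it has no edge to a parent. -/
def fillTables : Prog :=
  .for .h (.var .s - 1) (
    .assign .u (.get1 .ord (.var .s - 1 - .var .h)) ;;
    .ite (.neq (.get1 .deg (.var .u)) 1) innerTable (
      .assign .tu (.var .u) ;; .assign .to 1 ;; .assign .v (.get1 .vert (.var .u)) ;; leafTable))

/-- The root is the leaf of the vertex 0, so at the cut of its only child the side 0 contains just
this vertex, and the table for that side is again that of a leaf. -/
def finish : Prog :=
  .assign .c (.get2 .ch (.var .r) 0) ;; .assign .tu (.var .c) ;; .assign .to 0 ;; .assign .v 0 ;;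
  leafTable ;;
  .for .q1 (.get2 .cnt (.var .c) 1) (.for .q2 (.get2 .cnt (.var .c) 0) (
    .assign .x (.get .tab (.var .c) 1 (.var .q1) (.var .q2)) ;;
    .assign .y (.get .tab (.var .c) 0 (.var .q2) (.var .q1)) ;;
    addSizes ;;
    relax .fin 0 0 0 0)) ;;
  .assign .out0 (.cap (.get1 .fin 0) 1) ;; .assign .out1 (.get1 .fin 0 - 1)

/-- Store the values `f 0 i` and `f 1 i` for all `i` less than the given number. -/
def initSig (f : ℕ → ℕ → ℕ) : ℕ → Prog
  | 0 => .skip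
  | k + 1 => initSig f k ;; .store2 .sig 0 (.lit k) (.lit (f 0 k)) ;;
      .store2 .sig 1 (.lit k) (.lit (f 1 k))

def core : Prog :=
  readHead ;; readEdges ;; sortEdges ;; readTree ;; readLeaves ;; searchTree ;; markSides ;;
  analyseCuts ;; fillTables ;; finish

def solver (d opt : ℕ) (f : ℕ → ℕ → ℕ) : Prog :=
  .assign .d (.lit d) ;; .assign .opt (.lit opt) ;; initSig f (d + 1) ;; core

end Mach

/-! ### Correctness of the search for a class -/

namespace Mach

theorem lookup_ends (s : St) {x o c k : ℕ} (hx : s.v .tu = x) (ho : s.v .to = o)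
    (hc : s.a .cnt x o 0 0 = c) (hk : s.a .K x (1 - o) 0 0 = k) :
    Ends lookup s fun s' t => t ≤ c * (4 * k + 7) + 3 ∧
      ((s'.v .res = c ∧ ∀ q < c, ∃ j < k, s.a .vec x o q (j + 1) ≠ s.a .vec x o c (j + 1)) ∨
        (s'.v .res < c ∧
          ∀ j < k, s.a .vec x o (s'.v .res) (j + 1) = s.a .vec x o c (j + 1))) := by
  subst hx ho hc hk
  rw [lookup, ends_seq, ends_assign]
  set c := s.a .cnt (s.v .tu) (s.v .to) 0 0 with hc
  set k := s.a .K (s.v .tu) (1 - s.v .to) 0 0 with hk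
  refine (ends_for (fun j s' => (s'.v .res = c ∧ ∀ q < j, ∃ i < k,
      s.a .vec (s.v .tu) (s.v .to) q (i + 1) ≠ s.a .vec (s.v .tu) (s.v .to) c (i + 1)) ∨
    (s'.v .res < c ∧ ∀ i < k, s.a .vec (s.v .tu) (s.v .to) (s'.v .res) (i + 1) =
      s.a .vec (s.v .tu) (s.v .to) c (i + 1))) c (4 * k + 5) rfl ?_ ?_ ?_).mono ?_
  · intro s' ha
    simp [numClasses, ha.v .tu rfl, ha.v .to rfl, ha.a .cnt rfl, hc]
  · left
    simp [numClasses, hc]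
  · intro j s1 hj ha hcc hI
    rw [ends_seq, ends_assign, ends_seq]
    have e1 := ha.v .tu rfl
    have e2 := ha.v .to rfl
    have e3 := ha.a .cnt rfl
    have e4 := ha.a .K rfl
    have e5 := ha.a .vec rfl
    simp only [St.setV_v, St.setV_a, reduceCtorEq, if_false] at e1 e2 e3 e4 e5
    refine (ends_for (fun i s' => s'.v .ne = 0 ↔ ∀ i' < i,
        s.a .vec (s.v .tu) (s.v .to) j (i' + 1) = s.a .vec (s.v .tu) (s.v .to) c (i' + 1))
        k 2 rfl ?_ ?_ ?_).mono ?_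
    · intro s' ha'
      simp [numColumns, ha'.v .tu rfl, ha'.v .to rfl, ha'.a .K rfl, e1, e2, e4, hk]
    · simp
    · intro i s2 hi ha' htt hI'
      have f1 := ha'.v .tu rfl
      have f2 := ha'.v .to rfl
      have f3 := ha'.a .cnt rfl
      have f5 := ha'.a .vec rfl
      have f6 := ha'.v .cc rfl
      simp only [St.setV_v, St.setV_a, reduceCtorEq, if_false, e1, e2, e3, e5, hcc] at f1 f2 f3 f5 f6
      rw [ends_ite]
      simp only [Ex.neq_eval, ends_assign, ends_skip]
      simp only [Ex.eval_get, Ex.eval_var, Ex.eval_add, Ex.eval_lit, f1, f2, f3, f5, f6, htt,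
        numClasses, Ex.eval_ofNat, ← hc]
      split_ifs with hne
      · refine ⟨?_, by norm_num⟩
        simp only [St.setV_v, reduceCtorEq, if_false, hI']
        exact ⟨fun h i' hi' => by rcases Nat.lt_succ_iff_lt_or_eq.mp hi' with h' | rfl; exacts [h _ h', hne],
          fun h i' hi' => h i' (by omega)⟩
      · refine ⟨?_, by norm_num⟩
        simp only [St.setV_v, reduceCtorEq, if_false, if_true]
        refine ⟨by simp, fun h => absurd (h i (by omega)) hne⟩
    · rintro s2 t2 ha2 ⟨hI2, ht2⟩
      have f6 := ha2.v .cc rfl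
      have f7 := ha2.v .res rfl
      simp only [St.setV_v, reduceCtorEq, if_false, hcc] at f6 f7
      rw [ends_ite]
      simp only [ends_assign, ends_skip, Ex.eval_var]
      split_ifs with hne
      · rw [hI2] at hne
        refine ⟨?_, by omega⟩
        simp only [St.setV_v, reduceCtorEq, if_false, if_true, f6]
        exact Or.inr ⟨hj, hne⟩
      · rw [hI2] at hne
        push Not at hne
        refine ⟨?_, by omega⟩
        simp only [St.setV_v, reduceCtorEq, if_false, f7]
        rcases hI with ⟨h1, h2⟩ | h
        · exact Or.inl ⟨h1, fun q hq => by
            rcases Nat.lt_succ_iff_lt_or_eq.mp hq with h' | rfl; exacts [h2 _ h', hne]⟩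
        · exact Or.inr h
  · rintro s' t ha ⟨hI, ht⟩
    exact ⟨by rw [show 4 * k + 5 + 2 = 4 * k + 7 from rfl] at ht; omega, hI⟩

/-- The values of the class with number `q` at the columns. -/
def St.row (s : St) (x o q j : ℕ) : ℕ := s.a .vec x o q (j + 1)

@[simp] theorem St.row_setV (s : St) (y : Var) (e x o q j : ℕ) :
    (s.setV y e).row x o q j = s.row x o q j := rfl

@[simp] theorem St.row_setA (s : St) {A : Arr} (hA : .vec ≠ A) (i j k l e x o q j' : ℕ) :
    (s.setA A i j k l e).row x o q j' = s.row x o q j' := by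
  simp [St.row, hA]

theorem St.row_setV_eq (s : St) (y : Var) (e : ℕ) : (s.setV y e).row = s.row := rfl

/-- The expression `e` is evaluated while the slot `c` is being overwritten, so `hf` may rely on all
slots but this one. Values are stored from index 1 on; index 0 keeps its value. -/
theorem fillCandidate_ends (e : Ex) (f : ℕ → ℕ) (s : St) {x o c k : ℕ} (hx : s.v .tu = x)
    (ho : s.v .to = o) (hc : s.a .cnt x o 0 0 = c) (hk : s.a .K x (1 - o) 0 0 = k)
    (hf : ∀ s' j, j < k → (∀ y, y ≠ .t → y ≠ .x → s'.v y = s.v y) → s'.v .t = j →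
      s'.v .x = s.a .rep x (1 - o) (j + 1) 0 → (∀ A, A ≠ .vec → s'.a A = s.a A) →
      (∀ x' o' q i, ¬ (x' = x ∧ o' = o ∧ q = c) → s'.a .vec x' o' q i = s.a .vec x' o' q i) →
      e.eval s' = f j) :
    Ends (fillCandidate e) s fun s' t => t ≤ 4 * k + 2 ∧ (∀ j < k, s'.row x o c j = f j) ∧
      ∀ x' o' q i, ¬ (x' = x ∧ o' = o ∧ q = c ∧ i ≠ 0) →
        s'.a .vec x' o' q i = s.a .vec x' o' q i := by
  rw [fillCandidate]
  refine (ends_for (fun j s' => (∀ i < j, s'.row x o c i = f i) ∧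
      ∀ x' o' q i, ¬ (x' = x ∧ o' = o ∧ q = c ∧ i ≠ 0) →
        s'.a .vec x' o' q i = s.a .vec x' o' q i) k 2 rfl ?_ ?_ ?_).mono ?_
  · intro s' ha
    simp [numColumns, ha.v .tu rfl, ha.v .to rfl, ha.a .K rfl, hx, ho, hk]
  · simp
  · intro j s1 hj ha ht ⟨hI1, hI2⟩
    have hv : ∀ y, y ≠ .t → y ≠ .x → s1.v y = s.v y := fun y h1 h2 =>
      ha.v y (by simp [Prog.for, Prog.writesV, h1, h2])
    have hA : ∀ A, A ≠ .vec → s1.a A = s.a A := fun A h1 =>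
      ha.a A (by simp [Prog.for, Prog.writesA, h1])
    have e1 := (hv .tu (by simp) (by simp)).trans hx
    have e2 := (hv .to (by simp) (by simp)).trans ho
    have e3 := hA .cnt (by simp)
    have e4 := hA .rep (by simp)
    rw [ends_seq, ends_assign, ends_store]
    rw [hf _ j hj (fun y h1 h2 => by simp [h1, h2, hv]) (by simp [ht])
      (by simp [e1, e2, e4, ht]) (fun A h => by simp [h, hA])
      (fun x' o' q i h => by
        rw [St.setV_a]; exact hI2 x' o' q i (fun h' => h ⟨h'.1, h'.2.1, h'.2.2.1⟩))]
    refine ⟨⟨fun i hi => ?_, fun x' o' q i h => ?_⟩, le_rfl⟩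
    · simp only [numClasses, Ex.eval_var, Ex.eval_get, Ex.eval_add, Ex.eval_ofNat, Ex.eval_lit,
        St.setV_v, St.setV_a, St.setA_a, e1, e2, e3, ht, hc, reduceCtorEq, if_false, true_and,
        St.row]
      rcases Nat.lt_succ_iff_lt_or_eq.mp hi with h' | rfl
      · rw [if_neg (by omega)]; exact hI1 i h'
      · simp
    · simp only [numClasses, Ex.eval_var, Ex.eval_get, Ex.eval_add, Ex.eval_ofNat, Ex.eval_lit,
        St.setV_v, St.setV_a, St.setA_a, e1, e2, e3, ht, hc, reduceCtorEq, if_false, true_and]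
      rw [if_neg (by rintro ⟨rfl, rfl, rfl, rfl⟩; exact h ⟨rfl, rfl, rfl, by omega⟩)]
      exact hI2 _ _ _ _ h
  · rintro s' t ha ⟨hI, ht⟩
    exact ⟨by omega, hI⟩

theorem findClass_ends (e : Ex) (f : ℕ → ℕ) (s : St) {x o c k : ℕ} (hx : s.v .tu = x)
    (ho : s.v .to = o) (hc : s.a .cnt x o 0 0 = c) (hk : s.a .K x (1 - o) 0 0 = k)
    (hf : ∀ s' j, j < k → (∀ y, y ≠ .t → y ≠ .x → s'.v y = s.v y) → s'.v .t = j →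
      s'.v .x = s.a .rep x (1 - o) (j + 1) 0 → (∀ A, A ≠ .vec → s'.a A = s.a A) →
      (∀ x' o' q i, ¬ (x' = x ∧ o' = o ∧ q = c) → s'.a .vec x' o' q i = s.a .vec x' o' q i) →
      e.eval s' = f j) :
    Ends (findClass e) s fun s' t => t ≤ (c + 1) * (4 * k + 7) ∧
      (∀ j < k, s'.row x o c j = f j) ∧
      (∀ x' o' q i, ¬ (x' = x ∧ o' = o ∧ q = c ∧ i ≠ 0) →
        s'.a .vec x' o' q i = s.a .vec x' o' q i) ∧
      ((s'.v .res = c ∧ ∀ q < c, ∃ j < k, s.row x o q j ≠ f j) ∨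
        (s'.v .res < c ∧ ∀ j < k, s.row x o (s'.v .res) j = f j)) := by
  rw [findClass, ends_seq]
  refine (fillCandidate_ends e f s hx ho hc hk hf).mono ?_
  rintro s1 t1 ha1 ⟨ht1, h1, h2⟩
  refine (lookup_ends s1 ((ha1.v .tu rfl).trans hx) ((ha1.v .to rfl).trans ho)
    (by rw [ha1.a .cnt rfl, hc]) (by rw [ha1.a .K rfl, hk])).mono ?_
  rintro s2 t2 ha2 ⟨ht2, h3⟩
  have hv := ha2.a .vec rfl
  have key : ∀ q < c, ∀ j, s1.row x o q j = s.row x o q j := fun q hq j => h2 _ _ _ _ (by omega)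
  refine ⟨?_, fun j hj => by rw [St.row, hv]; exact h1 j hj,
    fun x' o' q i h => by rw [hv]; exact h2 _ _ _ _ h, ?_⟩
  · rw [Nat.succ_mul]; omega
  · rcases h3 with ⟨h3, h4⟩ | ⟨h3, h4⟩
    · refine Or.inl ⟨h3, fun q hq => ?_⟩
      obtain ⟨j, hj, hne⟩ := h4 q hq
      exact ⟨j, hj, by rw [← key q hq j, ← h1 j hj]; exact hne⟩
    · exact Or.inr ⟨h3, fun j hj => by rw [← key _ h3 j, ← h1 j hj]; exact h4 j hj⟩

end Mach

namespace Mach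

/-! ### Capped sums -/

/-- On the columns `0, …, k - 1`, the function `f` is the sum, capped at `d`, of a multiset of the
first `L` rows of `g`. -/
def CappedSum (d L k : ℕ) (g : ℕ → ℕ → ℕ) (f : ℕ → ℕ) : Prop :=
  ∃ M : Multiset ℕ, (∀ l ∈ M, l < L) ∧ ∀ j < k, f j = min d (M.map fun l => g l j).sum

/-- The functions `v 0, …, v (c - 1)` are different capped sums, the first one being zero. -/
structure SumList (d L k : ℕ) (g : ℕ → ℕ → ℕ) (c : ℕ) (v : ℕ → ℕ → ℕ) : Prop where
  pos : 0 < c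
  zero : ∀ j < k, v 0 j = 0
  sound : ∀ q < c, CappedSum d L k g (v q)
  inj : ∀ q < c, ∀ q' < c, (∀ j < k, v q j = v q' j) → q = q'

variable {d L k : ℕ} {g : ℕ → ℕ → ℕ}

theorem CappedSum.zero : CappedSum d L k g fun _ => 0 := ⟨0, by simp, by simp⟩

/-- Capping before an addition loses nothing: `min d (min d a + b) = min d (a + b)`. -/
theorem CappedSum.add_row {f f' : ℕ → ℕ} {l : ℕ} (h : CappedSum d L k g f) (hl : l < L)
    (hf : ∀ j < k, f' j = min d (f j + g l j)) : CappedSum d L k g f' := by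
  obtain ⟨M, hM, h⟩ := h
  refine ⟨l ::ₘ M, ?_, fun j hj => ?_⟩
  · intro x hx
    rcases Multiset.mem_cons.mp hx with rfl | hx
    exacts [hl, hM x hx]
  · rw [hf j hj, h j hj, Multiset.map_cons, Multiset.sum_cons]; omega

theorem CappedSum.congr {f f' : ℕ → ℕ} (h : CappedSum d L k g f) (hf : ∀ j < k, f' j = f j) :
    CappedSum d L k g f' := by
  obtain ⟨M, hM, h⟩ := h
  exact ⟨M, hM, fun j hj => (hf j hj).trans (h j hj)⟩

theorem SumList.congr {c : ℕ} {v v' : ℕ → ℕ → ℕ} (h : SumList d L k g c v)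
    (hv : ∀ q < c, ∀ j < k, v' q j = v q j) : SumList d L k g c v' where
  pos := h.pos
  zero j hj := (hv 0 h.pos j hj).trans (h.zero j hj)
  sound q hq := (h.sound q hq).congr (hv q hq)
  inj q hq q' hq' he := h.inj q hq q' hq' fun j hj => by
    rw [← hv q hq j hj, ← hv q' hq' j hj, he j hj]

theorem SumList.snoc {c : ℕ} {v v' : ℕ → ℕ → ℕ} (h : SumList d L k g c v)
    (hv : ∀ q < c, ∀ j < k, v' q j = v q j) (hs : CappedSum d L k g (v' c))
    (hne : ∀ q < c, ∃ j < k, v q j ≠ v' c j) : SumList d L k g (c + 1) v' where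
  pos := by omega
  zero j hj := (hv 0 h.pos j hj).trans (h.zero j hj)
  sound q hq := by
    rcases Nat.lt_succ_iff_lt_or_eq.mp hq with h' | rfl
    exacts [(h.sound q h').congr (hv q h'), hs]
  inj q hq q' hq' he := by
    rcases Nat.lt_succ_iff_lt_or_eq.mp hq with h1 | rfl <;>
      rcases Nat.lt_succ_iff_lt_or_eq.mp hq' with h2 | rfl
    · exact h.inj q h1 q' h2 fun j hj => by rw [← hv q h1 j hj, ← hv q' h2 j hj, he j hj]
    · obtain ⟨j, hj, hn⟩ := hne q h1
      exact absurd (by rw [← hv q h1 j hj, he j hj]) hn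
    · obtain ⟨j, hj, hn⟩ := hne q' h2
      exact absurd (by rw [← hv q' h2 j hj, he j hj]) hn
    · rfl

/-- A multiset is built up from the empty one by adding rows, and each addition stays within the
list by `hc`. -/
theorem SumList.complete {c : ℕ} {v : ℕ → ℕ → ℕ} (h : SumList d L k g c v)
    (hc : ∀ q < c, ∀ l < L, ∃ q' < c, ∀ j < k, v q' j = min d (v q j + g l j))
    (M : Multiset ℕ) (hM : ∀ l ∈ M, l < L) :
    ∃ q < c, ∀ j < k, v q j = min d (M.map fun l => g l j).sum := by
  induction M using Multiset.induction with
  | empty => exact ⟨0, h.pos, by simpa using h.zero⟩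
  | cons l M ih =>
    obtain ⟨q, hq, h1⟩ := ih fun x hx => hM x (Multiset.mem_cons_of_mem hx)
    obtain ⟨q', hq', h2⟩ := hc q hq l (hM l (Multiset.mem_cons_self l M))
    refine ⟨q', hq', fun j hj => ?_⟩
    rw [h2 j hj, h1 j hj, Multiset.map_cons, Multiset.sum_cons]; omega

/-- The list always consists of distinct capped sums, so `hN` bounds its length and hence the number
of rounds. When the work list is exhausted, every class has been extended by every row. -/
theorem closure_ends (s : St) {x o N : ℕ} (hx : s.v .tu = x) (ho : s.v .to = o)
    (hd : s.v .d = d) (hL : s.a .K x o 0 0 = L) (hk : s.a .K x (1 - o) 0 0 = k)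
    (hg : ∀ l < L, ∀ j < k, s.a .adj (s.a .rep x o (l + 1) 0) (s.a .rep x (1 - o) (j + 1) 0) 0 0 =
      g l j)
    (hz : ∀ j < k, s.row x o 0 j = 0)
    (hN : ∀ c v, SumList d L k g c v → c ≤ N) :
    Ends closure s fun s' t =>
      t ≤ N * (L * ((N + 1) * (4 * k + 7) + 4) + 5) + 3 ∧
      (∃ c, s'.a .cnt x o 0 0 = c ∧ c ≤ N ∧ SumList d L k g c (s'.row x o) ∧
        ∀ q < c, ∀ l < L, ∃ q' < c, ∀ j < k,
          s'.row x o q' j = min d (s'.row x o q j + g l j)) ∧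
      (∀ x' o' q i, ¬ (x' = x ∧ o' = o ∧ i ≠ 0) → s'.a .vec x' o' q i = s.a .vec x' o' q i) ∧
      (∀ x' o' i j, ¬ (x' = x ∧ o' = o) → s'.a .cnt x' o' i j = s.a .cnt x' o' i j) := by
  rw [closure, ends_seq, ends_store, ends_seq, ends_assign]
  simp only [Ex.eval_var, Ex.eval_lit, Ex.eval_ofNat, hx, ho]
  refine (ends_while (fun j s' => s'.v .q = j ∧ j ≤ N ∧ ∃ c, s'.a .cnt x o 0 0 = c ∧ j ≤ c ∧
      SumList d L k g c (s'.row x o) ∧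
      (∀ q < j, ∀ l < L, ∃ q' < c, ∀ j < k,
          s'.row x o q' j = min d (s'.row x o q j + g l j)) ∧
      (∀ x' o' q i, ¬ (x' = x ∧ o' = o ∧ i ≠ 0) → s'.a .vec x' o' q i = s.a .vec x' o' q i) ∧
      (∀ x' o' i j, ¬ (x' = x ∧ o' = o) → s'.a .cnt x' o' i j = s.a .cnt x' o' i j))
      N (L * ((N + 1) * (4 * k + 7) + 4) + 4) ?_ ?_ ?_).mono ?_
  · refine ⟨by simp, Nat.zero_le _, 1, by simp, by omega, ?_, by simp, ?_, ?_⟩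
    · exact ⟨by omega, fun j hj => by simpa using hz j hj,
        fun q hq => CappedSum.zero.congr fun j hj => by
          rw [Nat.lt_one_iff] at hq; subst hq; simpa using hz j hj,
        fun q hq q' hq' _ => by omega⟩
    · intro x' o' q i _; simp
    · intro x' o' i j h
      simp only [St.setV_a, St.setA_a]
      rw [if_neg (by tauto)]
  · rintro j s' ha ⟨hq, hjN, c, hc, hjc, hS, -⟩ hne
    have e1 := ha.v .tu rfl
    have e2 := ha.v .to rfl
    simp only [St.setV_v, St.setA_v, reduceCtorEq, if_false, hx, ho] at e1 e2
    simp only [numClasses, Ex.eval_sub, Ex.eval_get, Ex.eval_var, Ex.eval_lit, e1, e2, hc, hq] at hne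
    have := hN c _ hS
    omega
  · rintro j s1 hjN ha ⟨hq, -, c0, hc0, hjc0, hS0, hC0, hV0, hD0⟩ hne
    have e1 := ha.v .tu rfl
    have e2 := ha.v .to rfl
    have e3 := ha.v .d rfl
    have e4 := ha.a .K rfl
    have e5 := ha.a .adj rfl
    have e6 := ha.a .rep rfl
    simp only [St.setV_v, St.setV_a, St.setA_v, reduceCtorEq, if_false, hx, ho, hd,
      St.setA_a_ne _ (show Arr.K ≠ .cnt by decide), St.setA_a_ne _ (show Arr.adj ≠ .cnt by decide),
      St.setA_a_ne _ (show Arr.rep ≠ .cnt by decide)] at e1 e2 e3 e4 e5 e6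
    simp only [numClasses, Ex.eval_sub, Ex.eval_get, Ex.eval_var, Ex.eval_lit, e1, e2, hc0, hq] at hne
    rw [ends_seq]
    refine (ends_for (fun i s' => ∃ c, s'.a .cnt x o 0 0 = c ∧ j < c ∧
      SumList d L k g c (s'.row x o) ∧
      (∀ q l, (q < j ∧ l < L ∨ q = j ∧ l < i) → ∃ q' < c, ∀ j < k,
          s'.row x o q' j = min d (s'.row x o q j + g l j)) ∧
      (∀ x' o' q i, ¬ (x' = x ∧ o' = o ∧ i ≠ 0) → s'.a .vec x' o' q i = s.a .vec x' o' q i) ∧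
      (∀ x' o' i j, ¬ (x' = x ∧ o' = o) → s'.a .cnt x' o' i j = s.a .cnt x' o' i j))
      L ((N + 1) * (4 * k + 7) + 2) rfl ?_ ?_ ?_).mono ?_
    · intro s' ha'
      simp [ha'.v .tu rfl, ha'.v .to rfl, ha'.a .K rfl, e1, e2, e4, hL]
    · refine ⟨c0, hc0, by omega, hS0, ?_, hV0, hD0⟩
      rintro q l (⟨h1, h2⟩ | ⟨_, h2⟩)
      · exact hC0 q h1 l h2
      · omega
    · rintro i s2 hi ha' hl ⟨c, hc, hjc, hS, hC, hV, hD⟩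
      have f1 := (ha'.v .tu rfl).trans e1
      have f2 := (ha'.v .to rfl).trans e2
      have f3 := (ha'.v .d rfl).trans e3
      have f4 := (ha'.a .K rfl).trans e4
      have f5 := (ha'.a .adj rfl).trans e5
      have f6 := (ha'.a .rep rfl).trans e6
      have f7 := (ha'.v .q rfl).trans hq
      have hcN := hN c _ hS
      rw [ends_seq]
      refine (findClass_ends _ (fun i' => min d (s2.row x o j i' + g i i')) s2 f1 f2 hc
        (by rw [f4, hk]) ?_).mono ?_
      · intro s3 i' hi' hv ht hxx hA hvec
        simp only [Ex.eval_var, Ex.eval_get, Ex.eval_add, Ex.eval_cap, Ex.eval_ofNat, Ex.eval_lit,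
          ht, hxx, hv .tu (by decide) (by decide), hv .to (by decide) (by decide),
          hv .q (by decide) (by decide), hv .l (by decide) (by decide),
          hv .d (by decide) (by decide), hA .rep (by decide), hA .adj (by decide), f1, f2, f3, f5,
          f6, f7, hl]
        rw [hvec _ _ _ _ (by omega), hg i hi i' hi']
        exact min_comm _ _
      · rintro s3 t3 ha3 ⟨ht3, h1, h2, h3⟩
        have g1 := (ha3.v .tu rfl).trans f1
        have g2 := (ha3.v .to rfl).trans f2
        have g3 := ha3.a .cnt rfl
        have hle : (c + 1) * (4 * k + 7) ≤ (N + 1) * (4 * k + 7) := Nat.mul_le_mul_right _ (by omega)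
        have hrow : ∀ q < c, ∀ i', s3.row x o q i' = s2.row x o q i' := fun q hq i' =>
          h2 _ _ _ _ (by omega)
        have hV' : ∀ x' o' q i, ¬ (x' = x ∧ o' = o ∧ i ≠ 0) →
            s3.a .vec x' o' q i = s.a .vec x' o' q i := fun x' o' q i h => by
          rw [h2 _ _ _ _ (by tauto)]; exact hV _ _ _ _ h
        rw [ends_ite]
        simp only [Ex.neq_eval, ends_skip, ends_store]
        simp only [numClasses, Ex.eval_get, Ex.eval_var, Ex.eval_lit, Ex.eval_add, Ex.eval_ofNat, g1,
          g2, g3, hc]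
        split_ifs with hres
        -- The candidate already occupies the slot after the last class, so raising the counter is
        -- all that is needed to add it.
        · have hnew := (h3.resolve_right (by omega)).2
          refine ⟨⟨c + 1, by simp, by omega, ?_, ?_, ?_, ?_⟩, by omega⟩
          · refine hS.snoc (fun q hq i' hi' => by simpa using hrow q hq i') ?_ ?_
            · exact (hS.sound j hjc).add_row hi fun i' hi' => by simpa using h1 i' hi'
            · intro q hq
              obtain ⟨i', hi', hn⟩ := hnew q hq
              exact ⟨i', hi', by simpa [h1 i' hi'] using hn⟩
          · intro q l hql
            have hqc : q < c := by omega
            by_cases hqi : q = j ∧ l = i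
            · obtain ⟨rfl, rfl⟩ := hqi
              exact ⟨c, by omega, fun i' hi' => by simpa [hrow q hqc] using h1 i' hi'⟩
            · obtain ⟨q', hq', h⟩ := hC q l (by omega)
              exact ⟨q', by omega, fun i' hi' => by simpa [hrow q hqc, hrow q' hq'] using h i' hi'⟩
          · intro x' o' q i h
            simpa using hV' _ _ _ _ h
          · intro x' o' i j h
            simp only [St.setV_a, St.setA_a, g3]
            rw [if_neg (by tauto)]; exact hD _ _ _ _ h
        · obtain ⟨hres, hold⟩ := h3.resolve_left (by tauto)
          refine ⟨⟨c, by simpa [g3] using hc, hjc, ?_, ?_, ?_, ?_⟩, by omega⟩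
          · exact hS.congr fun q hq i' hi' => by simpa using hrow q hq i'
          · intro q l hql
            have hqc : q < c := by omega
            by_cases hqi : q = j ∧ l = i
            · obtain ⟨rfl, rfl⟩ := hqi
              exact ⟨_, hres, fun i' hi' => by
                simpa [hrow q hqc, hrow _ hres] using hold i' hi'⟩
            · obtain ⟨q', hq', h⟩ := hC q l (by omega)
              exact ⟨q', by omega, fun i' hi' => by simpa [hrow q hqc, hrow q' hq'] using h i' hi'⟩
          · intro x' o' q i h
            simpa using hV' _ _ _ _ h
          · intro x' o' i j h
            simpa [g3] using hD _ _ _ _ h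
    · rintro s2 t2 ha2 ⟨⟨c, hc, hjc, hS, hC, hV, hD⟩, ht⟩
      have f7 := (ha2.v .q rfl).trans hq
      rw [ends_assign]
      refine ⟨⟨by simp [f7], hjN, c, by simpa using hc, hjc, ?_, ?_, ?_, ?_⟩, ?_⟩
      · simpa [St.row_setV_eq] using hS
      · intro q hq' l hl
        simpa using hC q l (by omega)
      · simpa using hV
      · simpa using hD
      · rw [show (N + 1) * (4 * k + 7) + 2 + 2 = (N + 1) * (4 * k + 7) + 4 from rfl] at ht
        omega
  · rintro s' t ha ⟨⟨j, hq, -, c, hc, hjc, hS, hC, hV, hD⟩, hend, ht⟩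
    have e1 := ha.v .tu rfl
    have e2 := ha.v .to rfl
    simp only [St.setV_v, St.setA_v, reduceCtorEq, if_false, hx, ho] at e1 e2
    simp only [numClasses, Ex.eval_sub, Ex.eval_get, Ex.eval_var, Ex.eval_lit, e1, e2, hc, hq] at hend
    have hj : j = c := by omega
    subst hj
    exact ⟨by rw [Nat.add_assoc _ 4 1, show 4 + 1 = 5 from rfl] at ht; omega, ⟨j, hc, hN j _ hS, hS, hC⟩, hV, hD⟩

end Mach

namespace Mach

/-! ### The number of capped sums -/

/-- Every row in `S` has a column of its own. -/
def Irredundant (k : ℕ) (g : ℕ → ℕ → ℕ) (S : Finset ℕ) : Prop :=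
  ∀ i ∈ S, ∃ j < k, g i j ≠ 0 ∧ ∀ i' ∈ S, i' ≠ i → g i' j = 0

/-- A row without a column of its own can be erased: whatever it covers is covered by another row.
-/
theorem exists_irredundant_cover (k : ℕ) (g : ℕ → ℕ → ℕ) (T : Finset ℕ) :
    ∃ S ⊆ T, Irredundant k g S ∧ ∀ j < k, (∃ i ∈ T, g i j ≠ 0) → ∃ i ∈ S, g i j ≠ 0 := by
  induction T using Finset.strongInduction with
  | H T ih =>
    by_cases hT : Irredundant k g T
    · exact ⟨T, subset_rfl, hT, fun _ _ h => h⟩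
    · unfold Irredundant at hT
      push Not at hT
      obtain ⟨i, hi, h⟩ := hT
      obtain ⟨S, hS, hirr, hcov⟩ := ih (T.erase i) (Finset.erase_ssubset hi)
      refine ⟨S, hS.trans (Finset.erase_subset _ _), hirr, fun j hj => ?_⟩
      rintro ⟨i', hi', hne⟩
      apply hcov j hj
      by_cases he : i' = i
      · subst he
        obtain ⟨i'', h1, h2, h3⟩ := h j hj hne
        exact ⟨i'', Finset.mem_erase.mpr ⟨h2, h1⟩, h3⟩
      · exact ⟨i', Finset.mem_erase.mpr ⟨he, hi'⟩, hne⟩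

/-- Layers are peeled off: an irredundant subset `S` of the rows in `M` that covers every column
covered by `M` contributes at least 1 there, so what remains of `M` matters only up to one less.
After `d` layers nothing remains to be matched. -/
theorem exists_small_multiset {k L κ : ℕ} {g : ℕ → ℕ → ℕ}
    (hκ : ∀ S : Finset ℕ, (∀ i ∈ S, i < L) → Irredundant k g S → S.card ≤ κ) (d : ℕ) :
    ∀ M : Multiset ℕ, (∀ l ∈ M, l < L) → ∃ R : Multiset ℕ, (∀ l ∈ R, l < L) ∧ R.card ≤ d * κ ∧
      ∀ j < k, min d (R.map fun l => g l j).sum = min d (M.map fun l => g l j).sum := by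
  induction d with
  | zero => exact fun M _ => ⟨0, by simp, by simp, by simp⟩
  | succ d ih =>
    intro M hM
    obtain ⟨S, hS, hirr, hcov⟩ := exists_irredundant_cover k g M.toFinset
    have hSM : S.val ≤ M := by
      rw [Multiset.le_iff_subset S.nodup]
      intro x hx
      exact Multiset.mem_toFinset.mp (hS hx)
    obtain ⟨M', rfl⟩ := Multiset.le_iff_exists_add.mp hSM
    have hSL : ∀ i ∈ S, i < L := fun i hi => hM i (Multiset.mem_of_le hSM hi)
    obtain ⟨R, hR, hcard, hsum⟩ := ih M' fun l hl => hM l (Multiset.mem_add.mpr (Or.inr hl))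
    refine ⟨S.val + R, ?_, ?_, fun j hj => ?_⟩
    · intro l hl
      rcases Multiset.mem_add.mp hl with h | h
      exacts [hSL l h, hR l h]
    · have := hκ S hSL hirr
      rw [Multiset.card_add, Finset.card_val, Nat.succ_mul]; omega
    · have h1 := hsum j hj
      rw [Multiset.map_add, Multiset.map_add, Multiset.sum_add, Multiset.sum_add]
      -- In a covered column `S` contributes at least 1, and agreement of the remainders up to `d`
      -- gives agreement up to `d + 1`. In the other columns both sums must vanish.
      by_cases h : ∃ i ∈ (S.val + M').toFinset, g i j ≠ 0
      · obtain ⟨i, hi, hne⟩ := hcov j hj h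
        have : g i j ≤ (S.val.map fun l => g l j).sum :=
          Multiset.single_le_sum (by simp) _ (Multiset.mem_map_of_mem _ hi)
        omega
      · push Not at h
        have h0 : (M'.map fun l => g l j).sum = 0 := by
          rw [Multiset.sum_eq_zero_iff]
          intro x hx
          obtain ⟨l, hl, rfl⟩ := Multiset.mem_map.mp hx
          exact h l (by simp [hl])
        have h2 : (S.val.map fun l => g l j).sum = 0 := by
          rw [Multiset.sum_eq_zero_iff]
          intro x hx
          obtain ⟨l, hl, rfl⟩ := Multiset.mem_map.mp hx
          exact h l (Multiset.mem_toFinset.mpr (Multiset.mem_add.mpr (Or.inl hl)))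
        rw [h0] at h1 ⊢
        rw [h2]
        -- For `d = 0` the equation `h1` says nothing, but then `R` is empty by its size.
        rcases Nat.eq_zero_or_pos d with rfl | hd
        · have : R = 0 := by simpa using hcard
          simp [this]
        · omega

open Classical in
/-- The sums of at most `D` of the first `L` rows. -/
noncomputable def smallSums (L : ℕ) (g : ℕ → ℕ → ℕ) : ℕ → Finset (ℕ → ℕ)
  | 0 => {fun _ => 0}
  | D + 1 => (smallSums L g D ×ˢ Finset.range (L + 1)).image fun p j =>
      (if p.2 < L then g p.2 j else 0) + p.1 j

-- The choice `L` stands for no row, hence `L + 1` choices for each of the `D` places.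
open Classical in
theorem card_smallSums_le (L : ℕ) (g : ℕ → ℕ → ℕ) (D : ℕ) :
    (smallSums L g D).card ≤ (L + 1) ^ D := by
  induction D with
  | zero => simp [smallSums]
  | succ D ih =>
    refine Finset.card_image_le.trans ?_
    rw [Finset.card_product, Finset.card_range, pow_succ]
    exact Nat.mul_le_mul_right _ ih

open Classical in
theorem mem_smallSums (L : ℕ) (g : ℕ → ℕ → ℕ) (D : ℕ) :
    ∀ R : Multiset ℕ, (∀ l ∈ R, l < L) → R.card ≤ D →
      (fun j => (R.map fun l => g l j).sum) ∈ smallSums L g D := by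
  induction D with
  | zero =>
    intro R _ hR
    have : R = 0 := by simpa using hR
    subst this
    simp [smallSums]
  | succ D ih =>
    intro R hR hc
    rw [smallSums, Finset.mem_image]
    induction R using Multiset.induction with
    | empty =>
      exact ⟨(_, L), Finset.mem_product.mpr ⟨ih 0 (by simp) (by simp), by simp⟩, by simp⟩
    | cons l R _ =>
      refine ⟨(fun j => (R.map fun l => g l j).sum, l), Finset.mem_product.mpr ⟨ih R (fun x hx => hR x (Multiset.mem_cons_of_mem hx))
        (by simpa using hc), ?_⟩, ?_⟩
      · have := hR l (Multiset.mem_cons_self l R)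
        simp; omega
      · have := hR l (Multiset.mem_cons_self l R)
        funext j
        rw [Multiset.map_cons, Multiset.sum_cons, if_pos this]

/-- A listed function is determined by a sum of at most `d * Nat.log 2 w` rows, with fewer than `w`
rows to choose from. The logarithm is the bound on the size of an irredundant set. -/
theorem SumList.le_pow {d L k w c : ℕ} {g : ℕ → ℕ → ℕ} {v : ℕ → ℕ → ℕ} (h : SumList d L k g c v)
    (hL : L + 1 ≤ w)
    (hw : ∀ S : Finset ℕ, (∀ i ∈ S, i < L) → Irredundant k g S → 2 ^ S.card ≤ w) :
    c ≤ w ^ (d * Nat.log 2 w) := by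
  have hκ : ∀ S : Finset ℕ, (∀ i ∈ S, i < L) → Irredundant k g S → S.card ≤ Nat.log 2 w :=
    fun S h1 h2 => Nat.le_log_of_pow_le (by norm_num) (hw S h1 h2)
  have key : ∀ q < c, ∃ f ∈ smallSums L g (d * Nat.log 2 w), ∀ j < k, v q j = min d (f j) := by
    intro q hq
    obtain ⟨M, hM, hv⟩ := h.sound q hq
    obtain ⟨R, hR, hc, hs⟩ := exists_small_multiset hκ d M hM
    exact ⟨_, mem_smallSums L g _ R hR hc, fun j hj => by rw [hv j hj, hs j hj]⟩
  choose! f hf1 hf2 using key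
  calc c = (Finset.range c).card := (Finset.card_range c).symm
    _ ≤ (smallSums L g (d * Nat.log 2 w)).card := by
        refine Finset.card_le_card_of_injOn f (fun q hq => hf1 q (by simpa using hq)) ?_
        intro q hq q' hq' he
        simp only [Finset.coe_range, Set.mem_Iio] at hq hq'
        exact h.inj q hq q' hq' fun j hj => by rw [hf2 q hq j hj, hf2 q' hq' j hj, he]
    _ ≤ (L + 1) ^ (d * Nat.log 2 w) := card_smallSums_le _ _ _
    _ ≤ w ^ (d * Nat.log 2 w) := Nat.pow_le_pow_left hL _

end Mach

namespace Mach

/-! ### Twin classes -/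

/-- The neighbours of `a` across the cut that are listed among the first `t` edges. -/
def contents (A B ins : ℕ → ℕ) (t a : ℕ) : List ℕ :=
  ((List.range t).filter fun i => A i = a ∧ ins (A i) ≠ ins (B i)).map B

theorem contents_succ (A B ins : ℕ → ℕ) (t a : ℕ) :
    contents A B ins (t + 1) a =
      contents A B ins t a ++ if A t = a ∧ ins (A t) ≠ ins (B t) then [B t] else [] := by
  simp only [contents, List.range_succ, List.filter_append, List.map_append]
  congr 1
  split_ifs with h
  · rw [List.filter_singleton, decide_eq_true h]; rfl
  · rw [List.filter_singleton, decide_eq_false h]; rfl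

theorem mem_contents {A B ins : ℕ → ℕ} {t a b : ℕ} :
    b ∈ contents A B ins t a ↔ ∃ i < t, A i = a ∧ B i = b ∧ ins a ≠ ins b := by
  simp only [contents, List.mem_map, List.mem_filter, List.mem_range, decide_eq_true_eq]
  constructor
  · rintro ⟨i, ⟨hi, rfl, h⟩, rfl⟩; exact ⟨i, hi, rfl, rfl, h⟩
  · rintro ⟨i, hi, rfl, rfl, h⟩; exact ⟨i, ⟨hi, rfl, h⟩, rfl⟩

/-- `dict` stores a prefix tree: the node `c` stands for the list `C c`. -/
structure PrefixTree (fr : ℕ) (dict : ℕ → ℕ → ℕ) (C : ℕ → List ℕ) : Prop where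
  pos : 0 < fr
  root : C 0 = []
  inj : ∀ c < fr, ∀ c' < fr, C c = C c' → c = c'
  child : ∀ c < fr, ∀ b c', c' ≠ 0 → (dict c b = c' ↔ c' < fr ∧ C c' = C c ++ [b])
  fresh : ∀ c, fr ≤ c → ∀ b, dict c b = 0
  parent : ∀ c' < fr, c' ≠ 0 → ∃ c < fr, ∃ b, C c' = C c ++ [b]

theorem PrefixTree.extend {fr : ℕ} {dict : ℕ → ℕ → ℕ} {C : ℕ → List ℕ}
    (h : PrefixTree fr dict C) {c b : ℕ} (hc : c < fr) (hb : dict c b = 0) :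
    PrefixTree (fr + 1) (fun c' b' => if c' = c ∧ b' = b then fr else dict c' b')
      (Function.update C fr (C c ++ [b])) := by
  have hpos := h.pos
  -- By `child`, the missing dictionary entry means that no node other than the root stands for the
  -- longer list, and the root stands for the empty one.
  have hnew : ∀ x < fr, C x ≠ C c ++ [b] := by
    intro x hx he
    have hx0 : x ≠ 0 := by rintro rfl; simp [h.root] at he
    exact hx0 (((h.child c hc b x hx0).mpr ⟨hx, he⟩).symm.trans hb)
  have hC : ∀ x < fr, Function.update C fr (C c ++ [b]) x = C x := fun x hx =>
    Function.update_of_ne hx.ne _ _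
  have hCf : Function.update C fr (C c ++ [b]) fr = C c ++ [b] := Function.update_self _ _ _
  refine ⟨by omega, by rw [hC 0 hpos, h.root], ?_, ?_, ?_, ?_⟩
  · intro x hx y hy he
    rcases Nat.lt_succ_iff_lt_or_eq.mp hx with hx | rfl <;>
      rcases Nat.lt_succ_iff_lt_or_eq.mp hy with hy | rfl
    · rw [hC x hx, hC y hy] at he; exact h.inj x hx y hy he
    · rw [hC x hx, hCf] at he; exact absurd he (hnew x hx)
    · rw [hC y hy, hCf] at he; exact absurd he.symm (hnew y hy)
    · rfl
  · intro x hx b' c' hc'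
    rcases Nat.lt_succ_iff_lt_or_eq.mp hx with hx | rfl
    · rw [hC x hx]
      by_cases hxb : x = c ∧ b' = b
      · obtain ⟨rfl, rfl⟩ := hxb
        simp only [and_self, if_true]
        constructor
        · rintro rfl; exact ⟨by omega, hCf⟩
        · rintro ⟨h1, h2⟩
          rcases Nat.lt_succ_iff_lt_or_eq.mp h1 with h1 | h1
          · rw [hC c' h1] at h2; exact absurd h2 (hnew c' h1)
          · exact h1.symm
      · rw [if_neg hxb, h.child x hx b' c' hc']
        constructor
        · rintro ⟨h1, h2⟩; exact ⟨by omega, by rw [hC c' h1, h2]⟩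
        · rintro ⟨h1, h2⟩
          rcases Nat.lt_succ_iff_lt_or_eq.mp h1 with h1 | rfl
          · rw [hC c' h1] at h2; exact ⟨h1, h2⟩
          · rw [hCf] at h2
            have := List.append_inj' h2 rfl
            simp only [List.cons.injEq, and_true] at this
            exact absurd ⟨(h.inj c hc x hx this.1).symm, this.2.symm⟩ hxb
    · rw [if_neg (by omega), h.fresh x le_rfl, hCf]
      constructor
      · intro h0; exact absurd h0.symm hc'
      · rintro ⟨h1, h2⟩
        rcases Nat.lt_succ_iff_lt_or_eq.mp h1 with h1 | rfl
        · rw [hC c' h1] at h2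
          -- The new node has no children yet: the parent of such a child would be an old node that
          -- stands for the new list.
          obtain ⟨y, hy, b'', h3⟩ := h.parent c' h1 hc'
          rw [h3] at h2
          exact absurd (List.append_inj' h2 rfl).1 (hnew y hy)
        · rw [hCf] at h2
          have := congrArg List.length h2
          simp at this
  · intro x hx b'
    rw [if_neg (by omega)]; exact h.fresh x (by omega) b'
  · intro c' hc' h0
    rcases Nat.lt_succ_iff_lt_or_eq.mp hc' with h1 | rfl
    · obtain ⟨y, hy, b'', h3⟩ := h.parent c' h1 h0
      exact ⟨y, by omega, b'', by rw [hC c' h1, hC y hy, h3]⟩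
    · exact ⟨c, by omega, b, by rw [hCf, hC c hc]⟩

/-- The pair `(a, b)` moves `a` from its node of the prefix tree to the child labelled `b`. So the
node of `a` always stands for the list of neighbours of `a` seen so far, at constant cost per edge,
and nodes stand for different lists. -/
theorem refineTwins_ends (s : St) {u e : ℕ} (hu : s.v .u = u) (he : s.v .e = e)
    (hst : ∀ a, s.a .st u a 0 0 = 0) (hdict : ∀ c b, s.a .dict u c b 0 = 0) :
    Ends refineTwins s fun s' t => t ≤ e * 10 + 3 ∧
      (∃ C : ℕ → List ℕ, C 0 = [] ∧ ∀ a a', (s'.a .st u a 0 0 = s'.a .st u a' 0 0 ↔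
        C (s'.a .st u a 0 0) = C (s'.a .st u a' 0 0)) ∧ (s'.a .st u a 0 0 = 0 ↔
        C (s'.a .st u a 0 0) = []) ∧
        C (s'.a .st u a 0 0) = contents (s.a .ea · 0 0 0) (s.a .eb · 0 0 0) (s.a .ins u · 0 0) e a) ∧
      (∀ u' a, u' ≠ u → s'.a .st u' a 0 0 = s.a .st u' a 0 0) ∧
      (∀ u' c b, u' ≠ u → s'.a .dict u' c b 0 = s.a .dict u' c b 0) := by
  rw [refineTwins, ends_seq, ends_assign]
  set A : ℕ → ℕ := (s.a .ea · 0 0 0) with hA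
  set B : ℕ → ℕ := (s.a .eb · 0 0 0) with hB
  set ins : ℕ → ℕ := (s.a .ins u · 0 0) with hins
  refine (ends_for (fun t s' => ∃ C : ℕ → List ℕ,
      PrefixTree (s'.v .fr) (fun c b => s'.a .dict u c b 0) C ∧
      (∀ a, s'.a .st u a 0 0 < s'.v .fr ∧ C (s'.a .st u a 0 0) = contents A B ins t a) ∧
      (∀ u' a, u' ≠ u → s'.a .st u' a 0 0 = s.a .st u' a 0 0) ∧
      (∀ u' c b, u' ≠ u → s'.a .dict u' c b 0 = s.a .dict u' c b 0)) e 8 rfl ?_ ?_ ?_).mono ?_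
  · intro s' ha
    simp [ha.v .e rfl, he]
  -- Only the root exists at first; the lists of the other numbers do not matter.
  · refine ⟨fun c => if c = 0 then [] else [c], ⟨?_, ?_, ?_, ?_, ?_, ?_⟩, ?_, ?_, ?_⟩ <;>
      simp_all [contents]
    omega
  · rintro t s1 ht ha hct ⟨C, hP, hC, hS, hD⟩
    have e1 := ha.v .u rfl
    have e2 := ha.a .ea rfl
    have e3 := ha.a .eb rfl
    have e4 := ha.a .ins rfl
    simp only [St.setV_v, St.setV_a, reduceCtorEq, if_false, hu] at e1 e2 e3 e4
    rw [ends_ite]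
    simp only [crossing, Ex.neq_eval, Ex.eval_get, Ex.eval_var, Ex.eval_lit, e1, e2, e3, e4, hct,
      ends_skip, ends_seq, ends_assign, ends_ite, ends_store, St.setV_v, St.setV_a, St.setA_a,
      St.setA_v, reduceCtorEq, if_false, if_true, false_and, true_and, Ex.eval_add, Ex.eval_ofNat,
      and_self, and_true]
    change if ins (A t) = ins (B t) then _ else _
    split_ifs with h h'
    · refine ⟨⟨C, hP, fun a => ?_, hS, hD⟩, by norm_num⟩
      rw [contents_succ, if_neg (by tauto), List.append_nil]; exact hC a
    · have hca := hC (A t)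
      refine ⟨⟨_, hP.extend hca.1 h', fun a => ?_, ?_, ?_⟩, by norm_num⟩
      · change (if a = A t then _ else _) < _ ∧ Function.update _ _ _ (if a = A t then _ else _) = _
        rw [contents_succ]
        by_cases haa : a = A t
        · subst haa
          rw [if_pos rfl, if_pos ⟨rfl, h⟩]
          exact ⟨Nat.lt_succ_self _, by rw [Function.update_self, hca.2]⟩
        · have := hC a
          rw [if_neg haa, if_neg (by tauto), List.append_nil, Function.update_of_ne (by omega)]
          exact ⟨by omega, this.2⟩
      · intro u' a hu'
        simpa [hu'] using hS u' a hu'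
      · intro u' c b hu'
        simpa [hu'] using hD u' c b hu'
    · have hca := hC (A t)
      have hch := (hP.child _ hca.1 (B t) _ h').mp rfl
      refine ⟨⟨C, hP, fun a => ?_, ?_, hD⟩, by norm_num⟩
      · change (if a = A t then _ else _) < _ ∧ C (if a = A t then _ else _) = _
        rw [contents_succ]
        by_cases haa : a = A t
        · subst haa
          rw [if_pos rfl, if_pos ⟨rfl, h⟩, ← hca.2]
          exact hch
        · rw [if_neg haa, if_neg (by tauto), List.append_nil]
          exact hC a
      · intro u' a hu'
        simpa [hu'] using hS u' a hu'
  · rintro s' t ha ⟨⟨C, hP, hC, hS, hD⟩, ht⟩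
    refine ⟨by omega, ⟨C, hP.root, fun a a' => ⟨⟨fun h => by rw [h], fun h =>
      hP.inj _ (hC a).1 _ (hC a').1 h⟩, ⟨fun h => by rw [h, hP.root], fun h =>
      hP.inj _ (hC a).1 0 hP.pos (h.trans hP.root.symm)⟩, (hC a).2⟩⟩, hS, hD⟩

/-- The first crossing edge at which a class appears provides the representative. By `hst`, only
nonzero classes occur there, so class 0 never receives a column. -/
theorem collectReps_ends (s : St) {u e : ℕ} (hu : s.v .u = u) (he : s.v .e = e)
    (hidx : ∀ c, s.a .idx u c 0 0 = 0) (hK : ∀ o, s.a .K u o 0 0 = 0)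
    (hst : ∀ i < e, s.a .ins u (s.a .ea i 0 0 0) 0 0 ≠ s.a .ins u (s.a .eb i 0 0 0) 0 0 →
      s.a .st u (s.a .ea i 0 0 0) 0 0 ≠ 0) :
    Ends collectReps s fun s' t => t ≤ e * 10 + 2 ∧
      s'.a .idx u 0 0 0 = 0 ∧
      (∀ c, s'.a .idx u c 0 0 ≠ 0 → ∃ i < e,
        s.a .ins u (s.a .ea i 0 0 0) 0 0 ≠ s.a .ins u (s.a .eb i 0 0 0) 0 0 ∧
        s.a .st u (s.a .ea i 0 0 0) 0 0 = c ∧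
        s'.a .idx u c 0 0 ≤ s'.a .K u (s.a .ins u (s.a .ea i 0 0 0) 0 0) 0 0 ∧
        s'.a .rep u (s.a .ins u (s.a .ea i 0 0 0) 0 0) (s'.a .idx u c 0 0) 0 = s.a .ea i 0 0 0) ∧
      (∀ i < e, s.a .ins u (s.a .ea i 0 0 0) 0 0 ≠ s.a .ins u (s.a .eb i 0 0 0) 0 0 →
        s'.a .idx u (s.a .st u (s.a .ea i 0 0 0) 0 0) 0 0 ≠ 0) ∧
      (∀ o j, 1 ≤ j → j ≤ s'.a .K u o 0 0 → ∃ i < e,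
        s.a .ins u (s.a .ea i 0 0 0) 0 0 ≠ s.a .ins u (s.a .eb i 0 0 0) 0 0 ∧
        s'.a .rep u o j 0 = s.a .ea i 0 0 0 ∧ s.a .ins u (s.a .ea i 0 0 0) 0 0 = o ∧
        s'.a .idx u (s.a .st u (s.a .ea i 0 0 0) 0 0) 0 0 = j) ∧
      (∀ u' c, u' ≠ u → s'.a .idx u' c 0 0 = s.a .idx u' c 0 0) ∧
      (∀ u' o, u' ≠ u → s'.a .K u' o 0 0 = s.a .K u' o 0 0) ∧
      (∀ u' o j, u' ≠ u → s'.a .rep u' o j 0 = s.a .rep u' o j 0) := by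
  rw [collectReps]
  set A : ℕ → ℕ := (s.a .ea · 0 0 0) with hA
  set B : ℕ → ℕ := (s.a .eb · 0 0 0) with hB
  set ins : ℕ → ℕ := (s.a .ins u · 0 0) with hins
  set st : ℕ → ℕ := (s.a .st u · 0 0) with hst'
  change ∀ i < e, ins (A i) ≠ ins (B i) → st (A i) ≠ 0 at hst
  refine (ends_for (fun t s' =>
      s'.a .idx u 0 0 0 = 0 ∧
      (∀ c, s'.a .idx u c 0 0 ≠ 0 → ∃ i < e, ins (A i) ≠ ins (B i) ∧ st (A i) = c ∧
        s'.a .idx u c 0 0 ≤ s'.a .K u (ins (A i)) 0 0 ∧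
        s'.a .rep u (ins (A i)) (s'.a .idx u c 0 0) 0 = A i) ∧
      (∀ i < t, ins (A i) ≠ ins (B i) → s'.a .idx u (st (A i)) 0 0 ≠ 0) ∧
      (∀ o j, 1 ≤ j → j ≤ s'.a .K u o 0 0 → ∃ i < e, ins (A i) ≠ ins (B i) ∧
        s'.a .rep u o j 0 = A i ∧ ins (A i) = o ∧ s'.a .idx u (st (A i)) 0 0 = j) ∧
      (∀ u' c, u' ≠ u → s'.a .idx u' c 0 0 = s.a .idx u' c 0 0) ∧
      (∀ u' o, u' ≠ u → s'.a .K u' o 0 0 = s.a .K u' o 0 0) ∧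
      (∀ u' o j, u' ≠ u → s'.a .rep u' o j 0 = s.a .rep u' o j 0)) e 8 rfl ?_ ?_ ?_).mono ?_
  · intro s' ha
    simp [ha.v .e rfl, he]
  · simp [hidx, hK]
    omega
  · rintro t s1 ht ha hct ⟨h0, h1, h2, h3, h4, h5, h6⟩
    have e1 := (ha.v .u rfl).trans hu
    have e2 := ha.a .ea rfl
    have e3 := ha.a .eb rfl
    have e4 := ha.a .ins rfl
    have e5 := ha.a .st rfl
    rw [ends_ite]
    simp only [crossing, Ex.neq_eval, Ex.eval_get, Ex.eval_var, Ex.eval_lit, e1, e2, e3, e4, e5, hct,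
      ends_skip, ends_seq, ends_assign, ends_ite, ends_store, St.setV_v, St.setV_a, St.setA_a,
      St.setA_v, reduceCtorEq, if_false, if_true, false_and, true_and, Ex.eval_add, Ex.eval_ofNat,
      and_self, and_true]
    change if ins (A t) = ins (B t) then _ else
      if s1.a .idx u (st (A t)) 0 0 = 0 then _ else _
    by_cases h : ins (A t) = ins (B t)
    · rw [if_pos h]
      refine ⟨⟨h0, h1, fun i hi hne => ?_, h3, h4, h5, h6⟩, by norm_num⟩
      rcases Nat.lt_succ_iff_lt_or_eq.mp hi with hi | rfl
      exacts [h2 i hi hne, absurd h hne]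
    rw [if_neg h]
    by_cases h' : s1.a .idx u (st (A t)) 0 0 = 0
    · rw [if_pos h']
      change ((if 0 = st (A t) then _ else _) = 0 ∧ _ ∧ _ ∧ _ ∧ _ ∧ _ ∧ _) ∧ _
      -- This keeps `idx` zero at class 0, the class of the vertices without neighbours across the
      -- cut.
      have hs0 := hst t ht h
      change (_ ∧ (∀ c, (if c = st (A t) then s1.a .K u (ins (A t)) 0 0 + 1 else
        s1.a .idx u c 0 0) ≠ 0 → ∃ i < e, ins (A i) ≠ ins (B i) ∧ st (A i) = c ∧
        (if c = st (A t) then s1.a .K u (ins (A t)) 0 0 + 1 else s1.a .idx u c 0 0) ≤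
          (if ins (A i) = ins (A t) then s1.a .K u (ins (A t)) 0 0 + 1 else
            s1.a .K u (ins (A i)) 0 0) ∧
        (if ins (A i) = ins (A t) ∧ (if c = st (A t) then s1.a .K u (ins (A t)) 0 0 + 1 else
        s1.a .idx u c 0 0) = s1.a .K u (ins (A t)) 0 0 + 1 then A t else
          s1.a .rep u (ins (A i)) (if c = st (A t) then s1.a .K u (ins (A t)) 0 0 + 1 else
        s1.a .idx u c 0 0) 0) = A i) ∧
        (∀ i < t + 1, ins (A i) ≠ ins (B i) → (if st (A i) = st (A t) then
          s1.a .K u (ins (A t)) 0 0 + 1 else s1.a .idx u (st (A i)) 0 0) ≠ 0) ∧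
        (∀ o j, 1 ≤ j → j ≤ (if o = ins (A t) then s1.a .K u (ins (A t)) 0 0 + 1 else
          s1.a .K u o 0 0) → ∃ i < e, ins (A i) ≠ ins (B i) ∧
          (if o = ins (A t) ∧ j = s1.a .K u (ins (A t)) 0 0 + 1 then A t else
            s1.a .rep u o j 0) = A i ∧ ins (A i) = o ∧ (if st (A i) = st (A t) then
          s1.a .K u (ins (A t)) 0 0 + 1 else s1.a .idx u (st (A i)) 0 0) = j) ∧
        _ ∧ _ ∧ _) ∧ _
      refine ⟨⟨by rw [if_neg (Ne.symm hs0)]; exact h0, ?_, ?_, ?_, ?_, ?_, ?_⟩, by norm_num⟩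
      · intro c hc
        by_cases hcc : c = st (A t)
        · exact ⟨t, ht, h, hcc.symm, by simp [hcc]⟩
        · rw [if_neg hcc] at hc ⊢
          obtain ⟨i, hi, g1, g2, g3, g4⟩ := h1 c hc
          refine ⟨i, hi, g1, g2, ?_, ?_⟩
          · split_ifs with hi'
            · rw [← hi']; omega
            · exact g3
          · rw [if_neg]
            · exact g4
            · rintro ⟨k1, k2⟩
              rw [k1] at g3; omega
      · intro i hi hne
        split_ifs with hi'
        · omega
        · rcases Nat.lt_succ_iff_lt_or_eq.mp hi with hi | rfl
          exacts [h2 i hi hne, absurd rfl hi']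
      · intro o j hj1 hj2
        by_cases hn : o = ins (A t) ∧ j = s1.a .K u (ins (A t)) 0 0 + 1
        · exact ⟨t, ht, h, by simp [hn], hn.1.symm, by simp [hn]⟩
        · rw [if_neg hn]
          have hj3 : j ≤ s1.a .K u o 0 0 := by
            split_ifs at hj2 with ho
            · subst ho; simp at hn; omega
            · exact hj2
          obtain ⟨i, hi, g1, g2, g3, g4⟩ := h3 o j hj1 hj3
          refine ⟨i, hi, g1, g2, g3, ?_⟩
          rw [if_neg]
          · exact g4
          · intro hs; rw [hs, h'] at g4; omega
      · intro u' c hu'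
        simpa [hu'] using h4 u' c hu'
      · intro u' c hu'
        simpa [hu'] using h5 u' c hu'
      · intro u' c j hu'
        simpa [hu'] using h6 u' c j hu'
    · rw [if_neg h']
      refine ⟨⟨h0, h1, fun i hi hne => ?_, h3, h4, h5, h6⟩, by norm_num⟩
      rcases Nat.lt_succ_iff_lt_or_eq.mp hi with hi | rfl
      exacts [h2 i hi hne, h']
  · rintro s' t ha ⟨h, ht⟩
    exact ⟨by omega, h⟩

end Mach

/-! ### Twin classes of a graph across a cut -/

namespace Mach

open Classical in
/-- The adjacency matrix. -/
noncomputable def ad (H : SimpleGraph ℕ) (a b : ℕ) : ℕ := if H.Adj a b then 1 else 0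

theorem ad_comm (H : SimpleGraph ℕ) (a b : ℕ) : ad H a b = ad H b a := by
  classical exact if_congr (H.adj_comm a b) rfl rfl

/-- The sequence of the pairs `(A i, B i)`, `i < e`, consists of all pairs of neighbours, and the
neighbours of a vertex are listed in increasing order. -/
structure EdgeSeq (H : SimpleGraph ℕ) (e : ℕ) (A B : ℕ → ℕ) : Prop where
  adj : ∀ i < e, H.Adj (A i) (B i)
  cover : ∀ a b, H.Adj a b → ∃ i < e, A i = a ∧ B i = b
  strict : ∀ j < e, ∀ i < j, A i = A j → B i < B j

/-- `a` and `b` are neighbours on different sides of a cut. -/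
def Cross (H : SimpleGraph ℕ) (side : ℕ → ℕ) (a b : ℕ) : Prop := H.Adj a b ∧ side a ≠ side b

theorem EdgeSeq.pairwise_contents {H : SimpleGraph ℕ} {e : ℕ} {A B : ℕ → ℕ} (h : EdgeSeq H e A B)
    (ins : ℕ → ℕ) (a : ℕ) : ∀ t ≤ e, (contents A B ins t a).Pairwise (· < ·) := by
  intro t
  induction t with
  | zero => intro _; simp [contents]
  | succ t ih =>
    intro ht
    rw [contents_succ]
    split_ifs with hc
    · rw [List.pairwise_append]
      refine ⟨ih (by omega), List.pairwise_singleton _ _, ?_⟩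
      intro b hb b' hb'
      obtain ⟨i, hi, h1, h2, -⟩ := mem_contents.mp hb
      rw [List.mem_singleton.mp hb', ← h2]
      exact h.strict t (by omega) i hi (h1.trans hc.1.symm)
    · rw [List.append_nil]; exact ih (by omega)

/-- Both lists are strictly increasing, so they are equal as soon as they have the same members.
This is what the order of the edges is for. -/
theorem EdgeSeq.contents_eq_iff {H : SimpleGraph ℕ} {e : ℕ} {A B : ℕ → ℕ} (h : EdgeSeq H e A B)
    (ins : ℕ → ℕ) (a a' : ℕ) : contents A B ins e a = contents A B ins e a' ↔
      ∀ b, Cross H ins a b ↔ Cross H ins a' b := by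
  have hmem : ∀ a b, b ∈ contents A B ins e a ↔ Cross H ins a b := by
    intro a b
    rw [mem_contents]
    constructor
    · rintro ⟨i, hi, rfl, rfl, hne⟩; exact ⟨h.adj i hi, hne⟩
    · rintro ⟨hadj, hne⟩
      obtain ⟨i, hi, h1, h2⟩ := h.cover a b hadj
      exact ⟨i, hi, h1, h2, hne⟩
  constructor
  · intro he b; rw [← hmem, ← hmem, he]
  · intro he
    have hp := h.pairwise_contents ins a e le_rfl
    have hp' := h.pairwise_contents ins a' e le_rfl
    refine List.Perm.eq_of_pairwise (le := (· < ·)) (fun x y _ _ h1 h2 => by omega) hp hp' ?_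
    refine (List.perm_ext_iff_of_nodup ?_ ?_).mpr fun b => by rw [hmem, hmem, he]
    · exact hp.imp fun h => h.ne
    · exact hp'.imp fun h => h.ne

/-- The columns `1, …, K o` of the vertices on the side `o` are the classes of vertices with the
same, non-empty neighbourhood across the cut, represented by the vertices `rep o j`. -/
structure Twins (H : SimpleGraph ℕ) (side col K : ℕ → ℕ) (rep : ℕ → ℕ → ℕ) : Prop where
  col_ne : ∀ a, col a ≠ 0 ↔ ∃ b, Cross H side a b
  col_eq : ∀ a a', (∀ b, Cross H side a b ↔ Cross H side a' b) → col a = col a'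
  rep_col : ∀ a, col a ≠ 0 → col a ≤ K (side a) ∧ ∀ b,
    Cross H side a b ↔ Cross H side (rep (side a) (col a)) b
  col_rep : ∀ o j, 1 ≤ j → j ≤ K o → side (rep o j) = o ∧ col (rep o j) = j

/-- The column of the vertex `z` at the cut of the node `u`. -/
def St.col (s : St) (u z : ℕ) : ℕ := s.a .idx u (s.a .st u z 0 0) 0 0

/-- The array `ins` is known to be right only for vertices with a neighbour, which is enough because
only those can cross the cut. -/
theorem twins_ends (s : St) {H : SimpleGraph ℕ} {side : ℕ → ℕ} {u e : ℕ} (hu : s.v .u = u)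
    (he : s.v .e = e) (hE : EdgeSeq H e (s.a .ea · 0 0 0) (s.a .eb · 0 0 0))
    (hside : ∀ a, side a ≤ 1) (hins : ∀ a b, H.Adj a b → s.a .ins u a 0 0 = side a)
    (hst : ∀ a, s.a .st u a 0 0 = 0) (hdict : ∀ c b, s.a .dict u c b 0 = 0)
    (hidx : ∀ c, s.a .idx u c 0 0 = 0) (hK : ∀ o, s.a .K u o 0 0 = 0) :
    Ends (refineTwins ;; collectReps) s fun s' t => t ≤ e * 20 + 5 ∧
      Twins H side (s'.col u) (fun o => s'.a .K u o 0 0) (fun o j => s'.a .rep u o j 0) ∧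
      s'.a .idx u 0 0 0 = 0 ∧
      (∀ u' a, u' ≠ u → s'.a .st u' a 0 0 = s.a .st u' a 0 0) ∧
      (∀ u' c b, u' ≠ u → s'.a .dict u' c b 0 = s.a .dict u' c b 0) ∧
      (∀ u' c, u' ≠ u → s'.a .idx u' c 0 0 = s.a .idx u' c 0 0) ∧
      (∀ u' o, u' ≠ u → s'.a .K u' o 0 0 = s.a .K u' o 0 0) ∧
      (∀ u' o j, u' ≠ u → s'.a .rep u' o j 0 = s.a .rep u' o j 0) := by
  rw [ends_seq]
  refine (refineTwins_ends s hu he hst hdict).mono ?_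
  rintro s1 t1 ha1 ⟨ht1, ⟨C, hC0, hC⟩, hS, hD⟩
  set A : ℕ → ℕ := (s.a .ea · 0 0 0) with hA
  set B : ℕ → ℕ := (s.a .eb · 0 0 0) with hB
  set ins : ℕ → ℕ := (s.a .ins u · 0 0) with hins'
  have hcross : ∀ a b, Cross H ins a b ↔ Cross H side a b := by
    intro a b
    refine and_congr_right fun h => ?_
    rw [show ins a = side a from hins a b h, show ins b = side b from hins b a h.symm]
  have hsteq : ∀ a a', s1.a .st u a 0 0 = s1.a .st u a' 0 0 ↔
      ∀ b, Cross H side a b ↔ Cross H side a' b := by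
    intro a a'
    rw [(hC a a').1, (hC a a').2.2, (hC a' a).2.2, hE.contents_eq_iff]
    simp only [hcross]
  have hst0 : ∀ a, s1.a .st u a 0 0 ≠ 0 ↔ ∃ b, Cross H side a b := by
    intro a
    rw [ne_eq, (hC a a).2.1, (hC a a).2.2, List.eq_nil_iff_forall_not_mem]
    push Not
    refine exists_congr fun b => ?_
    rw [mem_contents, ← hcross]
    constructor
    · rintro ⟨i, hi, rfl, rfl, hne⟩; exact ⟨hE.adj i hi, hne⟩
    · rintro ⟨hadj, hne⟩
      obtain ⟨i, hi, h1, h2⟩ := hE.cover a b hadj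
      exact ⟨i, hi, h1, h2, hne⟩
  have e2 := ha1.a .ea rfl
  have e3 := ha1.a .eb rfl
  have e4 := ha1.a .ins rfl
  have e5 := ha1.a .idx rfl
  have e6 := ha1.a .K rfl
  have e7 := ha1.a .rep rfl
  refine (collectReps_ends s1 ((ha1.v .u rfl).trans hu) ((ha1.v .e rfl).trans he)
    (by rw [e5]; exact hidx) (by rw [e6]; exact hK) ?_).mono ?_
  · intro i hi hne
    rw [e2, e3, e4] at hne
    rw [e2, hst0]
    exact ⟨B i, (hcross _ _).mp ⟨hE.adj i hi, hne⟩⟩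
  · rintro s2 t2 ha2 ⟨ht2, h0, h1, h2, h3, h4, h5, h6⟩
    simp only [e2, e3, e4] at h1 h2 h3
    change ∀ i < e, ins (A i) ≠ ins (B i) → s2.a .idx u (s1.a .st u (A i) 0 0) 0 0 ≠ 0 at h2
    change ∀ c, s2.a .idx u c 0 0 ≠ 0 → ∃ i < e, ins (A i) ≠ ins (B i) ∧
      s1.a .st u (A i) 0 0 = c ∧ s2.a .idx u c 0 0 ≤ s2.a .K u (ins (A i)) 0 0 ∧
      s2.a .rep u (ins (A i)) (s2.a .idx u c 0 0) 0 = A i at h1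
    change ∀ o j, 1 ≤ j → j ≤ s2.a .K u o 0 0 → ∃ i < e, ins (A i) ≠ ins (B i) ∧
      s2.a .rep u o j 0 = A i ∧ ins (A i) = o ∧ s2.a .idx u (s1.a .st u (A i) 0 0) 0 0 = j at h3
    have hsc : ∀ a, s2.col u a = s2.a .idx u (s1.a .st u a 0 0) 0 0 := fun a => by
      rw [St.col, ha2.a .st rfl]
    have hsA : ∀ i < e, ins (A i) = side (A i) := fun i hi => hins _ _ (hE.adj i hi)
    refine ⟨by omega, ⟨fun a => ?_, fun a a' h => ?_, fun a h => ?_, fun o j hj1 hj2 => ?_⟩, h0,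
      ?_, ?_, fun u' c hu' => by rw [h4 _ _ hu', e5], fun u' o hu' => by rw [h5 _ _ hu', e6],
      fun u' o j hu' => by rw [h6 _ _ _ hu', e7]⟩
    · rw [hsc, ← hst0]
      constructor
      · intro h h'; rw [h'] at h; exact h h0
      · intro h
        obtain ⟨b, hb⟩ := (hst0 a).mp h
        obtain ⟨i, hi, rfl, rfl⟩ := hE.cover a b hb.1
        exact h2 i hi ((hcross _ _).mpr hb).2
    · rw [hsc, hsc, (hsteq a a').mpr h]
    · rw [hsc] at h ⊢
      obtain ⟨i, hi, g1, g2, g3, g4⟩ := h1 _ h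
      have g5 := (hsteq _ _).mp g2
      -- The two vertices have a common neighbour across the cut, and there are only two sides.
      have hs : side a = ins (A i) := by
        have hc := (hcross _ _).mp ⟨hE.adj i hi, g1⟩
        have h6 := ((g5 (B i)).mp hc).2
        have h7 := hc.2
        rw [hsA i hi]
        have := hside a; have := hside (A i); have := hside (B i)
        omega
      simp only [hs]
      exact ⟨g3, fun b => by rw [g4, g5 b]⟩
    · obtain ⟨i, hi, g1, g2, g3, g4⟩ := h3 o j hj1 hj2
      rw [g2, hsc, g4, ← hsA i hi]
      exact ⟨g3, rfl⟩
    · intro u' a hu'; rw [ha2.a .st rfl]; exact hS u' a hu'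
    · intro u' c b hu'; rw [ha2.a .dict rfl]; exact hD u' c b hu'

/-! ### Classes of vertex sets -/

/-- The functions `F 0, …, F (c - 1)` are, without repetition, all functions that count, up to `d`,
the neighbours in a multiset of vertices on the side `o`. -/
structure Classes (H : SimpleGraph ℕ) (d : ℕ) (side : ℕ → ℕ) (o c : ℕ) (F : ℕ → ℕ → ℕ) : Prop where
  pos : 0 < c
  zero : ∀ z, side z ≠ o → F 0 z = 0
  sound : ∀ q < c, ∃ M : Multiset ℕ, (∀ a ∈ M, side a = o) ∧
    ∀ z, side z ≠ o → F q z = min d (M.map (ad H z)).sum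
  complete : ∀ M : Multiset ℕ, (∀ a ∈ M, side a = o) →
    ∃ q < c, ∀ z, side z ≠ o → F q z = min d (M.map (ad H z)).sum
  inj : ∀ q < c, ∀ q' < c, (∀ z, side z ≠ o → F q z = F q' z) → q = q'

theorem Classes.congr {H : SimpleGraph ℕ} {d : ℕ} {side : ℕ → ℕ} {o c : ℕ} {F F' : ℕ → ℕ → ℕ}
    (h : Classes H d side o c F) (hF : ∀ q < c, ∀ z, F' q z = F q z) :
    Classes H d side o c F' where
  pos := h.pos
  zero z hz := (hF 0 h.pos z).trans (h.zero z hz)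
  sound q hq := by
    obtain ⟨M, h1, h2⟩ := h.sound q hq
    exact ⟨M, h1, fun z hz => (hF q hq z).trans (h2 z hz)⟩
  complete M hM := by
    obtain ⟨q, hq, h2⟩ := h.complete M hM
    exact ⟨q, hq, fun z hz => (hF q hq z).trans (h2 z hz)⟩
  inj q hq q' hq' he := h.inj q hq q' hq' fun z hz => by rw [← hF q hq, ← hF q' hq', he z hz]

/-- The number `w` bounds the number of classes of twins and the sizes of irredundant sets. -/
structure CutBound (H : SimpleGraph ℕ) (side : ℕ → ℕ) (o w : ℕ) : Prop where
  twins : ∀ R : Finset ℕ, (∀ a ∈ R, side a = o ∧ ∃ b, Cross H side a b) →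
    (∀ a ∈ R, ∀ a' ∈ R, (∀ b, Cross H side a b ↔ Cross H side a' b) → a = a') → R.card + 1 ≤ w
  irredundant : ∀ S : Finset ℕ, (∀ a ∈ S, side a = o ∧ ∃ b, Cross H side a b ∧
    ∀ a' ∈ S, a' ≠ a → ¬ H.Adj a' b) → 2 ^ S.card ≤ w

theorem Twins.ad_eq {H : SimpleGraph ℕ} {side col K : ℕ → ℕ} {rep : ℕ → ℕ → ℕ}
    (h : Twins H side col K rep) {a z : ℕ} (ha : col a ≠ 0) (hz : side z ≠ side a) :
    ad H a z = ad H (rep (side a) (col a)) z := by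
  obtain ⟨h1, h2⟩ := h.rep_col a ha
  have h3 := h2 z
  have h4 := (h.col_rep (side a) (col a) (by omega) h1).1
  simp only [Cross, h4, hz.symm, ne_eq, not_false_eq_true, and_true] at h3
  classical exact if_congr h3 rfl rfl

theorem Twins.ad_eq_zero {H : SimpleGraph ℕ} {side col K : ℕ → ℕ} {rep : ℕ → ℕ → ℕ}
    (h : Twins H side col K rep) {a z : ℕ} (ha : col a = 0) (hz : side z ≠ side a) :
    ad H a z = 0 := by
  have := (h.col_ne a).not.mp (by simpa using ha)
  push Not at this
  have h3 := this z
  simp only [Cross, not_and, not_not] at h3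
  simp only [ad, ite_eq_right_iff, one_ne_zero, imp_false]
  exact fun h4 => hz (h3 h4).symm

/-- The representatives of different columns are not twins, and all of them have neighbours across
the cut. -/
theorem Twins.card_le {H : SimpleGraph ℕ} {side col K : ℕ → ℕ} {rep : ℕ → ℕ → ℕ} {o w : ℕ}
    (h : Twins H side col K rep) (hw : CutBound H side o w) : K o + 1 ≤ w := by
  have hinj : Set.InjOn (rep o) (Finset.Icc 1 (K o)) := by
    intro j hj j' hj' he
    simp only [Finset.coe_Icc, Set.mem_Icc] at hj hj'
    rw [← (h.col_rep o j hj.1 hj.2).2, ← (h.col_rep o j' hj'.1 hj'.2).2, he]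
  have := hw.twins ((Finset.Icc 1 (K o)).image (rep o)) ?_ ?_
  · rwa [Finset.card_image_of_injOn hinj, Nat.card_Icc, Nat.add_sub_cancel] at this
  · intro a ha
    obtain ⟨j, hj, rfl⟩ := Finset.mem_image.mp ha
    rw [Finset.mem_Icc] at hj
    obtain ⟨h1, h2⟩ := h.col_rep o j hj.1 hj.2
    exact ⟨h1, (h.col_ne _).mp (by omega)⟩
  · intro a ha a' ha' he
    obtain ⟨j, hj, rfl⟩ := Finset.mem_image.mp ha
    obtain ⟨j', hj', rfl⟩ := Finset.mem_image.mp ha'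
    rw [Finset.mem_Icc] at hj hj'
    have := h.col_eq _ _ he
    rw [(h.col_rep o j hj.1 hj.2).2, (h.col_rep o j' hj'.1 hj'.2).2] at this
    rw [this]

/-- Private columns of rows are private neighbours of the representatives, so the bound for sets of
vertices carries over. -/
theorem Twins.irredundant_le {H : SimpleGraph ℕ} {side col K : ℕ → ℕ} {rep : ℕ → ℕ → ℕ} {o w : ℕ}
    (h : Twins H side col K rep) (hw : CutBound H side o w) (ho : o ≤ 1) {S : Finset ℕ}
    (hS : ∀ l ∈ S, l < K o) (hirr : Irredundant (K (1 - o))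
      (fun l j => ad H (rep o (l + 1)) (rep (1 - o) (j + 1))) S) : 2 ^ S.card ≤ w := by
  have hinj : Set.InjOn (fun l => rep o (l + 1)) S := by
    intro l hl l' hl' he
    have h1 := (h.col_rep o (l + 1) (by omega) (hS l hl)).2
    have h2 := (h.col_rep o (l' + 1) (by omega) (hS l' hl')).2
    simp only at he
    rw [he] at h1; omega
  rw [← Finset.card_image_of_injOn hinj]
  refine hw.irredundant _ fun a ha => ?_
  obtain ⟨l, hl, rfl⟩ := Finset.mem_image.mp ha
  obtain ⟨j, hj, hne, hpriv⟩ := hirr l hl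
  have h1 := h.col_rep o (l + 1) (by omega) (hS l hl)
  have h2 := h.col_rep (1 - o) (j + 1) (by omega) hj
  refine ⟨h1.1, rep (1 - o) (j + 1), ⟨?_, ?_⟩, ?_⟩
  · by_contra hn; exact hne (by simp [ad, hn])
  · rw [h1.1, h2.1]; omega
  · intro a' ha' hne' hadj
    obtain ⟨l', hl', rfl⟩ := Finset.mem_image.mp ha'
    have := hpriv l' hl' (by rintro rfl; exact hne' rfl)
    simp [ad, hadj] at this

/-- The list of capped sums that the closure of the rows produces consists of all classes. -/
theorem Twins.classes {H : SimpleGraph ℕ} {side col K : ℕ → ℕ} {rep : ℕ → ℕ → ℕ} {d o c : ℕ}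
    (h : Twins H side col K rep) (hside : ∀ a, side a ≤ 1) (ho : o ≤ 1) {F : ℕ → ℕ → ℕ}
    {v : ℕ → ℕ → ℕ} (hv : SumList d (K o) (K (1 - o))
      (fun l j => ad H (rep o (l + 1)) (rep (1 - o) (j + 1))) c v)
    (hcl : ∀ q < c, ∀ l < K o, ∃ q' < c, ∀ j < K (1 - o),
      v q' j = min d (v q j + ad H (rep o (l + 1)) (rep (1 - o) (j + 1))))
    (hF0 : ∀ q z, col z = 0 → F q z = 0) (hF : ∀ q z j, col z = j + 1 → F q z = v q j) :
    Classes H d side o c F := by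
  have hsz : ∀ z, side z ≠ o → side z = 1 - o := fun z hz => by have := hside z; omega
  have hcol : ∀ z j, side z ≠ o → col z = j + 1 → j < K (1 - o) := by
    intro z j hz hj
    have := (h.rep_col z (by omega)).1
    rw [hsz z hz] at this; omega
  -- multisets of vertices and multisets of rows
  have key1 : ∀ M : Multiset ℕ, ∀ z j, side z ≠ o → col z = j + 1 → (∀ l ∈ M, l < K o) →
      ((M.map fun l => rep o (l + 1)).map (ad H z)).sum =
        (M.map fun l => ad H (rep o (l + 1)) (rep (1 - o) (j + 1))).sum := by
    intro M z j hz hj hM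
    rw [Multiset.map_map]
    refine congrArg _ (Multiset.map_congr rfl fun l hl => ?_)
    have h1 := h.col_rep o (l + 1) (by omega) (hM l hl)
    have h2 := h.ad_eq (a := z) (z := rep o (l + 1)) (by omega) (by rw [h1.1]; exact hz.symm)
    rw [Function.comp_apply, h2, hsz z hz, hj, ad_comm]
  have key0 : ∀ M : Multiset ℕ, ∀ z, side z ≠ o → col z = 0 → (∀ a ∈ M, side a = o) →
      (M.map (ad H z)).sum = 0 := by
    intro M z hz hj hM
    rw [Multiset.sum_eq_zero_iff]
    intro x hx
    obtain ⟨a, ha, rfl⟩ := Multiset.mem_map.mp hx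
    exact h.ad_eq_zero hj (by rw [hM a ha]; exact hz.symm)
  -- A vertex with a column is replaced by the representative of its class; a vertex without one
  -- contributes nothing and is dropped. Twins yield the same row repeatedly, which is why multisets
  -- are used.
  have key2 : ∀ M : Multiset ℕ, (∀ a ∈ M, side a = o) → ∃ M' : Multiset ℕ, (∀ l ∈ M', l < K o) ∧
      ∀ z j, side z ≠ o → col z = j + 1 → (M.map (ad H z)).sum =
        (M'.map fun l => ad H (rep o (l + 1)) (rep (1 - o) (j + 1))).sum := by
    intro M
    induction M using Multiset.induction with
    | empty => exact fun _ => ⟨0, by simp, by simp⟩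
    | cons a M ih =>
      intro hM
      obtain ⟨M', h1, h2⟩ := ih fun x hx => hM x (Multiset.mem_cons_of_mem hx)
      have ha := hM a (Multiset.mem_cons_self a M)
      by_cases hc : col a = 0
      · refine ⟨M', h1, fun z j hz hj => ?_⟩
        rw [Multiset.map_cons, Multiset.sum_cons, ad_comm, h.ad_eq_zero hc (by rw [ha]; exact hz),
          zero_add, h2 z j hz hj]
      · have hr := (h.rep_col a hc).1
        rw [ha] at hr
        refine ⟨(col a - 1) ::ₘ M', ?_, fun z j hz hj => ?_⟩
        · intro l hl
          rcases Multiset.mem_cons.mp hl with rfl | hl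
          exacts [by omega, h1 l hl]
        · have h3 := h.ad_eq hc (z := z) (by rw [ha]; exact hz)
          have hca : col a - 1 + 1 = col a := by omega
          have h4 := h.ad_eq (a := z) (z := rep o (col a)) (by omega)
            (by rw [(h.col_rep o (col a) (by omega) hr).1]; exact hz.symm)
          rw [Multiset.map_cons, Multiset.sum_cons, Multiset.map_cons, Multiset.sum_cons,
            h2 z j hz hj, hca, ad_comm, h3, ha, ad_comm, h4, hsz z hz, hj, ad_comm]
  refine ⟨hv.pos, fun z hz => ?_, fun q hq => ?_, fun M hM => ?_, fun q hq q' hq' he => ?_⟩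
  · rcases hj : col z with _ | j
    · exact hF0 0 z hj
    · rw [hF 0 z j hj]; exact hv.zero j (hcol z j hz hj)
  · obtain ⟨M, hM, hvM⟩ := hv.sound q hq
    have hMs : ∀ a ∈ M.map (fun l => rep o (l + 1)), side a = o := by
      intro a ha
      obtain ⟨l, hl, rfl⟩ := Multiset.mem_map.mp ha
      exact (h.col_rep o (l + 1) (by omega) (hM l hl)).1
    refine ⟨_, hMs, fun z hz => ?_⟩
    rcases hj : col z with _ | j
    · rw [hF0 q z hj, key0 _ z hz hj hMs, Nat.min_zero]
    · rw [hF q z j hj, key1 M z j hz hj hM, hvM j (hcol z j hz hj)]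
  · obtain ⟨M', hM', hs⟩ := key2 M hM
    obtain ⟨q, hq, hvq⟩ := hv.complete hcl M' hM'
    refine ⟨q, hq, fun z hz => ?_⟩
    rcases hj : col z with _ | j
    · rw [hF0 q z hj, key0 _ z hz hj hM, Nat.min_zero]
    · rw [hF q z j hj, hs z j hz hj, hvq j (hcol z j hz hj)]
  · refine hv.inj q hq q' hq' fun j hj => ?_
    have h1 := h.col_rep (1 - o) (j + 1) (by omega) hj
    have h2 := he (rep (1 - o) (j + 1)) (by rw [h1.1]; omega)
    rwa [hF q _ j h1.2, hF q' _ j h1.2] at h2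

end Mach

/-! ### Analysis of all cuts -/

namespace Mach

/-- The cut of the node `u` has been analysed. -/
structure CutDone (H : SimpleGraph ℕ) (d N w : ℕ) (side : ℕ → ℕ) (u : ℕ) (s : St) : Prop where
  twins : Twins H side (s.col u) (fun o => s.a .K u o 0 0) (fun o j => s.a .rep u o j 0)
  classes : ∀ o ≤ 1, Classes H d side o (s.a .cnt u o 0 0) (fun q z => s.a .vec u o q (s.col u z))
  cnt_le : ∀ o ≤ 1, s.a .cnt u o 0 0 ≤ N
  K_le : ∀ o ≤ 1, s.a .K u o 0 0 + 1 ≤ w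

/-- Nothing has been stored for the cut of the node `u`. -/
structure CutFresh (u : ℕ) (s : St) : Prop where
  st : ∀ a, s.a .st u a 0 0 = 0
  dict : ∀ c b, s.a .dict u c b 0 = 0
  idx : ∀ c, s.a .idx u c 0 0 = 0
  K : ∀ o, s.a .K u o 0 0 = 0
  vec : ∀ o q i, s.a .vec u o q i = 0

/-- The states contain the same data for the cut of the node `u`. -/
structure CutAgree (u : ℕ) (s s' : St) : Prop where
  st : ∀ a, s'.a .st u a 0 0 = s.a .st u a 0 0
  dict : ∀ c b, s'.a .dict u c b 0 = s.a .dict u c b 0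
  idx : ∀ c, s'.a .idx u c 0 0 = s.a .idx u c 0 0
  K : ∀ o, s'.a .K u o 0 0 = s.a .K u o 0 0
  rep : ∀ o j, s'.a .rep u o j 0 = s.a .rep u o j 0
  vec : ∀ o q i, s'.a .vec u o q i = s.a .vec u o q i
  cnt : ∀ o, s'.a .cnt u o 0 0 = s.a .cnt u o 0 0

theorem CutAgree.fresh {u : ℕ} {s s' : St} (h : CutAgree u s s') (hf : CutFresh u s) :
    CutFresh u s' :=
  ⟨fun a => (h.st a).trans (hf.st a), fun c b => (h.dict c b).trans (hf.dict c b),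
    fun c => (h.idx c).trans (hf.idx c), fun o => (h.K o).trans (hf.K o),
    fun o q i => (h.vec o q i).trans (hf.vec o q i)⟩

/-- Slots from `cnt` on only hold candidates, so agreement on the earlier slots suffices. -/
theorem CutDone.congr {H : SimpleGraph ℕ} {d N w : ℕ} {side : ℕ → ℕ} {u : ℕ} {s s' : St}
    (h : CutDone H d N w side u s) (hst : ∀ a, s'.a .st u a 0 0 = s.a .st u a 0 0)
    (hidx : ∀ c, s'.a .idx u c 0 0 = s.a .idx u c 0 0) (hK : ∀ o, s'.a .K u o 0 0 = s.a .K u o 0 0)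
    (hrep : ∀ o j, s'.a .rep u o j 0 = s.a .rep u o j 0)
    (hcnt : ∀ o, s'.a .cnt u o 0 0 = s.a .cnt u o 0 0)
    (hvec : ∀ o q i, q < s.a .cnt u o 0 0 → s'.a .vec u o q i = s.a .vec u o q i) :
    CutDone H d N w side u s' := by
  have hcol : s'.col u = s.col u := funext fun z => by rw [St.col, St.col, hst, hidx]
  refine ⟨?_, fun o ho => ?_, fun o ho => ?_, fun o ho => ?_⟩
  · have h2 := h.twins
    rw [hcol]
    simpa only [hK, hrep] using h2
  · rw [hcnt, hcol]
    exact (h.classes o ho).congr fun q hq z => hvec o q _ hq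
  · rw [hcnt]; exact h.cnt_le o ho
  · rw [hK]; exact h.K_le o ho

theorem CutAgree.done {H : SimpleGraph ℕ} {d N w : ℕ} {side : ℕ → ℕ} {u : ℕ} {s s' : St}
    (h : CutAgree u s s') (hd : CutDone H d N w side u s) : CutDone H d N w side u s' :=
  hd.congr h.st h.idx h.K h.rep h.cnt fun o q i _ => h.vec o q i

variable {H : SimpleGraph ℕ} {d w : ℕ} {side : ℕ → ℕ}

/-- The twin classes of both sides come from one pass over the edges. Then one closure for each side
uses the representatives of this side as rows and those of the other side as columns. -/
theorem analyseCut_ends (s : St) {u e : ℕ} (hu : s.v .u = u)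
    (he : s.v .e = e) (hd : s.v .d = d) (hE : EdgeSeq H e (s.a .ea · 0 0 0) (s.a .eb · 0 0 0))
    (hadj : ∀ a b, s.a .adj a b 0 0 = ad H a b)
    (hside : ∀ a, side a ≤ 1) (hins : ∀ a b, H.Adj a b → s.a .ins u a 0 0 = side a)
    (hf : CutFresh u s) (hw : ∀ o ≤ 1, CutBound H side o w) :
    Ends analyseCut s fun s' t =>
      t ≤ e * 20 + 2 * (w ^ (d * Nat.log 2 w) *
        (w * ((w ^ (d * Nat.log 2 w) + 1) * (4 * w + 7) + 4) + 5)) + 14 ∧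
      CutDone H d (w ^ (d * Nat.log 2 w)) w side u s' ∧
      ∀ u', u' ≠ u → CutAgree u' s s' := by
  set N := w ^ (d * Nat.log 2 w) with hN
  rw [analyseCut, ends_seq]
  refine (twins_ends s hu he hE hside hins hf.st hf.dict hf.idx hf.K).mono ?_
  rintro s1 t1 ha1 ⟨ht1, hT, h0, a1, a2, a3, a4, a5⟩
  have hK : ∀ o ≤ 1, s1.a .K u o 0 0 + 1 ≤ w := fun o ho => hT.card_le (hw o ho)
  -- This is where the complexity of the cut bounds the number of classes, and with it the running
  -- time of the closure.
  have hbound : ∀ o ≤ 1, ∀ c v, SumList d (s1.a .K u o 0 0) (s1.a .K u (1 - o) 0 0)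
      (fun l j => ad H (s1.a .rep u o (l + 1) 0) (s1.a .rep u (1 - o) (j + 1) 0)) c v → c ≤ N :=
    fun o ho c v hv => hv.le_pow (hK o ho) fun S hS hirr => hT.irredundant_le (hw o ho) ho hS hirr
  have htime : ∀ o ≤ 1, N * (s1.a .K u o 0 0 *
      ((N + 1) * (4 * s1.a .K u (1 - o) 0 0 + 7) + 4) + 5) + 3 ≤
      N * (w * ((N + 1) * (4 * w + 7) + 4) + 5) + 3 := by
    intro o ho
    have h1 := hK o ho
    have h2 := hK (1 - o) (by omega)
    gcongr <;> omega
  rw [ends_seq, ends_assign, ends_seq, ends_assign, ends_seq]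
  refine (closure_ends (d := d) _ (x := u) (o := 0) (N := N) (L := s1.a .K u 0 0 0)
    (k := s1.a .K u 1 0 0)
    (g := fun l j => ad H (s1.a .rep u 0 (l + 1) 0) (s1.a .rep u 1 (j + 1) 0))
    ?_ ?_ ?_ ?_ ?_ ?_ ?_ (hbound 0 (by omega))).mono ?_
  · simp [ha1.v .u rfl, hu]
  · simp
  · simp [ha1.v .d rfl, hd]
  · simp
  · simp
  · intro l hl j hj
    simp only [St.setV_a, ha1.a .adj rfl, hadj, Nat.sub_zero]
  · intro j hj
    simp only [St.row, St.setV_a, ha1.a .vec rfl, hf.vec]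
  rintro s2 t2 ha2 ⟨ht2, ⟨c0, b1, b2, b3, b4⟩, b5, b6⟩
  have hv2 := ha2.v .tu rfl
  have hd2 := ha2.v .d rfl
  simp only [St.setV_v, reduceCtorEq, if_false, if_true, Ex.eval_var,
    ha1.v .u rfl, ha1.v .d rfl, hu, hd] at hv2 hd2
  have K2 := ha2.a .K rfl
  have R2 := ha2.a .rep rfl
  have A2 := ha2.a .adj rfl
  have I2 := ha2.a .idx rfl
  have S2 := ha2.a .st rfl
  have D2 := ha2.a .dict rfl
  simp only [St.setV_a] at K2 R2 A2 I2 S2 D2 b5 b6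
  rw [ends_seq, ends_assign]
  refine (closure_ends (d := d) _ (x := u) (o := 1) (N := N) (L := s1.a .K u 1 0 0)
    (k := s1.a .K u 0 0 0)
    (g := fun l j => ad H (s1.a .rep u 1 (l + 1) 0) (s1.a .rep u 0 (j + 1) 0))
    ?_ ?_ ?_ ?_ ?_ ?_ ?_ (hbound 1 (by omega))).mono ?_
  · simp [hv2]
  · simp
  · simp [hd2]
  · simp [K2]
  · simp [K2]
  · intro l hl j hj
    simp only [St.setV_a, A2, R2, ha1.a .adj rfl, hadj, Nat.sub_self]
  · intro j hj
    simp only [St.row, St.setV_a]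
    rw [b5 _ _ _ _ (by omega), ha1.a .vec rfl, hf.vec]
  rintro s3 t3 ha3 ⟨ht3, ⟨c1, d1, d2, d3, d4⟩, d5, d6⟩
  have K3 := (ha3.a .K rfl).trans K2
  have R3 := (ha3.a .rep rfl).trans R2
  have I3 := (ha3.a .idx rfl).trans I2
  have S3 := (ha3.a .st rfl).trans S2
  have D3 := (ha3.a .dict rfl).trans D2
  simp only [St.setV_a] at d5 d6
  have hcol : s3.col u = s1.col u := funext fun z => by rw [St.col, St.col, I3, S3]
  -- Slots are written from index 1 on. Index 0, where the vertices without a column are looked up,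
  -- keeps the value 0.
  have hv0 : ∀ o q, s3.a .vec u o q 0 = 0 := fun o q => by
    rw [d5 _ _ _ _ (by omega), b5 _ _ _ _ (by omega), ha1.a .vec rfl, hf.vec]
  have hr0 : ∀ q j, s3.row u 0 q j = s2.row u 0 q j := fun q j => d5 _ _ _ _ (by omega)
  have hc0 : s3.a .cnt u 0 0 0 = c0 := by rw [d6 _ _ _ _ (by omega), b1]
  refine ⟨?_, ⟨?_, ?_, ?_, ?_⟩, ?_⟩
  · have := htime 0 (by omega); have := htime 1 (by omega)
    simp only [Nat.sub_zero, Nat.sub_self] at *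
    omega
  · rw [hcol]; simpa only [K3, R3] using hT
  · intro o ho
    have hF0 : ∀ q z, s3.col u z = 0 → s3.a .vec u o q (s3.col u z) = 0 := fun q z hz => by
      rw [hz, hv0]
    have hF1 : ∀ q z j, s3.col u z = j + 1 → s3.a .vec u o q (s3.col u z) = s3.row u o q j :=
      fun q z j hz => by rw [hz, St.row]
    rw [hcol] at hF0 hF1 ⊢
    rcases (by omega : o = 0 ∨ o = 1) with rfl | rfl
    · rw [hc0]
      refine hT.classes hside ho (v := s3.row u 0) ?_ ?_ hF0 hF1
      · exact b3.congr fun q _ j _ => hr0 q j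
      · simpa only [hr0] using b4
    · rw [d1]
      exact hT.classes hside ho (v := s3.row u 1) d3 d4 hF0 hF1
  · intro o ho
    rcases (by omega : o = 0 ∨ o = 1) with rfl | rfl
    · rw [hc0]; exact b2
    · rw [d1]; exact d2
  · intro o ho; rw [K3]; exact hK o ho
  · intro u' hu'
    refine ⟨fun a => ?_, fun c b => ?_, fun c => ?_, fun o => ?_, fun o j => ?_, fun o q i => ?_,
      fun o => ?_⟩
    · rw [S3]; exact a1 _ _ hu'
    · rw [D3]; exact a2 _ _ _ hu'
    · rw [I3]; exact a3 _ _ hu'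
    · rw [K3]; exact a4 _ _ hu'
    · rw [R3]; exact a5 _ _ _ hu'
    · rw [d5 _ _ _ _ (by tauto), b5 _ _ _ _ (by tauto), ha1.a .vec rfl]
    · rw [d6 _ _ _ _ (by tauto), b6 _ _ _ _ (by tauto), ha1.a .cnt rfl]

theorem analyseCuts_ends (s : St) {sz e : ℕ} {side : ℕ → ℕ → ℕ} (hs : s.v .s = sz)
    (he : s.v .e = e) (hd : s.v .d = d) (hE : EdgeSeq H e (s.a .ea · 0 0 0) (s.a .eb · 0 0 0))
    (hadj : ∀ a b, s.a .adj a b 0 0 = ad H a b)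
    (hside : ∀ u a, side u a ≤ 1)
    (hord : ∀ i < sz, ∀ j < sz, s.a .ord i 0 0 0 = s.a .ord j 0 0 0 → i = j)
    (hins : ∀ i < sz, 1 ≤ i → ∀ a b, H.Adj a b →
      s.a .ins (s.a .ord i 0 0 0) a 0 0 = side (s.a .ord i 0 0 0) a)
    (hf : ∀ u, CutFresh u s)
    (hw : ∀ i < sz, 1 ≤ i → ∀ o ≤ 1, CutBound H (side (s.a .ord i 0 0 0)) o w) :
    Ends analyseCuts s fun s' t =>
      t ≤ (sz - 1) * (e * 20 + 2 * (w ^ (d * Nat.log 2 w) *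
        (w * ((w ^ (d * Nat.log 2 w) + 1) * (4 * w + 7) + 4) + 5)) + 17) + 2 ∧
      ∀ i < sz, 1 ≤ i → CutDone H d (w ^ (d * Nat.log 2 w)) w (side (s.a .ord i 0 0 0))
        (s.a .ord i 0 0 0) s' := by
  set N := w ^ (d * Nat.log 2 w) with hN
  rw [analyseCuts]
  refine (ends_for (fun h s' => (∀ i < h, CutDone H d N w (side (s.a .ord (i + 1) 0 0 0))
      (s.a .ord (i + 1) 0 0 0) s') ∧
      ∀ u, (∀ i < h, s.a .ord (i + 1) 0 0 0 ≠ u) → CutFresh u s') (sz - 1)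
      (e * 20 + 2 * (N * (w * ((N + 1) * (4 * w + 7) + 4) + 5)) + 15) rfl ?_ ?_ ?_).mono ?_
  · intro s' ha
    simp [ha.v .s rfl, hs]
  · refine ⟨by simp, fun u _ => ?_⟩
    have := hf u
    exact ⟨this.st, this.dict, this.idx, this.K, this.vec⟩
  · rintro h s1 hh ha hvh ⟨hD, hF⟩
    rw [ends_seq, ends_assign]
    simp only [Ex.eval_get, Ex.eval_add, Ex.eval_var, Ex.eval_ofNat, Ex.eval_lit, hvh,
      ha.a .ord rfl]
    set u := s.a .ord (h + 1) 0 0 0 with hu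
    have hne : ∀ i < h, s.a .ord (i + 1) 0 0 0 ≠ u := fun i hi heq => by
      have := hord (i + 1) (by omega) (h + 1) (by omega) heq
      omega
    have hfu := hF u hne
    refine (analyseCut_ends (H := H) (d := d) (w := w) (side := side u) (s1.setV .u u) (u := u)
      (e := e) (by simp) (by simp [ha.v .e rfl, he]) (by simp [ha.v .d rfl, hd]) ?_ ?_ (hside u) ?_
      ⟨hfu.st, hfu.dict, hfu.idx, hfu.K, hfu.vec⟩ (hw (h + 1) (by omega) (by omega))).mono ?_
    · simpa [ha.a .ea rfl, ha.a .eb rfl] using hE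
    · simpa [ha.a .adj rfl] using hadj
    · intro a b hab
      rw [St.setV_a, ha.a .ins rfl]
      exact hins (h + 1) (by omega) (by omega) a b hab
    · rintro s2 t2 ha2 ⟨ht, hdone, hagree⟩
      have conv : ∀ u' , u' ≠ u → CutAgree u' s1 (s2.setV .h (h + 1)) := fun u' hu' => by
        have := hagree u' hu'
        exact ⟨this.st, this.dict, this.idx, this.K, this.rep, this.vec, this.cnt⟩
      rw [← hN] at ht hdone
      refine ⟨⟨fun i hi => ?_, fun u' hu' => ?_⟩, by omega⟩
      · rcases Nat.lt_succ_iff_lt_or_eq.mp hi with hi | rfl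
        · exact (conv _ (hne i hi)).done (hD i hi)
        · exact hdone.congr (fun _ => rfl) (fun _ => rfl) (fun _ => rfl) (fun _ _ => rfl)
            (fun _ => rfl) (fun _ _ _ _ => rfl)
      · exact (conv u' (hu' h (by omega)).symm).fresh (hF u' fun i hi => hu' i (by omega))
  · rintro s' t ha ⟨⟨hD, -⟩, ht⟩
    refine ⟨by rw [Nat.add_assoc _ 15 2] at ht; exact ht, fun i hi hi1 => ?_⟩
    have := hD (i - 1) (by omega)
    rwa [Nat.sub_add_cancel hi1] at this

end Mach

namespace Mach

/-! ### Optima -/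

/-- `t` is `0` if `S` is empty, and otherwise the successor of the minimum, respectively of the
maximum if `opt ≠ 0`, of `S`. -/
def OptCode (opt : ℕ) (S : Set ℕ) (t : ℕ) : Prop :=
  (t = 0 ∧ S = ∅) ∨ ∃ x, t = x + 1 ∧ if opt = 0 then IsLeast S x else IsGreatest S x

def relaxed (opt cur val : ℕ) : ℕ :=
  if val = 0 then cur
  else if opt = 0 then (if cur - val + (1 - cur) = 0 then cur else val)
  else (if val - cur = 0 then cur else val)

theorem OptCode.zero (opt : ℕ) : OptCode opt ∅ 0 := Or.inl ⟨rfl, rfl⟩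

theorem OptCode.congr {opt t : ℕ} {S S' : Set ℕ} (h : OptCode opt S t)
    (hS : ∀ x, x ∈ S' ↔ x ∈ S) : OptCode opt S' t := by
  rwa [Set.ext hS]

/-- The added set is empty if `val = 0` and a singleton otherwise, so one comparison updates the
optimum. -/
theorem OptCode.relaxed {opt t : ℕ} {S : Set ℕ} (h : OptCode opt S t) (val : ℕ) :
    OptCode opt (S ∪ {x | val = x + 1}) (relaxed opt t val) := by
  unfold Mach.relaxed
  rcases val with _ | y
  · simpa using h
  have hset : {x | y + 1 = x + 1} = ({y} : Set ℕ) := by ext x; simp [eq_comm]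
  rw [if_neg (Nat.succ_ne_zero y), hset]
  rcases h with ⟨rfl, rfl⟩ | ⟨x, rfl, h⟩
  · refine Or.inr ⟨y, by split_ifs <;> omega, ?_⟩
    split_ifs <;> simp
  · by_cases ho : opt = 0
    · rw [if_pos ho] at h ⊢
      by_cases hxy : x ≤ y
      · refine Or.inr ⟨x, by rw [if_pos (by omega)], ?_⟩
        rw [if_pos ho]
        refine ⟨Or.inl h.1, ?_⟩
        rintro z (hz | rfl)
        exacts [h.2 hz, hxy]
      · refine Or.inr ⟨y, by rw [if_neg (by omega)], ?_⟩
        rw [if_pos ho]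
        refine ⟨Or.inr rfl, ?_⟩
        rintro z (hz | rfl)
        · have := h.2 hz; omega
        · exact le_rfl
    · rw [if_neg ho] at h ⊢
      by_cases hxy : y ≤ x
      · refine Or.inr ⟨x, by rw [if_pos (by omega)], ?_⟩
        rw [if_neg ho]
        refine ⟨Or.inl h.1, ?_⟩
        rintro z (hz | rfl)
        exacts [h.2 hz, hxy]
      · refine Or.inr ⟨y, by rw [if_neg (by omega)], ?_⟩
        rw [if_neg ho]
        refine ⟨Or.inr rfl, ?_⟩
        rintro z (hz | rfl)
        · have := h.2 hz; omega
        · exact le_rfl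

/-- An optimum of the optima is an optimum of the union. Empty members drop out because their code 0
is no successor. -/
theorem OptCode.iUnion {opt t : ℕ} {ι : Type*} {P : ι → Prop} {code : ι → ℕ} {S : ι → Set ℕ}
    (h : OptCode opt {x | ∃ i, P i ∧ code i = x + 1} t) (hS : ∀ i, P i → OptCode opt (S i) (code i)) :
    OptCode opt {x | ∃ i, P i ∧ x ∈ S i} t := by
  have hmem : ∀ i x, P i → code i = x + 1 → x ∈ S i := by
    intro i x hi hx
    rcases hS i hi with ⟨h0, -⟩ | ⟨y, hy, h⟩
    · omega
    · obtain rfl : x = y := by omega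
      split_ifs at h <;> exact h.1
  rcases h with ⟨rfl, h⟩ | ⟨x, rfl, h⟩
  · refine Or.inl ⟨rfl, Set.eq_empty_of_forall_notMem ?_⟩
    rintro x ⟨i, hi, hx⟩
    rcases hS i hi with ⟨h0, he⟩ | ⟨y, hy, -⟩
    · rw [he] at hx; exact hx
    · exact Set.notMem_empty y (h ▸ ⟨i, hi, hy⟩)
  · refine Or.inr ⟨x, rfl, ?_⟩
    split_ifs at h ⊢ with ho
    · obtain ⟨⟨i, hi, hx⟩, hl⟩ := h
      refine ⟨⟨i, hi, hmem i x hi hx⟩, ?_⟩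
      rintro z ⟨j, hj, hz⟩
      rcases hS j hj with ⟨h0, he⟩ | ⟨y, hy, h⟩
      · rw [he] at hz; exact absurd hz (Set.notMem_empty z)
      · rw [if_pos ho] at h
        exact (hl ⟨j, hj, hy⟩).trans (h.2 hz)
    · obtain ⟨⟨i, hi, hx⟩, hl⟩ := h
      refine ⟨⟨i, hi, hmem i x hi hx⟩, ?_⟩
      rintro z ⟨j, hj, hz⟩
      rcases hS j hj with ⟨h0, he⟩ | ⟨y, hy, h⟩
      · rw [he] at hz; exact absurd hz (Set.notMem_empty z)
      · rw [if_neg ho] at h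
        exact (h.2 hz).trans (hl ⟨j, hj, hy⟩)

def sumCode (n x y : ℕ) : ℕ := if x * y = 0 then 0 else min ((x - 1) + (y - 1)) n + 1

/-- Minima and maxima are compatible with sums of sets. By `hn` the cap has no effect. -/
theorem OptCode.sumCode {opt n t t' : ℕ} {S S' : Set ℕ} (h : OptCode opt S t)
    (h' : OptCode opt S' t') (hn : ∀ x ∈ S, ∀ y ∈ S', x + y ≤ n) :
    OptCode opt {z | ∃ x ∈ S, ∃ y ∈ S', z = x + y} (sumCode n t t') := by
  unfold Mach.sumCode
  rcases h with ⟨rfl, rfl⟩ | ⟨x, rfl, h⟩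
  · exact Or.inl ⟨by simp, by simp⟩
  rcases h' with ⟨rfl, rfl⟩ | ⟨y, rfl, h'⟩
  · exact Or.inl ⟨by simp, by simp⟩
  have hx : x ∈ S := by split_ifs at h <;> exact h.1
  have hy : y ∈ S' := by split_ifs at h' <;> exact h'.1
  have hxy := hn x hx y hy
  refine Or.inr ⟨x + y, ?_, ?_⟩
  · rw [if_neg (by positivity)]
    congr 1
    rw [Nat.add_sub_cancel, Nat.add_sub_cancel]
    exact min_eq_left hxy
  · split_ifs at h h' ⊢
    · refine ⟨⟨x, hx, y, hy, rfl⟩, ?_⟩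
      rintro z ⟨a, ha, b, hb, rfl⟩
      exact Nat.add_le_add (h.2 ha) (h'.2 hb)
    · refine ⟨⟨x, hx, y, hy, rfl⟩, ?_⟩
      rintro z ⟨a, ha, b, hb, rfl⟩
      exact Nat.add_le_add (h.2 ha) (h'.2 hb)

/-- The indices are evaluated after `cur` has been overwritten, so they must not depend on it. -/
theorem relax_ends (s : St) (A : Arr) (i j k l : Ex) {i' j' k' l' opt val : ℕ}
    (ho : s.v .opt = opt) (hv : s.v .val = val)
    (hi : ∀ e, i.eval (s.setV .cur e) = i') (hj : ∀ e, j.eval (s.setV .cur e) = j')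
    (hk : ∀ e, k.eval (s.setV .cur e) = k') (hl : ∀ e, l.eval (s.setV .cur e) = l')
    (h0 : (Ex.get A i j k l).eval s = s.a A i' j' k' l') :
    Ends (relax A i j k l) s fun s' t => t ≤ 5 ∧
      s'.a A i' j' k' l' = relaxed opt (s.a A i' j' k' l') val ∧
      ∀ x y z w, ¬ (x = i' ∧ y = j' ∧ z = k' ∧ w = l') → s'.a A x y z w = s.a A x y z w := by
  rw [relax, ends_seq, ends_assign, ends_ite]
  simp only [ends_ite, ends_skip, ends_store, hi, hj, hk, hl, h0, Ex.eval_var, Ex.eval_sub,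
    Ex.eval_add, Ex.eval_ofNat, St.setV_v, St.setV_a, reduceCtorEq, if_false, if_true, ho, hv,
    relaxed]
  have hset : ∀ x y z w, ¬ (x = i' ∧ y = j' ∧ z = k' ∧ w = l') → ∀ e, (s.setV .cur e).a A x y z w =
    s.a A x y z w := fun _ _ _ _ _ _ => rfl
  split_ifs <;> refine ⟨by norm_num, ?_, ?_⟩ <;> simp <;> try (intros; simp_all)

/-! ### Searching for classes at an analysed cut, and sums of classes -/

variable {H : SimpleGraph ℕ} {d N w : ℕ} {side : ℕ → ℕ → ℕ}

/-- Every vertex across the cut either has a column, which the rows cover, or has no neighbours on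
this side and is counted 0 by all classes. -/
theorem CutDone.eq_of_rows {s : St} {u o c : ℕ} {sd : ℕ → ℕ} (h : CutDone H d N w sd u s)
    (hside : ∀ a, sd a ≤ 1) (ho : o ≤ 1) (hc : s.a .cnt u o 0 0 = c) {q q' : ℕ}
    (hq : q < c) (hq' : q' < c)
    (he : ∀ j < s.a .K u (1 - o) 0 0, s.row u o q j = s.row u o q' j) {z : ℕ} (hz : sd z ≠ o) :
    s.a .vec u o q (s.col u z) = s.a .vec u o q' (s.col u z) := by
  subst hc
  have hsz : sd z = 1 - o := by have := hside z; omega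
  rcases hj : s.col u z with _ | j
  · have key : ∀ q < s.a .cnt u o 0 0, s.a .vec u o q (s.col u z) = 0 := by
      intro q hq
      obtain ⟨M, hM, hF⟩ := (h.classes o ho).sound q hq
      rw [hF z hz]
      have : (M.map (ad H z)).sum = 0 := by
        rw [Multiset.sum_eq_zero_iff]
        intro x hx
        obtain ⟨a, ha, rfl⟩ := Multiset.mem_map.mp hx
        exact h.twins.ad_eq_zero hj (by rw [hM a ha]; exact hz.symm)
      rw [this, Nat.min_zero]
    have h1 := key q hq
    have h2 := key q' hq'
    rw [hj] at h1 h2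
    rw [h1, h2]
  · have := (h.twins.rep_col z (by omega)).1
    rw [hsz, hj] at this
    exact he j this

/-- The search for the class of a multiset of vertices is successful. -/
theorem CutDone.findClass_ends (s : St) {u o : ℕ} {sd : ℕ → ℕ} (h : CutDone H d N w sd u s)
    (hside : ∀ a, sd a ≤ 1) (ho : o ≤ 1) (hu : s.v .tu = u) (hto : s.v .to = o) (e : Ex)
    (f : ℕ → ℕ) (M : Multiset ℕ) (hM : ∀ a ∈ M, sd a = o)
    (hf : ∀ z, sd z ≠ o → f z = min d (M.map (ad H z)).sum)
    (he : ∀ s' z, sd z ≠ o → (∀ y, y ≠ .t → y ≠ .x → s'.v y = s.v y) → s'.v .x = z →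
      (∀ A, A ≠ .vec → s'.a A = s.a A) →
      (∀ x' o' q i, ¬ (x' = u ∧ o' = o ∧ q = s.a .cnt u o 0 0) →
        s'.a .vec x' o' q i = s.a .vec x' o' q i) → e.eval s' = f z) :
    Ends (findClass e) s fun s' t => t ≤ (N + 1) * (4 * w + 7) ∧
      s'.v .res < s.a .cnt u o 0 0 ∧
      (∀ z, sd z ≠ o → s.a .vec u o (s'.v .res) (s.col u z) = f z) ∧
      (∀ x' o' q i, ¬ (x' = u ∧ o' = o ∧ q = s.a .cnt u o 0 0 ∧ i ≠ 0) →
        s'.a .vec x' o' q i = s.a .vec x' o' q i) := by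
  obtain ⟨q, hq, hF⟩ := (h.classes o ho).complete M hM
  have hT := h.twins
  have hrep : ∀ j < s.a .K u (1 - o) 0 0, sd (s.a .rep u (1 - o) (j + 1) 0) = 1 - o ∧
    s.col u (s.a .rep u (1 - o) (j + 1) 0) = j + 1 := fun j hj =>
      hT.col_rep (1 - o) (j + 1) (by omega) hj
  have hrow : ∀ j < s.a .K u (1 - o) 0 0, s.row u o q j = f (s.a .rep u (1 - o) (j + 1) 0) := by
    intro j hj
    obtain ⟨h1, h2⟩ := hrep j hj
    have := hF _ (by rw [h1]; omega)
    rw [h2] at this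
    rw [St.row, this, hf _ (by rw [h1]; omega)]
  refine (Mach.findClass_ends e (fun j => f (s.a .rep u (1 - o) (j + 1) 0)) s hu hto rfl rfl
    ?_).mono ?_
  · intro s' j hj hv ht hx hA hvec
    exact he s' _ (by rw [(hrep j hj).1]; omega) hv hx hA hvec
  · rintro s' t ha ⟨ht, h1, h2, h3⟩
    have hcN := h.cnt_le o ho
    have hKw := h.K_le (1 - o) (by omega)
    -- The list of classes is complete, so it contains the class `q` of `M`, and an unsuccessful
    -- search would contradict this.
    rcases h3 with ⟨-, h3⟩ | ⟨h3, h4⟩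
    · obtain ⟨j, hj, hne⟩ := h3 q hq
      exact absurd (hrow j hj) hne
    · refine ⟨ht.trans (Nat.mul_le_mul (by omega) (by omega)), h3, fun z hz => ?_, h2⟩
      rw [h.eq_of_rows hside ho rfl h3 hq (fun j hj => by rw [h4 j hj, hrow j hj]) hz]
      exact (hF z hz).trans (hf z hz).symm

/-- The data of the cuts in the set `U` of nodes. -/
def AllDone (H : SimpleGraph ℕ) (d N w : ℕ) (side : ℕ → ℕ → ℕ) (U : Set ℕ) (s : St) : Prop :=
  ∀ u ∈ U, CutDone H d N w (side u) u s

/-- The classes as functions on the vertices. -/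
def St.cls (s : St) (u o q z : ℕ) : ℕ := s.a .vec u o q (s.col u z)

/-- The states contain the same data about the cuts, except for the slots for candidates. -/
structure SameCuts (s s' : St) : Prop where
  st : s'.a .st = s.a .st
  idx : s'.a .idx = s.a .idx
  K : s'.a .K = s.a .K
  rep : s'.a .rep = s.a .rep
  cnt : s'.a .cnt = s.a .cnt
  vec : ∀ u o q i, q ≠ s.a .cnt u o 0 0 → s'.a .vec u o q i = s.a .vec u o q i

theorem SameCuts.trans {s s' s'' : St} (h : SameCuts s s') (h' : SameCuts s' s'') :
    SameCuts s s'' :=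
  ⟨h'.st.trans h.st, h'.idx.trans h.idx, h'.K.trans h.K, h'.rep.trans h.rep, h'.cnt.trans h.cnt,
    fun u o q i hq => (h'.vec u o q i (by rwa [h.cnt])).trans (h.vec u o q i hq)⟩

theorem SameCuts.col {s s' : St} (h : SameCuts s s') : s'.col = s.col := by
  funext u z; rw [St.col, St.col, h.st, h.idx]

theorem SameCuts.cls {s s' : St} (h : SameCuts s s') {u o q z : ℕ} (hq : q ≠ s.a .cnt u o 0 0) :
    s'.cls u o q z = s.cls u o q z := by
  rw [St.cls, St.cls, h.col, h.vec _ _ _ _ hq]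

theorem SameCuts.allDone {s s' : St} (h : SameCuts s s') {U : Set ℕ}
    (hd : AllDone H d N w side U s) : AllDone H d N w side U s' := fun u hu =>
  (hd u hu).congr (fun _ => by rw [h.st]) (fun _ => by rw [h.idx]) (fun _ => by rw [h.K])
    (fun _ _ => by rw [h.rep]) (fun _ => by rw [h.cnt]) fun o q i hq => h.vec u o q i hq.ne

/-- By `hpart`, the target side is the union of the two source sides. The sum of multisets for the
two source classes lies on it, so the list of classes of the target contains the capped sum of the
two functions. -/
theorem join_ends (s : St) {U : Set ℕ} (hD : AllDone H d N w side U s) (hd : s.v .d = d)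
    (hside : ∀ u a, side u a ≤ 1) {iu io ju jo tu ti jn : ℕ} (hiU : iu ∈ U) (hjU : ju ∈ U)
    (htU : tu ∈ U) (hio : io ≤ 1) (hjo : jo ≤ 1) (hto : ti ≤ 1)
    (e1 : s.v .iu = iu) (e2 : s.v .io = io) (e3 : s.v .ju = ju) (e4 : s.v .jo = jo)
    (e5 : s.v .tu = tu) (e6 : s.v .to = ti) (e7 : s.v .jn = jn)
    (hit : iu ≠ tu) (hjt : ju ≠ tu ∨ jo ≠ ti)
    (hpart : ∀ z, side tu z = ti ↔ side iu z = io ∨ side ju z = jo) :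
    Ends join s fun s' t => t ≤ N * (N * ((N + 1) * (4 * w + 7) + 3) + 4) + 2 ∧ SameCuts s s' ∧
      (∀ q1 < s.a .cnt iu io 0 0, ∀ q2 < s.a .cnt ju jo 0 0,
        s'.a .J jn q1 q2 0 < s.a .cnt tu ti 0 0 ∧ ∀ z, side tu z ≠ ti →
          s.cls tu ti (s'.a .J jn q1 q2 0) z = min d (s.cls iu io q1 z + s.cls ju jo q2 z)) ∧
      ∀ j q1 q2, j ≠ jn → s'.a .J j q1 q2 0 = s.a .J j q1 q2 0 := by
  set c1 := s.a .cnt iu io 0 0 with hc1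
  set c2 := s.a .cnt ju jo 0 0 with hc2
  have hc1N : c1 ≤ N := (hD iu hiU).cnt_le io hio
  have hc2N : c2 ≤ N := (hD ju hjU).cnt_le jo hjo
  let P : ℕ → ℕ → St → Prop := fun q1 q2 s' => s'.a .J jn q1 q2 0 < s.a .cnt tu ti 0 0 ∧
    ∀ z, side tu z ≠ ti →
      s.cls tu ti (s'.a .J jn q1 q2 0) z = min d (s.cls iu io q1 z + s.cls ju jo q2 z)
  rw [join]
  refine (ends_for (fun i s' => SameCuts s s' ∧ (∀ q1 < i, ∀ q2 < c2, P q1 q2 s') ∧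
      ∀ j q1 q2, j ≠ jn → s'.a .J j q1 q2 0 = s.a .J j q1 q2 0)
    c1 (c2 * ((N + 1) * (4 * w + 7) + 3) + 2) rfl ?_ ?_ ?_).mono ?_
  · intro s' ha
    simp [ha.v .iu rfl, ha.v .io rfl, ha.a .cnt rfl, e1, e2, hc1]
  · exact ⟨⟨rfl, rfl, rfl, rfl, rfl, fun _ _ _ _ _ => rfl⟩, by simp, by simp⟩
  · rintro i s1 hi ha hq1 ⟨hS1, hP1, hJ1⟩
    refine (ends_for (fun j s' => SameCuts s s' ∧
        (∀ q1 q2, (q1 < i ∧ q2 < c2 ∨ q1 = i ∧ q2 < j) → P q1 q2 s') ∧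
        ∀ j q1 q2, j ≠ jn → s'.a .J j q1 q2 0 = s.a .J j q1 q2 0)
      c2 ((N + 1) * (4 * w + 7) + 1) rfl ?_ ?_ ?_).mono ?_
    · intro s' ha'
      simp [ha'.v .ju rfl, ha'.v .jo rfl, ha'.a .cnt rfl, ha.v .ju rfl, ha.v .jo rfl,
        ha.a .cnt rfl, e3, e4, hc2]
    · refine ⟨⟨hS1.st, hS1.idx, hS1.K, hS1.rep, hS1.cnt, hS1.vec⟩, ?_, hJ1⟩
      rintro q1 q2 (⟨h1, h2⟩ | ⟨_, h2⟩)
      · exact hP1 q1 h1 q2 h2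
      · omega
    · rintro j s2 hj ha' hq2 ⟨hS2, hP2, hJ2⟩
      have f1 := (ha'.v .iu rfl).trans ((ha.v .iu rfl).trans e1)
      have f2 := (ha'.v .io rfl).trans ((ha.v .io rfl).trans e2)
      have f3 := (ha'.v .ju rfl).trans ((ha.v .ju rfl).trans e3)
      have f4 := (ha'.v .jo rfl).trans ((ha.v .jo rfl).trans e4)
      have f5 := (ha'.v .tu rfl).trans ((ha.v .tu rfl).trans e5)
      have f6 := (ha'.v .to rfl).trans ((ha.v .to rfl).trans e6)
      have f7 := (ha'.v .jn rfl).trans ((ha.v .jn rfl).trans e7)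
      have f8 := (ha'.v .d rfl).trans ((ha.v .d rfl).trans hd)
      have f9 := (ha'.v .q1 rfl).trans hq1
      have hD2 := hS2.allDone hD
      have ei : s2.a .cnt iu io 0 0 = c1 := by rw [hS2.cnt]
      have ej : s2.a .cnt ju jo 0 0 = c2 := by rw [hS2.cnt]
      have et : s2.a .cnt tu ti 0 0 = s.a .cnt tu ti 0 0 := by rw [hS2.cnt]
      obtain ⟨M1, hM1, hF1⟩ := ((hD2 iu hiU).classes io hio).sound i (by rw [ei]; exact hi)
      obtain ⟨M2, hM2, hF2⟩ := ((hD2 ju hjU).classes jo hjo).sound j (by rw [ej]; exact hj)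
      rw [ends_seq]
      refine (CutDone.findClass_ends s2 (hD2 tu htU) (hside tu) hto f5 f6 _
        (fun z => min d (s2.cls iu io i z + s2.cls ju jo j z)) (M1 + M2) ?_ ?_ ?_).mono ?_
      · intro a ha
        rcases Multiset.mem_add.mp ha with h | h
        · exact (hpart a).mpr (Or.inl (hM1 a h))
        · exact (hpart a).mpr (Or.inr (hM2 a h))
      · intro z hz
        rw [ne_eq, hpart, not_or] at hz
        have h1 := hF1 z hz.1
        have h2 := hF2 z hz.2
        simp only [St.cls]
        rw [h1, h2, Multiset.map_add, Multiset.sum_add]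
        omega
      · intro s3 z hz hv hx hA hvec
        simp only [columnOf, Ex.eval_cap, Ex.eval_add, Ex.eval_get, Ex.eval_var, Ex.eval_lit,
          hv .iu (by decide) (by decide), hv .io (by decide) (by decide),
          hv .ju (by decide) (by decide), hv .jo (by decide) (by decide),
          hv .q1 (by decide) (by decide), hv .q2 (by decide) (by decide),
          hv .d (by decide) (by decide), hx, hA .idx (by decide), hA .st (by decide),
          f1, f2, f3, f4, f8, f9, hq2]
        -- The slot being written belongs to the target, and by `hit` and `hjt` neither source reads
        -- from it.
        rw [hvec _ _ _ _ (by rintro ⟨h, -⟩; exact hit h),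
          hvec _ _ _ _ (by rintro ⟨h, h', -⟩; rcases hjt with h1 | h1; exacts [h1 h, h1 h'])]
        exact min_comm _ _
      · rintro s3 t3 ha3 ⟨ht3, hres, hcls, hvec⟩
        have hS3 : SameCuts s2 s3 := ⟨ha3.a .st rfl, ha3.a .idx rfl, ha3.a .K rfl, ha3.a .rep rfl,
          ha3.a .cnt rfl, fun u o q i hq => hvec u o q i (by
            rintro ⟨rfl, rfl, rfl, -⟩; exact hq rfl)⟩
        have hS := hS2.trans hS3
        have g1 := (ha3.v .jn rfl).trans f7
        have g2 := (ha3.v .q1 rfl).trans f9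
        have g3 := (ha3.v .q2 rfl).trans hq2
        rw [ends_store]
        simp only [Ex.eval_var, Ex.eval_lit, g1, g2, g3]
        refine ⟨⟨⟨hS.st, hS.idx, hS.K, hS.rep, hS.cnt, hS.vec⟩, ?_, ?_⟩, by omega⟩
        · intro q1 q2 hq
          by_cases hcase : q1 = i ∧ q2 = j
          · obtain ⟨rfl, rfl⟩ := hcase
            simp only [P, St.setV_a, St.setA_a, and_self, if_true]
            rw [et] at hres
            refine ⟨hres, fun z hz => ?_⟩
            have h1 := hcls z hz
            rw [← hS2.cls (by omega : s3.v .res ≠ s.a .cnt tu ti 0 0),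
              ← hS2.cls (show q1 ≠ s.a .cnt iu io 0 0 by omega),
              ← hS2.cls (show q2 ≠ s.a .cnt ju jo 0 0 by omega)]
            exact h1
          · have h1 := hP2 q1 q2 (by omega)
            simp only [P, St.setV_a, St.setA_a] at h1 ⊢
            rw [if_neg (by tauto), ha3.a .J rfl]
            exact h1
        · intro j' q1 q2 hj'
          simp only [St.setV_a, St.setA_a]
          rw [if_neg (by tauto), ha3.a .J rfl]
          exact hJ2 j' q1 q2 hj'
    · rintro s2 t2 ha2 ⟨⟨hS2, hP2, hJ2⟩, ht2⟩
      refine ⟨⟨⟨hS2.st, hS2.idx, hS2.K, hS2.rep, hS2.cnt, hS2.vec⟩, ?_, hJ2⟩, ?_⟩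
      · intro q1 hq1' q2 hq2'
        exact hP2 q1 q2 (by omega)
      · rw [Nat.add_assoc _ 1 2] at ht2; exact ht2
  · rintro s' t ha ⟨⟨hS, hP, hJ⟩, ht⟩
    refine ⟨ht.trans ?_, hS, hP, hJ⟩
    rw [Nat.add_assoc _ 2 2]
    gcongr

end Mach

/-! ### Table entries of leaves and of inner nodes -/

namespace Mach

variable {H : SimpleGraph ℕ} {d N w : ℕ}

/-- The only sets to consider are the empty set, of class 0, and `{v}`, whose class is `res`. The
vertex `v` is admissible or not according to how often the outside class counts it. -/
theorem leafTable_ends (s : St) {u o v opt : ℕ} {sd : ℕ → ℕ} (hD : CutDone H d N w sd u s)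
    (hside : ∀ a, sd a ≤ 1) (ho : o ≤ 1) (hd : 1 ≤ d) (hu : s.v .tu = u) (hto : s.v .to = o)
    (hv : s.v .v = v) (hopt : s.v .opt = opt) (hvo : sd v = o)
    (hadj : ∀ b, s.a .adj v b 0 0 = ad H v b) (hsig : ∀ k, s.a .sig 0 k 0 0 ≤ 1)
    (hfresh : ∀ x q, s.a .tab u o x q = 0) :
    Ends leafTable s fun s' t => t ≤ (N + 1) * (4 * w + 7) + N * 17 + 2 ∧ SameCuts s s' ∧
      (∀ x y q q', ¬ (x = u ∧ y = o) → s'.a .tab x y q q' = s.a .tab x y q q') ∧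
      ∃ res < s.a .cnt u o 0 0, (∀ z, sd z ≠ o → s.cls u o res z = ad H v z) ∧
        ∀ x, ∀ q < s.a .cnt u (1 - o) 0 0, OptCode opt
          {y | (y = 0 ∧ x = 0 ∧ s.a .sig 0 (s.cls u (1 - o) q v) 0 0 ≠ 0) ∨
            (y = 1 ∧ x = res ∧ s.a .sig 1 (s.cls u (1 - o) q v) 0 0 ≠ 0)} (s'.a .tab u o x q) := by
  have had : ∀ z, ad H v z ≤ 1 := fun z => by unfold ad; split_ifs <;> omega
  rw [leafTable, ends_seq]
  refine (hD.findClass_ends s hside ho hu hto _ (ad H v) {v} ?_ ?_ ?_).mono ?_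
  · simpa using hvo
  · intro z _
    have := had z
    rw [Multiset.map_singleton, Multiset.sum_singleton, ad_comm H z v]; omega
  · intro s' z _ hv' hx hA _
    simp only [Ex.eval_get, Ex.eval_var, Ex.eval_lit, hv' .v (by decide) (by decide), hx,
      hA .adj (by decide), hv, hadj]
  rintro s1 t1 ha1 ⟨ht1, hres, hcls, hvec⟩
  have hS1 : SameCuts s s1 := ⟨ha1.a .st rfl, ha1.a .idx rfl, ha1.a .K rfl, ha1.a .rep rfl,
    ha1.a .cnt rfl, fun u o q i hq => hvec u o q i (by rintro ⟨rfl, rfl, rfl, -⟩; exact hq rfl)⟩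
  set res := s1.v .res with hresd
  have hcN : s.a .cnt u (1 - o) 0 0 ≤ N := hD.cnt_le _ (by omega)
  let T : ℕ → ℕ → Set ℕ := fun x q =>
    {y | (y = 0 ∧ x = 0 ∧ s.a .sig 0 (s.cls u (1 - o) q v) 0 0 ≠ 0) ∨
            (y = 1 ∧ x = res ∧ s.a .sig 1 (s.cls u (1 - o) q v) 0 0 ≠ 0)}
  refine (ends_for (fun i s' =>
      (∀ x y q q', ¬ (x = u ∧ y = o) → s'.a .tab x y q q' = s.a .tab x y q q') ∧
      (∀ x, ∀ q < i, OptCode opt (T x q) (s'.a .tab u o x q)) ∧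
      ∀ x q, i ≤ q → s'.a .tab u o x q = 0) (s.a .cnt u (1 - o) 0 0) 15 rfl ?_ ?_ ?_).mono ?_
  · intro s' ha
    simp [ha.v .tu rfl, ha.v .to rfl, ha.a .cnt rfl, ha1.v .tu rfl, ha1.v .to rfl, ha1.a .cnt rfl,
      hu, hto]
  · refine ⟨fun _ _ _ _ _ => ?_, by simp, fun x q _ => ?_⟩
    · rw [St.setV_a, ha1.a .tab rfl]
    · rw [St.setV_a, ha1.a .tab rfl]; exact hfresh x q
  · rintro q s2 hq ha2 hq2 ⟨hI1, hI2, hI3⟩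
    have f1 := (ha2.v .tu rfl).trans ((ha1.v .tu rfl).trans hu)
    have f2 := (ha2.v .to rfl).trans ((ha1.v .to rfl).trans hto)
    have f3 := (ha2.v .v rfl).trans ((ha1.v .v rfl).trans hv)
    have f4 := (ha2.v .opt rfl).trans ((ha1.v .opt rfl).trans hopt)
    have f5 : s2.v .res = res := ha2.v .res rfl
    have g1 := (ha2.a .sig rfl).trans (ha1.a .sig rfl)
    have g2 : s2.a .vec u (1 - o) q (s2.a .idx u (s2.a .st u v 0 0) 0 0) = s.cls u (1 - o) q v := by
      rw [ha2.a .vec rfl, ha2.a .idx rfl, ha2.a .st rfl]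
      exact hS1.cls hq.ne
    set k0 := s.cls u (1 - o) q v with hk0
    rw [ends_seq, ends_assign, ends_seq, ends_assign, ends_seq]
    simp only [columnOf, Ex.eval_get, Ex.eval_var, Ex.eval_lit, Ex.eval_sub, Ex.eval_ofNat, f1, f2,
      f3, hq2, g2, St.setV_v, St.setV_a, if_true, g1]
    refine (relax_ends _ .tab (.var .tu) (.var .to) 0 (.var .q) (i' := u) (j' := o) (k' := 0)
      (l' := q) (opt := opt) ?_ rfl ?_ ?_ ?_ ?_ ?_).mono ?_
    · simp [f4]
    · intro e; simp [f1]
    · intro e; simp [f2]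
    · intro e; simp
    · intro e; simp [hq2]
    · simp [f1, f2, hq2]
    rintro s3 t3 ha3 ⟨ht3, hu3, hn3⟩
    have hsig3 := ha3.a .sig rfl
    simp only [St.setV_a, St.setV_v, if_true] at hu3 hn3 hsig3
    have hk3 : s3.v .k0 = k0 := (ha3.v .k0 rfl).trans (by simp)
    have hv3 : ∀ x : Var, x ≠ .k0 → x ≠ .val → x ≠ .cur → s3.v x = s2.v x := by
      intro x h1 h2 h3
      rw [ha3.v x (by cases x <;> first | rfl | simp at h3)]
      simp [h1, h2]
    have h4 : Ends (.ite (.get2 .sig 1 (.var .k0)) (.assign .val 2) (.assign .val 0)) s3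
        fun s4 t => t = 2 ∧
          s4 = s3.setV .val (if s.a .sig 1 k0 0 0 = 0 then 0 else 2) := by
      rw [ends_ite]
      simp only [ends_assign, Ex.eval_get, Ex.eval_var, Ex.eval_lit, Ex.eval_ofNat, hk3, hsig3, g1]
      split_ifs <;> simp
    rw [ends_seq]
    refine h4.mono ?_
    rintro s4 t4 - ⟨rfl, rfl⟩
    refine (relax_ends _ .tab (.var .tu) (.var .to) (.var .res) (.var .q) (i' := u) (j' := o)
      (k' := res) (l' := q) (opt := opt) ?_ rfl ?_ ?_ ?_ ?_ ?_).mono ?_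
    · rw [St.setV_v, if_neg (by decide), hv3 _ (by decide) (by decide) (by decide), f4]
    · intro e; simp [hv3 .tu (by decide) (by decide) (by decide), f1]
    · intro e; simp [hv3 .to (by decide) (by decide) (by decide), f2]
    · intro e; simp [hv3 .res (by decide) (by decide) (by decide), f5]
    · intro e; simp [hv3 .q (by decide) (by decide) (by decide), hq2]
    · simp [hv3 .q (by decide) (by decide) (by decide), hv3 .tu (by decide) (by decide) (by decide),
        hv3 .to (by decide) (by decide) (by decide), hv3 .res (by decide) (by decide) (by decide),
        f1, f2, f5, hq2]
    rintro s5 t5 ha5 ⟨ht5, hu5, hn5⟩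
    simp only [St.setV_a, St.setV_v, if_true] at hu5 hn5 ⊢
    refine ⟨⟨?_, ?_, ?_⟩, by omega⟩
    · intro x y q1 q2 hxy
      rw [hn5 _ _ _ _ (by tauto), hn3 _ _ _ _ (by tauto), hI1 _ _ _ _ hxy]
    · intro x q' hq'
      by_cases hqq : q' = q
      swap
      · rw [hn5 _ _ _ _ (by tauto), hn3 _ _ _ _ (by tauto)]
        exact hI2 x q' (by omega)
      subst hqq
      have h0 : OptCode opt ∅ (s2.a .tab u o x q') := by
        rw [hI3 x q' le_rfl]; exact OptCode.zero opt
      have h1 : OptCode opt {y | y = 0 ∧ x = 0 ∧ s.a .sig 0 k0 0 0 ≠ 0}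
          (s3.a .tab u o x q') := by
        by_cases hx : x = 0
        · subst hx
          rw [hu3]
          refine (h0.relaxed _).congr fun y => ?_
          have := hsig k0
          simp only [Set.mem_ofPred_eq, Set.empty_union, true_and]
          omega
        · rw [hn3 _ _ _ _ (by tauto)]
          refine h0.congr fun y => ?_
          simp [hx]
      -- If `v` has no neighbour across the cut, then `res` is 0 and both sets compete for the same
      -- entry.
      by_cases hx : x = res
      · subst hx
        rw [hu5]
        refine (h1.relaxed _).congr fun y => ?_
        simp only [T, Set.mem_ofPred_eq, Set.mem_union, true_and, ← hk0]
        refine or_congr Iff.rfl ?_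
        split_ifs with h
        · simp [h]
        · simp only [h, ne_eq, not_false_eq_true, and_true]; omega
      · rw [hn5 _ _ _ _ (by tauto)]
        refine h1.congr fun y => ?_
        simp [T, hx, ← hk0]
    · intro x q' hq'
      rw [hn5 u o x q' (by omega), hn3 u o x q' (by omega)]
      exact hI3 x q' (by omega)
  · rintro s2 t2 ha2 ⟨⟨hI1, hI2, -⟩, ht2⟩
    have hle : s.a .cnt u (1 - o) 0 0 * (15 + 2) ≤ N * 17 := by gcongr
    refine ⟨by omega, hS1.trans ⟨ha2.a .st rfl, ha2.a .idx rfl, ha2.a .K rfl, ha2.a .rep rfl,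
      ha2.a .cnt rfl, fun _ _ _ _ _ => by rw [ha2.a .vec rfl]⟩, hI1, res, hres, hcls, hI2⟩

theorem addSizes_ends (s : St) : Ends addSizes s fun s' t => t ≤ 2 ∧
    s' = s.setV .val (sumCode (s.v .n) (s.v .x) (s.v .y)) := by
  rw [addSizes, ends_ite]
  simp only [ends_assign, Ex.eval_mul, Ex.eval_var, Ex.eval_add, Ex.eval_cap, Ex.eval_sub,
    Ex.eval_ofNat, sumCode]
  split_ifs <;> simp

/-- The sizes that the classes `q1`, `q2` of the children and `q3` of the complement of the node
contribute. -/
def St.contribution (s : St) (ch1 ch2 q1 q2 q3 : ℕ) : ℕ :=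
  sumCode (s.v .n) (s.a .tab ch1 1 q1 (s.a .J 1 q2 q3 0)) (s.a .tab ch2 1 q2 (s.a .J 2 q1 q3 0))

/-- The table of the node `u` takes the triples of classes in `D` into account. -/
def CombineInv (s : St) (u ch1 ch2 opt : ℕ) (D : ℕ → ℕ → ℕ → Prop) (s' : St) : Prop :=
  (∀ x y q q', ¬ (x = u ∧ y = 1) → s'.a .tab x y q q' = s.a .tab x y q q') ∧
    ∀ q q3, OptCode opt {x | ∃ p : ℕ × ℕ, (D p.1 p.2 q3 ∧
          s.a .J 0 p.1 p.2 0 = q) ∧ s.contribution ch1 ch2 p.1 p.2 q3 = x + 1}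
        (s'.a .tab u 1 q q3)

/-- All three loops have the same invariant `CombineInv`, with a growing set of triples. The entry
for `(q, q3)` collects all pairs of classes of the children whose union has class `q`. -/
theorem combine_ends (s : St) {u ch1 ch2 opt : ℕ} (hu : s.v .u = u) (h1 : s.v .ch1 = ch1)
    (h2 : s.v .ch2 = ch2) (hopt : s.v .opt = opt) (hn1 : ch1 ≠ u) (hn2 : ch2 ≠ u)
    (c1 : s.a .cnt ch1 1 0 0 ≤ N) (c2 : s.a .cnt ch2 1 0 0 ≤ N) (c3 : s.a .cnt u 0 0 0 ≤ N)
    (hfresh : ∀ x q, s.a .tab u 1 x q = 0) :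
    Ends combine s fun s' t => t ≤ N * (N * (N * 11 + 4) + 4) + 2 ∧
      (∀ x y q q', ¬ (x = u ∧ y = 1) → s'.a .tab x y q q' = s.a .tab x y q q') ∧
      ∀ q, ∀ q3 < s.a .cnt u 0 0 0, OptCode opt
        {x | ∃ p : ℕ × ℕ, (p.1 < s.a .cnt ch1 1 0 0 ∧ p.2 < s.a .cnt ch2 1 0 0 ∧
          s.a .J 0 p.1 p.2 0 = q) ∧ s.contribution ch1 ch2 p.1 p.2 q3 = x + 1}
        (s'.a .tab u 1 q q3) := by
  have hcongr : ∀ (D D' : ℕ → ℕ → ℕ → Prop) (s' s'' : St), CombineInv s u ch1 ch2 opt D s' → s''.a .tab = s'.a .tab →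
      (∀ q1 q2 q3, D' q1 q2 q3 ↔ D q1 q2 q3) → CombineInv s u ch1 ch2 opt D' s'' := by
    rintro D D' s' s'' ⟨h, h'⟩ hs hD
    exact ⟨by rwa [hs], fun q q3 => by simpa only [hD, hs] using h' q q3⟩
  set C1 := s.a .cnt ch1 1 0 0 with hC1
  set C2 := s.a .cnt ch2 1 0 0 with hC2
  set C3 := s.a .cnt u 0 0 0 with hC3
  rw [combine]
  refine (ends_for (fun i s' => CombineInv s u ch1 ch2 opt (fun q1 q2 q3 => q1 < i ∧ q2 < C2 ∧ q3 < C3) s')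
    C1 (C2 * (C3 * 11 + 4) + 2) rfl ?_ ?_ ?_).mono ?_
  · intro s' ha
    simp [ha.v .ch1 rfl, ha.a .cnt rfl, h1, ← hC1]
  · refine ⟨fun _ _ _ _ _ => rfl, fun q q3 => ?_⟩
    rw [St.setV_a, hfresh]
    exact (OptCode.zero opt).congr (by simp)
  · intro i s1 hi ha1 hi1 hI1
    refine (ends_for (fun j s' => CombineInv s u ch1 ch2 opt (fun q1 q2 q3 =>
      (q1 < i ∧ q2 < C2 ∧ q3 < C3) ∨ (q1 = i ∧ q2 < j ∧ q3 < C3)) s')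
      C2 (C3 * 11 + 2) rfl ?_ ?_ ?_).mono ?_
    · intro s' ha
      simp [ha.v .ch2 rfl, ha.a .cnt rfl, ha1.v .ch2 rfl, ha1.a .cnt rfl, h2, ← hC2]
    · exact hcongr (fun q1 q2 q3 => q1 < i ∧ q2 < C2 ∧ q3 < C3) _ s1 (s1.setV .q2 0) hI1 rfl (by simp)
    · intro j s2 hj ha2 hj2 hI2
      refine (ends_for (fun k s' => CombineInv s u ch1 ch2 opt (fun q1 q2 q3 =>
        ((q1 < i ∧ q2 < C2 ∧ q3 < C3) ∨ (q1 = i ∧ q2 < j ∧ q3 < C3)) ∨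
          (q1 = i ∧ q2 = j ∧ q3 < k)) s') C3 9 rfl ?_ ?_ ?_).mono ?_
      · intro s' ha
        simp [ha.v .u rfl, ha.a .cnt rfl, ha1.v .u rfl, ha1.a .cnt rfl, ha2.v .u rfl,
          ha2.a .cnt rfl, hu, ← hC3]
      · exact hcongr (fun q1 q2 q3 => (q1 < i ∧ q2 < C2 ∧ q3 < C3) ∨ (q1 = i ∧ q2 < j ∧ q3 < C3)) _
          s2 (s2.setV .q3 0) hI2 rfl (by simp)
      · intro k s3 hk ha3 hk3 hI3
        have f1 := (ha3.v .u rfl).trans ((ha2.v .u rfl).trans ((ha1.v .u rfl).trans hu))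
        have f2 := (ha3.v .ch1 rfl).trans ((ha2.v .ch1 rfl).trans ((ha1.v .ch1 rfl).trans h1))
        have f3 := (ha3.v .ch2 rfl).trans ((ha2.v .ch2 rfl).trans ((ha1.v .ch2 rfl).trans h2))
        have f4 := (ha3.v .opt rfl).trans ((ha2.v .opt rfl).trans ((ha1.v .opt rfl).trans hopt))
        have f5 := (ha3.v .q1 rfl).trans ((ha2.v .q1 rfl).trans hi1)
        have f6 := (ha3.v .q2 rfl).trans hj2
        have f7 : s3.v .n = s.v .n := (ha3.v .n rfl).trans ((ha2.v .n rfl).trans (ha1.v .n rfl))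
        have g1 : s3.a .J = s.a .J := (ha3.a .J rfl).trans ((ha2.a .J rfl).trans (ha1.a .J rfl))
        rw [ends_seq, ends_assign, ends_seq, ends_assign, ends_seq]
        simp only [Ex.eval_get, Ex.eval_var, Ex.eval_lit, Ex.eval_ofNat, f2, f3, f5, f6, hk3, g1,
          St.setV_v, St.setV_a, reduceCtorEq, if_false]
        refine (addSizes_ends _).mono ?_
        rintro s4 t4 - ⟨ht4, rfl⟩
        -- The tables of the children belong to nodes other than `u`, so the loops still read the
        -- original values.
        have hval : sumCode (s3.v .n) (s3.a .tab ch1 1 i (s.a .J 1 j k 0))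
            (s3.a .tab ch2 1 j (s.a .J 2 i k 0)) = s.contribution ch1 ch2 i j k := by
          rw [f7, hI3.1 _ _ _ _ (by tauto), hI3.1 _ _ _ _ (by tauto), St.contribution]
        simp only [St.setV_v, reduceCtorEq, if_false, if_true, hval]
        refine (relax_ends _ .tab (.var .u) 1 (.get3 .J 0 (.var .q1) (.var .q2)) (.var .q3)
          (i' := u) (j' := 1) (k' := s.a .J 0 i j 0) (l' := k) (opt := opt)
          (val := s.contribution ch1 ch2 i j k) ?_ rfl ?_ ?_ ?_ ?_ ?_).mono ?_
        · simp [f4]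
        · intro e; simp [f1]
        · intro e; simp
        · intro e; simp [f5, f6, g1]
        · intro e; simp [hk3]
        · simp [f1, f5, f6, g1, hk3]
        rintro s5 t5 ha5 ⟨ht5, hu5, hn5⟩
        simp only [St.setV_a] at hu5 hn5
        refine ⟨⟨fun x y q q' hxy => ?_, fun q q3 => ?_⟩, by omega⟩
        · rw [St.setV_a, hn5 _ _ _ _ (by tauto), hI3.1 _ _ _ _ hxy]
        · rw [St.setV_a]
          have hI := hI3.2 q q3
          by_cases hq : q = s.a .J 0 i j 0 ∧ q3 = k
          · obtain ⟨rfl, rfl⟩ := hq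
            rw [hu5]
            refine (hI.relaxed _).congr fun x => ?_
            simp only [Set.mem_ofPred_eq, Set.mem_union]
            constructor
            · rintro ⟨p, ⟨(hp | ⟨h, h', -⟩), hp'⟩, hx⟩
              · exact Or.inl ⟨p, ⟨Or.inl hp, hp'⟩, hx⟩
              by_cases hk : q3 < q3
              · omega
              · exact Or.inr (by rw [h, h'] at hx; exact hx)
            · rintro (⟨p, ⟨(hp | ⟨h, h', h''⟩), hp'⟩, hx⟩ | hx)
              · exact ⟨p, ⟨Or.inl hp, hp'⟩, hx⟩
              · omega
              · exact ⟨(i, j), ⟨Or.inr ⟨rfl, rfl, by omega⟩, rfl⟩, hx⟩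
          · rw [hn5 _ _ _ _ (by tauto)]
            refine hI.congr fun x => ?_
            simp only [Set.mem_ofPred_eq]
            refine exists_congr fun p => and_congr_left fun _ => and_congr_left fun hp => ?_
            refine or_congr Iff.rfl (and_congr_right fun h => and_congr_right fun h' => ?_)
            rw [h, h'] at hp
            have : q3 ≠ k := fun hk => hq ⟨hp.symm, hk⟩
            omega
      · rintro s3 t3 ha3 ⟨hI, ht⟩
        refine ⟨hcongr (fun q1 q2 q3 => ((q1 < i ∧ q2 < C2 ∧ q3 < C3) ∨
          (q1 = i ∧ q2 < j ∧ q3 < C3)) ∨ (q1 = i ∧ q2 = j ∧ q3 < C3)) _ _ (s3.setV .q2 (j + 1)) hI rfl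
          fun q1 q2 q3 => ?_, ht⟩
        constructor
        · rintro (h | ⟨h, h', h''⟩)
          · exact Or.inl (Or.inl h)
          · rcases Nat.lt_succ_iff_lt_or_eq.mp h' with h' | h'
            exacts [Or.inl (Or.inr ⟨h, h', h''⟩), Or.inr ⟨h, h', h''⟩]
        · rintro ((h | ⟨h, h', h''⟩) | ⟨h, h', h''⟩)
          exacts [Or.inl h, Or.inr ⟨h, by omega, h''⟩, Or.inr ⟨h, by omega, h''⟩]
    · rintro s2 t2 ha2 ⟨hI, ht⟩
      refine ⟨hcongr (fun q1 q2 q3 => (q1 < i ∧ q2 < C2 ∧ q3 < C3) ∨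
        (q1 = i ∧ q2 < C2 ∧ q3 < C3)) _ _ (s2.setV .q1 (i + 1)) hI rfl fun q1 q2 q3 => ?_, ht⟩
      omega
  · rintro s' t ha ⟨hI, ht⟩
    refine ⟨ht.trans ?_, hI.1, fun q q3 hq3 => ?_⟩
    · rw [Nat.add_assoc _ 2 2]; gcongr
    · refine (hI.2 q q3).congr fun x => ?_
      simp only [Set.mem_ofPred_eq]
      refine exists_congr fun p => and_congr_left fun _ => ?_
      tauto

end Mach

namespace Mach

/-! ### Partial solutions -/

variable {H : SimpleGraph ℕ} {d n : ℕ} {sg : ℕ → ℕ → ℕ}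

/-- The number of neighbours of `z` in `X`. -/
noncomputable def cn (H : SimpleGraph ℕ) (X : Finset ℕ) (z : ℕ) : ℕ := ∑ a ∈ X, ad H z a

theorem cn_union {X Y : Finset ℕ} (h : Disjoint X Y) (z : ℕ) :
    cn H (X ∪ Y) z = cn H X z + cn H Y z := Finset.sum_union h

/-- The vertex `v` has an admissible number of neighbours, `k` of which are outside of `X`. -/
def OkAt (H : SimpleGraph ℕ) (d : ℕ) (sg : ℕ → ℕ → ℕ) (v : ℕ) (X : Finset ℕ) (k : ℕ) : Prop :=
  (v ∈ X → sg 1 (min d (cn H X v + k)) ≠ 0) ∧ (v ∉ X → sg 0 (min d (cn H X v + k)) ≠ 0)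

/-- The sizes of the sets of vertices in the region `R` that count as `F` outside of `R` and in which
all vertices of `R` are admissible if the vertices outside count as `F'`. -/
def Sol (H : SimpleGraph ℕ) (d n : ℕ) (sg : ℕ → ℕ → ℕ) (R : ℕ → Prop) (F F' : ℕ → ℕ) : Set ℕ :=
  {y | ∃ X : Finset ℕ, X.card = y ∧ (∀ a ∈ X, a < n ∧ R a) ∧
    (∀ z, ¬ R z → F z = min d (cn H X z)) ∧ ∀ v < n, R v → OkAt H d sg v X (F' v)}

/-- The sizes of all solutions. -/
def allSizes (H : SimpleGraph ℕ) (d n : ℕ) (sg : ℕ → ℕ → ℕ) : Set ℕ :=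
  {y | ∃ X : Finset ℕ, X.card = y ∧ (∀ a ∈ X, a < n) ∧ ∀ v < n, OkAt H d sg v X 0}

theorem OkAt.congr {v k k' : ℕ} {X Y : Finset ℕ} (h : OkAt H d sg v X k) (hv : v ∈ Y ↔ v ∈ X)
    (hk : min d (cn H Y v + k') = min d (cn H X v + k)) : OkAt H d sg v Y k' := by
  rw [OkAt, hv, hk]; exact h

/-- The region contains a single vertex, and a vertex is not its own neighbour, so the outside class
alone decides whether it is admissible. -/
theorem mem_sol_leaf {R : ℕ → Prop} {v x : ℕ} {F F' : ℕ → ℕ} (hv : v < n) (hR : R v)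
    (hRv : ∀ z < n, R z → z = v) (hF' : F' v ≤ d) : x ∈ Sol H d n sg R F F' ↔
      (x = 0 ∧ (∀ z, ¬ R z → F z = 0) ∧ sg 0 (F' v) ≠ 0) ∨
        (x = 1 ∧ (∀ z, ¬ R z → F z = min d (ad H v z)) ∧ sg 1 (F' v) ≠ 0) := by
  have hvv : ad H v v = 0 := by simp [ad]
  constructor
  · rintro ⟨X, rfl, hX, hout, hok⟩
    have hsub : X ⊆ {v} := fun a ha => by
      rw [Finset.mem_singleton]; exact hRv a (hX a ha).1 (hX a ha).2
    have hv' := hok v hv hR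
    rcases Finset.subset_singleton_iff.mp hsub with rfl | rfl
    · left
      refine ⟨rfl, fun z hz => by rw [hout z hz]; simp [cn], ?_⟩
      have := hv'.2 (by simp)
      simpa [cn, hF'] using this
    · right
      refine ⟨rfl, fun z hz => by rw [hout z hz, ad_comm]; simp [cn], ?_⟩
      have := hv'.1 (by simp)
      simpa [cn, hvv, hF'] using this
  · rintro (⟨rfl, hF, hs⟩ | ⟨rfl, hF, hs⟩)
    · refine ⟨∅, rfl, by simp, fun z hz => by rw [hF z hz]; simp [cn], fun z hzn hz => ?_⟩
      obtain rfl := hRv z hzn hz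
      refine ⟨by simp, fun _ => ?_⟩
      simpa [cn, hF'] using hs
    · refine ⟨{v}, rfl, by simp [hv, hR], fun z hz => ?_, fun z hzn hz => ?_⟩
      · rw [hF z hz, ad_comm]; simp [cn]
      · obtain rfl := hRv z hzn hz
        refine ⟨fun _ => ?_, by simp⟩
        simpa [cn, hvv, hF'] using hs

theorem card_union_le {X Y : Finset ℕ} (h : Disjoint X Y) (hX : ∀ a ∈ X, a < n)
    (hY : ∀ a ∈ Y, a < n) : X.card + Y.card ≤ n := by
  rw [← Finset.card_union_of_disjoint h, ← Finset.card_range n]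
  refine Finset.card_le_card fun a ha => ?_
  rw [Finset.mem_range]
  rcases Finset.mem_union.mp ha with h | h
  exacts [hX a h, hY a h]

theorem disjoint_of_regions {R1 R2 : ℕ → Prop} (h : ∀ z, R1 z → ¬ R2 z) {X Y : Finset ℕ}
    (hX : ∀ a ∈ X, R1 a) (hY : ∀ a ∈ Y, R2 a) : Disjoint X Y :=
  Finset.disjoint_left.mpr fun a ha hb => h a (hX a ha) (hY a hb)

/-- Solutions for disjoint regions are disjoint sets of vertices, so the cap in `sumCode` is
harmless. -/
theorem Sol.add_le {R1 R2 : ℕ → Prop} (h : ∀ z, R1 z → ¬ R2 z) {F1 G1 F2 G2 : ℕ → ℕ} {x y : ℕ}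
    (hx : x ∈ Sol H d n sg R1 F1 G1) (hy : y ∈ Sol H d n sg R2 F2 G2) : x + y ≤ n := by
  obtain ⟨X, rfl, hX, -, -⟩ := hx
  obtain ⟨Y, rfl, hY, -, -⟩ := hy
  exact card_union_le (disjoint_of_regions h (fun a ha => (hX a ha).2) fun a ha => (hY a ha).2)
    (fun a ha => (hX a ha).1) fun a ha => (hY a ha).1

theorem Classes.exists_finset {sd : ℕ → ℕ} {o c : ℕ} {F : ℕ → ℕ → ℕ} (h : Classes H d sd o c F)
    (X : Finset ℕ) (hX : ∀ a ∈ X, sd a = o) :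
    ∃ q < c, ∀ z, sd z ≠ o → F q z = min d (cn H X z) :=
  h.complete X.val hX

/-- The solutions for the union of two regions. -/
theorem mem_sol_union {sd sd1 sd2 : ℕ → ℕ} {o o1 o2 c c1 c2 : ℕ} {F F1 F2 G1 G2 : ℕ → ℕ → ℕ}
    {F3 : ℕ → ℕ} {J0 : ℕ → ℕ → ℕ} (hF : Classes H d sd o c F) (hF1 : Classes H d sd1 o1 c1 F1)
    (hF2 : Classes H d sd2 o2 c2 F2) (hpart : ∀ z, sd z = o ↔ sd1 z = o1 ∨ sd2 z = o2)
    (hdisj : ∀ z, sd1 z = o1 → ¬ sd2 z = o2)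
    (hJ0 : ∀ q1 < c1, ∀ q2 < c2, J0 q1 q2 < c ∧
      ∀ z, sd z ≠ o → F (J0 q1 q2) z = min d (F1 q1 z + F2 q2 z))
    (hG1 : ∀ q2 < c2, ∀ z, sd1 z = o1 → G1 q2 z = min d (F2 q2 z + F3 z))
    (hG2 : ∀ q1 < c1, ∀ z, sd2 z = o2 → G2 q1 z = min d (F1 q1 z + F3 z)) {q x : ℕ} (hq : q < c) :
    x ∈ Sol H d n sg (sd · = o) (F q) F3 ↔ ∃ p : ℕ × ℕ, (p.1 < c1 ∧ p.2 < c2 ∧ J0 p.1 p.2 = q) ∧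
      x ∈ {z | ∃ x ∈ Sol H d n sg (sd1 · = o1) (F1 p.1) (G1 p.2),
        ∃ y ∈ Sol H d n sg (sd2 · = o2) (F2 p.2) (G2 p.1), z = x + y} := by
  have hdisj' : ∀ z, sd2 z = o2 → ¬ sd1 z = o1 := fun z h h' => hdisj z h' h
  constructor
  · rintro ⟨X, rfl, hX, hout, hok⟩
    set X1 := X.filter (sd1 · = o1) with hX1
    set X2 := X.filter (sd2 · = o2) with hX2
    have hd12 : Disjoint X1 X2 := disjoint_of_regions hdisj (fun a ha => (Finset.mem_filter.mp ha).2)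
      fun a ha => (Finset.mem_filter.mp ha).2
    have hU : X = X1 ∪ X2 := by
      rw [hX1, hX2, ← Finset.filter_or]
      exact (Finset.filter_true_of_mem fun a ha => (hpart a).mp (hX a ha).2).symm
    have hcn : ∀ z, cn H X z = cn H X1 z + cn H X2 z := fun z => by rw [hU, cn_union hd12]
    obtain ⟨q1, hq1, h1⟩ := hF1.exists_finset X1 fun a ha => (Finset.mem_filter.mp ha).2
    obtain ⟨q2, hq2, h2⟩ := hF2.exists_finset X2 fun a ha => (Finset.mem_filter.mp ha).2
    obtain ⟨hlt, hJ⟩ := hJ0 q1 hq1 q2 hq2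
    -- Classes are listed without repetition, so the class computed for the union of the two parts
    -- is the given class `q` of the set.
    refine ⟨(q1, q2), ⟨hq1, hq2, hF.inj _ hlt _ hq fun z hz => ?_⟩, X1.card, ?_, X2.card, ?_, ?_⟩
    · have hz' := hz
      rw [ne_eq, hpart, not_or] at hz'
      rw [hJ z hz, hout z hz, h1 z hz'.1, h2 z hz'.2, hcn]; omega
    · refine ⟨X1, rfl, fun a ha => ?_, h1, fun v hv hv1 => ?_⟩
      · rw [Finset.mem_filter] at ha; exact ⟨(hX a ha.1).1, ha.2⟩
      · refine (hok v hv ((hpart v).mpr (Or.inl hv1))).congr (by simp [hX1, hv1]) ?_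
        rw [hG1 q2 hq2 v hv1, h2 v (hdisj v hv1), hcn]; omega
    · refine ⟨X2, rfl, fun a ha => ?_, h2, fun v hv hv2 => ?_⟩
      · rw [Finset.mem_filter] at ha; exact ⟨(hX a ha.1).1, ha.2⟩
      · refine (hok v hv ((hpart v).mpr (Or.inr hv2))).congr (by simp [hX2, hv2]) ?_
        rw [hG2 q1 hq1 v hv2, h1 v (hdisj' v hv2), hcn]; omega
    · rw [← Finset.card_union_of_disjoint hd12, ← hU]
  · rintro ⟨⟨q1, q2⟩, ⟨hq1, hq2, rfl⟩, _, ⟨X1, rfl, hX1, h1, hok1⟩, _, ⟨X2, rfl, hX2, h2, hok2⟩, rfl⟩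
    have hd12 : Disjoint X1 X2 := disjoint_of_regions hdisj (fun a ha => (hX1 a ha).2)
      fun a ha => (hX2 a ha).2
    dsimp only at *
    refine ⟨X1 ∪ X2, Finset.card_union_of_disjoint hd12, fun a ha => ?_, fun z hz => ?_,
      fun v hv hR => ?_⟩
    · change a < n ∧ sd a = o
      rw [hpart]
      rcases Finset.mem_union.mp ha with h | h
      exacts [⟨(hX1 a h).1, Or.inl (hX1 a h).2⟩, ⟨(hX2 a h).1, Or.inr (hX2 a h).2⟩]
    · rw [(hJ0 q1 hq1 q2 hq2).2 z hz]
      change ¬ sd z = o at hz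
      rw [hpart, not_or] at hz
      rw [h1 z hz.1, h2 z hz.2, cn_union hd12]; omega
    · rcases (hpart v).mp hR with h | h
      · have hn : v ∉ X2 := fun hv2 => hdisj v h (hX2 v hv2).2
        refine (hok1 v hv h).congr (by simp [hn]) ?_
        rw [hG1 q2 hq2 v h, h2 v (hdisj v h), cn_union hd12]; omega
      · have hn : v ∉ X1 := fun hv1 => hdisj v (hX1 v hv1).2 h
        refine (hok2 v hv h).congr (by simp [hn]) ?_
        rw [hG2 q1 hq1 v h, h1 v (hdisj' v h), cn_union hd12]; omega

/-- The solutions for the whole graph. -/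
theorem mem_allSizes {sd : ℕ → ℕ} {c1 c0 : ℕ} {F1 F0 : ℕ → ℕ → ℕ} (hside : ∀ z, sd z ≤ 1)
    (hF1 : Classes H d sd 1 c1 F1) (hF0 : Classes H d sd 0 c0 F0) {x : ℕ} :
    x ∈ allSizes H d n sg ↔ ∃ p : ℕ × ℕ, (p.1 < c1 ∧ p.2 < c0) ∧
      x ∈ {z | ∃ x ∈ Sol H d n sg (sd · = 1) (F1 p.1) (F0 p.2),
        ∃ y ∈ Sol H d n sg (sd · = 0) (F0 p.2) (F1 p.1), z = x + y} := by
  have hdisj : ∀ z, sd z = 1 → ¬ sd z = 0 := fun z h h' => by omega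
  have hdisj' : ∀ z, sd z = 0 → ¬ sd z = 1 := fun z h h' => by omega
  have hpart : ∀ z, sd z = 1 ∨ sd z = 0 := fun z => by have := hside z; omega
  constructor
  · rintro ⟨X, rfl, hX, hok⟩
    set X1 := X.filter (sd · = 1) with hX1
    set X2 := X.filter (sd · = 0) with hX2
    have hd12 : Disjoint X1 X2 := disjoint_of_regions hdisj (fun a ha => (Finset.mem_filter.mp ha).2)
      fun a ha => (Finset.mem_filter.mp ha).2
    have hU : X = X1 ∪ X2 := by
      rw [hX1, hX2, ← Finset.filter_or]
      exact (Finset.filter_true_of_mem fun a ha => hpart a).symm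
    have hcn : ∀ z, cn H X z = cn H X1 z + cn H X2 z := fun z => by rw [hU, cn_union hd12]
    obtain ⟨q1, hq1, h1⟩ := hF1.exists_finset X1 fun a ha => (Finset.mem_filter.mp ha).2
    obtain ⟨q2, hq2, h2⟩ := hF0.exists_finset X2 fun a ha => (Finset.mem_filter.mp ha).2
    refine ⟨(q1, q2), ⟨hq1, hq2⟩, X1.card, ⟨X1, rfl, fun a ha => ?_, h1, fun v hv hv1 => ?_⟩,
      X2.card, ⟨X2, rfl, fun a ha => ?_, h2, fun v hv hv2 => ?_⟩, ?_⟩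
    · rw [Finset.mem_filter] at ha; exact ⟨hX a ha.1, ha.2⟩
    · refine (hok v hv).congr (by simp [hX1, hv1]) ?_
      rw [h2 v (hdisj v hv1), hcn]; omega
    · rw [Finset.mem_filter] at ha; exact ⟨hX a ha.1, ha.2⟩
    · refine (hok v hv).congr (by simp [hX2, hv2]) ?_
      rw [h1 v (hdisj' v hv2), hcn]; omega
    · rw [← Finset.card_union_of_disjoint hd12, ← hU]
  · rintro ⟨⟨q1, q2⟩, -, _, ⟨X1, rfl, hX1, h1, hok1⟩, _, ⟨X2, rfl, hX2, h2, hok2⟩, rfl⟩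
    have hd12 : Disjoint X1 X2 := disjoint_of_regions hdisj (fun a ha => (hX1 a ha).2)
      fun a ha => (hX2 a ha).2
    dsimp only at *
    refine ⟨X1 ∪ X2, Finset.card_union_of_disjoint hd12, fun a ha => ?_, fun v hv => ?_⟩
    · rcases Finset.mem_union.mp ha with h | h
      exacts [(hX1 a h).1, (hX2 a h).1]
    · rcases hpart v with h | h
      · have hn : v ∉ X2 := fun hv2 => hdisj v h (hX2 v hv2).2
        refine (hok1 v hv h).congr (by simp [hn]) ?_
        rw [h2 v (hdisj v h), cn_union hd12]; omega
      · have hn : v ∉ X1 := fun hv1 => hdisj v (hX1 v hv1).2 h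
        refine (hok2 v hv h).congr (by simp [hn]) ?_
        rw [h1 v (hdisj' v h), cn_union hd12]; omega

end Mach

/-! ### The tables contain the optima -/

namespace Mach

variable {H : SimpleGraph ℕ} {d n N w opt : ℕ} {side : ℕ → ℕ → ℕ} {sg : ℕ → ℕ → ℕ}

/-- The table for the side `o` of the cut of the node `u` contains the optima. -/
def TabOK (H : SimpleGraph ℕ) (d n : ℕ) (sg : ℕ → ℕ → ℕ) (side : ℕ → ℕ → ℕ) (opt : ℕ) (s : St)
    (u o : ℕ) (s' : St) : Prop :=
  ∀ q < s.a .cnt u o 0 0, ∀ q' < s.a .cnt u (1 - o) 0 0,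
    OptCode opt (Sol H d n sg (side u · = o) (s.cls u o q) (s.cls u (1 - o) q'))
      (s'.a .tab u o q q')

theorem TabOK.congr {s s' s'' : St} {u o : ℕ} (h : TabOK H d n sg side opt s u o s')
    (ht : ∀ q q', s''.a .tab u o q q' = s'.a .tab u o q q') :
    TabOK H d n sg side opt s u o s'' := fun q hq q' hq' => by rw [ht]; exact h q hq q' hq'

theorem TabOK.congr_cuts {s s0 s' : St} {u o : ℕ} (h : TabOK H d n sg side opt s u o s')
    (hS : SameCuts s0 s) : TabOK H d n sg side opt s0 u o s' := fun q hq q' hq' => by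
  have := h q (by rwa [hS.cnt]) q' (by rwa [hS.cnt])
  have e1 : s.cls u o q = s0.cls u o q := funext fun z => hS.cls hq.ne
  have e2 : s.cls u (1 - o) q' = s0.cls u (1 - o) q' := funext fun z => hS.cls hq'.ne
  rwa [e1, e2] at this

theorem TabOK.congr_cuts' {s s0 s' : St} {u o : ℕ} (h : TabOK H d n sg side opt s0 u o s')
    (hS : SameCuts s0 s) : TabOK H d n sg side opt s u o s' := fun q hq q' hq' => by
  rw [hS.cnt] at hq hq'
  have e1 : s.cls u o q = s0.cls u o q := funext fun z => hS.cls hq.ne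
  have e2 : s.cls u (1 - o) q' = s0.cls u (1 - o) q' := funext fun z => hS.cls hq'.ne
  rw [e1, e2]
  exact h q hq q' hq'

theorem ad_le_one (a b : ℕ) : ad H a b ≤ 1 := by unfold ad; split_ifs <;> omega

/-- Since classes are listed without repetition, having the class of the empty set means `q = 0`,
and having the class of `{v}` means `q = res`. The hypothesis `1 ≤ d` keeps the cap from affecting a
single neighbour. -/
theorem leafTable_tabOK (s : St) {u o v : ℕ} (hD : CutDone H d N w (side u) u s)
    (hside : ∀ a, side u a ≤ 1) (ho : o ≤ 1) (hd : 1 ≤ d) (hu : s.v .tu = u) (hto : s.v .to = o)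
    (hv : s.v .v = v) (hopt : s.v .opt = opt) (hvn : v < n) (hvo : side u v = o)
    (honly : ∀ z < n, side u z = o → z = v) (hadj : ∀ a b, s.a .adj a b 0 0 = ad H a b)
    (hsig : ∀ i k, s.a .sig i k 0 0 = sg i k) (hsg : ∀ k, sg 0 k ≤ 1)
    (hfresh : ∀ x q, s.a .tab u o x q = 0) :
    Ends leafTable s fun s' t => t ≤ (N + 1) * (4 * w + 7) + N * 17 + 2 ∧ SameCuts s s' ∧
      (∀ x y q q', ¬ (x = u ∧ y = o) → s'.a .tab x y q q' = s.a .tab x y q q') ∧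
      TabOK H d n sg side opt s u o s' := by
  refine (leafTable_ends s hD hside ho hd hu hto hv hopt hvo (hadj v)
    (fun k => by rw [hsig]; exact hsg k) hfresh).mono ?_
  rintro s' t - ⟨ht, hS, htab, res, hres, hcls, hO⟩
  refine ⟨ht, hS, htab, fun q hq q' hq' => (hO q q' hq').congr fun x => ?_⟩
  have hC := hD.classes o ho
  obtain ⟨M, hM, hF⟩ := (hD.classes (1 - o) (by omega)).sound q' hq'
  have hle : s.cls u (1 - o) q' v ≤ d := by
    have := hF v (by omega)
    rw [St.cls, this]; exact min_le_left _ _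
  rw [mem_sol_leaf hvn hvo honly hle]
  simp only [Set.mem_ofPred_eq, hsig]
  refine or_congr (and_congr_right fun _ => and_congr_left fun _ => ?_)
    (and_congr_right fun _ => and_congr_left fun _ => ?_)
  · constructor
    · intro h
      exact hC.inj q hq 0 hC.pos fun z hz => (h z hz).trans (hC.zero z hz).symm
    · rintro rfl z hz; exact hC.zero z hz
  · have had : ∀ z, min d (ad H v z) = ad H v z := fun z => by
      have := ad_le_one (H := H) v z; omega
    simp only [had]
    constructor
    · intro h
      exact hC.inj q hq res hres fun z hz => (h z hz).trans (hcls z hz).symm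
    · rintro rfl z hz; exact hcls z hz

/-- `P e k` says that `e` has the value `k` in every state that agrees on `u`, `ch1` and `ch2`; the
registers set before do not matter. -/
theorem setJoin_ends (s : St) {iu io ju jo tu ti jn : Ex} {iu' io' ju' jo' tu' ti' jn' : ℕ}
    {P : Ex → ℕ → Prop} (hP : ∀ e k, P e k ↔ ∀ s' : St, s'.v .u = s.v .u → s'.v .ch1 = s.v .ch1 →
      s'.v .ch2 = s.v .ch2 → e.eval s' = k) (h1 : P iu iu') (h2 : P io io') (h3 : P ju ju')
    (h4 : P jo jo') (h5 : P tu tu') (h6 : P ti ti') (h7 : P jn jn') :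
    Ends (setJoin iu io ju jo tu ti jn) s fun s' t => t = 7 ∧ s'.a = s.a ∧ s'.v .iu = iu' ∧
      s'.v .io = io' ∧ s'.v .ju = ju' ∧ s'.v .jo = jo' ∧ s'.v .tu = tu' ∧ s'.v .to = ti' ∧
      s'.v .jn = jn' := by
  rw [hP] at h1 h2 h3 h4 h5 h6 h7
  simp only [setJoin, ends_seq, ends_assign]
  refine ⟨trivial, rfl, ?_, ?_, ?_, ?_, ?_, ?_, ?_⟩ <;>
    simp only [St.setV_v, reduceCtorEq, if_false, if_true]
  · exact h1 _ rfl rfl rfl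
  · exact h2 _ (by simp) (by simp) (by simp)
  · exact h3 _ (by simp) (by simp) (by simp)
  · exact h4 _ (by simp) (by simp) (by simp)
  · exact h5 _ (by simp) (by simp) (by simp)
  · exact h6 _ (by simp) (by simp) (by simp)
  · exact h7 _ (by simp) (by simp) (by simp)

def joinTime (N w : ℕ) : ℕ := N * (N * ((N + 1) * (4 * w + 7) + 3) + 4) + 2

/-- The three joins supply the class of a union of two parts and, for each child, the class of
everything outside of it. With these, `mem_sol_union` describes the solutions at `u` by solutions at
the children, and the optima follow by `OptCode.sumCode` and `OptCode.iUnion`. -/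
theorem innerTable_tabOK (s : St) {U : Set ℕ} (hD : AllDone H d N w side U s) (hd : s.v .d = d)
    (hside : ∀ u a, side u a ≤ 1) {u ch1 ch2 : ℕ} (huU : u ∈ U) (h1U : ch1 ∈ U) (h2U : ch2 ∈ U)
    (hu : s.v .u = u) (h1 : s.a .ch u 0 0 0 = ch1) (h2 : s.a .ch u 1 0 0 = ch2) (hn : s.v .n = n)
    (hopt : s.v .opt = opt) (hn1 : ch1 ≠ u) (hn2 : ch2 ≠ u) (hn12 : ch1 ≠ ch2)
    (hpart : ∀ z, side u z = 1 ↔ side ch1 z = 1 ∨ side ch2 z = 1)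
    (hdisj : ∀ z, side ch1 z = 1 → ¬ side ch2 z = 1)
    (hT1 : TabOK H d n sg side opt s ch1 1 s) (hT2 : TabOK H d n sg side opt s ch2 1 s)
    (hfresh : ∀ x q, s.a .tab u 1 x q = 0) :
    Ends innerTable s fun s' t =>
      t ≤ 3 * joinTime N w + N * (N * (N * 11 + 4) + 4) + 25 ∧ SameCuts s s' ∧
      (∀ x y q q', ¬ (x = u ∧ y = 1) → s'.a .tab x y q q' = s.a .tab x y q q') ∧
      TabOK H d n sg side opt s u 1 s' := by
  -- The complement of a child consists of its sibling and the complement of the node.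
  have hp2 : ∀ z, side ch1 z = 0 ↔ side ch2 z = 1 ∨ side u z = 0 := fun z => by
    have a1 := hpart z; have a2 := hdisj z
    have a3 := hside u z; have a4 := hside ch1 z; have a5 := hside ch2 z
    omega
  have hp3 : ∀ z, side ch2 z = 0 ↔ side ch1 z = 1 ∨ side u z = 0 := fun z => by
    have a1 := hpart z; have a2 := hdisj z
    have a3 := hside u z; have a4 := hside ch1 z; have a5 := hside ch2 z
    omega
  rw [innerTable, ends_seq, ends_assign, ends_seq, ends_assign, ends_seq]
  simp only [Ex.eval_get, Ex.eval_var, Ex.eval_lit, Ex.eval_ofNat, hu, h1, h2, St.setV_v,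
    St.setV_a, reduceCtorEq, if_false]
  -- the first join
  refine (setJoin_ends _ (iu' := ch1) (io' := 1) (ju' := ch2) (jo' := 1) (tu' := u) (ti' := 1)
    (jn' := 0) (fun _ _ => Iff.rfl) ?_ ?_ ?_ ?_ ?_ ?_ ?_).mono ?_
  · intro s' _ a _; simp [a]
  · intros; simp
  · intro s' _ _ a; simp [a]
  · intros; simp
  · intro s' a _ _; simp [a, hu]
  · intros; simp
  · intros; simp
  rintro s1 t1 ha1 ⟨rfl, e1, i1, i2, i3, i4, i5, i6, i7⟩
  have S1 : SameCuts s s1 := ⟨by simp [e1], by simp [e1], by simp [e1], by simp [e1], by simp [e1],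
    by simp [e1]⟩
  have r1 := ha1.v .u rfl
  have r2 := ha1.v .ch1 rfl
  have r3 := ha1.v .ch2 rfl
  have r4 := ha1.v .d rfl
  have r5 := ha1.v .n rfl
  have r6 := ha1.v .opt rfl
  simp only [St.setV_v, reduceCtorEq, if_false, if_true, hu, hd, hn, hopt] at r1 r2 r3 r4 r5 r6
  rw [ends_seq]
  refine (join_ends s1 (S1.allDone hD) r4 hside h1U h2U huU le_rfl le_rfl le_rfl i1 i2 i3 i4 i5 i6
    i7 hn1 (Or.inl hn2) hpart).mono ?_
  clear i1 i2 i3 i4 i5 i6 i7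
  rintro s2 t2 ha2 ⟨ht2, S2, J2, -⟩
  have e2 := ha2.a .tab rfl
  replace r1 := (ha2.v .u rfl).trans r1
  replace r2 := (ha2.v .ch1 rfl).trans r2
  replace r3 := (ha2.v .ch2 rfl).trans r3
  replace r4 := (ha2.v .d rfl).trans r4
  replace r5 := (ha2.v .n rfl).trans r5
  replace r6 := (ha2.v .opt rfl).trans r6
  replace S2 := S1.trans S2
  -- the second join
  rw [ends_seq]
  refine (setJoin_ends _ (iu' := ch2) (io' := 1) (ju' := u) (jo' := 0) (tu' := ch1) (ti' := 0)
    (jn' := 1) (fun _ _ => Iff.rfl) ?_ ?_ ?_ ?_ ?_ ?_ ?_).mono ?_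
  · intro s' _ _ a; simp [a, r3]
  · intros; simp
  · intro s' a _ _; simp [a, r1]
  · intros; simp
  · intro s' _ a _; simp [a, r2]
  · intros; simp
  · intros; simp
  rintro s3 t3 ha3 ⟨rfl, e3, i1, i2, i3, i4, i5, i6, i7⟩
  have S3 : SameCuts s2 s3 := ⟨by simp [e3], by simp [e3], by simp [e3], by simp [e3], by simp [e3],
    by simp [e3]⟩
  replace S3 := S2.trans S3
  replace r1 := (ha3.v .u rfl).trans r1
  replace r2 := (ha3.v .ch1 rfl).trans r2
  replace r3 := (ha3.v .ch2 rfl).trans r3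
  replace r4 := (ha3.v .d rfl).trans r4
  replace r5 := (ha3.v .n rfl).trans r5
  replace r6 := (ha3.v .opt rfl).trans r6
  rw [ends_seq]
  refine (join_ends s3 (S3.allDone hD) r4 hside h2U huU h1U le_rfl (by omega) (by omega) i1 i2 i3
    i4 i5 i6 i7 hn12.symm (Or.inl hn1.symm) hp2).mono ?_
  clear i1 i2 i3 i4 i5 i6 i7
  rintro s4 t4 ha4 ⟨ht4, S4, J4, J4'⟩
  have e4 := ha4.a .tab rfl
  replace r1 := (ha4.v .u rfl).trans r1
  replace r2 := (ha4.v .ch1 rfl).trans r2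
  replace r3 := (ha4.v .ch2 rfl).trans r3
  replace r4 := (ha4.v .d rfl).trans r4
  replace r5 := (ha4.v .n rfl).trans r5
  replace r6 := (ha4.v .opt rfl).trans r6
  replace S4 := S3.trans S4
  -- the third join
  rw [ends_seq]
  refine (setJoin_ends _ (iu' := ch1) (io' := 1) (ju' := u) (jo' := 0) (tu' := ch2) (ti' := 0)
    (jn' := 2) (fun _ _ => Iff.rfl) ?_ ?_ ?_ ?_ ?_ ?_ ?_).mono ?_
  · intro s' _ a _; simp [a, r2]
  · intros; simp
  · intro s' a _ _; simp [a, r1]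
  · intros; simp
  · intro s' _ _ a; simp [a, r3]
  · intros; simp
  · intros; simp
  rintro s5 t5 ha5 ⟨rfl, e5, i1, i2, i3, i4, i5, i6, i7⟩
  have S5 : SameCuts s4 s5 := ⟨by simp [e5], by simp [e5], by simp [e5], by simp [e5], by simp [e5],
    by simp [e5]⟩
  replace S5 := S4.trans S5
  replace r1 := (ha5.v .u rfl).trans r1
  replace r2 := (ha5.v .ch1 rfl).trans r2
  replace r3 := (ha5.v .ch2 rfl).trans r3
  replace r4 := (ha5.v .d rfl).trans r4
  replace r5 := (ha5.v .n rfl).trans r5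
  replace r6 := (ha5.v .opt rfl).trans r6
  rw [ends_seq]
  refine (join_ends s5 (S5.allDone hD) r4 hside h1U huU h2U le_rfl (by omega) (by omega) i1 i2 i3
    i4 i5 i6 i7 hn12 (Or.inl hn2.symm) hp3).mono ?_
  clear i1 i2 i3 i4 i5 i6 i7
  rintro s6 t6 ha6 ⟨ht6, S6, J6, J6'⟩
  have e6 := ha6.a .tab rfl
  replace r1 := (ha6.v .u rfl).trans r1
  replace r2 := (ha6.v .ch1 rfl).trans r2
  replace r3 := (ha6.v .ch2 rfl).trans r3
  replace r5 := (ha6.v .n rfl).trans r5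
  replace r6 := (ha6.v .opt rfl).trans r6
  replace S6 := S5.trans S6
  have htab : s6.a .tab = s.a .tab := by rw [e6, e5, e4, e3, e2, e1]; rfl
  have hc1 := (hD ch1 h1U).classes 1 le_rfl
  have hc2 := (hD ch2 h2U).classes 1 le_rfl
  have hc := (hD u huU).classes 1 le_rfl
  -- the values of the joins
  have j0 : ∀ q1 < s.a .cnt ch1 1 0 0, ∀ q2 < s.a .cnt ch2 1 0 0,
      s6.a .J 0 q1 q2 0 < s.a .cnt u 1 0 0 ∧ ∀ z, side u z ≠ 1 →
        s.cls u 1 (s6.a .J 0 q1 q2 0) z = min d (s.cls ch1 1 q1 z + s.cls ch2 1 q2 z) := by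
    intro q1 hq1 q2 hq2
    rw [J6' 0 q1 q2 (by omega), e5, J4' 0 q1 q2 (by omega), e3]
    have := J2 q1 (by rwa [S1.cnt]) q2 (by rwa [S1.cnt])
    rw [S1.cnt] at this
    refine ⟨this.1, fun z hz => ?_⟩
    rw [← S1.cls this.1.ne, this.2 z hz, S1.cls hq1.ne, S1.cls hq2.ne]
  have j1 : ∀ q2 < s.a .cnt ch2 1 0 0, ∀ q3 < s.a .cnt u 0 0 0,
      s6.a .J 1 q2 q3 0 < s.a .cnt ch1 0 0 0 ∧ ∀ z, side ch1 z ≠ 0 →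
        s.cls ch1 0 (s6.a .J 1 q2 q3 0) z = min d (s.cls ch2 1 q2 z + s.cls u 0 q3 z) := by
    intro q2 hq2 q3 hq3
    rw [J6' 1 q2 q3 (by omega), e5]
    have := J4 q2 (by rwa [S3.cnt]) q3 (by rwa [S3.cnt])
    rw [S3.cnt] at this
    refine ⟨this.1, fun z hz => ?_⟩
    rw [← S3.cls this.1.ne, this.2 z hz, S3.cls hq2.ne, S3.cls hq3.ne]
  have j2 : ∀ q1 < s.a .cnt ch1 1 0 0, ∀ q3 < s.a .cnt u 0 0 0,
      s6.a .J 2 q1 q3 0 < s.a .cnt ch2 0 0 0 ∧ ∀ z, side ch2 z ≠ 0 →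
        s.cls ch2 0 (s6.a .J 2 q1 q3 0) z = min d (s.cls ch1 1 q1 z + s.cls u 0 q3 z) := by
    intro q1 hq1 q3 hq3
    have := J6 q1 (by rwa [S5.cnt]) q3 (by rwa [S5.cnt])
    rw [S5.cnt] at this
    refine ⟨this.1, fun z hz => ?_⟩
    rw [← S5.cls this.1.ne, this.2 z hz, S5.cls hq1.ne, S5.cls hq3.ne]
  refine (combine_ends (N := N) s6 r1 r2 r3 r6 hn1 hn2 ?_ ?_ ?_ ?_).mono ?_
  · rw [S6.cnt]; exact (hD ch1 h1U).cnt_le 1 le_rfl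
  · rw [S6.cnt]; exact (hD ch2 h2U).cnt_le 1 le_rfl
  · rw [S6.cnt]; exact (hD u huU).cnt_le 0 (by omega)
  · rw [htab]; exact hfresh
  rintro s7 t7 ha7 ⟨ht7, hoff, hO⟩
  have S7 : SameCuts s6 s7 := ⟨ha7.a .st rfl, ha7.a .idx rfl, ha7.a .K rfl, ha7.a .rep rfl,
    ha7.a .cnt rfl, fun _ _ _ _ _ => by rw [ha7.a .vec rfl]⟩
  refine ⟨by unfold joinTime; omega, S6.trans S7, fun x y q q' hxy => ?_, fun q hq q3 hq3 => ?_⟩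
  · rw [hoff _ _ _ _ hxy, htab]
  · have h := hO q q3 (by rwa [S6.cnt])
    rw [S6.cnt] at h
    refine (h.iUnion (S := fun p => {z | ∃ x ∈ Sol H d n sg (side ch1 · = 1) (s.cls ch1 1 p.1)
        (s.cls ch1 0 (s6.a .J 1 p.2 q3 0)), ∃ y ∈ Sol H d n sg (side ch2 · = 1) (s.cls ch2 1 p.2)
        (s.cls ch2 0 (s6.a .J 2 p.1 q3 0)), z = x + y}) ?_).congr fun x => ?_
    · rintro ⟨q1, q2⟩ ⟨hq1, hq2, -⟩
      rw [St.contribution, r5, htab]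
      refine OptCode.sumCode ?_ ?_ fun x hx y hy => Sol.add_le hdisj hx hy
      · exact hT1 q1 hq1 _ (j1 q2 hq2 q3 hq3).1
      · exact hT2 q2 hq2 _ (j2 q1 hq1 q3 hq3).1
    · refine mem_sol_union hc hc1 hc2 (F3 := s.cls u 0 q3) (J0 := fun q1 q2 => s6.a .J 0 q1 q2 0)
        (G1 := fun q2 => s.cls ch1 0 (s6.a .J 1 q2 q3 0))
        (G2 := fun q1 => s.cls ch2 0 (s6.a .J 2 q1 q3 0)) hpart hdisj j0 ?_ ?_ hq
      · intro q2 hq2 z hz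
        exact (j1 q2 hq2 q3 hq3).2 z (by omega)
      · intro q1 hq1 z hz
        exact (j2 q1 hq1 q3 hq3).2 z (by omega)

end Mach

/-! ### The pass over the tree and the final answer -/

namespace Mach

variable {H : SimpleGraph ℕ} {d n N w opt sz : ℕ} {side : ℕ → ℕ → ℕ} {sg : ℕ → ℕ → ℕ}

/-- The arrays represent a rooted binary tree with the nodes `ord 0, …, ord (sz - 1)`, where `ord 0`
is the root, and the cuts of the nodes other than the root are given by `side`. -/
structure Nodes (n sz : ℕ) (side : ℕ → ℕ → ℕ) (s : St) : Prop where
  le_one : ∀ u a, side u a ≤ 1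
  inj : ∀ i < sz, ∀ j < sz, s.a .ord i 0 0 0 = s.a .ord j 0 0 0 → i = j
  leaf : ∀ i < sz, 1 ≤ i → s.a .deg (s.a .ord i 0 0 0) 0 0 0 = 1 →
    s.a .vert (s.a .ord i 0 0 0) 0 0 0 < n ∧
    side (s.a .ord i 0 0 0) (s.a .vert (s.a .ord i 0 0 0) 0 0 0) = 1 ∧
    ∀ z < n, side (s.a .ord i 0 0 0) z = 1 → z = s.a .vert (s.a .ord i 0 0 0) 0 0 0
  inner : ∀ i < sz, 1 ≤ i → s.a .deg (s.a .ord i 0 0 0) 0 0 0 ≠ 1 → ∃ j1 j2, i < j1 ∧ j1 < sz ∧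
    i < j2 ∧ j2 < sz ∧ j1 ≠ j2 ∧ s.a .ch (s.a .ord i 0 0 0) 0 0 0 = s.a .ord j1 0 0 0 ∧
    s.a .ch (s.a .ord i 0 0 0) 1 0 0 = s.a .ord j2 0 0 0 ∧
    (∀ z, side (s.a .ord i 0 0 0) z = 1 ↔
      side (s.a .ord j1 0 0 0) z = 1 ∨ side (s.a .ord j2 0 0 0) z = 1) ∧
    ∀ z, side (s.a .ord j1 0 0 0) z = 1 → ¬ side (s.a .ord j2 0 0 0) z = 1
  two_le : 2 ≤ sz
  child : s.a .ch (s.v .r) 0 0 0 = s.a .ord 1 0 0 0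
  root : 0 < n ∧ side (s.a .ord 1 0 0 0) 0 = 0 ∧ ∀ z < n, side (s.a .ord 1 0 0 0) z = 0 → z = 0

def tableTime (N w : ℕ) : ℕ :=
  (N + 1) * (4 * w + 7) + N * 17 + 3 * joinTime N w + N * (N * (N * 11 + 4) + 4) + 30

/-- The nodes other than the root. -/
def St.nonroot (s : St) (sz : ℕ) : Set ℕ := {u | ∃ i < sz, 1 ≤ i ∧ s.a .ord i 0 0 0 = u}

/-- By `Nodes.inner`, children come later in the search order than their parent, so going through
the order backwards always finds the tables of the children filled. -/
theorem fillTables_ends (s : St) (hN : Nodes n sz side s)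
    (hD : AllDone H d N w side (s.nonroot sz) s) (hd : s.v .d = d) (hd1 : 1 ≤ d) (hn : s.v .n = n)
    (hopt : s.v .opt = opt) (hsz : s.v .s = sz) (hadj : ∀ a b, s.a .adj a b 0 0 = ad H a b)
    (hsig : ∀ i k, s.a .sig i k 0 0 = sg i k) (hsg : ∀ k, sg 0 k ≤ 1)
    (hfresh : ∀ u o x q, s.a .tab u o x q = 0) :
    Ends fillTables s fun s' t => t ≤ (sz - 1) * (tableTime N w + 2) + 2 ∧ SameCuts s s' ∧
      (∀ u x q, s'.a .tab u 0 x q = 0) ∧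
      ∀ i < sz, 1 ≤ i → TabOK H d n sg side opt s (s.a .ord i 0 0 0) 1 s' := by
  set O : ℕ → ℕ := fun i => s.a .ord i 0 0 0 with hO
  rw [fillTables]
  refine (ends_for (fun h s' => SameCuts s s' ∧ (∀ u x q, s'.a .tab u 0 x q = 0) ∧
      (∀ i < sz, 1 ≤ i → sz - h ≤ i → TabOK H d n sg side opt s (O i) 1 s') ∧
      ∀ i, 1 ≤ i → i < sz - h → ∀ x q, s'.a .tab (O i) 1 x q = 0)
      (sz - 1) (tableTime N w) rfl ?_ ?_ ?_).mono ?_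
  · intro s' ha
    simp [ha.v .s rfl, hsz]
  · refine ⟨⟨rfl, rfl, rfl, rfl, rfl, fun _ _ _ _ _ => rfl⟩, fun _ _ _ => hfresh _ _ _ _, ?_,
      fun _ _ _ _ _ => hfresh _ _ _ _⟩
    intro i hi _ hi'; omega
  · rintro h s1 hh ha1 hh1 ⟨hS1, hz1, hT1, hf1⟩
    set i := sz - 1 - h with hi
    have hi1 : 1 ≤ i := by omega
    have his : i < sz := by omega
    have hsub : sz - (h + 1) = i := by omega
    have hsub' : sz - h = i + 1 := by omega
    have r1 := (ha1.v .d rfl).trans hd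
    have r2 := (ha1.v .n rfl).trans hn
    have r3 := (ha1.v .opt rfl).trans hopt
    have r4 := (ha1.v .s rfl).trans hsz
    have e1 := ha1.a .ord rfl
    have e2 := ha1.a .deg rfl
    have e3 := ha1.a .vert rfl
    have e4 := ha1.a .ch rfl
    have e5 := ha1.a .adj rfl
    have e6 := ha1.a .sig rfl
    have hmem : ∀ j < sz, 1 ≤ j → O j ∈ s.nonroot sz := fun j hj hj1 => ⟨j, hj, hj1, rfl⟩
    -- the invariant after the table of `O i` has been filled
    have hfin : ∀ s2 : St, SameCuts s1 s2 →
        (∀ x y q q', ¬ (x = O i ∧ y = 1) → s2.a .tab x y q q' = s1.a .tab x y q q') →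
        TabOK H d n sg side opt s1 (O i) 1 s2 → SameCuts s s2 ∧ (∀ u x q, s2.a .tab u 0 x q = 0) ∧
        (∀ j < sz, 1 ≤ j → sz - (h + 1) ≤ j → TabOK H d n sg side opt s (O j) 1 s2) ∧
        ∀ j, 1 ≤ j → j < sz - (h + 1) → ∀ x q, s2.a .tab (O j) 1 x q = 0 := by
      intro s2 hS2 hoff hT2
      have hne : ∀ j < sz, j ≠ i → O j ≠ O i := fun j hj hji heq => hji (hN.inj j hj i his heq)
      refine ⟨hS1.trans hS2, fun u x q => ?_, fun j hj hj1 hij => ?_, fun j hj1 hij x q => ?_⟩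
      · rw [hoff _ _ _ _ (by omega)]; exact hz1 u x q
      · by_cases hji : j = i
        · rw [hji]; exact hT2.congr_cuts hS1
        · exact (hT1 j hj hj1 (by omega)).congr fun q q' =>
            hoff _ _ _ _ fun h => hne j hj hji h.1
      · rw [hoff _ _ _ _ fun h => hne j (by omega) (by omega) h.1]
        exact hf1 j hj1 (by omega) x q
    rw [ends_seq, ends_assign, ends_ite]
    simp only [Ex.neq_eval]
    simp only [Ex.eval_get, Ex.eval_var, Ex.eval_lit, Ex.eval_ofNat, Ex.eval_sub, St.setV_v,
      St.setV_a, if_true, r4, hh1, e1, e2, ← hi]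
    change if s.a .deg (O i) 0 0 0 = 1 then _ else _
    split_ifs with hdeg
    · obtain ⟨hvn, hv1, hv2⟩ := hN.leaf i his hi1 hdeg
      rw [ends_seq, ends_assign, ends_seq, ends_assign, ends_seq, ends_assign]
      simp only [Ex.eval_get, Ex.eval_var, Ex.eval_lit, Ex.eval_ofNat, St.setV_v, St.setV_a,
        reduceCtorEq, if_false, if_true, e3]
      refine (leafTable_tabOK (H := H) (d := d) (N := N) (w := w) (n := n) (sg := sg) (side := side)
        (opt := opt) _ (u := O i) (o := 1) (v := s.a .vert (O i) 0 0 0) ?_ (hN.le_one _) le_rfl hd1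
        ?_ ?_ ?_ ?_ hvn hv1 hv2 ?_ ?_ hsg ?_).mono ?_
      · exact (hS1.allDone hD (O i) (hmem i his hi1)).congr (fun _ => rfl) (fun _ => rfl)
          (fun _ => rfl) (fun _ _ => rfl) (fun _ => rfl) (fun _ _ _ _ => rfl)
      · simp [hO]
      · simp
      · simp [hO]
      · simp [r3]
      · simp only [St.setV_a, e5]; exact hadj
      · simp only [St.setV_a, e6]; exact hsig
      · simp only [St.setV_a]; exact hf1 i hi1 (by omega)
      rintro s2 t2 ha2 ⟨ht2, hS2, hoff, hT2⟩
      obtain ⟨k1, k2, k3, k4⟩ := hfin s2 ⟨hS2.st, hS2.idx, hS2.K, hS2.rep, hS2.cnt, hS2.vec⟩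
        hoff hT2
      exact ⟨⟨⟨k1.st, k1.idx, k1.K, k1.rep, k1.cnt, k1.vec⟩, k2, k3, k4⟩, by
        unfold tableTime; omega⟩
    · obtain ⟨j1, j2, hj1, hj1s, hj2, hj2s, hj12, hc1, hc2, hp, hdis⟩ := hN.inner i his hi1 hdeg
      refine (innerTable_tabOK (H := H) (d := d) (N := N) (w := w) (n := n) (sg := sg) (side := side)
        (opt := opt) (s1.setV .u (O i)) (U := s.nonroot sz) (u := O i) (ch1 := O j1) (ch2 := O j2)
        ?_ ?_ hN.le_one (hmem i his hi1) (hmem j1 hj1s (by omega)) (hmem j2 hj2s (by omega)) ?_ ?_ ?_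
        ?_ ?_ ?_ ?_ ?_ hp hdis ?_ ?_ ?_).mono ?_
      · intro u hu
        exact (hS1.allDone hD u hu).congr (fun _ => rfl) (fun _ => rfl)
          (fun _ => rfl) (fun _ _ => rfl) (fun _ => rfl) (fun _ _ _ _ => rfl)
      · simp [r1]
      · simp
      · simp only [St.setV_a, e4]; exact hc1
      · simp only [St.setV_a, e4]; exact hc2
      · simp [r2]
      · simp [r3]
      · intro he; have := hN.inj _ hj1s _ his he; omega
      · intro he; have := hN.inj _ hj2s _ his he; omega
      · intro he; exact hj12 (hN.inj _ hj1s _ hj2s he)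
      · intro q hq q' hq'
        exact ((hT1 j1 hj1s (by omega) (by omega))).congr_cuts' hS1 q hq q' hq'
      · intro q hq q' hq'
        exact ((hT1 j2 hj2s (by omega) (by omega))).congr_cuts' hS1 q hq q' hq'
      · simp only [St.setV_a]; exact hf1 i hi1 (by omega)
      rintro s2 t2 ha2 ⟨ht2, hS2, hoff, hT2⟩
      obtain ⟨k1, k2, k3, k4⟩ := hfin s2 ⟨hS2.st, hS2.idx, hS2.K, hS2.rep, hS2.cnt, hS2.vec⟩
        hoff hT2
      exact ⟨⟨⟨k1.st, k1.idx, k1.K, k1.rep, k1.cnt, k1.vec⟩, k2, k3, k4⟩, by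
        unfold tableTime; omega⟩
  · rintro s' t - ⟨⟨hS, hz, hT, -⟩, ht⟩
    exact ⟨ht, hS, hz, fun i hi hi1 => hT i hi hi1 (by omega)⟩

/-- The cut below the root separates the vertex 0 from all other vertices. Both sides of this one
cut have correct tables, and `mem_allSizes` puts them together. -/
theorem finish_ends (s : St) (hN : Nodes n sz side s)
    (hD : AllDone H d N w side (s.nonroot sz) s) (hd1 : 1 ≤ d) (hn : s.v .n = n)
    (hopt : s.v .opt = opt) (hadj : ∀ a b, s.a .adj a b 0 0 = ad H a b)
    (hsig : ∀ i k, s.a .sig i k 0 0 = sg i k) (hsg : ∀ k, sg 0 k ≤ 1)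
    (hfresh : ∀ u x q, s.a .tab u 0 x q = 0) (hfin : s.a .fin 0 0 0 0 = 0)
    (hT : TabOK H d n sg side opt s (s.a .ord 1 0 0 0) 1 s) :
    Ends finish s fun s' t => t ≤ (N + 1) * (4 * w + 7) + N * 17 + N * (N * 11 + 4) + 10 ∧
      ∃ y, OptCode opt (allSizes H d n sg) y ∧ s'.v .out0 = min y 1 ∧ s'.v .out1 = y - 1 := by
  set c := s.a .ord 1 0 0 0 with hc
  have hcU : c ∈ s.nonroot sz := ⟨1, hN.two_le, le_rfl, rfl⟩
  have hDc := hD c hcU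
  obtain ⟨h0n, h0, h0'⟩ := hN.root
  rw [finish, ends_seq, ends_assign, ends_seq, ends_assign, ends_seq, ends_assign, ends_seq,
    ends_assign, ends_seq]
  simp only [Ex.eval_get, Ex.eval_var, Ex.eval_lit, Ex.eval_ofNat, St.setV_v, if_true, hN.child,
    ← hc]
  refine (leafTable_tabOK (H := H) (d := d) (N := N) (w := w) (n := n) (sg := sg) (side := side)
    (opt := opt) _ (u := c) (o := 0) (v := 0) ?_ (hN.le_one _) (by omega) hd1
    ?_ ?_ ?_ ?_ h0n h0 h0' ?_ ?_ hsg ?_).mono ?_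
  · exact hDc.congr (fun _ => rfl) (fun _ => rfl)
      (fun _ => rfl) (fun _ _ => rfl) (fun _ => rfl) (fun _ _ _ _ => rfl)
  · simp
  · simp
  · simp
  · simp [hopt]
  · simpa using hadj
  · simpa using hsig
  · simpa using hfresh c
  rintro s1 t1 ha1 ⟨ht1, hS1, hoff1, hT1⟩
  have r1 := ha1.v .c rfl
  have r2 := (ha1.v .n rfl)
  have r3 := (ha1.v .opt rfl)
  have e1 := ha1.a .fin rfl
  simp only [St.setV_v, St.setV_a, reduceCtorEq, if_false, if_true, hn, hopt] at r1 r2 r3 e1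
  replace hS1 : SameCuts s s1 := ⟨hS1.st, hS1.idx, hS1.K, hS1.rep, hS1.cnt, hS1.vec⟩
  replace hT1 : TabOK H d n sg side opt s c 0 s1 := hT1
  replace hT : TabOK H d n sg side opt s c 1 s1 := hT.congr fun q q' => hoff1 _ _ _ _ (by omega)
  set C1 := s.a .cnt c 1 0 0 with hC1
  set C0 := s.a .cnt c 0 0 0 with hC0
  let code : ℕ × ℕ → ℕ := fun p => sumCode n (s1.a .tab c 1 p.1 p.2) (s1.a .tab c 0 p.2 p.1)
  rw [ends_seq]
  refine (ends_for (fun i s' => OptCode opt {x | ∃ p : ℕ × ℕ, (p.1 < i ∧ p.2 < C0) ∧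
      code p = x + 1} (s'.a .fin 0 0 0 0)) C1 (C0 * 11 + 2) rfl ?_ ?_ ?_).mono ?_
  · intro s' ha
    simp [ha.v .c rfl, ha.a .cnt rfl, r1, hS1.cnt, hC1]
  · rw [St.setV_a, e1, hfin]
    exact (OptCode.zero opt).congr (by simp)
  · intro i s2 hi ha2 hi2 hI2
    refine (ends_for (fun j s' => OptCode opt {x | ∃ p : ℕ × ℕ, ((p.1 < i ∧ p.2 < C0) ∨
      (p.1 = i ∧ p.2 < j)) ∧ code p = x + 1} (s'.a .fin 0 0 0 0)) C0 9 rfl ?_ ?_ ?_).mono ?_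
    · intro s' ha
      simp [ha.v .c rfl, ha.a .cnt rfl, ha2.v .c rfl, ha2.a .cnt rfl, r1, hS1.cnt, hC0]
    · refine hI2.congr fun x => ?_
      simp
    · intro j s3 hj ha3 hj3 hI3
      have f1 := (ha3.v .c rfl).trans ((ha2.v .c rfl).trans r1)
      have f2 := (ha3.v .n rfl).trans ((ha2.v .n rfl).trans r2)
      have f3 := (ha3.v .opt rfl).trans ((ha2.v .opt rfl).trans r3)
      have f4 := (ha3.v .q1 rfl).trans hi2
      have g1 := (ha3.a .tab rfl).trans (ha2.a .tab rfl)
      rw [ends_seq, ends_assign, ends_seq, ends_assign, ends_seq]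
      simp only [Ex.eval_get, Ex.eval_var, Ex.eval_ofNat, f1, f4, hj3, g1,
        St.setV_v, St.setV_a, reduceCtorEq, if_false]
      refine (addSizes_ends _).mono ?_
      rintro s4 t4 - ⟨ht4, rfl⟩
      simp only [St.setV_v, reduceCtorEq, if_false, if_true, f2]
      refine (relax_ends _ .fin 0 0 0 0 (i' := 0) (j' := 0) (k' := 0) (l' := 0) (opt := opt)
        (val := code (i, j)) ?_ ?_ ?_ ?_ ?_ ?_ ?_).mono ?_
      · simp [f3]
      · simp [code]
      · intro e; simp
      · intro e; simp
      · intro e; simp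
      · intro e; simp
      · simp
      rintro s5 t5 ha5 ⟨ht5, hu5, -⟩
      simp only [St.setV_a] at hu5
      refine ⟨?_, by omega⟩
      rw [hu5]
      refine (hI3.relaxed _).congr fun x => ?_
      simp only [Set.mem_ofPred_eq, Set.mem_union]
      constructor
      · rintro ⟨p, (hp | ⟨h, h'⟩), hx⟩
        · exact Or.inl ⟨p, Or.inl hp, hx⟩
        · rcases Nat.lt_succ_iff_lt_or_eq.mp h' with h' | h'
          · exact Or.inl ⟨p, Or.inr ⟨h, h'⟩, hx⟩
          · rw [show p = (i, j) from Prod.ext h h'] at hx; exact Or.inr hx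
      · rintro (⟨p, (hp | ⟨h, h'⟩), hx⟩ | hx)
        · exact ⟨p, Or.inl hp, hx⟩
        · exact ⟨p, Or.inr ⟨h, by omega⟩, hx⟩
        · exact ⟨(i, j), Or.inr ⟨rfl, by simp⟩, hx⟩
    · rintro s3 t3 - ⟨hI, ht⟩
      refine ⟨hI.congr fun x => ?_, ht⟩
      simp only [Set.mem_ofPred_eq]
      refine exists_congr fun p => and_congr_left fun _ => ?_
      omega
  rintro s2 t2 ha2 ⟨hI, ht⟩
  rw [ends_seq, ends_assign, ends_assign]
  have hle1 : C1 ≤ N := hDc.cnt_le 1 le_rfl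
  have hle0 : C0 ≤ N := hDc.cnt_le 0 (by omega)
  have hle : C1 * (C0 * 11 + 2 + 2) ≤ N * (N * 11 + 4) := by
    rw [Nat.add_assoc]; gcongr
  refine ⟨by omega, s2.a .fin 0 0 0 0, ?_, by simp, by simp⟩
  refine (hI.iUnion (S := fun p => {z | ∃ x ∈ Sol H d n sg (side c · = 1) (s.cls c 1 p.1)
      (s.cls c 0 p.2), ∃ y ∈ Sol H d n sg (side c · = 0) (s.cls c 0 p.2) (s.cls c 1 p.1),
      z = x + y}) ?_).congr fun x => ?_
  · rintro ⟨q1, q2⟩ ⟨hq1, hq2⟩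
    refine OptCode.sumCode (hT q1 hq1 q2 hq2) (hT1 q2 hq2 q1 hq1) fun x hx y hy =>
      Sol.add_le (fun z h h' => by omega) hx hy
  · exact mem_allSizes (hN.le_one c) (hDc.classes 1 le_rfl) (hDc.classes 0 (by omega))

end Mach

namespace Mach

/-! ### Reading the graph -/

/-- The pairs `(A t, B t)`, `t < m`, are the edges of `H`, each one listed exactly once, and their
ends are less than `n`. -/
structure EdgeData (H : SimpleGraph ℕ) (n m : ℕ) (A B : ℕ → ℕ) : Prop where
  adj : ∀ t < m, H.Adj (A t) (B t)
  cover : ∀ a b, H.Adj a b → ∃ t < m, (A t = a ∧ B t = b) ∨ (A t = b ∧ B t = a)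
  inj : ∀ t < m, ∀ t' < m, (A t = A t' ∧ B t = B t') ∨ (A t = B t' ∧ B t = A t') → t = t'
  lt : ∀ a b, H.Adj a b → a < n

variable {H : SimpleGraph ℕ} {n m : ℕ} {A B : ℕ → ℕ}

theorem readEdges_ends (s : St) (hE : EdgeData H n m A B) (hm : s.v .m = m)
    (hA : ∀ t < m, s.inp (2 + 2 * t) = A t) (hB : ∀ t < m, s.inp (3 + 2 * t) = B t)
    (h0 : ∀ a b, s.a .adj a b 0 0 = 0) :
    Ends readEdges s fun s' t => t ≤ m * 4 + 2 ∧ ∀ a b, s'.a .adj a b 0 0 = ad H a b := by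
  rw [readEdges]
  refine (ends_for (fun i s' => ∀ a b, (s'.a .adj a b 0 0 = 0 ∨ s'.a .adj a b 0 0 = 1) ∧
      (s'.a .adj a b 0 0 = 1 ↔ ∃ t < i, (A t = a ∧ B t = b) ∨ (A t = b ∧ B t = a))) m 2 rfl
      ?_ ?_ ?_).mono ?_
  · intro s' ha; simp [ha.v .m rfl, hm]
  · simp [h0]
  · intro i s1 hi ha hi1 hI
    rw [ends_seq, ends_store, ends_store]
    simp only [Ex.eval_inp, Ex.eval_add, Ex.eval_mul, Ex.eval_ofNat, Ex.eval_var, Ex.eval_lit,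
      St.setA_v, St.setA_inp, ha.inp, hi1, hA i hi, hB i hi]
    refine ⟨fun a b => ?_, by omega⟩
    simp only [St.setV_a, St.setA_a, and_true, true_and]
    obtain ⟨h1, h2⟩ := hI a b
    have h3 : (∃ t < i + 1, (A t = a ∧ B t = b) ∨ (A t = b ∧ B t = a)) ↔
        (∃ t < i, (A t = a ∧ B t = b) ∨ (A t = b ∧ B t = a)) ∨
          ((A i = a ∧ B i = b) ∨ (A i = b ∧ B i = a)) := by
      constructor
      · rintro ⟨t, ht, h⟩
        rcases Nat.lt_succ_iff_lt_or_eq.mp ht with ht | rfl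
        exacts [Or.inl ⟨t, ht, h⟩, Or.inr h]
      · rintro (⟨t, ht, h⟩ | h)
        exacts [⟨t, by omega, h⟩, ⟨i, by omega, h⟩]
    rw [h3]
    split_ifs with c1 c2
    · exact ⟨Or.inr rfl, by simp only [true_iff]; right; right; omega⟩
    · exact ⟨Or.inr rfl, by simp only [true_iff]; right; left; omega⟩
    · refine ⟨h1, h2.trans ⟨Or.inl, ?_⟩⟩
      rintro (h | h)
      · exact h
      · omega
  · rintro s' t - ⟨hI, ht⟩
    refine ⟨ht, fun a b => ?_⟩
    obtain ⟨h1, h2⟩ := hI a b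
    unfold ad
    split_ifs with hab
    · exact h2.mpr (hE.cover a b hab)
    · rcases h1 with h1 | h1
      · exact h1
      · obtain ⟨t, ht, ⟨rfl, rfl⟩ | ⟨rfl, rfl⟩⟩ := h2.mp h1
        exacts [absurd (hE.adj t ht) hab, absurd (hE.adj t ht).symm hab]

/-- The edges with the second end less than `b` have been listed, and of the edges with the second
end `b`, those from the set `D` of positions in the input. -/
structure Sorted (H : SimpleGraph ℕ) (A B : ℕ → ℕ) (b : ℕ) (D : ℕ → Prop) (e : ℕ)
    (X Y : ℕ → ℕ) : Prop where
  adj : ∀ i < e, H.Adj (X i) (Y i)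
  strict : ∀ j < e, ∀ i < j, X i = X j → Y i < Y j
  src : ∀ i < e, Y i < b ∨ Y i = b ∧ ∃ t, D t ∧
    ((A t = X i ∧ B t = b) ∨ (A t = b ∧ B t = X i))
  cover : ∀ x y, y < b → H.Adj x y → ∃ i < e, X i = x ∧ Y i = y
  cover' : ∀ t, D t → ∀ x, ((A t = x ∧ B t = b) ∨ (A t = b ∧ B t = x)) →
    ∃ i < e, X i = x ∧ Y i = b

theorem Sorted.push {b t x e : ℕ} {D : ℕ → Prop} {X Y X' Y' : ℕ → ℕ} (hE : EdgeData H n m A B)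
    (h : Sorted H A B b D e X Y) (hD : ∀ t, D t → t < m) (ht : t < m) (hDt : ¬ D t)
    (hx : (A t = x ∧ B t = b) ∨ (A t = b ∧ B t = x))
    (hX : ∀ i < e, X' i = X i) (hY : ∀ i < e, Y' i = Y i) (hXe : X' e = x) (hYe : Y' e = b) :
    Sorted H A B b (fun t' => D t' ∨ t' = t) (e + 1) X' Y' := by
  have hadj := hE.adj t ht
  refine ⟨fun i hi => ?_, fun j hj i hi he => ?_, fun i hi => ?_, fun x' y hy hxy => ?_,
    fun t' ht' x' hx' => ?_⟩
  · rcases Nat.lt_succ_iff_lt_or_eq.mp hi with hi | rfl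
    · rw [hX i hi, hY i hi]; exact h.adj i hi
    · rw [hXe, hYe]
      rcases hx with ⟨rfl, rfl⟩ | ⟨rfl, rfl⟩
      exacts [hadj, hadj.symm]
  · rcases Nat.lt_succ_iff_lt_or_eq.mp hj with hj | rfl
    · rw [hX i (by omega), hX j hj] at he
      rw [hY i (by omega), hY j hj]
      exact h.strict j hj i hi he
    · rw [hX i hi, hXe] at he
      rw [hY i hi, hYe]
      -- An earlier pair with both ends equal would come from another position with the same edge,
      -- which `inj` excludes.
      rcases h.src i hi with h' | ⟨-, t', ht', h'⟩
      · exact h'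
      · exfalso
        rw [he] at h'
        have : t = t' := hE.inj t ht t' (hD t' ht') (by omega)
        exact hDt (this ▸ ht')
  · rcases Nat.lt_succ_iff_lt_or_eq.mp hi with hi | rfl
    · rw [hX i hi, hY i hi]
      rcases h.src i hi with h' | ⟨h', t', ht', h''⟩
      exacts [Or.inl h', Or.inr ⟨h', t', Or.inl ht', h''⟩]
    · rw [hXe, hYe]
      exact Or.inr ⟨rfl, t, Or.inr rfl, hx⟩
  · obtain ⟨i, hi, h1, h2⟩ := h.cover x' y hy hxy
    exact ⟨i, by omega, by rw [hX i hi, h1], by rw [hY i hi, h2]⟩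
  · rcases ht' with ht' | rfl
    · obtain ⟨i, hi, h1, h2⟩ := h.cover' t' ht' x' hx'
      exact ⟨i, by omega, by rw [hX i hi, h1], by rw [hY i hi, h2]⟩
    -- The ends of an edge differ, so only one of them is `b`, and `x'` is the other one, `x`.
    · have := hadj.ne
      exact ⟨e, by omega, by rw [hXe]; omega, hYe⟩

theorem Sorted.skip {b t e : ℕ} {D : ℕ → Prop} {X Y : ℕ → ℕ} (h : Sorted H A B b D e X Y)
    (h1 : A t ≠ b) (h2 : B t ≠ b) : Sorted H A B b (fun t' => D t' ∨ t' = t) e X Y where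
  adj := h.adj
  strict := h.strict
  src i hi := (h.src i hi).imp_right fun ⟨h', t', ht', h''⟩ => ⟨h', t', Or.inl ht', h''⟩
  cover := h.cover
  cover' t' ht' x hx := by
    rcases ht' with ht' | rfl
    exacts [h.cover' t' ht' x hx, by omega]

theorem Sorted.congr {b e : ℕ} {D D' : ℕ → Prop} {X Y : ℕ → ℕ} (h : Sorted H A B b D e X Y)
    (hD : ∀ t, D' t ↔ D t) : Sorted H A B b D' e X Y := by
  rwa [show D' = D from funext fun t => propext (hD t)]

theorem Sorted.next {b e : ℕ} {X Y : ℕ → ℕ} (hE : EdgeData H n m A B)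
    (h : Sorted H A B b (fun t => t < m) e X Y) : Sorted H A B (b + 1) (fun t => t < 0) e X Y where
  adj := h.adj
  strict := h.strict
  src i hi := by rcases h.src i hi with h | h <;> omega
  cover x y hy hxy := by
    rcases Nat.lt_succ_iff_lt_or_eq.mp hy with hy | rfl
    · exact h.cover x y hy hxy
    · obtain ⟨t, ht, h'⟩ := hE.cover x y hxy
      exact h.cover' t ht x (by omega)
  cover' t ht := absurd ht (Nat.not_lt_zero t)

theorem pushEdge_ends (s : St) {a : Ex} {e x b : ℕ} (he : s.v .e = e) (ha : a.eval s = x)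
    (hb : s.v .b = b) : Ends (pushEdge a) s fun s' t => t = 3 ∧ s'.v .e = e + 1 ∧
      (∀ i < e, s'.a .ea i 0 0 0 = s.a .ea i 0 0 0) ∧
      (∀ i < e, s'.a .eb i 0 0 0 = s.a .eb i 0 0 0) ∧
      s'.a .ea e 0 0 0 = x ∧ s'.a .eb e 0 0 0 = b := by
  rw [pushEdge, ends_seq, ends_store, ends_seq, ends_store, ends_assign]
  simp only [Ex.eval_var, Ex.eval_lit, Ex.eval_add, Ex.eval_ofNat, St.setA_v, he, ha, hb,
    St.setV_v, if_true, St.setV_a]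
  refine ⟨by norm_num, by trivial, fun i hi => ?_, fun i hi => ?_, ?_, ?_⟩
  · simp [hi.ne]
  · simp [hi.ne]
  · simp
  · simp

/-- By `strict` the listed pairs are distinct, and each one is an edge in one of its two
orientations. -/
theorem EdgeSeq.le_two_mul {e : ℕ} {X Y : ℕ → ℕ} (hE : EdgeData H n m A B) (h : EdgeSeq H e X Y) :
    e ≤ 2 * m := by
  have hsub : (Finset.range e).image (fun i => (X i, Y i)) ⊆
      (Finset.range m).image (fun t => (A t, B t)) ∪
        (Finset.range m).image (fun t => (B t, A t)) := by
    intro p hp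
    obtain ⟨i, hi, rfl⟩ := Finset.mem_image.mp hp
    obtain ⟨t, ht, h' | h'⟩ := hE.cover _ _ (h.adj i (Finset.mem_range.mp hi))
    · exact Finset.mem_union_left _ (Finset.mem_image.mpr
        ⟨t, Finset.mem_range.mpr ht, Prod.ext h'.1 h'.2⟩)
    · exact Finset.mem_union_right _ (Finset.mem_image.mpr
        ⟨t, Finset.mem_range.mpr ht, Prod.ext h'.2 h'.1⟩)
  have hinj : Set.InjOn (fun i => (X i, Y i)) (Finset.range e : Set ℕ) := by
    intro i hi j hj hij
    simp only [Finset.coe_range, Set.mem_Iio, Prod.mk.injEq] at hi hj hij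
    rcases lt_trichotomy i j with h1 | h1 | h1
    · have := h.strict j hj i h1 hij.1; omega
    · exact h1
    · have := h.strict i hi j h1 hij.1.symm; omega
  have := Finset.card_le_card hsub
  rw [Finset.card_image_of_injOn hinj, Finset.card_range] at this
  refine this.trans ((Finset.card_union_le _ _).trans ?_)
  have h1 := Finset.card_image_le (s := Finset.range m) (f := fun t => (A t, B t))
  have h2 := Finset.card_image_le (s := Finset.range m) (f := fun t => (B t, A t))
  rw [Finset.card_range] at h1 h2
  omega

/-- Round `b` appends the pairs with second end `b`. Second ends hence never decrease along the
list, and an equal second end with an equal first end would be a repeated edge. -/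
theorem sortEdges_ends (s : St) (hE : EdgeData H n m A B) (hn : s.v .n = n) (hm : s.v .m = m)
    (hA : ∀ t < m, s.inp (2 + 2 * t) = A t) (hB : ∀ t < m, s.inp (3 + 2 * t) = B t) :
    Ends sortEdges s fun s' t => t ≤ n * (m * 10 + 4) + 3 ∧
      EdgeSeq H (s'.v .e) (s'.a .ea · 0 0 0) (s'.a .eb · 0 0 0) ∧ s'.v .e ≤ 2 * m := by
  rw [sortEdges, ends_seq, ends_assign]
  refine (ends_for (fun b s' => Sorted H A B b (fun t => t < 0) (s'.v .e) (s'.a .ea · 0 0 0)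
    (s'.a .eb · 0 0 0)) n (m * 10 + 2) rfl ?_ ?_ ?_).mono ?_
  · intro s' ha; simp [ha.v .n rfl, hn]
  · simp only [Ex.eval_ofNat, St.setV_v, reduceCtorEq, if_false, if_true]
    exact ⟨by simp, by simp, by simp, by simp, by simp⟩
  · intro b s1 hb ha hb1 hI
    refine (ends_for (fun i s' => Sorted H A B b (fun t => t < i) (s'.v .e) (s'.a .ea · 0 0 0)
      (s'.a .eb · 0 0 0)) m 8 rfl ?_ ?_ ?_).mono ?_
    · intro s' ha'; simp [ha'.v .m rfl, ha.v .m rfl, hm]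
    · exact hI
    · intro i s2 hi ha2 hi2 hI2
      have hb2 := (ha2.v .b rfl).trans hb1
      have hinp : s2.inp = s.inp := (ha2.inp.trans ha.inp)
      have hadj := (hE.adj i hi).ne
      have hAi : (Ex.inp (2 + 2 * .var .t)).eval s2 = A i := by
        simp [hinp, hi2, hA i hi]
      have hBi : (Ex.inp (3 + 2 * .var .t)).eval s2 = B i := by
        simp [hinp, hi2, hB i hi]
      have hlt : ∀ t, t < i + 1 ↔ t < i ∨ t = i := fun t => Nat.lt_succ_iff_lt_or_eq
      rw [ends_seq, ends_ite]
      simp only [Ex.neq_eval, hAi, Ex.eval_var, hb2]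
      split_ifs with h1
      · refine (pushEdge_ends s2 rfl hBi hb2).mono ?_
        rintro s3 t3 ha3 ⟨rfl, e1, e2, e3, e4, e5⟩
        have hb3 := (ha3.v .b rfl).trans hb2
        have hBi' : (Ex.inp (3 + 2 * .var .t)).eval s3 = B i := by
          simp [hinp, ha3.inp, ha3.v .t rfl, hi2, hB i hi]
        rw [ends_ite]
        simp only [Ex.neq_eval, hBi', Ex.eval_var, hb3]
        -- The first end is `b`, so the second one is not, and the second test does nothing.
        rw [if_neg (by omega), ends_skip]
        refine ⟨?_, by omega⟩
        simp only [St.setV_v, St.setV_a, reduceCtorEq, if_false, e1]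
        exact (hI2.push hE (fun t ht => by omega) hi (by omega) (Or.inr ⟨h1, rfl⟩) e2 e3 e4 e5).congr
          hlt
      · rw [ends_skip, ends_ite]
        simp only [Ex.neq_eval, hBi, Ex.eval_var, hb2]
        split_ifs with h2
        · refine (pushEdge_ends s2 rfl hAi hb2).mono ?_
          rintro s3 t3 ha3 ⟨rfl, e1, e2, e3, e4, e5⟩
          refine ⟨?_, by omega⟩
          simp only [St.setV_v, St.setV_a, reduceCtorEq, if_false, e1]
          exact (hI2.push hE (fun t ht => by omega) hi (by omega) (Or.inl ⟨rfl, h2⟩) e2 e3 e4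
            e5).congr hlt
        · rw [ends_skip]
          refine ⟨?_, by omega⟩
          exact (hI2.skip h1 h2).congr hlt
    · rintro s2 t2 - ⟨hI2, ht2⟩
      exact ⟨hI2.next hE, ht2⟩
  · rintro s' t - ⟨hI, ht⟩
    have hseq : EdgeSeq H (s'.v .e) (s'.a .ea · 0 0 0) (s'.a .eb · 0 0 0) :=
      ⟨hI.adj, fun a b hab => hI.cover a b (hE.lt b a hab.symm) hab, hI.strict⟩
    refine ⟨?_, hseq, hseq.le_two_mul hE⟩
    rw [Nat.add_assoc _ 2 2, show 2 + 2 = 4 from rfl] at ht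
    omega

end Mach

namespace Mach

/-! ### Reading the tree -/

/-- The neighbours of `x` are `nb x 0, …, nb x (deg x - 1)`. -/
structure NbData (T : SimpleGraph ℕ) (deg : ℕ → ℕ) (nb : ℕ → ℕ → ℕ) : Prop where
  adj : ∀ x y, T.Adj x y ↔ ∃ i < deg x, nb x i = y
  inj : ∀ x, ∀ i < deg x, ∀ j < deg x, nb x i = nb x j → i = j

variable {T : SimpleGraph ℕ} {sz k : ℕ} {A B : ℕ → ℕ}

/-- Append `y` to the list of the neighbours of `x`. -/
theorem nb_push {deg deg' : ℕ → ℕ} {nb nb' : ℕ → ℕ → ℕ} {R R' : ℕ → ℕ → Prop} {x y : ℕ}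
    (hadj : ∀ a b, R a b ↔ ∃ i < deg a, nb a i = b)
    (hinj : ∀ a, ∀ i < deg a, ∀ j < deg a, nb a i = nb a j → i = j) (hxy : ¬ R x y)
    (hd : ∀ a, deg' a = if a = x then deg a + 1 else deg a)
    (hnb : ∀ a i, nb' a i = if a = x ∧ i = deg x then y else nb a i)
    (hR' : ∀ a b, R' a b ↔ R a b ∨ (a = x ∧ b = y)) :
    (∀ a b, R' a b ↔ ∃ i < deg' a, nb' a i = b) ∧
      ∀ a, ∀ i < deg' a, ∀ j < deg' a, nb' a i = nb' a j → i = j := by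
  constructor
  · intro a b
    rw [hR', hadj, hd]
    by_cases hax : a = x
    · subst hax
      rw [if_pos rfl]
      constructor
      · rintro (⟨i, hi, h⟩ | ⟨-, rfl⟩)
        · exact ⟨i, by omega, by rw [hnb, if_neg (by omega)]; exact h⟩
        · exact ⟨deg a, by omega, by rw [hnb, if_pos ⟨rfl, rfl⟩]⟩
      · rintro ⟨i, hi, h⟩
        rw [hnb] at h
        split_ifs at h with hc
        · exact Or.inr ⟨rfl, h.symm⟩
        · exact Or.inl ⟨i, by omega, h⟩
    · simp [hax, hnb]
  · intro a i hi j hj hij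
    rw [hd] at hi hj
    rw [hnb, hnb] at hij
    by_cases hax : a = x
    · subst hax
      simp only [true_and, if_true] at *
      split_ifs at hij with h1 h2 h2
      · omega
      · exact absurd ((hadj _ _).mpr ⟨j, by omega, hij.symm⟩) hxy
      · exact absurd ((hadj _ _).mpr ⟨i, by omega, hij⟩) hxy
      · exact hinj a i (by omega) j (by omega) hij
    · simp only [hax, false_and, if_false] at *
      exact hinj a i hi j hj hij

theorem pushNb_ends (s : St) (x y : Var) {x' y' : ℕ} (hx : s.v x = x') (hy : s.v y = y') :
    Ends (pushNb x y) s fun s' t => t = 2 ∧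
      (∀ a, s'.a .deg a 0 0 0 = if a = x' then s.a .deg a 0 0 0 + 1 else s.a .deg a 0 0 0) ∧
      ∀ a i, s'.a .nb a i 0 0 = if a = x' ∧ i = s.a .deg x' 0 0 0 then y' else s.a .nb a i 0 0 := by
  subst hx hy
  rw [pushNb, ends_seq, ends_store, ends_store]
  refine ⟨rfl, fun a => ?_, fun a i => ?_⟩
  · simp only [Ex.eval_get, Ex.eval_var, Ex.eval_lit, Ex.eval_add, Ex.eval_ofNat, St.setA_v,
      St.setA_a, reduceCtorEq, false_and, if_false, true_and, and_true]
    split_ifs with h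
    · rw [h]
    · rfl
  · simp

theorem readTree_ends (s : St) {m : ℕ} (hE : EdgeData T sz (sz - 1) A B) (hs : s.v .s = sz)
    (hm : s.v .m = m) (hA : ∀ t < sz - 1, s.inp (3 + 2 * m + 2 * t) = A t)
    (hB : ∀ t < sz - 1, s.inp (4 + 2 * m + 2 * t) = B t) (h0 : ∀ x, s.a .deg x 0 0 0 = 0) :
    Ends readTree s fun s' t => t ≤ (sz - 1) * 8 + 2 ∧
      NbData T (s'.a .deg · 0 0 0) (s'.a .nb · · 0 0) := by
  rw [readTree]
  refine (ends_for (fun i s' =>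
      (∀ a b, (∃ t < i, (A t = a ∧ B t = b) ∨ (A t = b ∧ B t = a)) ↔
        ∃ j < s'.a .deg a 0 0 0, s'.a .nb a j 0 0 = b) ∧
      ∀ a, ∀ i < s'.a .deg a 0 0 0, ∀ j < s'.a .deg a 0 0 0, s'.a .nb a i 0 0 = s'.a .nb a j 0 0 →
        i = j) (sz - 1) 6 rfl ?_ ?_ ?_).mono ?_
  · intro s' ha; simp [ha.v .s rfl, hs]
  · simp [h0]
  · rintro i s1 hi ha hi1 ⟨hI, hJ⟩
    have hm1 := (ha.v .m rfl).trans hm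
    have hne := (hE.adj i hi).ne
    rw [ends_seq, ends_assign, ends_seq, ends_assign, ends_seq]
    simp only [Ex.eval_inp, Ex.eval_add, Ex.eval_mul, Ex.eval_ofNat, Ex.eval_var, St.setV_v,
      St.setV_inp, reduceCtorEq, if_false, ha.inp, hi1, hm1, hA i hi, hB i hi]
    refine (pushNb_ends _ .x .y (x' := A i) (y' := B i) (by simp) (by simp)).mono ?_
    rintro s2 t2 ha2 ⟨ht2, hd2, hn2⟩
    refine (pushNb_ends _ .y .x (x' := B i) (y' := A i) ((ha2.v .y rfl).trans (by simp))
      ((ha2.v .x rfl).trans (by simp))).mono ?_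
    rintro s3 t3 ha3 ⟨ht3, hd3, hn3⟩
    refine ⟨?_, by omega⟩
    simp only [St.setV_a] at hd2 hn2 ⊢
    have step1 := nb_push (R' := fun a b => (∃ t < i, (A t = a ∧ B t = b) ∨ (A t = b ∧ B t = a)) ∨
      (a = A i ∧ b = B i)) (x := A i) (y := B i) hI hJ
      (by
        rintro ⟨t, ht, h⟩
        have := hE.inj t (by omega) i hi (by omega)
        omega)
      hd2 hn2 fun a b => Iff.rfl
    have step2 := nb_push (R' := fun a b => ∃ t < i + 1, (A t = a ∧ B t = b) ∨ (A t = b ∧ B t = a))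
      (x := B i) (y := A i) step1.1 step1.2
      (by
        rintro (⟨t, ht, h⟩ | h)
        · have := hE.inj t (by omega) i hi (by omega)
          omega
        · omega)
      hd3 hn3 (fun a b => by
        constructor
        · rintro ⟨t, ht, h⟩
          rcases Nat.lt_succ_iff_lt_or_eq.mp ht with ht | rfl
          · exact Or.inl (Or.inl ⟨t, ht, h⟩)
          · omega
        · rintro ((⟨t, ht, h⟩ | h) | h)
          · exact ⟨t, by omega, h⟩
          · exact ⟨i, by omega, by omega⟩
          · exact ⟨i, by omega, by omega⟩)
    exact step2
  · rintro s' t - ⟨⟨hI, hJ⟩, ht⟩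
    refine ⟨ht, fun x y => ?_, hJ⟩
    rw [← hI]
    constructor
    · intro hxy; exact hE.cover x y hxy
    · rintro ⟨t, ht, ⟨rfl, rfl⟩ | ⟨rfl, rfl⟩⟩
      exacts [hE.adj t ht, (hE.adj t ht).symm]

theorem readLeaves_ends (s : St) {m n : ℕ} {lf : ℕ → ℕ} (hs : s.v .s = sz) (hm : s.v .m = m)
    (hn : s.v .n = n) (hn0 : 0 < n) (hl : ∀ v < n, s.inp (3 + 2 * m + 2 * (sz - 1) + v) = lf v)
    (hinj : ∀ v < n, ∀ v' < n, lf v = lf v' → v = v') :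
    Ends readLeaves s fun s' t => t ≤ n * 4 + 3 ∧ (∀ v < n, s'.a .leaf v 0 0 0 = lf v) ∧
      (∀ v < n, s'.a .vert (lf v) 0 0 0 = v) ∧ s'.v .r = lf 0 := by
  rw [readLeaves, ends_seq]
  refine (ends_for (fun i s' => (∀ v < i, s'.a .leaf v 0 0 0 = lf v) ∧
      ∀ v < i, s'.a .vert (lf v) 0 0 0 = v) n 2 rfl ?_ ?_ ?_).mono ?_
  · intro s' ha; simp [ha.v .n rfl, hn]
  · simp
  · rintro i s1 hi ha hi1 ⟨hI, hJ⟩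
    simp only [ends_seq, ends_store, Ex.eval_inp, Ex.eval_add, Ex.eval_mul, Ex.eval_sub,
      Ex.eval_ofNat, Ex.eval_var, Ex.eval_lit, Ex.eval_get, St.setV_a, St.setA_v, St.setA_a,
      reduceCtorEq, if_false, if_true, false_and, true_and, and_true, and_self, ha.inp, hi1,
      (ha.v .m rfl).trans hm, (ha.v .s rfl).trans hs, hl i hi]
    refine ⟨⟨fun v hv => ?_, fun v hv => ?_⟩, by omega⟩
    · rcases Nat.lt_succ_iff_lt_or_eq.mp hv with hv | rfl
      · rw [if_neg hv.ne]; exact hI v hv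
      · rw [if_pos rfl]
    · rcases Nat.lt_succ_iff_lt_or_eq.mp hv with hv | rfl
      · rw [if_neg fun h => hv.ne (hinj v (by omega) i hi h)]; exact hJ v hv
      · rw [if_pos rfl]
  · rintro s' t - ⟨⟨hI, hJ⟩, ht⟩
    rw [ends_assign]
    simp only [Ex.eval_get, Ex.eval_ofNat, Ex.eval_lit, St.setV_v, St.setV_a, if_true]
    exact ⟨by omega, hI, hJ, hI 0 hn0⟩

end Mach

/-! ### Breadth-first search of the tree -/

namespace Mach

variable {T : SimpleGraph ℕ} {r sz : ℕ}

/-- A partial search of the tree `T` from the root `r`: the nodes `O 0, …, O (tail - 1)` have been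
found, `P` maps them to their parents, and `ch` lists the children. -/
structure Search (T : SimpleGraph ℕ) (r sz : ℕ) (O P V : ℕ → ℕ) (ch : ℕ → ℕ → ℕ) (nch : ℕ → ℕ)
    (tail : ℕ) : Prop where
  pos : 1 ≤ tail
  root : O 0 = r
  lt : ∀ i < tail, O i < sz
  inj : ∀ i < tail, ∀ j < tail, O i = O j → i = j
  vis : ∀ x, V x ≠ 0 ↔ ∃ i < tail, O i = x
  par : ∀ i < tail, 1 ≤ i → ∃ j < i, O j = P (O i) ∧ T.Adj (O j) (O i)
  children : ∀ x y, (y ≠ r ∧ V y ≠ 0 ∧ P y = x) ↔ ∃ k < nch x, ch x k = y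
  children_inj : ∀ x, ∀ i < nch x, ∀ j < nch x, ch x i = ch x j → i = j

theorem Search.push {O P vis O' P' vis' nch nch' : ℕ → ℕ} {ch ch' : ℕ → ℕ → ℕ} {tail h u y : ℕ}
    (hS : Search T r sz O P vis ch nch tail) (hh : h < tail) (hu : O h = u) (hy : vis y = 0)
    (hadj : T.Adj u y) (hysz : y < sz) (hO : ∀ i, O' i = if i = tail then y else O i)
    (hP : ∀ x, P' x = if x = y then u else P x) (hv : ∀ x, vis' x = if x = y then 1 else vis x)
    (hch : ∀ x k, ch' x k = if x = u ∧ k = nch u then y else ch x k)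
    (hnch : ∀ x, nch' x = if x = u then nch x + 1 else nch x) :
    Search T r sz O' P' vis' ch' nch' (tail + 1) := by
  have hne : ∀ i < tail, O i ≠ y := fun i hi he => (hS.vis y).mpr ⟨i, hi, he⟩ hy
  have hOl : ∀ i < tail, O' i = O i := fun i hi => by rw [hO, if_neg hi.ne]
  have hOt : O' tail = y := by rw [hO, if_pos rfl]
  have hr : y ≠ r := fun he => hne 0 hS.pos (hS.root.trans he.symm)
  -- The lists of children are neighbour lists for the relation between parent and found child, so
  -- appending to them is covered by `nb_push`.
  have key := nb_push (R := fun x z => z ≠ r ∧ vis z ≠ 0 ∧ P z = x) (R' := fun x z => z ≠ r ∧ vis' z ≠ 0 ∧ P' z = x) hS.children hS.children_inj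
    (x := u) (y := y) (by tauto) hnch hch (fun a b => by
      rw [hv, hP]
      by_cases hb : b = y
      · subst hb
        simp only [if_true, and_true, hy, ne_eq, not_true_eq_false, false_and, and_false, false_or]
        exact ⟨fun h => h.2.2.symm, fun h => ⟨hr, one_ne_zero, h.symm⟩⟩
      · simp [hb])
  refine ⟨by omega, by rw [hOl 0 hS.pos, hS.root], fun i hi => ?_, fun i hi j hj he => ?_,
    fun x => ?_, fun i hi hi1 => ?_, key.1, key.2⟩
  · rcases Nat.lt_succ_iff_lt_or_eq.mp hi with hi | rfl
    · rw [hOl i hi]; exact hS.lt i hi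
    · rw [hOt]; exact hysz
  · rcases Nat.lt_succ_iff_lt_or_eq.mp hi with hi | rfl <;>
      rcases Nat.lt_succ_iff_lt_or_eq.mp hj with hj | rfl
    · rw [hOl i hi, hOl j hj] at he; exact hS.inj i hi j hj he
    · rw [hOl i hi, hOt] at he; exact absurd he (hne i hi)
    · rw [hOl j hj, hOt] at he; exact absurd he.symm (hne j hj)
    · rfl
  · rw [hv]
    constructor
    · intro h
      split_ifs at h with hx
      · exact ⟨tail, by omega, by rw [hOt, hx]⟩
      · obtain ⟨i, hi, h⟩ := (hS.vis x).mp h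
        exact ⟨i, by omega, by rw [hOl i hi, h]⟩
    · rintro ⟨i, hi, rfl⟩
      rcases Nat.lt_succ_iff_lt_or_eq.mp hi with hi | rfl
      · rw [hOl i hi, if_neg (hne i hi)]; exact (hS.vis _).mpr ⟨i, hi, rfl⟩
      · rw [hOt, if_pos rfl]; exact one_ne_zero
  · rcases Nat.lt_succ_iff_lt_or_eq.mp hi with hi | rfl
    · obtain ⟨j, hj, h1, h2⟩ := hS.par i hi hi1
      refine ⟨j, hj, ?_, ?_⟩
      · rw [hOl i hi, hOl j (by omega), hP, if_neg (hne i hi), h1]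
      · rw [hOl i hi, hOl j (by omega)]; exact h2
    · exact ⟨h, hh, by rw [hOt, hOl h hh, hP, if_pos rfl, hu], by rw [hOt, hOl h hh, hu]; exact hadj⟩

/-- The nodes `O 0, …, O (sz - 1)` are all nodes of the tree, in an order in which every node other
than the root `O 0 = r` comes later than its parent. -/
structure Rooted (T : SimpleGraph ℕ) (r sz : ℕ) (O P : ℕ → ℕ) (ch : ℕ → ℕ → ℕ) (nch : ℕ → ℕ) :
    Prop where
  root : O 0 = r
  lt : ∀ i < sz, O i < sz
  inj : ∀ i < sz, ∀ j < sz, O i = O j → i = j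
  surj : ∀ x < sz, ∃ i < sz, O i = x
  par : ∀ i < sz, 1 ≤ i → ∃ j < i, O j = P (O i) ∧ T.Adj (O j) (O i)
  children : ∀ x y, (y ≠ r ∧ y < sz ∧ P y = x) ↔ ∃ k < nch x, ch x k = y
  children_inj : ∀ x, ∀ i < nch x, ∀ j < nch x, ch x i = ch x j → i = j

theorem Search.tail_le {O P vis nch : ℕ → ℕ} {ch : ℕ → ℕ → ℕ} {tail : ℕ}
    (hS : Search T r sz O P vis ch nch tail) : tail ≤ sz := by
  have hsub : (Finset.range tail).image O ⊆ Finset.range sz := by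
    intro x hx
    obtain ⟨i, hi, rfl⟩ := Finset.mem_image.mp hx
    exact Finset.mem_range.mpr (hS.lt i (Finset.mem_range.mp hi))
  have := Finset.card_le_card hsub
  rwa [Finset.card_image_of_injOn, Finset.card_range, Finset.card_range] at this
  intro i hi j hj
  simp only [Finset.coe_range, Set.mem_Iio] at hi hj
  exact hS.inj i hi j hj

/-- The found nodes contain the root and are closed under adjacency. `hconn` is connectedness in the
form of an induction principle. -/
theorem Search.le_tail {O P vis nch : ℕ → ℕ} {ch : ℕ → ℕ → ℕ} {tail : ℕ}
    (hS : Search T r sz O P vis ch nch tail)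
    (hconn : ∀ R : ℕ → Prop, R r → (∀ x y, R x → T.Adj x y → R y) → ∀ x < sz, R x)
    (hcl : ∀ i < tail, ∀ y, T.Adj (O i) y → vis y ≠ 0) :
    sz ≤ tail ∧ ∀ x < sz, ∃ i < tail, O i = x := by
  have hall : ∀ x < sz, ∃ i < tail, O i = x := by
    refine hconn _ ⟨0, hS.pos, hS.root⟩ ?_
    rintro x y ⟨i, hi, rfl⟩ hxy
    exact (hS.vis y).mp (hcl i hi y hxy)
  refine ⟨?_, hall⟩
  have hsub : Finset.range sz ⊆ (Finset.range tail).image O := by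
    intro x hx
    obtain ⟨i, hi, rfl⟩ := hall x (Finset.mem_range.mp hx)
    exact Finset.mem_image.mpr ⟨i, Finset.mem_range.mpr hi, rfl⟩
  have := (Finset.card_le_card hsub).trans Finset.card_image_le
  simpa using this

theorem searchTree_ends (s : St) (hN : NbData T (s.a .deg · 0 0 0) (s.a .nb · · 0 0))
    (hdeg : ∀ x, s.a .deg x 0 0 0 ≤ 3) (hlt : ∀ x y, T.Adj x y → x < sz) (hr : s.v .r = r)
    (hs : s.v .s = sz) (hrs : r < sz)
    (hconn : ∀ R : ℕ → Prop, R r → (∀ x y, R x → T.Adj x y → R y) → ∀ x < sz, R x)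
    (hvis : ∀ x, s.a .vis x 0 0 0 = 0) (hnch : ∀ x, s.a .nch x 0 0 0 = 0) :
    Ends searchTree s fun s' t => t ≤ sz * 35 + 5 ∧
      Rooted T r sz (s'.a .ord · 0 0 0) (s'.a .par · 0 0 0) (s'.a .ch · · 0 0)
        (s'.a .nch · 0 0 0) := by
  let I : ℕ → St → Prop := fun h s' => Search T r sz (s'.a .ord · 0 0 0) (s'.a .par · 0 0 0)
    (s'.a .vis · 0 0 0) (s'.a .ch · · 0 0) (s'.a .nch · 0 0 0) (s'.v .tail) ∧
    ∀ i < h, i < s'.v .tail → ∀ y, T.Adj (s'.a .ord i 0 0 0) y → s'.a .vis y 0 0 0 ≠ 0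
  rw [searchTree, ends_seq, ends_store, ends_seq, ends_store, ends_seq, ends_assign]
  refine (ends_for I sz 33 rfl ?_ ?_ ?_).mono ?_
  · intro s' ha; simp [ha.v .s rfl, hs]
  · refine ⟨?_, by simp⟩
    simp only [Ex.eval_ofNat, Ex.eval_var, Ex.eval_lit, St.setV_a, St.setA_a, St.setV_v, St.setA_v,
      reduceCtorEq, false_and, if_false, if_true, true_and, and_true, hr, hvis, hnch]
    refine ⟨le_rfl, by simp, ?_, ?_, ?_, ?_, ?_, by simp⟩
    · intro i hi; rw [if_pos (by omega)]; exact hrs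
    · intro i hi j hj _; omega
    · intro x
      constructor
      · intro h
        by_cases hx : x = r
        · exact ⟨0, by omega, by rw [if_pos rfl, hx]⟩
        · rw [if_neg hx] at h; exact absurd rfl h
      · rintro ⟨i, hi, h⟩
        rw [if_pos (by omega)] at h
        rw [if_pos h.symm]; exact one_ne_zero
    · intro i hi hi1; omega
    · intro x y
      constructor
      · rintro ⟨h1, h2, -⟩
        rw [if_neg h1] at h2
        exact absurd rfl h2
      · rintro ⟨k, hk, -⟩; omega
  · rintro h s1 hh ha hh1 ⟨hS, hcl⟩
    -- The queue does not run empty early: otherwise the found nodes would be closed under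
    -- adjacency, and all `sz` nodes would have been found.
    have hht : h < s1.v .tail := by
      by_contra hc
      have := (hS.le_tail hconn fun i hi y hy => hcl i (by omega) hi y hy).1
      omega
    have e1 := ha.a .deg rfl
    have e2 := ha.a .nb rfl
    simp only [St.setV_a, St.setA_a_ne _ (show Arr.deg ≠ Arr.ord by decide),
      St.setA_a_ne _ (show Arr.deg ≠ Arr.vis by decide),
      St.setA_a_ne _ (show Arr.nb ≠ Arr.ord by decide),
      St.setA_a_ne _ (show Arr.nb ≠ Arr.vis by decide)] at e1 e2
    rw [ends_seq, ends_assign]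
    simp only [Ex.eval_get, Ex.eval_var, Ex.eval_lit, hh1]
    set u := s1.a .ord h 0 0 0 with hu
    set D := s.a .deg u 0 0 0 with hD
    have hD3 : D ≤ 3 := hdeg u
    refine (ends_for (fun i s' => I h s' ∧ h < s'.v .tail ∧ s'.a .ord h 0 0 0 = u ∧
      ∀ j < i, s'.a .vis (s.a .nb u j 0 0) 0 0 0 ≠ 0) D 8 rfl ?_ ?_ ?_).mono ?_
    · intro s' ha'
      simp [ha'.v .u rfl, ha'.a .deg rfl, e1, hD]
    · exact ⟨⟨hS, hcl⟩, hht, rfl, by simp⟩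
    · rintro i s2 hi ha2 hi2 ⟨⟨hS2, hcl2⟩, hht2, hu2, hv2⟩
      have f1 := ha2.v .u rfl
      simp only [St.setV_v, if_true] at f1
      have f2 := (ha2.a .nb rfl).trans e2
      rw [ends_seq, ends_assign, ends_ite]
      simp only [Ex.eval_get, Ex.eval_var, Ex.eval_lit, f1, hi2, f2, St.setV_v, St.setV_a,
        reduceCtorEq, if_false, if_true]
      set y := s.a .nb u i 0 0 with hy
      have hadj : T.Adj u y := (hN.adj u y).mpr ⟨i, hi, rfl⟩
      split_ifs with hvy
      · rw [ends_seq, ends_store, ends_seq, ends_store, ends_seq, ends_store, ends_seq, ends_store,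
          ends_seq, ends_store, ends_assign]
        simp only [Ex.eval_get, Ex.eval_var, Ex.eval_lit, Ex.eval_add, Ex.eval_ofNat, f1, St.setV_v,
          St.setA_v, St.setV_a, reduceCtorEq, if_false, if_true,
          St.setA_a_ne _ (show Arr.nch ≠ Arr.vis by decide),
          St.setA_a_ne _ (show Arr.nch ≠ Arr.par by decide),
          St.setA_a_ne _ (show Arr.nch ≠ Arr.ch by decide)]
        have hP := hS2.push hht2 hu2 hvy hadj (hlt y u hadj.symm)
          (O' := fun i => if i = s2.v .tail then y else s2.a .ord i 0 0 0)
          (P' := fun x => if x = y then u else s2.a .par x 0 0 0)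
          (vis' := fun x => if x = y then 1 else s2.a .vis x 0 0 0)
          (ch' := fun x k => if x = u ∧ k = s2.a .nch u 0 0 0 then y else s2.a .ch x k 0 0)
          (nch' := fun x => if x = u then s2.a .nch u 0 0 0 + 1 else s2.a .nch x 0 0 0)
          (fun _ => rfl) (fun _ => rfl) (fun _ => rfl) (fun _ _ => rfl)
          (fun x => by by_cases hx : x = u <;> simp [hx])
        refine ⟨⟨⟨?_, ?_⟩, ?_, ?_, ?_⟩, by omega⟩
        · simpa using hP
        · intro j hj hjt z hz
          simp only [St.setV_a, St.setA_a, reduceCtorEq, false_and, if_false, true_and, and_true]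
            at hz ⊢
          rw [if_neg (by omega)] at hz
          split_ifs
          · exact one_ne_zero
          · exact hcl2 j hj (by omega) z hz
        · simp; omega
        · simp only [St.setV_a, St.setA_a, and_true, true_and]
          rw [if_neg (by omega)]; simpa using hu2
        · intro j hj
          simp only [St.setV_a, St.setA_a, reduceCtorEq, false_and, if_false, true_and, and_true]
          split_ifs with hc
          · exact one_ne_zero
          · rcases Nat.lt_succ_iff_lt_or_eq.mp hj with hj | rfl
            · exact hv2 j hj
            · exact absurd rfl hc
      · rw [ends_skip]
        refine ⟨⟨⟨hS2, hcl2⟩, hht2, hu2, fun j hj => ?_⟩, by omega⟩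
        rcases Nat.lt_succ_iff_lt_or_eq.mp hj with hj | rfl
        · exact hv2 j hj
        · exact hvy
    · rintro s2 t2 - ⟨⟨⟨hS2, hcl2⟩, hht2, hu2, hv2⟩, ht2⟩
      refine ⟨⟨hS2, fun i hi hit y hy => ?_⟩, by omega⟩
      rcases Nat.lt_succ_iff_lt_or_eq.mp hi with hi | rfl
      · exact hcl2 i hi hit y hy
      · simp only [St.setV_a, hu2] at hy ⊢
        obtain ⟨j, hj, rfl⟩ := (hN.adj u y).mp hy
        exact hv2 j hj
  · rintro s' t - ⟨⟨hS, hcl⟩, ht⟩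
    have h1 := hS.tail_le
    obtain ⟨h2, h3⟩ := hS.le_tail hconn fun i hi y hy => hcl i (by omega) hi y hy
    have h4 : s'.v .tail = sz := by omega
    rw [h4] at hS h3
    refine ⟨by omega, hS.root, hS.lt, hS.inj, h3, hS.par, fun x y => ?_, hS.children_inj⟩
    rw [← hS.children, hS.vis]
    refine and_congr_right fun _ => and_congr_left fun _ => ⟨h3 y, ?_⟩
    rintro ⟨i, hi, rfl⟩; exact hS.lt i hi

end Mach

/-! ### Ancestors in the rooted tree and the sides of its cuts -/

namespace Mach

/-- `u` is `x` or an ancestor of `x`, where `P` maps the nodes other than the root `r` to their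
parents. -/
def Anc (r : ℕ) (P : ℕ → ℕ) : ℕ → ℕ → Prop := Relation.ReflTransGen fun x y => x ≠ r ∧ y = P x

variable {T : SimpleGraph ℕ} {r sz n : ℕ} {O P nch deg : ℕ → ℕ} {ch nb : ℕ → ℕ → ℕ} {lf : ℕ → ℕ}

theorem anc_refl (x : ℕ) : Anc r P x x := Relation.ReflTransGen.refl

theorem anc_iff {x u : ℕ} (hx : x ≠ r) : Anc r P x u ↔ u = x ∨ Anc r P (P x) u := by
  rw [Anc, Relation.ReflTransGen.cases_head_iff]
  constructor
  · rintro (rfl | ⟨_, ⟨-, rfl⟩, h⟩)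
    exacts [Or.inl rfl, Or.inr h]
  · rintro (rfl | h)
    exacts [Or.inl rfl, Or.inr ⟨_, ⟨hx, rfl⟩, h⟩]

theorem anc_root {u : ℕ} : Anc r P r u ↔ u = r := by
  rw [Anc, Relation.ReflTransGen.cases_head_iff]
  constructor
  · rintro (rfl | ⟨_, ⟨h, -⟩, -⟩)
    exacts [rfl, absurd rfl h]
  · rintro rfl; exact Or.inl rfl

/-- Parents are unique, so the ancestors of a node form a chain. -/
theorem anc_total {x u v : ℕ} (hu : Anc r P x u) (hv : Anc r P x v) :
    Anc r P u v ∨ Anc r P v u :=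
  Relation.ReflTransGen.total_of_right_unique (fun _ _ _ h h' => h.2.trans h'.2.symm) hu hv

namespace Rooted

theorem ne_root (h : Rooted T r sz O P ch nch) {i : ℕ} (hi : i < sz) (hi1 : 1 ≤ i) : O i ≠ r := by
  intro he
  have := h.inj i hi 0 (by omega) (he.trans h.root.symm)
  omega

theorem index (h : Rooted T r sz O P ch nch) {x : ℕ} (hx : x < sz) (hr : x ≠ r) :
    ∃ i < sz, 1 ≤ i ∧ O i = x := by
  obtain ⟨i, hi, rfl⟩ := h.surj x hx
  refine ⟨i, hi, ?_, rfl⟩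
  rcases Nat.eq_zero_or_pos i with rfl | h'
  exacts [absurd h.root hr, h']

theorem anc_index (h : Rooted T r sz O P ch nch) {x u : ℕ} (hxu : Anc r P x u) :
    ∀ i < sz, O i = x → ∃ j ≤ i, O j = u := by
  induction hxu using Relation.ReflTransGen.head_induction_on with
  | refl => intro i _ hx; exact ⟨i, le_rfl, hx⟩
  | head hab _ ih =>
    rename_i a b
    rintro i hi rfl
    obtain ⟨ha, rfl⟩ := hab
    have hi1 : 1 ≤ i := by
      rcases Nat.eq_zero_or_pos i with rfl | h'
      exacts [absurd h.root ha, h']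
    obtain ⟨j, hj, h1, -⟩ := h.par i hi hi1
    obtain ⟨k, hk, h2⟩ := ih j (by omega) h1
    exact ⟨k, by omega, h2⟩

theorem anc_lt (h : Rooted T r sz O P ch nch) {x u : ℕ} (hx : x < sz) (hxu : Anc r P x u) :
    u < sz := by
  obtain ⟨i, hi, rfl⟩ := h.surj x hx
  obtain ⟨j, hj, rfl⟩ := h.anc_index hxu i hi rfl
  exact h.lt j (by omega)

/-- Going to the parent strictly decreases the position in the search order, so there are no cycles.
-/
theorem not_anc (h : Rooted T r sz O P ch nch) {x : ℕ} (hx : x < sz) (hr : x ≠ r) :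
    ¬ Anc r P (P x) x := by
  intro ha
  obtain ⟨i, hi, hi1, rfl⟩ := h.index hx hr
  obtain ⟨j, hj, h1, -⟩ := h.par i hi hi1
  obtain ⟨k, hk, h2⟩ := h.anc_index ha j (by omega) h1
  have := h.inj k (by omega) i hi h2
  omega

theorem par_lt (h : Rooted T r sz O P ch nch) {x : ℕ} (hx : x < sz) (hr : x ≠ r) : P x < sz := by
  obtain ⟨i, hi, hi1, rfl⟩ := h.index hx hr
  obtain ⟨j, hj, h1, -⟩ := h.par i hi hi1
  rw [← h1]; exact h.lt j (by omega)

theorem par_adj (h : Rooted T r sz O P ch nch) {x : ℕ} (hx : x < sz) (hr : x ≠ r) :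
    T.Adj (P x) x := by
  obtain ⟨i, hi, hi1, rfl⟩ := h.index hx hr
  obtain ⟨j, hj, h1, h2⟩ := h.par i hi hi1
  rwa [← h1]

theorem anc_children (h : Rooted T r sz O P ch nch) {x u : ℕ} (hx : x < sz) :
    Anc r P x u ↔ x = u ∨ ∃ k < nch u, Anc r P x (ch u k) := by
  constructor
  · intro ha
    rcases Relation.ReflTransGen.cases_tail ha with h' | ⟨y, hy, hyr, rfl⟩
    · exact Or.inl h'.symm
    · obtain ⟨k, hk, he⟩ := (h.children (P y) y).mp ⟨hyr, h.anc_lt hx hy, rfl⟩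
      exact Or.inr ⟨k, hk, by rw [he]; exact hy⟩
  · rintro (rfl | ⟨k, hk, ha⟩)
    · exact anc_refl x
    · obtain ⟨h1, -, h2⟩ := (h.children u (ch u k)).mpr ⟨k, hk, rfl⟩
      exact Relation.ReflTransGen.tail ha ⟨h1, h2.symm⟩

/-- A tree with `sz` nodes has no edges other than those to the parents. -/
theorem edge (h : Rooted T r sz O P ch nch) {A B : ℕ → ℕ} (hE : EdgeData T sz (sz - 1) A B)
    {x y : ℕ} (hxy : T.Adj x y) : (x ≠ r ∧ y = P x) ∨ (y ≠ r ∧ x = P y) := by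
  have hex : ∀ i ∈ Finset.Ico 1 sz, ∃ t ∈ Finset.range (sz - 1),
      (A t = O i ∧ B t = P (O i)) ∨ (A t = P (O i) ∧ B t = O i) := by
    intro i hi
    rw [Finset.mem_Ico] at hi
    have := h.par_adj (h.lt i hi.2) (h.ne_root hi.2 hi.1)
    obtain ⟨t, ht, h'⟩ := hE.cover _ _ this.symm
    exact ⟨t, Finset.mem_range.mpr ht, h'⟩
  choose! f hf1 hf2 using hex
  have hinj : Set.InjOn f (Finset.Ico 1 sz : Set ℕ) := by
    intro i hi j hj hij
    have hi' := Finset.mem_Ico.mp (Finset.mem_coe.mp hi)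
    have hj' := Finset.mem_Ico.mp (Finset.mem_coe.mp hj)
    have h1 := hf2 i hi
    have h2 := hf2 j hj
    rw [hij] at h1
    by_cases he : O i = O j
    · exact h.inj i hi'.2 j hj'.2 he
    -- Two different nodes with the same edge to their parents would be the parents of each other,
    -- against the search order.
    · exfalso
      obtain ⟨a, ha, ha', -⟩ := h.par i hi'.2 hi'.1
      obtain ⟨b, hb, hb', -⟩ := h.par j hj'.2 hj'.1
      have e1 := h.inj a (by omega) j hj'.2 (by omega)
      have e2 := h.inj b (by omega) i hi'.2 (by omega)
      omega
  -- There are as many nodes other than the root as edges, so the injective map from nodes to their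
  -- parent edges hits every edge.
  have himg : (Finset.Ico 1 sz).image f = Finset.range (sz - 1) := by
    refine Finset.eq_of_subset_of_card_le ?_ ?_
    · intro t ht
      obtain ⟨i, hi, rfl⟩ := Finset.mem_image.mp ht
      exact hf1 i hi
    · rw [Finset.card_image_of_injOn hinj]; simp
  obtain ⟨t, ht, hA⟩ := hE.cover x y hxy
  rw [← Finset.mem_range, ← himg] at ht
  obtain ⟨i, hi, rfl⟩ := Finset.mem_image.mp ht
  have h1 := hf2 i hi
  rw [Finset.mem_Ico] at hi
  have h2 := h.ne_root hi.2 hi.1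
  by_cases hx : x = O i
  · subst hx; left; exact ⟨h2, by omega⟩
  · right
    have hy : y = O i := by omega
    subst hy; exact ⟨h2, by omega⟩

end Rooted

/-- The side of the vertex `v` in the cut of the node `u`, where the vertices `0, …, n - 1` are mapped
to the leaves by `lf`. -/
noncomputable def sideOf (r : ℕ) (P lf : ℕ → ℕ) (n u v : ℕ) : ℕ :=
  open Classical in if v < n ∧ Anc r P (lf v) u then 1 else 0

theorem sideOf_eq_one {u v : ℕ} : sideOf r P lf n u v = 1 ↔ v < n ∧ Anc r P (lf v) u := by
  unfold sideOf; split_ifs with h <;> simp [h]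

theorem sideOf_le_one (u v : ℕ) : sideOf r P lf n u v ≤ 1 := by
  unfold sideOf; split_ifs <;> omega

theorem sideOf_eq_zero {u v : ℕ} (hv : v < n) :
    sideOf r P lf n u v = 0 ↔ ¬ Anc r P (lf v) u := by
  unfold sideOf; split_ifs with h <;> simp_all

/-- During a walk from the leaf of `a`, the nodes marked so far are the ancestors of this leaf that
are not ancestors of the current node. At the root, only the root itself is missing. -/
theorem markSides_ends (s : St) (hR : Rooted T r sz O P ch nch) {e : ℕ} (hr : s.v .r = r)
    (he : s.v .e = e) (hP : ∀ x, s.a .par x 0 0 0 = P x) (hl : ∀ v < n, s.a .leaf v 0 0 0 = lf v)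
    (hls : ∀ v < n, lf v < sz) (hn : ∀ i < e, s.a .ea i 0 0 0 < n)
    (h0 : ∀ u a, s.a .ins u a 0 0 = 0) :
    Ends markSides s fun s' t => t ≤ e * (sz * 3 + 5) + 2 ∧
      ∀ u i, u ≠ r → i < e →
        s'.a .ins u (s.a .ea i 0 0 0) 0 0 = sideOf r P lf n u (s.a .ea i 0 0 0) := by
  set X : ℕ → ℕ := fun i => s.a .ea i 0 0 0 with hX
  rw [markSides]
  refine (ends_for (fun t s' => ∀ u a, u ≠ r → (s'.a .ins u a 0 0 = 0 ∨ s'.a .ins u a 0 0 = 1) ∧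
      (s'.a .ins u a 0 0 = 1 ↔ (∃ i < t, X i = a) ∧ Anc r P (lf a) u)) e (sz * 3 + 3) rfl
      ?_ ?_ ?_).mono ?_
  · intro s' ha; simp [ha.v .e rfl, he]
  · simp [h0]
  · intro t s1 ht ha ht1 hI
    rw [ends_seq, ends_assign, ends_seq, ends_assign]
    simp only [Ex.eval_get, Ex.eval_var, Ex.eval_lit, ht1, ha.a .ea rfl, ha.a .leaf rfl, St.setV_v,
      St.setV_a, if_true]
    change Ends _ ((s1.setV .a (X t)).setV .cur (s.a .leaf (X t) 0 0 0)) _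
    have hXn : X t < n := hn t ht
    set a := X t with hat
    rw [hl a hXn]
    -- The walk ends because the position `p` of the current node in the search order decreases: `p
    -- + j < sz` after `j` rounds.
    refine (ends_while (fun j s' => (∃ p, O p = s'.v .cur ∧ p + j < sz) ∧ Anc r P (lf a) (s'.v .cur) ∧
      ∀ u a', u ≠ r → (s'.a .ins u a' 0 0 = 0 ∨ s'.a .ins u a' 0 0 = 1) ∧
        (s'.a .ins u a' 0 0 = 1 ↔ ((∃ i < t, X i = a') ∧ Anc r P (lf a') u) ∨
          (a' = a ∧ Anc r P (lf a) u ∧ ¬ Anc r P (s'.v .cur) u))) sz 2 ?_ ?_ ?_).mono ?_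
    · refine ⟨?_, by simpa using anc_refl _,
        fun u a' hu => ⟨(hI u a' hu).1, (hI u a' hu).2.trans ?_⟩⟩
      · obtain ⟨p, hp, h⟩ := hR.surj _ (hls a hXn)
        exact ⟨p, by simpa using h, by omega⟩
      · simp
    · rintro j s2 - ⟨⟨p, -, hp⟩, -⟩ -
      omega
    · rintro j s2 hj ha2 ⟨⟨p, hp, hpj⟩, hanc, hI2⟩ hc
      have f1 := ha2.v .r rfl
      have f2 := ha2.v .a rfl
      have f3 := ha2.a .par rfl
      simp only [St.setV_v, St.setV_a, reduceCtorEq, if_false, if_true, ha.v .r rfl, hr,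
        ha.a .par rfl] at f1 f2 f3
      have hcr : s2.v .cur ≠ r := by
        intro h
        apply hc
        rw [Ex.neq_eval, Ex.eval_var, Ex.eval_var, f1, h]
      have hcs : s2.v .cur < sz := by rw [← hp]; exact hR.lt p (by omega)
      rw [ends_seq, ends_store, ends_assign]
      simp only [Ex.eval_get, Ex.eval_var, Ex.eval_lit, Ex.eval_ofNat, f2, f3, St.setV_v, St.setA_v,
        St.setV_a, St.setA_a, reduceCtorEq, false_and, if_false, if_true, true_and, and_true, hP]
      have hp1 : 1 ≤ p := by
        rcases Nat.eq_zero_or_pos p with rfl | h'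
        exacts [absurd (hp.symm.trans hR.root) hcr, h']
      refine ⟨⟨?_, Relation.ReflTransGen.tail hanc ⟨hcr, rfl⟩, fun u a' hu => ?_⟩, le_rfl⟩
      · obtain ⟨q, hq, h1, -⟩ := hR.par p (by omega) hp1
        exact ⟨q, by rw [h1, hp], by omega⟩
      · by_cases hcase : u = s2.v .cur ∧ a' = a
        · obtain ⟨rfl, rfl⟩ := hcase
          rw [if_pos ⟨rfl, rfl⟩]
          refine ⟨Or.inr rfl, ?_⟩
          simp only [true_iff]
          exact Or.inr ⟨trivial, hanc, hR.not_anc hcs hcr⟩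
        · rw [if_neg hcase]
          refine ⟨(hI2 u a' hu).1, (hI2 u a' hu).2.trans (or_congr_right ?_)⟩
          refine and_congr_right fun ha' => and_congr_right fun _ => not_congr ?_
          rw [anc_iff hcr]
          have : u ≠ s2.v .cur := fun h => hcase ⟨h, ha'⟩
          tauto
    · rintro s2 t2 ha2 ⟨⟨j, -, -, hI2⟩, hc, ht2⟩
      have f1 := ha2.v .r rfl
      simp only [St.setV_v, reduceCtorEq, if_false, ha.v .r rfl, hr] at f1
      rw [Ex.neq_eval, Ex.eval_var, Ex.eval_var, f1] at hc
      refine ⟨fun u a' hu => ⟨(hI2 u a' hu).1, (hI2 u a' hu).2.trans ?_⟩, by omega⟩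
      rw [hc, anc_root]
      constructor
      · rintro (⟨⟨i, hi, h⟩, h'⟩ | ⟨rfl, h, -⟩)
        exacts [⟨⟨i, by omega, h⟩, h'⟩, ⟨⟨t, by omega, rfl⟩, h⟩]
      · rintro ⟨⟨i, hi, rfl⟩, h⟩
        rcases Nat.lt_succ_iff_lt_or_eq.mp hi with hi | rfl
        exacts [Or.inl ⟨⟨i, hi, rfl⟩, h⟩, Or.inr ⟨rfl, h, hu⟩]
  · rintro s' t - ⟨hI, ht⟩
    refine ⟨ht, fun u i hu hi => ?_⟩
    obtain ⟨h1, h2⟩ := hI u (X i) hu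
    by_cases hA : Anc r P (lf (X i)) u
    · rw [h2.mpr ⟨⟨i, hi, rfl⟩, hA⟩, sideOf_eq_one.mpr ⟨hn i hi, hA⟩]
    · rw [(sideOf_eq_zero (hn i hi)).mpr hA]
      rcases h1 with h1 | h1
      · exact h1
      · exact absurd (h2.mp h1).2 hA

/-- The leaves of the tree are `lf 0, …, lf (n - 1)`, and the inner nodes have degree three. -/
structure Leaves (sz n : ℕ) (deg lf : ℕ → ℕ) : Prop where
  two_le : 2 ≤ sz
  pos : 0 < n
  lt : ∀ v < n, lf v < sz
  inj : ∀ v < n, ∀ v' < n, lf v = lf v' → v = v'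
  deg_eq : ∀ v < n, deg (lf v) = 1
  surj : ∀ x < sz, deg x = 1 → ∃ v < n, lf v = x
  deg_ne : ∀ x < sz, deg x ≠ 1 → deg x = 3

namespace Rooted

/-- The neighbours of a node other than the root are its parent and its children, and the parent is
not among the children. -/
theorem deg_eq (h : Rooted T r sz O P ch nch) {A B : ℕ → ℕ} (hE : EdgeData T sz (sz - 1) A B)
    (hN : NbData T deg nb) {x : ℕ} (hx : x < sz) (hr : x ≠ r) : deg x = nch x + 1 := by
  have himg : (Finset.range (deg x)).image (nb x) =
      insert (P x) ((Finset.range (nch x)).image (ch x)) := by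
    ext y
    simp only [Finset.mem_image, Finset.mem_range, Finset.mem_insert]
    rw [← hN.adj, ← h.children]
    constructor
    · intro hxy
      rcases h.edge hE hxy with ⟨-, h'⟩ | ⟨h1, h2⟩
      exacts [Or.inl h', Or.inr ⟨h1, hE.lt y x hxy.symm, h2.symm⟩]
    · rintro (rfl | ⟨h1, h2, rfl⟩)
      exacts [(h.par_adj hx hr).symm, h.par_adj h2 h1]
  have hnot : P x ∉ (Finset.range (nch x)).image (ch x) := by
    simp only [Finset.mem_image, Finset.mem_range]
    rw [← h.children]
    rintro ⟨h1, h2, h3⟩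
    refine h.not_anc hx hr ?_
    rw [anc_iff h1, h3]; exact Or.inr (anc_refl x)
  have := congrArg Finset.card himg
  rwa [Finset.card_insert_of_notMem hnot, Finset.card_image_of_injOn, Finset.card_image_of_injOn,
    Finset.card_range, Finset.card_range] at this
  · intro i hi j hj; simp only [Finset.coe_range, Set.mem_Iio] at hi hj
    exact h.children_inj x i hi j hj
  · intro i hi j hj; simp only [Finset.coe_range, Set.mem_Iio] at hi hj
    exact hN.inj x i hi j hj

theorem deg_root (h : Rooted T r sz O P ch nch) {A B : ℕ → ℕ} (hE : EdgeData T sz (sz - 1) A B)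
    (hN : NbData T deg nb) : deg r = nch r := by
  have himg : (Finset.range (deg r)).image (nb r) = (Finset.range (nch r)).image (ch r) := by
    ext y
    simp only [Finset.mem_image, Finset.mem_range]
    rw [← hN.adj, ← h.children]
    constructor
    · intro hxy
      rcases h.edge hE hxy with ⟨h', -⟩ | ⟨h1, h2⟩
      exacts [absurd rfl h', ⟨h1, hE.lt y r hxy.symm, h2.symm⟩]
    · rintro ⟨h1, h2, h3⟩
      rw [← h3]; exact h.par_adj h2 h1
  have := congrArg Finset.card himg
  rwa [Finset.card_image_of_injOn, Finset.card_image_of_injOn,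
    Finset.card_range, Finset.card_range] at this
  · intro i hi j hj; simp only [Finset.coe_range, Set.mem_Iio] at hi hj
    exact h.children_inj r i hi j hj
  · intro i hi j hj; simp only [Finset.coe_range, Set.mem_Iio] at hi hj
    exact hN.inj r i hi j hj

/-- All nodes other than the root descend from the only child of the root. -/
theorem anc_one (h : Rooted T r sz O P ch nch) (h1 : nch r = 1) {i : ℕ} (hi : i < sz)
    (hi1 : 1 ≤ i) : Anc r P (O i) (O 1) ∧ ch r 0 = O 1 := by
  have hch : ch r 0 = O 1 := by
    obtain ⟨j, hj, h2, -⟩ := h.par 1 (by omega) le_rfl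
    obtain rfl : j = 0 := by omega
    obtain ⟨k, hk, h3⟩ := (h.children r (O 1)).mp
      ⟨h.ne_root (by omega) le_rfl, h.lt 1 (by omega), h2.symm.trans h.root⟩
    obtain rfl : k = 0 := by omega
    exact h3
  refine ⟨?_, hch⟩
  induction i using Nat.strong_induction_on with
  | _ i ih =>
    obtain ⟨j, hj, h2, -⟩ := h.par i hi hi1
    have hr := h.ne_root hi hi1
    rcases Nat.eq_zero_or_pos j with rfl | hj1
    · obtain ⟨k, hk, h3⟩ := (h.children r (O i)).mp ⟨hr, h.lt i hi, h2.symm.trans h.root⟩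
      obtain rfl : k = 0 := by omega
      rw [← h3, hch]; exact anc_refl _
    · rw [anc_iff hr, ← h2]
      exact Or.inr (ih j hj (by omega) hj1)

/-- A node other than the root has one child fewer than neighbours: none at a leaf and two at an
inner node. The root is a leaf and has one child, from which all other nodes descend. -/
theorem nodes (h : Rooted T r sz O P ch nch) {A B : ℕ → ℕ} (hE : EdgeData T sz (sz - 1) A B)
    (hN : NbData T deg nb) (hL : Leaves sz n deg lf) (hr : lf 0 = r) {s : St} (hrs : s.v .r = r)
    (hO : ∀ i, s.a .ord i 0 0 0 = O i) (hd : ∀ x, s.a .deg x 0 0 0 = deg x)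
    (hv : ∀ v < n, s.a .vert (lf v) 0 0 0 = v) (hc : ∀ x k, s.a .ch x k 0 0 = ch x k) :
    Nodes n sz (sideOf r P lf n) s := by
  have h1 : nch r = 1 := by rw [← h.deg_root hE hN, ← hr, hL.deg_eq 0 hL.pos]
  have h2 := hL.two_le
  refine ⟨sideOf_le_one, ?_, ?_, ?_, h2, ?_, ?_⟩
  · simpa only [hO] using h.inj
  · intro i hi hi1 hdeg
    rw [hO] at hdeg ⊢
    rw [hd] at hdeg
    obtain ⟨v, hvn, hvl⟩ := hL.surj _ (h.lt i hi) hdeg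
    rw [← hvl, hv v hvn]
    refine ⟨hvn, sideOf_eq_one.mpr ⟨hvn, anc_refl _⟩, fun z hz hside => ?_⟩
    have ha := (sideOf_eq_one.mp hside).2
    have hnc := h.deg_eq hE hN (h.lt i hi) (h.ne_root hi hi1)
    rw [h.anc_children (hL.lt z hz)] at ha
    rcases ha with ha | ⟨k, hk, -⟩
    · exact hL.inj z hz v hvn ha
    · rw [hvl] at hk; omega
  · intro i hi hi1 hdeg
    rw [hO] at hdeg ⊢
    rw [hd] at hdeg
    have hui := h.lt i hi
    have hur := h.ne_root hi hi1
    have hnc := h.deg_eq hE hN hui hur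
    have h3 := hL.deg_ne _ hui hdeg
    have hnc2 : nch (O i) = 2 := by omega
    obtain ⟨a1, a2, a3⟩ := (h.children (O i) (ch (O i) 0)).mpr ⟨0, by omega, rfl⟩
    obtain ⟨b1, b2, b3⟩ := (h.children (O i) (ch (O i) 1)).mpr ⟨1, by omega, rfl⟩
    have hne : ch (O i) 0 ≠ ch (O i) 1 := fun he => by
      have := h.children_inj (O i) 0 (by omega) 1 (by omega) he
      omega
    obtain ⟨j1, c1, c2, c3⟩ := h.index a2 a1
    obtain ⟨j2, d1, d2, d3⟩ := h.index b2 b1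
    obtain ⟨p1, e1, e2, -⟩ := h.par j1 c1 c2
    obtain ⟨p2, f1, f2, -⟩ := h.par j2 d1 d2
    have g1 := h.inj p1 (by omega) i hi (by rw [e2, c3, a3])
    have g2 := h.inj p2 (by omega) i hi (by rw [f2, d3, b3])
    refine ⟨j1, j2, by omega, c1, by omega, d1, ?_, ?_, ?_, ?_, ?_⟩
    · rintro rfl; exact hne (c3.symm.trans d3)
    · rw [hc, hO, c3]
    · rw [hc, hO, d3]
    · intro z
      rw [hO, hO, c3, d3, sideOf_eq_one, sideOf_eq_one, sideOf_eq_one, ← and_or_left]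
      refine and_congr_right fun hz => ?_
      rw [h.anc_children (hL.lt z hz), hnc2]
      constructor
      · rintro (hl | ⟨k, hk, hk'⟩)
        · exact absurd (by rw [← hl]; exact hL.deg_eq z hz) hdeg
        · rcases (by omega : k = 0 ∨ k = 1) with rfl | rfl
          exacts [Or.inl hk', Or.inr hk']
      · rintro (hk | hk)
        exacts [Or.inr ⟨0, by omega, hk⟩, Or.inr ⟨1, by omega, hk⟩]
    · intro z
      rw [hO, hO, c3, d3, sideOf_eq_one, sideOf_eq_one]
      rintro ⟨hz, hx⟩ ⟨-, hy⟩
      -- A common descendant of two siblings would make one of them an ancestor of the other, and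
      -- hence of its own parent.
      rcases anc_total hx hy with h' | h'
      · rw [anc_iff a1, a3.trans b3.symm] at h'
        rcases h' with h' | h'
        exacts [hne h'.symm, h.not_anc b2 b1 h']
      · rw [anc_iff b1, b3.trans a3.symm] at h'
        rcases h' with h' | h'
        exacts [hne h', h.not_anc a2 a1 h']
  · rw [hrs, hc, hO]; exact (h.anc_one h1 (i := 1) (by omega) le_rfl).2
  · rw [hO]
    refine ⟨hL.pos, ?_, fun z hz h0 => ?_⟩
    · rw [sideOf_eq_zero hL.pos, hr, anc_root]
      exact h.ne_root (by omega) le_rfl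
    · rw [sideOf_eq_zero hz] at h0
      by_contra hz0
      have hlr : lf z ≠ r := fun he => hz0 (hL.inj z hz 0 hL.pos (he.trans hr.symm))
      obtain ⟨i, hi, hi1, he⟩ := h.index (hL.lt z hz) hlr
      rw [← he] at h0
      exact h0 (h.anc_one h1 hi hi1).1

end Rooted

end Mach

/-! ### The whole program on a given input layout -/

namespace Mach

variable {H T : SimpleGraph ℕ} {d n m sz w opt : ℕ} {A B A' B' lf : ℕ → ℕ} {sg : ℕ → ℕ → ℕ}

/-- The number of steps of the algorithm. -/
def coreTime (n m sz N w : ℕ) : ℕ :=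
  m * 4 + n * (m * 10 + 4) + sz * 8 + n * 4 + sz * 35 + 2 * m * (sz * 3 + 5) +
    sz * (2 * m * 20 + 2 * (N * (w * ((N + 1) * (4 * w + 7) + 4) + 5)) + 17) +
    sz * (tableTime N w + 2) + ((N + 1) * (4 * w + 7) + N * 17 + N * (N * 11 + 4)) + 40

/-- The input of the algorithm: a graph `H` and a tree `T`, given by edge lists, and the leaves. -/
structure Layout (H T : SimpleGraph ℕ) (n m sz : ℕ) (A B A' B' lf : ℕ → ℕ) (inp : ℕ → ℕ) : Prop where
  vertices : inp 0 = n
  edges : inp 1 = m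
  nodes : inp (2 + 2 * m) = sz
  fst : ∀ t < m, inp (2 + 2 * t) = A t
  snd : ∀ t < m, inp (3 + 2 * t) = B t
  tree_fst : ∀ t < sz - 1, inp (3 + 2 * m + 2 * t) = A' t
  tree_snd : ∀ t < sz - 1, inp (4 + 2 * m + 2 * t) = B' t
  leaf : ∀ v < n, inp (3 + 2 * m + 2 * (sz - 1) + v) = lf v
  graph : EdgeData H n m A B
  tree : EdgeData T sz (sz - 1) A' B'
  leaves : ∀ deg nb, NbData T deg nb → Leaves sz n deg lf ∧ ∀ x, deg x ≤ 3
  conn : ∀ R : ℕ → Prop, R (lf 0) → (∀ x y, R x → T.Adj x y → R y) → ∀ x < sz, R x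

/-- Which rooted structure the search finds depends on the order of the input lists, so `hw` is
required for every rooted structure on the tree. -/
theorem core_ends (s : St) (h : Layout H T n m sz A B A' B' lf s.inp) (hd : s.v .d = d)
    (hd1 : 1 ≤ d) (hopt : s.v .opt = opt) (hz : ∀ A, A ≠ .sig → ∀ i j k l, s.a A i j k l = 0)
    (hsig : ∀ i k, s.a .sig i k 0 0 = sg i k) (hsg : ∀ k, sg 0 k ≤ 1)
    (hw : ∀ O P ch nch, Rooted T (lf 0) sz O P ch nch → ∀ i < sz, 1 ≤ i → ∀ o ≤ 1,
      CutBound H (sideOf (lf 0) P lf n (O i)) o w) :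
    Ends core s fun s' t => t ≤ coreTime n m sz (w ^ (d * Nat.log 2 w)) w ∧
      ∃ y, OptCode opt (allSizes H d n sg) y ∧ s'.v .out0 = min y 1 ∧ s'.v .out1 = y - 1 := by
  set N := w ^ (d * Nat.log 2 w) with hNdef
  have hH : Ends readHead s fun s' t => t = 3 ∧ s'.v .n = n ∧ s'.v .m = m ∧ s'.v .s = sz := by
    rw [readHead, ends_seq, ends_assign, ends_seq, ends_assign, ends_assign]
    simp [h.vertices, h.edges, h.nodes]
  rw [core, ends_seq]
  refine hH.mono ?_
  rintro s1 t1 ha1 ⟨rfl, hn1, hm1, hs1⟩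
  have i1 := ha1.inp
  rw [ends_seq]
  refine (readEdges_ends s1 h.graph hm1 (by rw [i1]; exact h.fst) (by rw [i1]; exact h.snd)
    (fun a b => by rw [ha1.a .adj rfl]; exact hz _ (by decide) _ _ _ _)).mono ?_
  rintro s2 t2 ha2 ⟨ht2, hadj⟩
  have i2 := ha2.inp.trans i1
  have hn2 := (ha2.v .n rfl).trans hn1
  have hm2 := (ha2.v .m rfl).trans hm1
  have hs2 := (ha2.v .s rfl).trans hs1
  rw [ends_seq]
  refine (sortEdges_ends s2 h.graph hn2 hm2 (by rw [i2]; exact h.fst)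
    (by rw [i2]; exact h.snd)).mono ?_
  rintro s3 t3 ha3 ⟨ht3, hE, he⟩
  have i3 := ha3.inp.trans i2
  have hn3 := (ha3.v .n rfl).trans hn2
  have hm3 := (ha3.v .m rfl).trans hm2
  have hs3 := (ha3.v .s rfl).trans hs2
  rw [ends_seq]
  refine (readTree_ends s3 h.tree hs3 hm3 (by rw [i3]; exact h.tree_fst)
    (by rw [i3]; exact h.tree_snd) (fun x => by
      rw [ha3.a .deg rfl, ha2.a .deg rfl, ha1.a .deg rfl]; exact hz _ (by decide) _ _ _ _)).mono ?_
  rintro s4 t4 ha4 ⟨ht4, hNb⟩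
  obtain ⟨hL, hdeg3⟩ := h.leaves _ _ hNb
  have i4 := ha4.inp.trans i3
  have hn4 := (ha4.v .n rfl).trans hn3
  have hm4 := (ha4.v .m rfl).trans hm3
  have hs4 := (ha4.v .s rfl).trans hs3
  rw [ends_seq]
  refine (readLeaves_ends s4 hs4 hm4 hn4 hL.pos (by rw [i4]; exact h.leaf) hL.inj).mono ?_
  rintro s5 t5 ha5 ⟨ht5, hleaf, hvert, hr5⟩
  have hn5 := (ha5.v .n rfl).trans hn4
  have hs5 := (ha5.v .s rfl).trans hs4
  rw [ends_seq]
  refine (searchTree_ends (T := T) (r := lf 0) (sz := sz) s5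
    (by rw [ha5.a .deg rfl, ha5.a .nb rfl]; exact hNb)
    (by rw [ha5.a .deg rfl]; exact hdeg3) (fun x y => h.tree.lt x y) hr5 hs5 (hL.lt 0 hL.pos) h.conn
    (fun x => by
      rw [ha5.a .vis rfl, ha4.a .vis rfl, ha3.a .vis rfl, ha2.a .vis rfl, ha1.a .vis rfl]
      exact hz _ (by decide) _ _ _ _)
    (fun x => by
      rw [ha5.a .nch rfl, ha4.a .nch rfl, ha3.a .nch rfl, ha2.a .nch rfl, ha1.a .nch rfl]
      exact hz _ (by decide) _ _ _ _)).mono ?_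
  rintro s6 t6 ha6 ⟨ht6, hR⟩
  set O : ℕ → ℕ := (s6.a .ord · 0 0 0) with hO
  set P : ℕ → ℕ := (s6.a .par · 0 0 0) with hP
  have hn6 := (ha6.v .n rfl).trans hn5
  have hs6 := (ha6.v .s rfl).trans hs5
  have hr6 := (ha6.v .r rfl).trans hr5
  have hea : s6.a .ea = s3.a .ea := by rw [ha6.a .ea rfl, ha5.a .ea rfl, ha4.a .ea rfl]
  have heb : s6.a .eb = s3.a .eb := by rw [ha6.a .eb rfl, ha5.a .eb rfl, ha4.a .eb rfl]
  have hev : s6.v .e = s3.v .e := by rw [ha6.v .e rfl, ha5.v .e rfl, ha4.v .e rfl]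
  rw [ends_seq]
  refine (markSides_ends (lf := lf) (n := n) s6 hR hr6 hev (fun _ => rfl)
    (fun v hv => by rw [ha6.a .leaf rfl]; exact hleaf v hv) hL.lt
    (fun i hi => by rw [hea]; exact h.graph.lt _ _ (hE.adj i hi)) (fun u a => by
      rw [ha6.a .ins rfl, ha5.a .ins rfl, ha4.a .ins rfl, ha3.a .ins rfl, ha2.a .ins rfl,
        ha1.a .ins rfl]
      exact hz _ (by decide) _ _ _ _)).mono ?_
  rintro s7 t7 ha7 ⟨ht7, hins⟩
  have hO7 : s7.a .ord = s6.a .ord := ha7.a .ord rfl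
  -- The arrays that the remaining programs fill have not been written so far and still contain
  -- zeros.
  have hzero : ∀ A, A ≠ .sig → core.writesA A = false ∨ (A = .st ∨ A = .dict ∨ A = .idx ∨ A = .K ∨
      A = .vec ∨ A = .tab ∨ A = .fin) → ∀ i j k l, s7.a A i j k l = 0 := by
    intro A hA hA' i j k l
    rw [ha7.a A, ha6.a A, ha5.a A, ha4.a A, ha3.a A, ha2.a A, ha1.a A, hz A hA] <;>
      · rcases hA' with h | rfl | rfl | rfl | rfl | rfl | rfl | rfl
        · revert h; clear hA; cases A <;> decide
        all_goals rfl
  have hnodes : Nodes n sz (sideOf (lf 0) P lf n) s7 := by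
    refine hR.nodes h.tree hNb hL rfl ((ha7.v .r rfl).trans hr6) (fun i => by rw [hO7])
      (fun x => ?_) (fun v hv => ?_) (fun x k => ?_)
    · rw [ha7.a .deg rfl, ha6.a .deg rfl, ha5.a .deg rfl]
    · rw [ha7.a .vert rfl, ha6.a .vert rfl]; exact hvert v hv
    · rw [ha7.a .ch rfl]
  have hadj7 : ∀ a b, s7.a .adj a b 0 0 = ad H a b := fun a b => by
    rw [ha7.a .adj rfl, ha6.a .adj rfl, ha5.a .adj rfl, ha4.a .adj rfl, ha3.a .adj rfl]
    exact hadj a b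
  have hE7 : EdgeSeq H (s3.v .e) (s7.a .ea · 0 0 0) (s7.a .eb · 0 0 0) := by
    rw [ha7.a .ea rfl, ha7.a .eb rfl, hea, heb]; exact hE
  have hd7 : s7.v .d = d := by
    rw [ha7.v .d rfl, ha6.v .d rfl, ha5.v .d rfl, ha4.v .d rfl, ha3.v .d rfl, ha2.v .d rfl,
      ha1.v .d rfl, hd]
  have hopt7 : s7.v .opt = opt := by
    rw [ha7.v .opt rfl, ha6.v .opt rfl, ha5.v .opt rfl, ha4.v .opt rfl, ha3.v .opt rfl,
      ha2.v .opt rfl, ha1.v .opt rfl, hopt]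
  have hsig7 : s7.a .sig = s.a .sig := by
    rw [ha7.a .sig rfl, ha6.a .sig rfl, ha5.a .sig rfl, ha4.a .sig rfl, ha3.a .sig rfl,
      ha2.a .sig rfl, ha1.a .sig rfl]
  have hn7 := (ha7.v .n rfl).trans hn6
  have hs7 := (ha7.v .s rfl).trans hs6
  rw [ends_seq]
  refine (analyseCuts_ends (H := H) (d := d) (w := w) (side := sideOf (lf 0) P lf n) s7 hs7
    ((ha7.v .e rfl).trans hev) hd7 hE7 hadj7 sideOf_le_one (by rw [hO7]; exact hR.inj)
    ?_ ?_ ?_).mono ?_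
  · intro i hi hi1 a b hab
    obtain ⟨j, hj, h1, -⟩ := hE.cover a b hab
    have := hins (O i) j (hR.ne_root hi hi1) hj
    rw [hea, h1] at this
    rw [hO7]; exact this
  · intro u
    exact ⟨fun _ => hzero _ (by decide) (by decide) _ _ _ _,
      fun _ _ => hzero _ (by decide) (by decide) _ _ _ _,
      fun _ => hzero _ (by decide) (by decide) _ _ _ _,
      fun _ => hzero _ (by decide) (by decide) _ _ _ _,
      fun _ _ _ => hzero _ (by decide) (by decide) _ _ _ _⟩
  · rw [hO7]; exact hw _ _ _ _ hR
  rintro s8 t8 ha8 ⟨ht8, hdone⟩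
  have hO8 : s8.a .ord = s7.a .ord := ha8.a .ord rfl
  rw [← hNdef] at ht8 hdone
  have hD8 : AllDone H d N w (sideOf (lf 0) P lf n) (s8.nonroot sz) s8 := by
    rintro u ⟨i, hi, hi1, rfl⟩
    rw [hO8]; exact hdone i hi hi1
  have hnodes8 : Nodes n sz (sideOf (lf 0) P lf n) s8 := by
    refine ⟨hnodes.le_one, ?_, ?_, ?_, hnodes.two_le, ?_, ?_⟩
    · rw [hO8]; exact hnodes.inj
    · rw [hO8, ha8.a .deg rfl, ha8.a .vert rfl]; exact hnodes.leaf
    · rw [hO8, ha8.a .deg rfl, ha8.a .ch rfl]; exact hnodes.inner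
    · rw [hO8, ha8.a .ch rfl, ha8.v .r rfl]; exact hnodes.child
    · rw [hO8]; exact hnodes.root
  have hadj8 : ∀ a b, s8.a .adj a b 0 0 = ad H a b := by rw [ha8.a .adj rfl]; exact hadj7
  have hsig8 : ∀ i k, s8.a .sig i k 0 0 = sg i k := by
    rw [ha8.a .sig rfl, hsig7]; exact hsig
  have hopt8 := (ha8.v .opt rfl).trans hopt7
  have hn8 := (ha8.v .n rfl).trans hn7
  rw [ends_seq]
  refine (fillTables_ends (n := n) (opt := opt) (sg := sg) s8 hnodes8 hD8 ((ha8.v .d rfl).trans hd7)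
    hd1 hn8 hopt8 ((ha8.v .s rfl).trans hs7) hadj8 hsig8 hsg (fun u o x q => by
      rw [ha8.a .tab rfl]; exact hzero _ (by decide) (by decide) _ _ _ _)).mono ?_
  rintro s9 t9 ha9 ⟨ht9, hS9, htab9, hT9⟩
  have hO9 : s9.a .ord = s8.a .ord := ha9.a .ord rfl
  have hD9 : AllDone H d N w (sideOf (lf 0) P lf n) (s9.nonroot sz) s9 := by
    have : s9.nonroot sz = s8.nonroot sz := by unfold St.nonroot; rw [hO9]
    rw [this]; exact hS9.allDone hD8
  have hnodes9 : Nodes n sz (sideOf (lf 0) P lf n) s9 := by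
    refine ⟨hnodes8.le_one, ?_, ?_, ?_, hnodes8.two_le, ?_, ?_⟩
    · rw [hO9]; exact hnodes8.inj
    · rw [hO9, ha9.a .deg rfl, ha9.a .vert rfl]; exact hnodes8.leaf
    · rw [hO9, ha9.a .deg rfl, ha9.a .ch rfl]; exact hnodes8.inner
    · rw [hO9, ha9.a .ch rfl, ha9.v .r rfl]; exact hnodes8.child
    · rw [hO9]; exact hnodes8.root
  refine (finish_ends (opt := opt) (sg := sg) s9 hnodes9 hD9 hd1 ((ha9.v .n rfl).trans hn8)
    ((ha9.v .opt rfl).trans hopt8) (by rw [ha9.a .adj rfl]; exact hadj8)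
    (by rw [ha9.a .sig rfl]; exact hsig8) hsg htab9 ?_ ?_).mono ?_
  · rw [ha9.a .fin rfl, ha8.a .fin rfl]; exact hzero _ (by decide) (by decide) _ _ _ _
  · rw [hO9]
    exact (hT9 1 (by have := hnodes.two_le; omega) le_rfl).congr_cuts' hS9
  rintro s10 t10 - ⟨ht10, hy⟩
  refine ⟨?_, hy⟩
  have b1 : (sz - 1) * 8 ≤ sz * 8 := by gcongr; omega
  have b2 : s3.v .e * (sz * 3 + 5) ≤ 2 * m * (sz * 3 + 5) := by gcongr
  have b3 : (sz - 1) * (s3.v .e * 20 + 2 * (N * (w * ((N + 1) * (4 * w + 7) + 4) + 5)) + 17) ≤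
      sz * (2 * m * 20 + 2 * (N * (w * ((N + 1) * (4 * w + 7) + 4) + 5)) + 17) := by
    gcongr; omega
  have b4 : (sz - 1) * (tableTime N w + 2) ≤ sz * (tableTime N w + 2) := by gcongr; omega
  unfold coreTime
  omega

end Mach

namespace Mach

/-! ### Cut functions -/

/-- If `f` is injective on a family of sets, the family has at most `w` members. For `∅` and
singletons of pairwise non-twins, no vertex has two neighbours in a member, so `hsep` applies to
every vertex across the cut. For the subsets of an irredundant set, it applies to the private
neighbours, which suffice to recover the subset. -/
theorem CutBound.of_separating {H : SimpleGraph ℕ} {sd : ℕ → ℕ} {o w n : ℕ} {W : Type*} {F : Set W}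
    (hfin : F.Finite) (hw : F.ncard ≤ w) (f : Finset ℕ → W) (hlt : ∀ a b, H.Adj a b → a < n)
    (hmem : ∀ Y : Finset ℕ, (∀ a ∈ Y, sd a = o ∧ a < n) → f Y ∈ F)
    (hsep : ∀ Y Y' b, f Y = f Y' → b < n → sd b ≠ o →
      (∀ a ∈ Y, ∀ a' ∈ Y, H.Adj a b → H.Adj a' b → a = a') →
      (∀ a ∈ Y', ∀ a' ∈ Y', H.Adj a b → H.Adj a' b → a = a') →
      (∃ a ∈ Y, H.Adj a b) → ∃ a ∈ Y', H.Adj a b) : CutBound H sd o w := by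
  have hcard : ∀ 𝓨 : Finset (Finset ℕ), (∀ Y ∈ 𝓨, ∀ a ∈ Y, sd a = o ∧ a < n) →
      Set.InjOn f (𝓨 : Set (Finset ℕ)) → 𝓨.card ≤ w := by
    intro 𝓨 h hinj
    rw [← Set.ncard_coe_finset]
    exact (Set.ncard_le_ncard_of_injOn f (fun Y hY => hmem Y (h Y hY)) hinj hfin).trans hw
  have hcross : ∀ a b, Cross H sd a b → sd a = o → a < n ∧ b < n ∧ sd b ≠ o := fun a b h ha =>
    ⟨hlt a b h.1, hlt b a h.1.symm, fun hb => h.2 (ha.trans hb.symm)⟩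
  constructor
  · intro R hR hdiff
    -- The empty set joins the singletons and accounts for the additional 1 in the bound.
    have hne : ∅ ∉ R.image (fun a => ({a} : Finset ℕ)) := by simp
    have := hcard (insert ∅ (R.image fun a => {a})) ?_ ?_
    · rwa [Finset.card_insert_of_notMem hne, Finset.card_image_of_injective _
        Finset.singleton_injective] at this
    · intro Y hY a ha
      rcases Finset.mem_insert.mp hY with rfl | hY
      · simp at ha
      · obtain ⟨x, hx, rfl⟩ := Finset.mem_image.mp hY
        rw [Finset.mem_singleton] at ha
        subst ha
        obtain ⟨h1, b, hb⟩ := hR a hx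
        exact ⟨h1, (hcross a b hb h1).1⟩
    · have hone : ∀ Y ∈ insert ∅ (R.image fun a => ({a} : Finset ℕ)), ∀ a ∈ Y, ∀ a' ∈ Y,
          a = a' := by
        intro Y hY a ha a' ha'
        rcases Finset.mem_insert.mp hY with rfl | hY
        · simp at ha
        · obtain ⟨x, -, rfl⟩ := Finset.mem_image.mp hY
          rw [Finset.mem_singleton] at ha ha'
          rw [ha, ha']
      have hadj : ∀ Y ∈ insert ∅ (R.image fun a => ({a} : Finset ℕ)),
          ∀ Y' ∈ insert ∅ (R.image fun a => ({a} : Finset ℕ)), f Y = f Y' → ∀ a ∈ Y,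
          ∃ a' ∈ Y', ∀ b, Cross H sd a b → Cross H sd a' b := by
        intro Y hY Y' hY' he a ha
        have hRa : a ∈ R := by
          rcases Finset.mem_insert.mp hY with rfl | hY
          · simp at ha
          · obtain ⟨x, hx, rfl⟩ := Finset.mem_image.mp hY
            rw [Finset.mem_singleton] at ha; rwa [ha]
        obtain ⟨h1, b0, hb0⟩ := hR a hRa
        have key : ∀ b, Cross H sd a b → ∃ a' ∈ Y', H.Adj a' b := fun b hb =>
          hsep Y Y' b he (hcross a b hb h1).2.1 (hcross a b hb h1).2.2
            (fun x hx y hy _ _ => hone Y hY x hx y hy) (fun x hx y hy _ _ => hone Y' hY' x hx y hy)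
            ⟨a, ha, hb.1⟩
        obtain ⟨a', ha', -⟩ := key b0 hb0
        refine ⟨a', ha', fun b hb => ?_⟩
        obtain ⟨a'', h2, h3⟩ := key b hb
        rw [hone Y' hY' a'' h2 a' ha'] at h3
        have hsa : sd a' = o := by
          rcases Finset.mem_insert.mp hY' with rfl | hY'
          · simp at ha'
          · obtain ⟨x, hx, rfl⟩ := Finset.mem_image.mp hY'
            rw [Finset.mem_singleton] at ha'; rw [ha']; exact (hR x hx).1
        exact ⟨h3, by rw [hsa]; exact (hcross a b hb h1).2.2.symm⟩
      have hempty : ∀ Y ∈ insert ∅ (R.image fun a => ({a} : Finset ℕ)), f Y = f ∅ → Y = ∅ := by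
        intro Y hY he
        by_contra hne
        obtain ⟨a, ha⟩ := Finset.nonempty_iff_ne_empty.mpr hne
        obtain ⟨a', ha', -⟩ := hadj Y hY ∅ (Finset.mem_insert_self _ _) he a ha
        simp at ha'
      intro Y hY Y' hY' he
      rw [Finset.mem_coe] at hY hY'
      rcases Finset.mem_insert.mp hY with rfl | hY1
      · exact (hempty Y' hY' he.symm).symm
      rcases Finset.mem_insert.mp hY' with rfl | hY1'
      · exact hempty Y hY he
      obtain ⟨x, hx, rfl⟩ := Finset.mem_image.mp hY1
      obtain ⟨y, hy, rfl⟩ := Finset.mem_image.mp hY1'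
      obtain ⟨y', hy', h1⟩ := hadj _ hY _ hY' he x (Finset.mem_singleton_self x)
      obtain ⟨x', hx', h2⟩ := hadj _ hY' _ hY he.symm y (Finset.mem_singleton_self y)
      rw [Finset.mem_singleton] at hx' hy'
      subst hx' hy'
      rw [hdiff _ hx _ hy fun b => ⟨h1 b, h2 b⟩]
  · intro S hS
    have := hcard S.powerset ?_ ?_
    · rwa [Finset.card_powerset] at this
    · intro Y hY a ha
      obtain ⟨h1, b, hb, -⟩ := hS a (Finset.mem_powerset.mp hY ha)
      exact ⟨h1, (hcross a b hb h1).1⟩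
    · have hsub : ∀ Y ∈ S.powerset, ∀ Y' ∈ S.powerset, f Y = f Y' → Y ⊆ Y' := by
        intro Y hY Y' hY' he a ha
        rw [Finset.mem_powerset] at hY hY'
        obtain ⟨h1, b, hb, hpriv⟩ := hS a (hY ha)
        -- Every subset of `S` contains at most one neighbour of the private neighbour `b`, so `f`
        -- decides whether it contains `a`.
        have honly : ∀ a' ∈ S, H.Adj a' b → a' = a := fun a' ha' h => by
          by_contra hne; exact hpriv a' ha' hne h
        obtain ⟨a', ha', h2⟩ := hsep Y Y' b he (hcross a b hb h1).2.1 (hcross a b hb h1).2.2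
          (fun x hx y hy h h' => (honly x (hY hx) h).trans (honly y (hY hy) h').symm)
          (fun x hx y hy h h' => (honly x (hY' hx) h).trans (honly y (hY' hy) h').symm)
          ⟨a, ha, hb.1⟩
        rwa [← honly a' (hY' ha') h2]
      intro Y hY Y' hY' he
      exact Finset.Subset.antisymm (hsub Y hY Y' hY' he) (hsub Y' hY' Y hY he.symm)

/-- A graph on `0, …, n - 1` as a graph on the natural numbers. -/
abbrev onNat {n : ℕ} (G : SimpleGraph (Fin n)) : SimpleGraph ℕ := G.map Fin.valEmbedding

theorem onNat_adj {n : ℕ} {G : SimpleGraph (Fin n)} {a b : Fin n} :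
    (onNat G).Adj a b ↔ G.Adj a b :=
  SimpleGraph.map_adj_apply (f := Fin.valEmbedding)

theorem onNat_adj_iff {n : ℕ} {G : SimpleGraph (Fin n)} {a b : ℕ} :
    (onNat G).Adj a b ↔ ∃ x y : Fin n, G.Adj x y ∧ (x : ℕ) = a ∧ (y : ℕ) = b := by
  rw [onNat, SimpleGraph.map_adj]; rfl

theorem onNat_lt {n : ℕ} {G : SimpleGraph (Fin n)} {a b : ℕ} (h : (onNat G).Adj a b) : a < n := by
  obtain ⟨x, y, -, rfl, -⟩ := onNat_adj_iff.mp h; exact x.2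

theorem le_floor_of_logb {c : ℕ} {k : ℝ} (hc : 0 < c) (h : Real.logb 2 (c : ℝ) ≤ k) :
    c ≤ ⌊(2 : ℝ) ^ k⌋₊ := by
  refine Nat.le_floor ?_
  rwa [Real.logb_le_iff_le_rpow one_lt_two (by exact_mod_cast hc)] at h

/-- Here `f Y` is the neighbourhood of `Y` in `A`, which shows directly whether a vertex of `A` has
a neighbour in `Y`. The sets `Y` lie on the side opposite to `A`. -/
theorem cutBound_of_boolCut {n : ℕ} (G : SimpleGraph (Fin n)) {A : Set (Fin n)} {k : ℝ} {sd : ℕ → ℕ}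
    {o : ℕ} (hA : ∀ x : Fin n, x ∈ A ↔ sd x ≠ o) (hk : boolCut G A ≤ k) :
    CutBound (onNat G) sd o ⌊(2 : ℝ) ^ k⌋₊ := by
  set F : Set (Set (Fin n)) := {X | X ⊆ A ∧ ∃ Y ⊆ Aᶜ, unionNeighbors G Y \ Aᶜ = X} with hF
  have hfin : F.Finite := Set.toFinite F
  let f : Finset ℕ → Set (Fin n) := fun Y => {x | x ∈ A ∧ ∃ a ∈ Y, (onNat G).Adj a x}
  have hmem : ∀ Y : Finset ℕ, (∀ a ∈ Y, sd a = o ∧ a < n) → f Y ∈ F := by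
    intro Y hY
    refine ⟨fun x hx => hx.1, {y | (y : ℕ) ∈ Y}, ?_, ?_⟩
    · intro y hy hyA
      exact (hA y).mp hyA (hY y hy).1
    · ext x
      simp only [unionNeighbors, Set.mem_sdiff, Set.mem_iUnion, SimpleGraph.mem_neighborSet,
        Set.mem_compl_iff, not_not, f, Set.mem_ofPred_eq]
      constructor
      · rintro ⟨⟨y, hy, hadj⟩, hx⟩
        exact ⟨hx, y, hy, onNat_adj.mpr hadj⟩
      · rintro ⟨hx, a, ha, hadj⟩
        refine ⟨⟨⟨a, (hY a ha).2⟩, ha, ?_⟩, hx⟩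
        exact (onNat_adj (a := ⟨a, (hY a ha).2⟩)).mp hadj
  refine CutBound.of_separating hfin (le_floor_of_logb ?_ hk) f (fun a b => onNat_lt) hmem ?_
  · rw [Set.ncard_pos hfin]; exact ⟨f ∅, hmem ∅ (by simp)⟩
  · rintro Y Y' b he hb hbo - - ⟨a, ha, hadj⟩
    have : (⟨b, hb⟩ : Fin n) ∈ f Y := ⟨(hA _).mpr hbo, a, ha, hadj⟩
    rw [he] at this
    exact this.2

/-- Here `f Y` is the sum of the rows of `Y`. Its entry at `b` is the parity of the number of
neighbours of `b` in `Y`, which is that number itself if it is at most 1. The sets `Y` lie on the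
side `A`. -/
theorem cutBound_of_cutRank {n : ℕ} (G : SimpleGraph (Fin n)) {A : Set (Fin n)} {k : ℝ} {sd : ℕ → ℕ}
    {o : ℕ} (hA : ∀ x : Fin n, x ∈ A ↔ sd x = o) (hk : cutRank G A ≤ k) :
    CutBound (onNat G) sd o ⌊(2 : ℝ) ^ k⌋₊ := by
  classical
  set V := Submodule.span (ZMod 2) (Set.range (cutRow G A)) with hV
  have hfin : (V : Set (↥(Aᶜ) → ZMod 2)).Finite := Set.toFinite _
  let row : ℕ → (↥(Aᶜ) → ZMod 2) := fun a b => if (onNat G).Adj a (b : Fin n) then 1 else 0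
  let f : Finset ℕ → (↥(Aᶜ) → ZMod 2) := fun Y => ∑ a ∈ Y, row a
  refine CutBound.of_separating (n := n) hfin ?_ f (fun a b => onNat_lt) ?_ ?_
  · refine le_floor_of_logb ?_ hk
    rw [Set.ncard_pos hfin]; exact ⟨0, V.zero_mem⟩
  · intro Y hY
    refine V.sum_mem fun a ha => Submodule.subset_span ⟨⟨⟨a, (hY a ha).2⟩, ?_⟩, ?_⟩
    · rw [hA]; exact (hY a ha).1
    · funext b
      simp only [cutRow, row]
      exact if_congr (onNat_adj (a := ⟨a, (hY a ha).2⟩)).symm rfl rfl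
  · rintro Y Y' b he hb hbo h h' ⟨a, ha, hadj⟩
    by_contra hno
    push Not at hno
    have hbA : (⟨b, hb⟩ : Fin n) ∈ Aᶜ := fun hbA => hbo ((hA _).mp hbA)
    have hval : ∀ Y : Finset ℕ, f Y ⟨⟨b, hb⟩, hbA⟩ = ∑ a ∈ Y, if (onNat G).Adj a b then 1 else 0 :=
      fun Y => by simp only [f, Finset.sum_apply, row]
    have h1 : f Y ⟨⟨b, hb⟩, hbA⟩ = 1 := by
      rw [hval, Finset.sum_eq_single_of_mem a ha, if_pos hadj]
      intro x hx hxa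
      rw [if_neg fun hxb => hxa (h x hx a ha hxb hadj)]
    have h2 : f Y' ⟨⟨b, hb⟩, hbA⟩ = 0 := by
      rw [hval]
      exact Finset.sum_eq_zero fun x hx => if_neg (hno x hx)
    rw [he, h2] at h1
    exact zero_ne_one h1

end Mach

namespace Mach

/-! ### The representation of the input -/

/-- The first and the second ends of the edges in a list. -/
def firstEnd {n : ℕ} (L : List (Fin n × Fin n)) (t : ℕ) : ℕ := (flattenEdges L).getD (2 * t) 0
def secondEnd {n : ℕ} (L : List (Fin n × Fin n)) (t : ℕ) : ℕ := (flattenEdges L).getD (2 * t + 1) 0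

theorem flattenEdges_length {n : ℕ} (L : List (Fin n × Fin n)) :
    (flattenEdges L).length = 2 * L.length := by
  induction L with
  | nil => rfl
  | cons e L ih =>
    have : flattenEdges (e :: L) = (e.1 : ℕ) :: (e.2 : ℕ) :: flattenEdges L := rfl
    rw [this, List.length_cons, List.length_cons, List.length_cons, ih]; omega

theorem ends_eq {n : ℕ} (L : List (Fin n × Fin n)) (t : ℕ) (ht : t < L.length) :
    firstEnd L t = (L[t].1 : ℕ) ∧ secondEnd L t = (L[t].2 : ℕ) := by
  induction L generalizing t with
  | nil => simp at ht
  | cons e L ih =>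
    have : flattenEdges (e :: L) = (e.1 : ℕ) :: (e.2 : ℕ) :: flattenEdges L := rfl
    cases t with
    | zero => simp [firstEnd, secondEnd, this]
    | succ t =>
      have := ih t (by simpa using ht)
      simpa [firstEnd, secondEnd, ‹flattenEdges (e :: L) = _›, Nat.mul_add] using this

theorem edgeData_of_isEdgeList {n : ℕ} {G : SimpleGraph (Fin n)} {L : List (Fin n × Fin n)}
    (h : IsEdgeList G L) : EdgeData (onNat G) n L.length (firstEnd L) (secondEnd L) := by
  obtain ⟨hnd, hmem⟩ := h
  have hadj : ∀ t (ht : t < L.length), G.Adj L[t].1 L[t].2 := by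
    intro t ht
    rw [← SimpleGraph.mem_edgeSet, ← hmem]
    exact List.mem_map.mpr ⟨L[t], List.getElem_mem ht, rfl⟩
  refine ⟨fun t ht => ?_, fun a b hab => ?_, fun t ht t' ht' he => ?_, fun a b => onNat_lt⟩
  · rw [(ends_eq L t ht).1, (ends_eq L t ht).2, onNat_adj]; exact hadj t ht
  · obtain ⟨x, y, hxy, rfl, rfl⟩ := onNat_adj_iff.mp hab
    rw [← SimpleGraph.mem_edgeSet, ← hmem, List.mem_map] at hxy
    obtain ⟨e, he, hxy⟩ := hxy
    obtain ⟨t, ht, rfl⟩ := List.getElem_of_mem he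
    refine ⟨t, ht, ?_⟩
    rw [(ends_eq L t ht).1, (ends_eq L t ht).2]
    rcases Sym2.eq_iff.mp hxy with ⟨h1, h2⟩ | ⟨h1, h2⟩
    · exact Or.inl ⟨by rw [h1], by rw [h2]⟩
    · exact Or.inr ⟨by rw [h1], by rw [h2]⟩
  · rw [(ends_eq L t ht).1, (ends_eq L t ht).2, (ends_eq L t' ht').1, (ends_eq L t' ht').2] at he
    simp only [Fin.val_inj] at he
    have h1 := (hnd.getElem_inj_iff (i := t) (hi := by simpa using ht) (j := t')
      (hj := by simpa using ht')).mp
    apply h1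
    rw [List.getElem_map, List.getElem_map]
    exact Sym2.eq_iff.mpr he

theorem length_of_isEdgeList {n : ℕ} {G : SimpleGraph (Fin n)} {L : List (Fin n × Fin n)}
    (h : IsEdgeList G L) : L.length = G.edgeSet.ncard := by
  classical
  obtain ⟨hnd, hmem⟩ := h
  have : G.edgeSet = ((L.map fun e => s(e.1, e.2)).toFinset : Set (Sym2 (Fin n))) := by
    ext e; simp only [List.coe_toFinset, Set.mem_ofPred_eq]; exact (hmem e).symm
  rw [this, Set.ncard_coe_finset, List.toFinset_card_of_nodup hnd, List.length_map]

variable {n : ℕ} (D : DecompTree (Fin n))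

/-- The leaf of the vertex `v`. -/
def leafOf (v : ℕ) : ℕ := if h : v < n then ((D.leaf ⟨v, h⟩ : Fin D.size) : ℕ) else 0

theorem leafOf_val (v : Fin n) : leafOf D v = ((D.leaf v : Fin D.size) : ℕ) := by
  simp [leafOf]

theorem leafOf_eq {v : ℕ} (hv : v < n) : leafOf D v = ((D.leaf ⟨v, hv⟩ : Fin D.size) : ℕ) := by
  simp [leafOf, hv]

theorem leafOf_lt {v : ℕ} (hv : v < n) : leafOf D v < D.size := by
  rw [leafOf_eq D hv]; exact Fin.is_lt _

theorem leafOf_inj {v v' : ℕ} (hv : v < n) (hv' : v' < n) (h : leafOf D v = leafOf D v') :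
    v = v' := by
  rw [leafOf_eq D hv, leafOf_eq D hv', Fin.val_inj, Subtype.val_inj] at h
  simpa using D.leaf.injective h

theorem two_le_size (hn : 2 ≤ n) : 2 ≤ D.size := by
  have h0 := leafOf_lt D (v := 0) (by omega)
  have h1 := leafOf_lt D (v := 1) (by omega)
  by_contra hc
  have := leafOf_inj D (v := 0) (v' := 1) (by omega) (by omega) (by omega)
  omega

theorem degree_pos (hn : 2 ≤ n) (u : Fin D.size) : 1 ≤ (D.tree.neighborSet u).ncard := by
  classical
  have : Nontrivial (Fin D.size) := Fin.nontrivial_iff_two_le.mpr (two_le_size D hn)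
  have := D.isTree.connected.preconnected.degree_pos_of_nontrivial u
  rwa [← SimpleGraph.card_neighborSet_eq_degree, ← Set.toFinset_card,
    ← Set.ncard_eq_toFinset_card'] at this

/-- The size of the tree, by counting the ends of its edges. -/
theorem size_add_two (hn : 2 ≤ n) : D.size + 2 = 2 * n := by
  classical
  have hsum := D.tree.sum_degrees_eq_twice_card_edges
  have hcard := D.isTree.card_edgeFinset
  rw [Fintype.card_fin] at hcard
  -- With at least two nodes, leaves have degree exactly 1, so degree plus twice the leaf indicator
  -- is always 3. Summation over the nodes gives `2 * (size - 1) + 2 * n = 3 * size`.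
  have hdeg : ∀ u, D.tree.degree u + 2 * (if IsTreeLeaf D.tree u then 1 else 0) = 3 := by
    intro u
    have h1 := degree_pos D hn u
    have h2 : D.tree.degree u = (D.tree.neighborSet u).ncard := by
      rw [← SimpleGraph.card_neighborSet_eq_degree, ← Set.toFinset_card,
        ← Set.ncard_eq_toFinset_card']
    split_ifs with hl
    · unfold IsTreeLeaf at hl; omega
    · have := D.subcubic u hl; omega
  have htot : ∑ u, (D.tree.degree u + 2 * (if IsTreeLeaf D.tree u then 1 else 0)) =
      D.size * 3 := by
    rw [Finset.sum_congr rfl fun u _ => hdeg u, Finset.sum_const, Finset.card_univ,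
      Fintype.card_fin, smul_eq_mul]
  have hleaf : ∑ u, (if IsTreeLeaf D.tree u then 1 else 0) = n := by
    rw [← Finset.sum_filter, Finset.sum_const, smul_eq_mul, mul_one, ← Fintype.card_subtype,
      ← Fintype.card_congr D.leaf, Fintype.card_fin]
  rw [Finset.sum_add_distrib, ← Finset.mul_sum, hleaf, hsum] at htot
  omega

theorem leaves_of_nbData (hn : 2 ≤ n) (deg : ℕ → ℕ) (nb : ℕ → ℕ → ℕ)
    (h : NbData (onNat D.tree) deg nb) : Leaves D.size n deg (leafOf D) ∧ ∀ x, deg x ≤ 3 := by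
  classical
  have hdeg : ∀ u : Fin D.size, deg u = (D.tree.neighborSet u).ncard := by
    intro u
    have himg : ((Finset.range (deg u)).image (nb u) : Set ℕ) =
        Fin.val '' (D.tree.neighborSet u) := by
      ext y
      simp only [Finset.coe_image, Finset.coe_range, Set.mem_image, Set.mem_Iio,
        SimpleGraph.mem_neighborSet]
      rw [← h.adj, onNat_adj_iff]
      constructor
      · rintro ⟨a, b, hab, ha, rfl⟩
        rw [Fin.val_inj] at ha; subst ha
        exact ⟨b, hab, rfl⟩
      · rintro ⟨b, hab, rfl⟩
        exact ⟨u, b, hab, rfl, rfl⟩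
    rw [← Set.ncard_image_of_injective _ Fin.val_injective, ← himg, Set.ncard_coe_finset,
      Finset.card_image_of_injOn, Finset.card_range]
    intro i hi j hj
    simp only [Finset.coe_range, Set.mem_Iio] at hi hj
    exact h.inj u i hi j hj
  have hcases : ∀ u : Fin D.size, deg u = 1 ∧ IsTreeLeaf D.tree u ∨
      deg u = 3 ∧ ¬ IsTreeLeaf D.tree u := by
    intro u
    have h1 := degree_pos D hn u
    have h2 := hdeg u
    by_cases hl : IsTreeLeaf D.tree u
    · refine Or.inl ⟨?_, hl⟩
      unfold IsTreeLeaf at hl; omega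
    · exact Or.inr ⟨h2.trans (D.subcubic u hl), hl⟩
  refine ⟨⟨two_le_size D hn, by omega, fun v => leafOf_lt D, fun v hv v' hv' => leafOf_inj D hv hv',
    fun v hv => ?_, fun x hx hd => ?_, fun x hx hd => ?_⟩, fun x => ?_⟩
  · rw [leafOf_eq D hv]
    rcases hcases (D.leaf ⟨v, hv⟩) with h' | h'
    exacts [h'.1, absurd (D.leaf ⟨v, hv⟩).2 h'.2]
  · rcases hcases ⟨x, hx⟩ with h' | h'
    · refine ⟨D.leaf.symm ⟨⟨x, hx⟩, h'.2⟩, Fin.is_lt _, ?_⟩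
      rw [leafOf_val, Equiv.apply_symm_apply]
    · have := h'.1; simp only at this; omega
  · rcases hcases ⟨x, hx⟩ with h' | h'
    exacts [absurd h'.1 hd, h'.1]
  · by_cases hx : x < D.size
    · rcases hcases ⟨x, hx⟩ with h' | h' <;> · have := h'.1; simp only at this; omega
    · by_contra hc
      exact hx (onNat_lt ((h.adj x (nb x 0)).mpr ⟨0, by omega, rfl⟩))

/-- Connectedness in the form in which the correctness proof of the search uses it. -/
theorem tree_conn (hn : 2 ≤ n) (R : ℕ → Prop) (h0 : R (leafOf D 0))
    (hR : ∀ x y, R x → (onNat D.tree).Adj x y → R y) : ∀ x < D.size, R x := by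
  intro x hx
  rw [leafOf_eq D (by omega : 0 < n)] at h0
  have := (SimpleGraph.reachable_iff_reflTransGen _ _).mp
    (D.isTree.connected.preconnected (D.leaf ⟨0, by omega⟩) ⟨x, hx⟩)
  have key : ∀ y : Fin D.size, Relation.ReflTransGen D.tree.Adj (D.leaf ⟨0, by omega⟩) y → R y := by
    intro y hy
    induction hy with
    | refl => exact h0
    | tail _ hbc ih => exact hR _ _ ih (onNat_adj.mpr hbc)
  exact key ⟨x, hx⟩ this

theorem layout {G : SimpleGraph (Fin n)} (hn : 2 ≤ n) {I : List ℕ} (hI : IsInput G D I)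
    {inp : ℕ → ℕ} (hinp : ∀ i, inp i = I.getD i 0) : ∃ A B A' B',
    Layout (onNat G) (onNat D.tree) n G.edgeSet.ncard D.size A B A' B' (leafOf D) inp ∧
    I.length = 3 + 2 * G.edgeSet.ncard + 2 * (D.size - 1) + n := by
  classical
  obtain ⟨L, K, hL, hK, rfl⟩ := hI
  have hm := length_of_isEdgeList hL
  have hk : K.length = D.size - 1 := by
    have := D.isTree.card_edgeFinset
    rw [Fintype.card_fin] at this
    rw [length_of_isEdgeList hK, Set.ncard_eq_toFinset_card']
    change D.tree.edgeFinset.card = _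
    omega
  have hlen1 := flattenEdges_length L
  have hlen2 := flattenEdges_length K
  rw [hm] at hlen1
  rw [hk] at hlen2
  set m := G.edgeSet.ncard with hmd
  have hget : ∀ (X Y : List ℕ) i, (X ++ Y).getD i 0 =
      if i < X.length then X.getD i 0 else Y.getD (i - X.length) 0 := by
    intro X Y i
    split_ifs with h
    · exact List.getD_append _ _ _ _ h
    · exact List.getD_append_right _ _ _ _ (by omega)
  refine ⟨firstEnd L, secondEnd L, firstEnd K, secondEnd K, ⟨?_, ?_, ?_, ?_, ?_, ?_, ?_, ?_, ?_, ?_,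
    leaves_of_nbData D hn, tree_conn D hn⟩, ?_⟩
  · rw [hinp]; simp
  · rw [hinp]; simp [hm]
  · rw [hinp]
    simp only [hget, List.length_append, List.length_cons, List.length_nil, hlen1, hlen2]
    rw [if_pos (by omega), if_pos (by omega), if_neg (by omega),
      show 2 + 2 * m - (0 + 1 + 1 + 2 * m) = 0 by omega]
    rfl
  · intro t ht
    rw [hinp]
    simp only [hget, List.length_append, List.length_cons, List.length_nil, hlen1, hlen2]
    simp only [firstEnd]
    rw [if_pos (by omega), if_pos (by omega), if_pos (by omega), if_neg (by omega)]
    congr 1; omega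
  · intro t ht
    rw [hinp]
    simp only [hget, List.length_append, List.length_cons, List.length_nil, hlen1, hlen2]
    simp only [secondEnd]
    rw [if_pos (by omega), if_pos (by omega), if_pos (by omega), if_neg (by omega)]
    congr 1; omega
  · intro t ht
    rw [hinp]
    simp only [hget, List.length_append, List.length_cons, List.length_nil, hlen1, hlen2]
    simp only [firstEnd]
    rw [if_pos (by omega), if_neg (by omega)]
    congr 1; omega
  · intro t ht
    rw [hinp]
    simp only [hget, List.length_append, List.length_cons, List.length_nil, hlen1, hlen2]
    simp only [secondEnd]
    rw [if_pos (by omega), if_neg (by omega)]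
    congr 1; omega
  · intro v hv
    rw [hinp]
    simp only [hget, List.length_append, List.length_cons, List.length_nil, hlen1, hlen2]
    rw [if_neg (by omega)]
    have : 3 + 2 * m + 2 * (D.size - 1) + v -
      (0 + 1 + 1 + 2 * m + (0 + 1) + 2 * (D.size - 1)) = v := by omega
    rw [this, leafOf_eq D hv, List.getD_eq_getElem _ _ (by simpa using hv)]
    simp
  · rw [← hm]; exact edgeData_of_isEdgeList hL
  · have := edgeData_of_isEdgeList hK; rwa [hk] at this
  · simp only [List.length_append, List.length_cons, List.length_nil, List.length_map,
      List.length_finRange, hlen1, hlen2]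
    omega

end Mach

namespace Mach

/-! ### The cuts of a decomposition tree -/

section
variable {V : Type*} {T : SimpleGraph V} {u p : V}

theorem reachable_delete_step {x y z : V} (hx : (T.deleteEdges {s(u, p)}).Reachable z x)
    (hxy : T.Adj x y) (hne : s(x, y) ≠ s(u, p)) : (T.deleteEdges {s(u, p)}).Reachable z y := by
  refine hx.trans (SimpleGraph.Adj.reachable ?_)
  rw [SimpleGraph.deleteEdges_adj]
  exact ⟨hxy, by simpa using hne⟩

/-- The removal of an edge splits a tree into two parts. -/
theorem reachable_delete_iff (hT : T.IsTree) (hup : T.Adj u p) (x : V) :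
    (T.deleteEdges {s(p, u)}).Reachable p x ↔ ¬ (T.deleteEdges {s(u, p)}).Reachable u x := by
  have hb := SimpleGraph.isAcyclic_iff_forall_adj_isBridge.mp hT.isAcyclic hup
  rw [Sym2.eq_swap (a := p) (b := u)]
  constructor
  · intro h1 h2
    rw [SimpleGraph.isBridge_iff] at hb
    exact hb (h2.trans h1.symm)
  · intro h1
    -- A walk from `u` stays in its part until it uses the removed edge, which leads to an end of
    -- that edge.
    have key : ∀ x, Relation.ReflTransGen T.Adj u x → (T.deleteEdges {s(u, p)}).Reachable u x ∨
        (T.deleteEdges {s(u, p)}).Reachable p x := by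
      intro x hx
      induction hx with
      | refl => exact Or.inl (SimpleGraph.Reachable.refl _)
      | tail _ hab ih =>
        rename_i a b _
        by_cases he : s(a, b) = s(u, p)
        · rcases Sym2.eq_iff.mp he with ⟨-, rfl⟩ | ⟨-, rfl⟩
          exacts [Or.inr (SimpleGraph.Reachable.refl _), Or.inl (SimpleGraph.Reachable.refl _)]
        · exact ih.imp (reachable_delete_step · hab he) (reachable_delete_step · hab he)
    exact (key x ((SimpleGraph.reachable_iff_reflTransGen _ _).mp
      (hT.connected.preconnected u x))).resolve_left h1

end

variable {n : ℕ} {D : DecompTree (Fin n)}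

theorem side_swap {u p : Fin D.size} (hup : D.tree.Adj u p) : D.side p u = (D.side u p)ᶜ := by
  ext x; exact reachable_delete_iff D.isTree hup _

theorem le_width (f : Set (Fin n) → ℝ) {u p : Fin D.size} (hup : D.tree.Adj u p) :
    f (D.side u p) ≤ D.width f := by
  refine le_csSup (Set.Finite.bddAbove ?_) ⟨u, p, hup, rfl⟩
  refine (Set.finite_range fun e : Fin D.size × Fin D.size => f (D.side e.1 e.2)).subset ?_
  rintro _ ⟨a, b, -, rfl⟩
  exact ⟨(a, b), rfl⟩

theorem width_eq {f : Set (Fin n) → ℝ} (hD : D.IsOptimal f) : D.width f = cutWidth f := by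
  refine (IsLeast.csInf_eq (s := Set.range fun D' : DecompTree (Fin n) => D'.width f)
    ⟨⟨D, rfl⟩, ?_⟩).symm
  rintro _ ⟨D', rfl⟩
  exact hD D'

/-- The values of `f` on both sides of a cut bound its complexity. -/
def BoundsCuts (G : SimpleGraph (Fin n)) (f : Set (Fin n) → ℝ) : Prop :=
  ∀ (sd : ℕ → ℕ) (o : ℕ) (k : ℝ), (∀ x, sd x ≤ 1) → o ≤ 1 → f {x | sd x = 1} ≤ k →
    f {x | sd x = 1}ᶜ ≤ k → CutBound (onNat G) sd o ⌊(2 : ℝ) ^ k⌋₊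

/-- The width of a tree takes the maximum over both orientations of each edge, so values on both
sides are available and no symmetry of the cut function is needed. -/
theorem boundsCuts_cutRank (G : SimpleGraph (Fin n)) : BoundsCuts G (cutRank G) := by
  intro sd o k hsd ho h1 h0
  rcases Nat.le_one_iff_eq_zero_or_eq_one.mp ho with rfl | rfl
  · refine cutBound_of_cutRank G (fun x => ?_) h0
    have := hsd x
    simp only [Set.mem_compl_iff, Set.mem_ofPred_eq]; omega
  · exact cutBound_of_cutRank G (fun x => Iff.rfl) h1

theorem boundsCuts_boolCut (G : SimpleGraph (Fin n)) : BoundsCuts G (boolCut G) := by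
  intro sd o k hsd ho h1 h0
  rcases Nat.le_one_iff_eq_zero_or_eq_one.mp ho with rfl | rfl
  · refine cutBound_of_boolCut G (fun x => ?_) h1
    have := hsd x
    simp only [Set.mem_ofPred_eq]; omega
  · exact cutBound_of_boolCut G (fun x => Iff.rfl) h0

/-- A single vertex with a neighbour across the cut is an irredundant set. -/
theorem two_le_of_cutBound {H : SimpleGraph ℕ} {sd : ℕ → ℕ} {o w a b : ℕ}
    (h : CutBound H sd o w) (hab : H.Adj a b) (ha : sd a = o) (hb : sd b ≠ o) : 2 ≤ w := by
  have := h.irredundant {a} ?_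
  · simpa using this
  · intro x hx
    rw [Finset.mem_singleton] at hx
    subst hx
    refine ⟨ha, b, ?_, fun a' ha' hne => absurd (Finset.mem_singleton.mp ha') hne⟩
    exact ⟨hab, by rw [ha]; exact hb.symm⟩

theorem two_le_of_edge {G : SimpleGraph (Fin n)} {a b : Fin n} (h : G.Adj a b) : 2 ≤ n := by
  have h1 := a.2
  have h2 := b.2
  have : (a : ℕ) ≠ b := fun he => h.ne (Fin.ext he)
  omega

/-- A graph with an edge has width at least one. -/
theorem one_le_width {G : SimpleGraph (Fin n)} {f : Set (Fin n) → ℝ} (hf : BoundsCuts G f)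
    {a b : Fin n} (hab : G.Adj a b) : 1 ≤ D.width f := by
  classical
  set u : Fin D.size := (D.leaf a).1
  have hn := two_le_of_edge hab
  have hcard : (D.tree.neighborSet u).ncard = 1 :=
    le_antisymm (D.leaf a).2 (degree_pos D hn u)
  obtain ⟨p, hp⟩ := Set.ncard_eq_one.mp hcard
  have hup : D.tree.Adj u p := by
    rw [← SimpleGraph.mem_neighborSet, hp]; rfl
  -- Removing the only edge at the leaf of `a` isolates this leaf, so the cut separates `a` from the
  -- other vertices, in particular from `b`.
  have hside : D.side u p = {x : Fin n | (if (x : ℕ) = a then 1 else 0) = 1} := by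
    ext x
    have hx : (x : ℕ) = a ↔ u = D.leaf x := by
      rw [Fin.val_inj, Subtype.val_inj, D.leaf.apply_eq_iff_eq, eq_comm]
    simp only [Set.mem_ofPred_eq, ite_eq_left_iff, zero_ne_one, imp_false, not_not, hx]
    constructor
    · intro h
      have h := (SimpleGraph.reachable_iff_reflTransGen _ _).mp h
      rcases Relation.ReflTransGen.cases_head h with h | ⟨y, hy, -⟩
      · exact h
      · rw [SimpleGraph.deleteEdges_adj] at hy
        have : y ∈ D.tree.neighborSet u := hy.1
        rw [hp, Set.mem_singleton_iff] at this
        exact absurd (by rw [this]; rfl) hy.2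
    · intro h
      change (D.tree.deleteEdges {s(u, p)}).Reachable u (D.leaf x)
      rw [← h]
  have h1 := le_width f hup
  have h0 := le_width f hup.symm
  rw [side_swap hup] at h0
  rw [hside] at h1 h0
  have := two_le_of_cutBound (hf (fun x => if x = a then 1 else 0) 1 (D.width f)
    (fun x => by split_ifs <;> simp) le_rfl h1 h0) (onNat_adj.mpr hab) (by simp)
    (by
      have hba : (b : ℕ) ≠ a := fun h => hab.ne (Fin.ext h.symm)
      simp [hba])
  have h2 : (2 : ℝ) ≤ 2 ^ D.width f := by
    refine le_trans ?_ (Nat.floor_le (by positivity))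
    exact_mod_cast this
  by_contra hc
  have := Real.rpow_lt_rpow_of_exponent_lt one_lt_two (not_le.mp hc)
  rw [Real.rpow_one] at this
  linarith

/-- The removal of the edge from `u` to its parent separates the vertices below `u` from the
others. -/
theorem side_eq {O P nch : ℕ → ℕ} {ch : ℕ → ℕ → ℕ} {r : ℕ} {A B : ℕ → ℕ}
    (h : Rooted (onNat D.tree) r D.size O P ch nch)
    (hE : EdgeData (onNat D.tree) D.size (D.size - 1) A B) {u p : Fin D.size} (hu : (u : ℕ) ≠ r)
    (hp : (p : ℕ) = P u) :
    D.side u p = {x : Fin n | sideOf r P (leafOf D) n u x = 1} := by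
  ext x
  simp only [Set.mem_ofPred_eq, sideOf_eq_one, x.2, true_and, leafOf_val]
  have hnot : ∀ y : Fin D.size, Anc r P y u → (y : ℕ) ≠ p := by
    intro y hy he
    rw [he, hp] at hy
    exact h.not_anc u.2 hu hy
  constructor
  · intro hx
    have hx := (SimpleGraph.reachable_iff_reflTransGen _ _).mp hx
    generalize (D.leaf x : Fin D.size) = y at hx
    induction hx with
    | refl => exact anc_refl _
    | tail _ hab ih =>
      rename_i a b _
      rw [SimpleGraph.deleteEdges_adj] at hab
      obtain ⟨hab, hne⟩ := hab
      rcases h.edge hE (onNat_adj.mpr hab) with ⟨h1, h2⟩ | ⟨h1, h2⟩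
      · rcases (anc_iff h1).mp ih with h3 | h3
        · exfalso
          apply hne
          have e1 : a = u := Fin.ext h3.symm
          have e2 : b = p := Fin.ext (by rw [h2, hp, e1])
          rw [e1, e2]; rfl
        · rwa [h2]
      · rw [anc_iff h1, ← h2]; exact Or.inr ih
  · intro hx
    have key : ∀ y, Anc r P y u → ∀ hy : y < D.size,
        (D.tree.deleteEdges {s(u, p)}).Reachable u ⟨y, hy⟩ := by
      intro y hy
      induction hy using Relation.ReflTransGen.head_induction_on with
      | refl => intro _; exact SimpleGraph.Reachable.refl _
      | head hab hb ih =>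
        rename_i a b
        intro ha
        obtain ⟨har, rfl⟩ := hab
        have hPa := h.par_lt ha har
        refine reachable_delete_step (ih hPa) (x := ⟨P a, hPa⟩) ?_ ?_
        · rw [← onNat_adj]; exact h.par_adj ha har
        -- The climb from `y` to `u` passes only nodes below `u`, and the parent `p` is not among
        -- them, so the removed edge is never used.
        · intro he
          have h1 := hnot ⟨P a, hPa⟩ hb
          have h2 := hnot ⟨a, ha⟩ (Relation.ReflTransGen.head ⟨har, rfl⟩ hb)
          rcases Sym2.eq_iff.mp he with ⟨-, e2⟩ | ⟨e1, -⟩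
          · exact h2 (by rw [← e2])
          · exact h1 (by rw [← e1])
    exact key _ hx _

theorem cutBound_of_rooted {G : SimpleGraph (Fin n)} {f : Set (Fin n) → ℝ} (hf : BoundsCuts G f)
    {O P nch : ℕ → ℕ} {ch : ℕ → ℕ → ℕ} {r : ℕ} {A B : ℕ → ℕ}
    (h : Rooted (onNat D.tree) r D.size O P ch nch)
    (hE : EdgeData (onNat D.tree) D.size (D.size - 1) A B) {i o : ℕ} (hi : i < D.size)
    (hi1 : 1 ≤ i) (ho : o ≤ 1) :
    CutBound (onNat G) (sideOf r P (leafOf D) n (O i)) o ⌊(2 : ℝ) ^ D.width f⌋₊ := by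
  have hu := h.lt i hi
  have hr := h.ne_root hi hi1
  have hp := h.par_lt hu hr
  have hup : D.tree.Adj ⟨O i, hu⟩ ⟨P (O i), hp⟩ := by
    rw [← onNat_adj]; exact (h.par_adj hu hr).symm
  have h1 := le_width f hup
  have h0 := le_width f hup.symm
  rw [side_swap hup] at h0
  rw [side_eq h hE hr rfl] at h1 h0
  exact hf _ o _ (fun x => sideOf_le_one _ _) ho h1 h0

end Mach

namespace Mach

/-! ### The sets of sizes -/

theorem iSup_ne_top {μ : Set ℕ} (h : μ.Finite) : (⨆ x ∈ μ, ((x + 1 : ℕ) : ℕ∞)) ≠ ⊤ := by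
  obtain ⟨K, hK⟩ := h.bddAbove
  refine ne_top_of_le_ne_top (ENat.natCast_ne_top (K + 1)) (iSup₂_le fun x hx => ?_)
  have := hK hx
  exact_mod_cast Nat.succ_le_succ this

/-- A finite or co-finite set is constant from `d(μ)` on. -/
theorem constant_from {μ : Set ℕ} (h : FiniteOrCofinite μ) :
    (∀ x, dValue μ ≤ x → x ∈ μ) ∨ ∀ x, dValue μ ≤ x → x ∉ μ := by
  set a := ⨆ x ∈ μ, ((x + 1 : ℕ) : ℕ∞)
  set b := ⨆ x ∈ μᶜ, ((x + 1 : ℕ) : ℕ∞)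
  have hD : ((dValue μ : ℕ) : ℕ∞) = min a b := by
    refine ENat.natCast_toNat ?_
    rcases h with h | h
    · exact ne_top_of_le_ne_top (iSup_ne_top h) (min_le_left _ _)
    · exact ne_top_of_le_ne_top (iSup_ne_top h) (min_le_right _ _)
  rcases le_total a b with hab | hab
  · rw [min_eq_left hab] at hD
    refine Or.inr fun x hx hm => ?_
    have : ((x + 1 : ℕ) : ℕ∞) ≤ a := le_iSup₂ (f := fun x (_ : x ∈ μ) => ((x + 1 : ℕ) : ℕ∞)) x hm
    rw [← hD] at this
    have : x + 1 ≤ dValue μ := by exact_mod_cast this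
    omega
  · rw [min_eq_right hab] at hD
    refine Or.inl fun x hx => ?_
    by_contra hm
    have : ((x + 1 : ℕ) : ℕ∞) ≤ b := le_iSup₂ (f := fun x (_ : x ∈ μᶜ) => ((x + 1 : ℕ) : ℕ∞)) x hm
    rw [← hD] at this
    have : x + 1 ≤ dValue μ := by exact_mod_cast this
    omega

/-- From `dValue μ` on, membership is constant, so counting neighbours up to `d` is enough. -/
theorem mem_iff_min_mem {μ : Set ℕ} (h : FiniteOrCofinite μ) {d : ℕ} (hd : dValue μ ≤ d) (x : ℕ) :
    min d x ∈ μ ↔ x ∈ μ := by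
  rcases le_total x d with hx | hx
  · rw [min_eq_right hx]
  · rw [min_eq_left hx]
    rcases constant_from h with h | h
    · exact iff_of_true (h d hd) (h x (hd.trans hx))
    · exact iff_of_false (h d hd) (h x (hd.trans hx))

open Classical in
/-- The indicator functions of `ρ` and `σ`. -/
noncomputable def indic (σ ρ : Set ℕ) (i k : ℕ) : ℕ :=
  if i = 0 then (if k ∈ ρ then 1 else 0) else (if k ∈ σ then 1 else 0)

theorem indic_le_one (σ ρ : Set ℕ) (i k : ℕ) : indic σ ρ i k ≤ 1 := by
  unfold indic; split_ifs <;> omega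

theorem indic_zero {σ ρ : Set ℕ} {k : ℕ} : indic σ ρ 0 k ≠ 0 ↔ k ∈ ρ := by simp [indic]

theorem indic_one {σ ρ : Set ℕ} {k : ℕ} : indic σ ρ 1 k ≠ 0 ↔ k ∈ σ := by simp [indic]

theorem cn_eq {n : ℕ} (G : SimpleGraph (Fin n)) (X : Finset (Fin n)) (v : Fin n) :
    cn (onNat G) (X.map Fin.valEmbedding) v = (G.neighborSet v ∩ ↑X).ncard := by
  classical
  have : G.neighborSet v ∩ ↑X = ((X.filter fun a => G.Adj v a : Finset (Fin n)) : Set (Fin n)) := by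
    ext a; simp [and_comm]
  rw [this, Set.ncard_coe_finset, Finset.card_filter, cn, Finset.sum_map]
  refine Finset.sum_congr rfl fun a _ => ?_
  unfold ad
  by_cases h : G.Adj v a
  · rw [if_pos h]; exact if_pos (onNat_adj.mpr h)
  · rw [if_neg h]; exact if_neg (onNat_adj.not.mpr h)

/-- Counts in the tables are capped at `d`, so only the values of `sg` up to `d` matter. -/
theorem allSizes_eq {n d : ℕ} (G : SimpleGraph (Fin n)) {σ ρ : Set ℕ} {sg : ℕ → ℕ → ℕ}
    (hσ : FiniteOrCofinite σ) (hρ : FiniteOrCofinite ρ) (hd : dPair σ ρ ≤ d)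
    (hsg : ∀ i ≤ 1, ∀ k ≤ d, sg i k = indic σ ρ i k) :
    allSizes (onNat G) d n sg = sigmaRhoSizes G σ ρ := by
  have hok : ∀ (X : Finset (Fin n)) (v : Fin n), OkAt (onNat G) d sg v (X.map Fin.valEmbedding) 0 ↔
      (v ∈ X → (G.neighborSet v ∩ ↑X).ncard ∈ σ) ∧ (v ∉ X → (G.neighborSet v ∩ ↑X).ncard ∈ ρ) := by
    intro X v
    have hm : (v : ℕ) ∈ X.map Fin.valEmbedding ↔ v ∈ X := by
      simp [Fin.val_inj]
    rw [OkAt, hm, add_zero, cn_eq, hsg 1 le_rfl _ (min_le_left _ _),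
      hsg 0 zero_le_one _ (min_le_left _ _), indic_zero, indic_one,
      mem_iff_min_mem hσ ((le_max_left _ _).trans hd),
      mem_iff_min_mem hρ ((le_max_right _ _).trans hd)]
  ext y
  constructor
  · rintro ⟨X, rfl, hX, h⟩
    have hm : (X.attachFin hX).map Fin.valEmbedding = X := by
      ext a
      simp only [Finset.mem_map, Finset.mem_attachFin, Fin.valEmbedding_apply]
      exact ⟨by rintro ⟨b, hb, rfl⟩; exact hb, fun ha => ⟨⟨a, hX a ha⟩, ha, rfl⟩⟩
    refine ⟨X.attachFin hX, fun v => ?_, Finset.card_attachFin _ _⟩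
    rw [← hok, hm]; exact h v v.2
  · rintro ⟨X, h, rfl⟩
    refine ⟨X.map Fin.valEmbedding, Finset.card_map _, fun a ha => ?_, fun v hv => ?_⟩
    · obtain ⟨b, -, rfl⟩ := Finset.mem_map.mp ha; exact b.2
    · exact (hok X ⟨v, hv⟩).mpr (h ⟨v, hv⟩)

/-! ### The time bound -/

/-- The joins dominate: `N * N` searches, each through up to `N` classes with fewer than `w`
columns. Reading the input and marking the sides cost `O(n m)`. -/
theorem coreTime_le {n m sz N w : ℕ} (hn : 2 ≤ n) (hm : 1 ≤ m) (hsz : sz ≤ 2 * n) (hw : 1 ≤ w)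
    (hwN : w ≤ N) : coreTime n m sz N w ≤ 1000 * (n * m + n * (N ^ 3 * w)) := by
  -- The products `N w` and `N³ w` become atoms, so that `omega` can add up the estimates.
  obtain ⟨P, hP⟩ : ∃ P, P = N * w := ⟨_, rfl⟩
  obtain ⟨Q, hQ⟩ : ∃ Q, Q = N * (N * P) := ⟨_, rfl⟩
  have hQ' : N ^ 3 * w = Q := by rw [hQ, hP]; ring
  have hN1 : 1 ≤ N := hw.trans hwN
  have hP1 : 1 ≤ P := hP ▸ Nat.mul_pos hN1 hw
  have hNP : N ≤ P := hP ▸ Nat.le_mul_of_pos_right N hw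
  have hPNP : P ≤ N * P := Nat.le_mul_of_pos_left P hN1
  have hNPQ : N * P ≤ Q := hQ ▸ Nat.le_mul_of_pos_left _ hN1
  have hNN : N * N ≤ N * P := Nat.mul_le_mul_left _ hNP
  -- The closure takes about `N² w²` steps, which `w ≤ N` brings below `N³ w`.
  have hPP : P * P ≤ Q := by
    rw [hQ, ← mul_assoc, hP, mul_assoc, mul_assoc]
    refine Nat.mul_le_mul_left _ ?_
    exact Nat.mul_le_mul_right _ hwN
  have h1 : (N + 1) * (4 * w + 7) ≤ 22 * P := by
    calc (N + 1) * (4 * w + 7) ≤ (2 * N) * (11 * w) := Nat.mul_le_mul (by omega) (by omega)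
      _ = 22 * P := by rw [hP]; ring
  have h2 : joinTime N w ≤ 31 * Q := by
    have e1 : N * ((N + 1) * (4 * w + 7) + 3) ≤ 25 * (N * P) := by
      calc N * ((N + 1) * (4 * w + 7) + 3) ≤ N * (25 * P) := Nat.mul_le_mul_left _ (by omega)
        _ = 25 * (N * P) := by ring
    have e2 : N * (N * ((N + 1) * (4 * w + 7) + 3) + 4) ≤ 29 * Q := by
      calc N * (N * ((N + 1) * (4 * w + 7) + 3) + 4) ≤ N * (29 * (N * P)) :=
            Nat.mul_le_mul_left _ (by omega)
        _ = 29 * Q := by rw [hQ]; ring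
    unfold joinTime; omega
  have h3 : N * (N * 11 + 4) ≤ 15 * (N * P) := by
    calc N * (N * 11 + 4) ≤ N * (15 * P) := Nat.mul_le_mul_left _ (by omega)
      _ = 15 * (N * P) := by ring
  have h4 : N * (N * (N * 11 + 4) + 4) ≤ 19 * Q := by
    calc N * (N * (N * 11 + 4) + 4) ≤ N * (19 * (N * P)) := Nat.mul_le_mul_left _ (by omega)
      _ = 19 * Q := by rw [hQ]; ring
  have h5 : tableTime N w ≤ 190 * Q := by unfold tableTime; omega
  have h6 : N * (w * ((N + 1) * (4 * w + 7) + 4) + 5) ≤ 31 * Q := by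
    have e1 : w * ((N + 1) * (4 * w + 7) + 4) ≤ 26 * (w * P) := by
      calc w * ((N + 1) * (4 * w + 7) + 4) ≤ w * (26 * P) := Nat.mul_le_mul_left _ (by omega)
        _ = 26 * (w * P) := by ring
    have e2 : 1 ≤ w * P := Nat.mul_pos hw hP1
    calc N * (w * ((N + 1) * (4 * w + 7) + 4) + 5) ≤ N * (31 * (w * P)) :=
          Nat.mul_le_mul_left _ (by omega)
      _ = 31 * (P * P) := by rw [hP]; ring
      _ ≤ 31 * Q := Nat.mul_le_mul_left _ hPP
  have h7 : sz * (2 * m * 20 + 2 * (N * (w * ((N + 1) * (4 * w + 7) + 4) + 5)) + 17) ≤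
      80 * (n * m) + 160 * (n * Q) := by
    calc _ ≤ (2 * n) * (40 * m + 80 * Q) := Nat.mul_le_mul hsz (by omega)
      _ = _ := by ring
  have h8 : sz * (tableTime N w + 2) ≤ 384 * (n * Q) := by
    calc _ ≤ (2 * n) * (192 * Q) := Nat.mul_le_mul hsz (by omega)
      _ = _ := by ring
  have h9 : n * (m * 10 + 4) ≤ 14 * (n * m) := by
    calc _ ≤ n * (14 * m) := Nat.mul_le_mul_left _ (by omega)
      _ = _ := by ring
  have h10 : 2 * m * (sz * 3 + 5) ≤ 22 * (n * m) := by
    calc _ ≤ 2 * m * (11 * n) := Nat.mul_le_mul_left _ (by omega)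
      _ = _ := by ring
  have h11 : n ≤ n * m := Nat.le_mul_of_pos_right n hm
  have h12 : m ≤ n * m := Nat.le_mul_of_pos_left m (by omega)
  have h13 : Q ≤ n * Q := Nat.le_mul_of_pos_left Q (by omega)
  rw [hQ', coreTime]
  omega

end Mach

namespace Mach

/-! ### The array program for given `σ` and `ρ` -/

theorem initSig_ends (f : ℕ → ℕ → ℕ) (k : ℕ) (s : St) :
    Ends (initSig f k) s fun s' t => t = 2 * k + 1 ∧ s'.v = s.v ∧ s'.inp = s.inp ∧
      (∀ A, A ≠ .sig → s'.a A = s.a A) ∧ ∀ i j, s'.a .sig i j 0 0 =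
        if i ≤ 1 ∧ j < k then f i j else s.a .sig i j 0 0 := by
  induction k with
  | zero => rw [initSig, ends_skip]; simp
  | succ k ih =>
    rw [initSig, ends_seq]
    refine ih.mono ?_
    rintro s1 t1 - ⟨rfl, h1, h2, h3, h4⟩
    rw [ends_seq, ends_store, ends_store]
    refine ⟨by omega, h1, h2, fun A hA => ?_, fun i j => ?_⟩
    · rw [St.setA_a_ne _ hA, St.setA_a_ne _ hA, h3 A hA]
    · simp only [St.setA_a, Ex.eval_lit, Ex.eval_ofNat, and_true, true_and, h4]
      by_cases hj : j = k
      · subst hj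
        by_cases h1 : i = 1
        · simp [h1]
        · by_cases h0 : i = 0
          · simp [h0]
          · simp [h0, h1, show ¬ i ≤ 1 by omega]
      · simp [hj, show j < k + 1 ↔ j < k by omega]

theorem initSig_tame (f : ℕ → ℕ → ℕ) (k : ℕ) : (initSig f k).tame = true := by
  induction k with
  | zero => rfl
  | succ k ih => simp [initSig, Prog.tame, ih, Ex.tame, Ex.small]

theorem initSig_maxCost (f : ℕ → ℕ → ℕ) (k : ℕ) : (initSig f k).maxCost ≤ 60000 := by
  induction k with
  | zero => simp [initSig, Prog.maxCost]
  | succ k ih =>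
    simp only [initSig, Prog.maxCost, max_le_iff]
    exact ⟨ih, Nat.le_of_ble_eq_true rfl, Nat.le_of_ble_eq_true rfl⟩

theorem initSig_maxNeed (f : ℕ → ℕ → ℕ) (k : ℕ) : (initSig f k).maxNeed ≤ 40000 := by
  induction k with
  | zero => simp [initSig, Prog.maxNeed]
  | succ k ih =>
    simp only [initSig, Prog.maxNeed, max_le_iff]
    exact ⟨ih, ⟨Nat.le_of_ble_eq_true rfl, Nat.le_of_ble_eq_true rfl⟩,
      Nat.le_of_ble_eq_true rfl, Nat.le_of_ble_eq_true rfl⟩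

theorem initSig_maxLit (f : ℕ → ℕ → ℕ) (hf : ∀ i j, f i j ≤ 1) (k : ℕ) :
    (initSig f k).maxLit ≤ k + 1 := by
  induction k with
  | zero => simp [initSig, Prog.maxLit]
  | succ k ih =>
    have h0 := hf 0 k
    have h1 := hf 1 k
    simp only [initSig, Prog.maxLit, Ex.maxLit, max_le_iff]
    omega

/-- `core` is one fixed program, independent of `σ`, `ρ` and `d`. Its cost per statement and its
exponent are therefore absolute constants, obtained by evaluation. -/
theorem core_tame : core.tame = true := rfl
set_option maxRecDepth 10000 in
theorem core_maxCost : core.maxCost ≤ 60000 := Nat.le_of_ble_eq_true rfl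
set_option maxRecDepth 10000 in
theorem core_maxNeed : core.maxNeed ≤ 40000 := Nat.le_of_ble_eq_true rfl
set_option maxRecDepth 10000 in
theorem core_maxLit : core.maxLit ≤ 30 := Nat.le_of_ble_eq_true rfl

variable {n d opt : ℕ} {D : DecompTree (Fin n)} {G : SimpleGraph (Fin n)} {σ ρ : Set ℕ}
  {f : Set (Fin n) → ℝ} {I : List ℕ}

/-- The initial state. -/
def initSt (I : List ℕ) : St := ⟨fun _ => 0, fun _ _ _ _ _ => 0, fun i => I.getD i 0⟩

theorem solver_ends (hn : 2 ≤ n) (hσ : FiniteOrCofinite σ) (hρ : FiniteOrCofinite ρ)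
    (hd : dPair σ ρ = d) (hd1 : 1 ≤ d) (hI : IsInput G D I) (hf : BoundsCuts G f) {w : ℕ}
    (hw : w = ⌊(2 : ℝ) ^ D.width f⌋₊) :
    Ends (solver d opt (indic σ ρ)) (initSt I) fun s' t =>
      t ≤ 2 * d + 5 + coreTime n G.edgeSet.ncard D.size (w ^ (d * Nat.log 2 w)) w ∧
      ∃ y, OptCode opt (sigmaRhoSizes G σ ρ) y ∧ s'.v .out0 = min y 1 ∧ s'.v .out1 = y - 1 := by
  obtain ⟨A, B, A', B', hL, -⟩ := layout D hn hI (inp := fun i => I.getD i 0) fun _ => rfl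
  rw [solver, ends_seq, ends_assign, ends_seq, ends_assign, ends_seq]
  refine (initSig_ends _ _ _).mono ?_
  rintro s1 t1 - ⟨rfl, h1, h2, h3, h4⟩
  -- Only the entries up to `d` have been stored; the others are still 0.
  refine (core_ends (d := d) (opt := opt) (sg := fun i j => if i ≤ 1 ∧ j < d + 1 then indic σ ρ i j
    else 0) s1 (by rw [h2]; exact hL) ?_ hd1 ?_ ?_ ?_ ?_
    fun O P ch nch hR i hi hi1 o ho => cutBound_of_rooted hf hR hL.tree hi hi1 ho).mono ?_
  · rw [h1]; rfl
  · rw [h1]; rfl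
  · intro A hA i j k l; rw [h3 A hA]; rfl
  · intro i k; rw [h4]; rfl
  · intro k
    split_ifs
    exacts [indic_le_one _ _ _ _, zero_le_one]
  · rintro s' t - ⟨ht, y, hy, h5⟩
    rw [allSizes_eq G hσ hρ hd.le fun i hi k hk => if_pos ⟨hi, by omega⟩] at hy
    rw [← hw] at ht
    exact ⟨by omega, y, hy, h5⟩

/-! ### The program for the random access machine -/

open RAM (Expr Program State Runs)

/-- The number of words of the input, or more. -/
def baseExpr : Expr :=
  .add (.add (.add (.load (.lit 0)) (.lit 3)) (.add (.load (.lit 1)) (.load (.lit 1))))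
    (.add (.load (.add (.add (.load (.lit 1)) (.load (.lit 1))) (.lit 2)))
      (.load (.add (.add (.load (.lit 1)) (.load (.lit 1))) (.lit 2))))

noncomputable def ramSolver (d opt : ℕ) (σ ρ : Set ℕ) : Program :=
  .seq (.assign 0 baseExpr) (.seq (solver d opt (indic σ ρ)).compile
    (.seq (.assign 0 (.reg (Var.out0.ctorIdx + 1))) (.assign 1 (.reg (Var.out1.ctorIdx + 1)))))

/-- `M` bounds the input, the base and the literals, and `M + T` all values that are ever stored. So
every number that occurs is at most `(M + T) ^ ν`, a word by `hW`. -/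
theorem ramSolver_runs (hn : 2 ≤ n) (hσ : FiniteOrCofinite σ) (hρ : FiniteOrCofinite ρ)
    (hd : dPair σ ρ = d) (hd1 : 1 ≤ d) (hopt : opt ≤ 1) (hI : IsInput G D I) (hf : BoundsCuts G f)
    {w m T W ν : ℕ}
    (hw : w = ⌊(2 : ℝ) ^ D.width f⌋₊) (hm : m = G.edgeSet.ncard)
    (hT : T = 2 * d + 5 + coreTime n m D.size (w ^ (d * Nat.log 2 w)) w)
    (hν : 40000 ≤ ν) (hW : (n + 2 * m + 2 * D.size + d + 40 + T) ^ ν < W) :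
    ∃ (s : State) (t : ℕ), Runs W (ramSolver d opt σ ρ) (RAM.start I) s t ∧ t ≤ 60000 * T + 50 ∧
      ∃ y, OptCode opt (sigmaRhoSizes G σ ρ) y ∧ s.var 0 = min y 1 ∧ s.var 1 = y - 1 := by
  obtain ⟨A, B, A', B', hL, hlen⟩ := layout D hn hI (inp := fun i => I.getD i 0) fun _ => rfl
  obtain ⟨s', t, hex, ht, y, hy, hy0, hy1⟩ := solver_ends (opt := opt) hn hσ hρ hd hd1 hI hf hw
  rw [← hm] at ht hL hlen
  set M := n + 2 * m + 2 * D.size + d + 40 with hM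
  have hMW : M + T < W := (Nat.le_self_pow (by omega) _).trans_lt hW
  have e0 : I.getD 0 0 = n := hL.vertices
  have e1 : I.getD 1 0 = m := hL.edges
  have e2 : I.getD (m + m + 2) 0 = D.size := by
    have := hL.nodes
    rwa [show 2 + 2 * m = m + m + 2 by omega] at this
  set b := n + 3 + (m + m) + (D.size + D.size) with hb
  have hbe : baseExpr.eval (RAM.start I) = b := by
    simp only [baseExpr, Expr.eval, RAM.start, e0, e1, e2, hb]
  have hbf : baseExpr.Fits W (RAM.start I) := by
    simp only [baseExpr, Expr.Fits, Expr.eval, RAM.start, e0, e1, e2]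
    omega
  have hbI : I.length ≤ b := by omega
  have hsim : Sim b (initSt I) ⟨Function.update (RAM.start I).var 0 b, (RAM.start I).mem⟩ := by
    refine ⟨by simp, fun x => by simp [RAM.start, initSt], fun A i j k l => ?_, fun i => ?_⟩
    · simp only [RAM.start, initSt]
      exact List.getD_eq_default _ _ (by omega)
    · simp only [RAM.start, initSt]
      rcases le_total i b with h | h
      · rw [min_eq_left h]
      · rw [min_eq_right h, List.getD_eq_default _ _ hbI, List.getD_eq_default _ _ (by omega)]
  have hlt : ∀ a ∈ I, a ≤ M := by
    obtain ⟨L, K, hL', hK, rfl⟩ := hI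
    have hfl : ∀ {N : ℕ} (L : List (Fin N × Fin N)), ∀ a ∈ flattenEdges L, a ≤ N := by
      intro N L a ha
      obtain ⟨e, -, he⟩ := List.mem_flatMap.mp ha
      simp only [List.mem_cons, List.not_mem_nil, or_false] at he
      rcases he with rfl | rfl
      exacts [e.1.2.le, e.2.2.le]
    have hLm := length_of_isEdgeList hL'
    intro a ha
    simp only [List.mem_append, List.mem_cons, List.not_mem_nil, or_false, List.mem_map] at ha
    rcases ha with (((((ha | ha) | ha) | ha) | ha) | ⟨v, -, ha⟩)
    · omega
    · omega
    · have := hfl _ a ha; omega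
    · omega
    · have := hfl _ a ha; omega
    · have := (D.leaf v : Fin D.size).2; omega
  have hbd : Bounded M (initSt I) := by
    refine ⟨fun x => Nat.zero_le _, fun A i j k l => Nat.zero_le _, fun i => ?_⟩
    simp only [initSt]
    rcases lt_or_ge i I.length with h | h
    · rw [List.getD_eq_getElem _ _ h]; exact hlt _ (List.getElem_mem h)
    · rw [List.getD_eq_default _ _ h]; exact Nat.zero_le _
  have hlit := initSig_maxLit (indic σ ρ) (indic_le_one σ ρ) (d + 1)
  have hcl := core_maxLit
  obtain ⟨S, t', hrun, ht', hS, hbS⟩ := hex.simulate (W := W) (κ := 60000) (ν := ν) M _ hsim hbd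
    (by omega) (by omega)
    (by simp only [solver, Prog.maxLit, Ex.maxLit, max_le_iff]; omega)
    (by simp [solver, Prog.tame, Ex.tame, Ex.small, initSig_tame, core_tame])
    (by
      simp only [solver, Prog.maxNeed, Ex.need, max_le_iff]
      exact ⟨by omega, by omega, (initSig_maxNeed _ _).trans hν, core_maxNeed.trans hν⟩)
    (by
      simp only [solver, Prog.maxCost, Ex.cost, max_le_iff]
      exact ⟨by omega, by omega, initSig_maxCost _ _, core_maxCost⟩)
    ((Nat.pow_le_pow_left (by omega) _).trans_lt hW)
  have hv0 := hbS.var .out0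
  have hv1 := hbS.var .out1
  rw [← hS.var] at hv0 hv1
  refine ⟨_, _, Runs.seq _ _ _ _ _ _ _ (Runs.assign _ _ _ hbf) (Runs.seq _ _ _ _ _ _ _
    (by rw [hbe]; exact hrun) (Runs.seq _ _ _ _ _ _ _ (Runs.assign _ _ _ ?_)
    (Runs.assign _ _ _ ?_))), ?_, y, hy, ?_, ?_⟩
  · simp only [Expr.Fits]; omega
  · simp only [Expr.Fits, Function.update_of_ne (Nat.succ_ne_zero _)]
    exact hv1.trans_lt (by omega)
  · have : baseExpr.cost + 1 ≤ 40 := by decide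
    simp only [Expr.cost]
    omega
  · rw [← hy0, ← hS.var]
    simp [Expr.eval]
  · rw [← hy1, ← hS.var]
    simp [Expr.eval]

end Mach

namespace Mach

open RAM (Expr Program State Runs)

variable {n : ℕ} {σ ρ : Set ℕ}

/-! ### Sets that are empty or contain all numbers -/

theorem mem_sizes {G : SimpleGraph (Fin n)} (p q : Prop) (hσ : ∀ x, x ∈ σ ↔ p)
    (hρ : ∀ x, x ∈ ρ ↔ q) (y : ℕ) : y ∈ sigmaRhoSizes G σ ρ ↔
      ∃ X : Finset (Fin n), (∀ v, (v ∈ X → p) ∧ (v ∉ X → q)) ∧ X.card = y := by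
  simp only [sigmaRhoSizes, IsSigmaRhoSet, hσ, hρ, Set.mem_ofPred_eq]

/-- If `σ` and `ρ` are trivial, then either every set is a solution, or only the whole vertex set,
or only the empty set, or none at all. So the optimum is always `n` or 0, as recorded by `z`. -/
theorem exists_trivial_answer (hσ : (∀ x, x ∈ σ) ∨ ∀ x, x ∉ σ) (hρ : (∀ x, x ∈ ρ) ∨ ∀ x, x ∉ ρ)
    (opt : Objective) : ∃ b ≤ 1, ∃ z : Bool, ∀ n, 1 ≤ n → ∀ (G : SimpleGraph (Fin n)) (s : State),
      s.var 0 = b → s.var 1 = (if z then n else 0) → IsAnswer opt σ ρ G s := by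
  have single : ∀ {S : Set ℕ} {x : ℕ}, (∀ y, y ∈ S ↔ y = x) → opt.IsOptimum S x := by
    intro S x h
    have hx := (h x).mpr rfl
    cases opt
    exacts [⟨hx, fun y hy => ((h y).mp hy).ge⟩, ⟨hx, fun y hy => ((h y).mp hy).le⟩]
  rcases hσ with hσ | hσ <;> rcases hρ with hρ | hρ
  · refine ⟨1, le_rfl, match opt with | .minimize => false | .maximize => true,
      fun n _ G s h0 h1 => Or.inl ⟨h0, ?_⟩⟩
    have hm := mem_sizes (G := G) True True (fun x => iff_true_intro (hσ x))
      fun x => iff_true_intro (hρ x)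
    cases opt
    · rw [h1]
      exact ⟨(hm _).mpr ⟨∅, by simp, rfl⟩, fun y _ => Nat.zero_le y⟩
    · rw [h1]
      refine ⟨(hm _).mpr ⟨Finset.univ, by simp, by simp⟩, fun y hy => ?_⟩
      obtain ⟨X, -, rfl⟩ := (hm y).mp hy
      simpa using Finset.card_le_univ X
  · refine ⟨1, le_rfl, true, fun n _ G s h0 h1 => Or.inl ⟨h0, single fun y => ?_⟩⟩
    rw [mem_sizes True False (fun x => iff_true_intro (hσ x)) (fun x => iff_false_intro (hρ x)), h1]
    constructor
    · rintro ⟨X, hX, rfl⟩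
      have : X = Finset.univ := Finset.eq_univ_of_forall fun v => by
        by_contra h; exact (hX v).2 h
      simp [this]
    · rintro rfl; exact ⟨Finset.univ, by simp, by simp⟩
  · refine ⟨1, le_rfl, false, fun n _ G s h0 h1 => Or.inl ⟨h0, single fun y => ?_⟩⟩
    rw [mem_sizes False True (fun x => iff_false_intro (hσ x)) (fun x => iff_true_intro (hρ x)), h1]
    constructor
    · rintro ⟨X, hX, rfl⟩
      have : X = ∅ := Finset.eq_empty_of_forall_notMem fun v h => (hX v).1 h
      simp [this]
    · rintro rfl; exact ⟨∅, by simp, by simp⟩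
  · refine ⟨0, Nat.zero_le _, true, fun n hn G s h0 h1 => Or.inr ⟨h0, ?_⟩⟩
    rw [Set.eq_empty_iff_forall_notMem]
    intro y hy
    obtain ⟨X, hX, -⟩ := (mem_sizes False False (fun x => iff_false_intro (hσ x))
      (fun x => iff_false_intro (hρ x)) y).mp hy
    have h := hX ⟨0, hn⟩
    by_cases h' : (⟨0, hn⟩ : Fin n) ∈ X
    exacts [h.1 h', h.2 h']

def trivialSolver (b : ℕ) (z : Bool) : Program :=
  .seq (.assign 0 (.lit b)) (.assign 1 (if z then .load (.lit 0) else .lit 0))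

theorem trivialSolver_runs {b : ℕ} (hb : b ≤ 1) (z : Bool) {I : List ℕ} (h0 : I.getD 0 0 = n)
    {W : ℕ} (hn : 1 ≤ n) (hW : n < W) : ∃ (s : State) (t : ℕ), Runs W (trivialSolver b z)
      (RAM.start I) s t ∧ t ≤ 10 ∧ s.var 0 = b ∧ s.var 1 = (if z then n else 0) := by
  refine ⟨_, _, Runs.seq _ _ _ _ _ _ _ (Runs.assign _ _ _ ?_) (Runs.assign _ _ _ ?_), ?_, ?_, ?_⟩
  · simp only [Expr.Fits]; omega
  · cases z
    · simp only [Expr.Fits, Bool.false_eq_true, if_false]; omega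
    · simp only [Expr.Fits, Expr.eval, if_true, RAM.start, h0]; omega
  · cases z <;> simp [Expr.cost]
  · simp [Expr.eval]
  · cases z <;> simp [Expr.eval, RAM.start, -List.getD_eq_getElem?_getD, h0]

/-! ### The theorem -/

theorem answer_of_code {opt : Objective} {G : SimpleGraph (Fin n)} {s : State} {y : ℕ}
    (h : OptCode (match opt with | .minimize => 0 | .maximize => 1) (sigmaRhoSizes G σ ρ) y)
    (h0 : s.var 0 = min y 1) (h1 : s.var 1 = y - 1) : IsAnswer opt σ ρ G s := by
  rcases h with ⟨rfl, h⟩ | ⟨x, rfl, h⟩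
  · exact Or.inr ⟨h0, h⟩
  · refine Or.inl ⟨by omega, ?_⟩
    rw [h1, Nat.add_sub_cancel]
    cases opt
    exacts [h, h]

/-- The number of steps is at most the bound in terms of the width. -/
theorem steps_le_timeBound {n m d w : ℕ} {k : ℝ} (hk : 1 ≤ k) (hd : 1 ≤ d)
    (hw : w = ⌊(2 : ℝ) ^ k⌋₊) :
    ((n * m + n * ((w ^ (d * Nat.log 2 w)) ^ 3 * w) : ℕ) : ℝ) ≤ timeBound n m d k := by
  have hwk : (w : ℝ) ≤ 2 ^ k := hw ▸ Nat.floor_le (by positivity)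
  have hw1 : 1 ≤ w := by
    rw [hw]
    exact Nat.le_floor (by simpa using Real.one_le_rpow one_le_two (by linarith))
  -- The chain is `2 ^ log w ≤ w ≤ 2 ^ k`.
  have hlog : (Nat.log 2 w : ℝ) ≤ k := by
    have h1 : ((2 : ℝ)) ^ (Nat.log 2 w : ℝ) ≤ 2 ^ k := by
      rw [Real.rpow_natCast]
      refine le_trans ?_ hwk
      exact_mod_cast Nat.pow_log_le_self 2 (by omega : w ≠ 0)
    exact (Real.rpow_le_rpow_left_iff one_lt_two).mp h1
  have hd0 : (1 : ℝ) ≤ d := by exact_mod_cast hd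
  have hN : ((w ^ (d * Nat.log 2 w) : ℕ) : ℝ) ≤ 2 ^ (d * k ^ 2) := by
    push_cast
    calc (w : ℝ) ^ (d * Nat.log 2 w) ≤ ((2 : ℝ) ^ k) ^ (d * Nat.log 2 w) :=
          pow_le_pow_left₀ (by positivity) hwk _
      _ = 2 ^ (k * (d * Nat.log 2 w : ℕ)) := by rw [Real.rpow_mul two_pos.le, Real.rpow_natCast]
      _ ≤ 2 ^ (d * k ^ 2) := by
          refine Real.rpow_le_rpow_of_exponent_le one_le_two ?_
          push_cast
          have : (d : ℝ) * Nat.log 2 w ≤ d * k := mul_le_mul_of_nonneg_left hlog (by linarith)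
          calc k * ((d : ℝ) * Nat.log 2 w) ≤ k * (d * k) :=
                mul_le_mul_of_nonneg_left this (by linarith)
            _ = d * k ^ 2 := by ring
  have hQ : (((w ^ (d * Nat.log 2 w)) ^ 3 * w : ℕ) : ℝ) ≤ 2 ^ (3 * d * k ^ 2 + k) := by
    rw [Nat.cast_mul, Nat.cast_pow]
    calc _ ≤ ((2 : ℝ) ^ (d * k ^ 2)) ^ 3 * 2 ^ k :=
          mul_le_mul (pow_le_pow_left₀ (by positivity) hN 3) hwk (by positivity) (by positivity)
      _ = 2 ^ (3 * d * k ^ 2 + k) := by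
          rw [Real.rpow_add two_pos, ← Real.rpow_natCast, ← Real.rpow_mul two_pos.le]
          congr 2; push_cast; ring
  rw [timeBound, Nat.cast_add, Nat.cast_mul, Nat.cast_mul, ← mul_add]
  refine mul_le_mul_of_nonneg_left (add_le_add_right (hQ.trans ?_) _) (by positivity)
  -- The factor `d * k` may be dropped since it is at least 1.
  exact le_mul_of_one_le_left (by positivity) (one_le_mul_of_one_le_of_one_le hd0 hk)

/-- A polynomial in the time bound is less than the number of words. -/
theorem pow_lt_of_logb_le {X W a c : ℕ} {τ : ℝ} (hX : 2 ≤ X) (hτ : (X : ℝ) ≤ τ) (ha : a < c)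
    (hW : c * Real.logb 2 τ ≤ W) : X ^ a < 2 ^ W := by
  have hX' : (2 : ℝ) ≤ X := by exact_mod_cast hX
  have h1 : τ ^ c ≤ 2 ^ W := by
    rw [← Real.logb_pow, Real.logb_le_iff_le_rpow one_lt_two (pow_pos (by linarith) _),
      Real.rpow_natCast] at hW
    exact hW
  have h2 : (X : ℝ) ^ a < 2 ^ W :=
    calc (X : ℝ) ^ a < (X : ℝ) ^ c := pow_lt_pow_right₀ (by linarith) ha
      _ ≤ τ ^ c := pow_le_pow_left₀ (by positivity) hτ _
      _ ≤ 2 ^ W := h1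
  exact_mod_cast h2

/-- The cut function enters only through `BoundsCuts`, so one argument serves both widths. The
program does not depend on the cut function either. -/
theorem exists_solver {F : ∀ n, SimpleGraph (Fin n) → Set (Fin n) → ℝ}
    (hF : ∀ n G, BoundsCuts G (F n G)) :
    ∃ C c : ℕ, ∀ (σ ρ : Set ℕ), FiniteOrCofinite σ → FiniteOrCofinite ρ → ∀ opt : Objective,
      ∃ P : RAM.Program, ∀ (n : ℕ) (G : SimpleGraph (Fin n)) (D : DecompTree (Fin n)),
        1 ≤ G.edgeSet.ncard → D.IsOptimal (F n G) →
          SolvesWithin P opt σ ρ G D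
            (c * Real.logb 2 (timeBound n G.edgeSet.ncard (dPair σ ρ) (cutWidth (F n G))))
            (C * timeBound n G.edgeSet.ncard (dPair σ ρ) (cutWidth (F n G))) := by
  obtain ⟨ν, hν⟩ : ∃ ν, ν = 40000 := ⟨_, rfl⟩
  -- The array program takes at most `1010 * X` statements of cost at most 60000. The values stay
  -- below `X ^ 12`, and expressions raise them to the power `ν`; the additional 1 makes the
  -- inequality strict.
  refine ⟨70000000, 12 * ν + 1, fun σ ρ hσ hρ opt => ?_⟩
  rcases Nat.eq_zero_or_pos (dPair σ ρ) with hd | hd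
  · have h0 : ∀ {μ : Set ℕ}, FiniteOrCofinite μ → dValue μ ≤ dPair σ ρ →
        (∀ x, x ∈ μ) ∨ ∀ x, x ∉ μ := fun h hle =>
      (constant_from h).imp (fun h x => h x (by omega)) fun h x => h x (by omega)
    obtain ⟨b, hb, z, h⟩ := exists_trivial_answer (h0 hσ (le_max_left _ _))
      (h0 hρ (le_max_right _ _)) opt
    refine ⟨trivialSolver b z, fun n G D hm _ I hI W hW => ?_⟩
    obtain ⟨⟨a, a'⟩, hab⟩ := Set.nonempty_of_ncard_ne_zero (by omega : G.edgeSet.ncard ≠ 0)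
    have hn := two_le_of_edge ((SimpleGraph.mem_edgeSet G).mp hab)
    set m := G.edgeSet.ncard
    have hnm : n ≤ n * m := Nat.le_mul_of_pos_right n hm
    have hT : timeBound n m (dPair σ ρ) (cutWidth (F n G)) = ((n * m : ℕ) : ℝ) := by
      simp [timeBound, hd]
    rw [hT] at hW ⊢
    have hlt := pow_lt_of_logb_le (a := 1) (hn.trans hnm) le_rfl (by omega) hW
    rw [pow_one] at hlt
    obtain ⟨L, K, -, -, rfl⟩ := id hI
    obtain ⟨s, t, hr, ht, hs⟩ := trivialSolver_runs hb z (n := n) (W := 2 ^ W)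
      (I := [n, L.length] ++ flattenEdges L ++ [D.size] ++ flattenEdges K ++
        (List.finRange n).map fun v => ((D.leaf v : Fin D.size) : ℕ)) (by simp) (by omega)
      (by omega)
    refine ⟨s, t, hr, ?_, h n (by omega) G s hs.1 hs.2⟩
    have : t ≤ 70000000 * (n * m) := by omega
    exact_mod_cast this
  · refine ⟨ramSolver (dPair σ ρ) (match opt with | .minimize => 0 | .maximize => 1) σ ρ,
      fun n G D hm hD I hI W hW => ?_⟩
    obtain ⟨⟨a, a'⟩, hab⟩ := Set.nonempty_of_ncard_ne_zero (by omega : G.edgeSet.ncard ≠ 0)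
    have hn := two_le_of_edge ((SimpleGraph.mem_edgeSet G).mp hab)
    have hk := one_le_width (D := D) (hF n G) ((SimpleGraph.mem_edgeSet G).mp hab)
    rw [← width_eq hD] at hW ⊢
    set k := D.width (F n G) with hkdef
    set d := dPair σ ρ with hddef
    obtain ⟨m, hmdef⟩ : ∃ m, m = G.edgeSet.ncard := ⟨_, rfl⟩
    rw [← hmdef] at hm hW ⊢
    obtain ⟨w, hw⟩ : ∃ w, w = ⌊(2 : ℝ) ^ k⌋₊ := ⟨_, rfl⟩
    have hτ := steps_le_timeBound (n := n) (m := m) hk hd hw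
    have hw2 : 2 ≤ w := by
      rw [hw]
      refine Nat.le_floor ?_
      simpa using Real.rpow_le_rpow_of_exponent_le one_le_two hk
    have hlog : 1 ≤ Nat.log 2 w := Nat.log_pos one_lt_two hw2
    have hwN : w ≤ w ^ (d * Nat.log 2 w) :=
      Nat.le_self_pow (Nat.mul_pos hd hlog).ne' w
    -- Storing the indicator functions takes about `2 * d` steps, which must be covered by the bound
    -- as well.
    have hdN : d ≤ w ^ (d * Nat.log 2 w) :=
      calc d ≤ 2 ^ d := Nat.lt_two_pow_self.le
        _ ≤ w ^ d := Nat.pow_le_pow_left hw2 d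
        _ ≤ _ := Nat.pow_le_pow_right (by omega) (Nat.le_mul_of_pos_right d hlog)
    have hsz := size_add_two D hn
    obtain ⟨N, hN⟩ : ∃ N, N = w ^ (d * Nat.log 2 w) := ⟨_, rfl⟩
    rw [← hN] at hτ hwN hdN
    have hcore := coreTime_le hn hm (by omega : D.size ≤ 2 * n) (by omega) hwN
    obtain ⟨X, hX⟩ : ∃ X, X = n * m + n * (N ^ 3 * w) := ⟨_, rfl⟩
    rw [← hX] at hτ hcore
    have h1 : n ≤ n * m := Nat.le_mul_of_pos_right n hm
    have h2 : m ≤ n * m := Nat.le_mul_of_pos_left m (by omega)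
    have h3 : N ≤ n * (N ^ 3 * w) :=
      calc N ≤ N ^ 3 := Nat.le_self_pow (by omega) N
        _ ≤ N ^ 3 * w := Nat.le_mul_of_pos_right _ (by omega)
        _ ≤ _ := Nat.le_mul_of_pos_left _ (by omega)
    obtain ⟨T, hT⟩ : ∃ T, T = 2 * d + 5 + coreTime n m D.size N w := ⟨_, rfl⟩
    have hTX : T ≤ 1010 * X := by omega
    have hMX : n + 2 * m + 2 * D.size + d + 40 + T ≤ 2048 * X := by omega
    have hX2 : 2 ≤ X := by omega
    -- Since `2 ≤ X`, the factor `2048 = 2 ^ 11` is at most `X ^ 11`.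
    have hword : (n + 2 * m + 2 * D.size + d + 40 + T) ^ ν < 2 ^ W := by
      refine lt_of_le_of_lt ?_ (pow_lt_of_logb_le (a := 12 * ν) hX2 hτ (by omega) hW)
      rw [pow_mul]
      refine Nat.pow_le_pow_left (hMX.trans ?_) ν
      calc 2048 * X = 2 ^ 11 * X := by norm_num
        _ ≤ X ^ 11 * X := Nat.mul_le_mul_right _ (Nat.pow_le_pow_left hX2 11)
        _ = X ^ 12 := by ring
    obtain ⟨s, t, hr, ht, y, hy, h0, h1⟩ := ramSolver_runs hn hσ hρ hddef.symm hd
      (opt := match opt with | .minimize => 0 | .maximize => 1) (by cases opt <;> simp) hI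
      (hF n G) hw hmdef (hN ▸ hT) hν.ge hword
    refine ⟨s, t, hr, ?_, answer_of_code hy h0 h1⟩
    have ht' : t ≤ 70000000 * X := by omega
    calc (t : ℝ) ≤ ((70000000 * X : ℕ) : ℝ) := by exact_mod_cast ht'
      _ = ((70000000 : ℕ) : ℝ) * X := by rw [Nat.cast_mul]
      _ ≤ _ := mul_le_mul_of_nonneg_left hτ (by positivity)

end Mach

theorem theorem4 :
    (∃ C c : ℕ, ∀ (σ ρ : Set ℕ), FiniteOrCofinite σ → FiniteOrCofinite ρ → ∀ opt : Objective,
      ∃ P : RAM.Program, ∀ (n : ℕ) (G : SimpleGraph (Fin n)) (D : DecompTree (Fin n)),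
        1 ≤ G.edgeSet.ncard → D.IsOptimal (cutRank G) →
          SolvesWithin P opt σ ρ G D
            (c * Real.logb 2 (timeBound n G.edgeSet.ncard (dPair σ ρ) (rankWidth G)))
            (C * timeBound n G.edgeSet.ncard (dPair σ ρ) (rankWidth G))) ∧
    (∃ C c : ℕ, ∀ (σ ρ : Set ℕ), FiniteOrCofinite σ → FiniteOrCofinite ρ → ∀ opt : Objective,
      ∃ P : RAM.Program, ∀ (n : ℕ) (G : SimpleGraph (Fin n)) (D : DecompTree (Fin n)),
        1 ≤ G.edgeSet.ncard → D.IsOptimal (boolCut G) →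
          SolvesWithin P opt σ ρ G D
            (c * Real.logb 2 (timeBound n G.edgeSet.ncard (dPair σ ρ) (boolWidth G)))
            (C * timeBound n G.edgeSet.ncard (dPair σ ρ) (boolWidth G))) := by
  exact ⟨Mach.exists_solver fun _ => Mach.boundsCuts_cutRank,
    Mach.exists_solver fun _ => Mach.boundsCuts_boolCut⟩
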